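/- Let $T>0$, $\theta\in(\frac12,1]$, and let $D\subset\mathbb R^3$ be a non-empty bounded open set satisfying the interior cone condition. Write $\|\cdot\|_{2,x}$, $(\cdot,\cdot)_{2,x}$ for the norm and inner product of $L^2(D)^3$ or $L^2(D)^{3\times3}$. Let $(e_i)_{i\in\mathbb N}$ be a complete orthonormal system of $L^2(D)^3$, let $G$ be a Hilbert--Schmidt operator from $L^2(D)^3$ into $H^2(D)^3$, and put $G_i=Ge_i$, so that $\sum_i\|G_i\|_{H^2(D)^3}^2<\infty$. Let $m_0\in H^1(D)^3$ with $|m_0|=1$ a.e. in $D$. On a probability space $(\Omega,\mathcal F,\mathbb P)$ let $W=\sum_i\beta_ie_i$ be a cylindrical Wiener process ($\beta_i$ independent real Brownian motions), and let $GW=\sum_i\beta_iG_i$, with continuous paths in $L^2(D)^3$. For $N\ge1$ let $\Delta t=T/N$ and $G\Delta W_N^n=GW((n+1)\Delta t)-GW(n\Delta t)$. Define $m_N^0=m_0$ and, for $0\le n\le N-1$, let $v_N^n$ be the unique element of $\mathbb W_{N,n}=\{\psi\in H^1(D)^3:\ \psi\perp m_N^n \text{ a.e. in } D\}$ such that for all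 $\varphi\in\mathbb W_{N,n}$ $$(v_N^n-m_N^n\times v_N^n,\varphi)_{2,x}+2\theta\Delta t(\nabla v_N^n,\nabla\varphi)_{2,x}=-2\Delta t(\nabla m_N^n,\nabla\varphi)_{2,x}+\big((\mathrm{Id}-m_N^n\times)(m_N^n\times G\Delta W_N^n),\varphi\big)_{2,x}+\frac{\Delta t}{2}\sum_{i}\big((\mathrm{Id}-m_N^n\times)((m_N^n\times G_i)\times G_i),\varphi\big)_{2,x},$$ and set $m_N^{n+1}=(m_N^n+v_N^n)/|m_N^n+v_N^n|$. Let $m_N(t)=m_N^n$ for $t\in[n\Delta t,(n+1)\Delta t)$ and $X_N(t)=\sum_{0\le(n+1)\Delta t\le t}m_N^n\times(G\Delta W_N^n)$. Let $(\bar\Omega,\bar{\mathcal F},\bar{\mathbb P})$ be a probability space carrying random variables $(\bar m_N,\bar X_N,G\bar W_N)$, $N\ge1$, and $(\bar m,\bar X,G\bar W)$ with values in $L^2(0,T;L^2(D)^3)\times L^2(0,T;L^2(D)^3)\times C([0,T];L^2(D)^3)$, such that for each $N\ge 1$ the triple $(\bar m_N,\bar X_N,G\bar W_N)$ has the same law as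 $(m_N,X_N,GW)$, and such that, along some subsequence, $\bar m_N\to\bar m$ and $\bar X_N\to\bar X$ a.s. in $L^2(0,T;L^2(D)^3)$ and $G\bar W_N\to G\bar W$ a.s. in $C([0,T];L^2(D)^3)$. Then, $\bar{\mathbb P}$-almost surely: for a.e. $s\in[0,T]$ one has $\bar m(s)\in H^1(D)^3$, $\bar m(s)$ has a weak Laplacian $\Delta\bar m(s)\in L^1(D)^3$ with homogeneous Neumann boundary condition, that is, $\int_D\varphi\,\Delta\bar m(s)\,dx=-\sum_{k=1}^3\int_D\partial_{x_k}\varphi\,\partial_{x_k}\bar m(s)\,dx$ for all $\varphi\in C_c^\infty(\mathbb R^3)$, the series $\sum_{i}(\bar m\times G_i)\times G_i$ converges a.e. in $D$, and $$\Delta\bar m+\bar m|\nabla\bar m|^2+\bar m\times\Delta\bar m+\tfrac12\sum_{i\in\mathbb N}(\bar m\times G_i)\times G_i$$ belongs to $L^2(D)^3$ and is Bochner integrable on $[0,T]$ as an $L^2(D)^3$-valued function of time; for a.e. $t\in[0,T]$, in $L^2(D)^3$, $$\bar X(t)=\bar m(t)-m_0-\int_0^t\Big(\Delta\bar m+\bar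 m|\nabla\bar m|^2+\bar m\times\Delta\bar m+\tfrac12\sum_{i\in\mathbb N}(\bar m\times G_i)\times G_i\Big)\,ds;$$ and $\bar m\in C([0,T];L^2(D)^3)$, i.e. $\bar m$ coincides for a.e. $t\in[0,T]$ with a continuous function from $[0,T]$ into $L^2(D)^3$. -/

import Mathlib

open MeasureTheory ProbabilityTheory Set Filter Topology
open scoped NNReal

noncomputable section

namespace SLLG

/-- The Euclidean space `ℝ³`. -/
abbrev E3 : Type := EuclideanSpace ℝ (Fin 3)

/-- The space `L²(D)³`. -/
abbrev L2 (D : Set E3) : Type := Lp E3 2 (volume.restrict D)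

/-- The space `L²(0,T; L²(D)³)`. -/
abbrev L2T (T : ℝ) (D : Set E3) : Type := Lp (L2 D) 2 (volume.restrict (Icc (0 : ℝ) T))

/-- The space `C([0,T]; L²(D)³)`. -/
abbrev CT (T : ℝ) (D : Set E3) : Type := C(Icc (0 : ℝ) T, L2 D)

instance (D : Set E3) : MeasurableSpace (L2 D) := borel _
instance (D : Set E3) : BorelSpace (L2 D) := ⟨rfl⟩
instance (T : ℝ) (D : Set E3) : MeasurableSpace (L2T T D) := borel _
instance (T : ℝ) (D : Set E3) : BorelSpace (L2T T D) := ⟨rfl⟩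
instance (T : ℝ) (D : Set E3) : MeasurableSpace (CT T D) := borel _
instance (T : ℝ) (D : Set E3) : BorelSpace (CT T D) := ⟨rfl⟩

/-- The class in `L²(μ; F)` of a square integrable function (and `0` for other functions). -/
def mkL2 {α F : Type*} [MeasurableSpace α] [NormedAddCommGroup F] (μ : Measure α) (f : α → F) :
    Lp F 2 μ :=
  open Classical in if h : MemLp f 2 μ then h.toLp f else 0

/-- The cross product of `ℝ³`. -/
def cross (a b : E3) : E3 := WithLp.toLp 2 (crossProduct a.ofLp b.ofLp)

/-- The (interior) cone condition: every point `x` of `D` is the vertex of a finite cone contained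
in `D`, with a height `r` and an opening `c` (the cosine of the half-angle) independent of `x`. -/
def ConeCondition (D : Set E3) : Prop :=
  ∃ r c : ℝ, 0 < r ∧ 0 < c ∧ c < 1 ∧ ∀ x ∈ D, ∃ ξ : E3, ‖ξ‖ = 1 ∧
    ∀ y : E3, ‖y - x‖ < r → c * ‖y - x‖ ≤ inner ℝ (y - x) ξ → y ∈ D

/-! ### Sobolev spaces -/

/-- The `k`-th partial derivative of a scalar function on `ℝ³`. -/
def pderiv3 (k : Fin 3) (φ : E3 → ℝ) (x : E3) : ℝ := fderiv ℝ φ x (EuclideanSpace.single k 1)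

/-- `g` is the weak partial derivative `∂u/∂x_k` of `u` in `D`. -/
def HasWeakPartial (D : Set E3) (k : Fin 3) (u g : L2 D) : Prop :=
  ∀ φ : E3 → ℝ, ContDiff ℝ (⊤ : ℕ∞) φ → HasCompactSupport φ → tsupport φ ⊆ D →
    ∫ x in D, pderiv3 k φ x • u x = - ∫ x in D, φ x • g x

/-- `u ∈ H¹(D)³`. -/
def MemH1 {D : Set E3} (u : L2 D) : Prop := ∀ k, ∃ g : L2 D, HasWeakPartial D k u g

/-- The weak partial derivative `∂u/∂x_k ∈ L²(D)³` (and `0` if there is none). -/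
def weakPartial {D : Set E3} (k : Fin 3) (u : L2 D) : L2 D :=
  open Classical in if h : ∃ g : L2 D, HasWeakPartial D k u g then h.choose else 0

/-- The scalar product `(∇u, ∇v)` of `L²(D)^{3×3}`. -/
def gradInner {D : Set E3} (u v : L2 D) : ℝ :=
  ∑ k, inner ℝ (weakPartial k u) (weakPartial k v)

/-- `u ∈ H²(D)³`. -/
def MemH2 {D : Set E3} (u : L2 D) : Prop := MemH1 u ∧ ∀ k, MemH1 (weakPartial k u)

/-- The squared norm of `H²(D)³`. -/
def normSqH2 {D : Set E3} (u : L2 D) : ℝ :=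
  ‖u‖ ^ 2 + ∑ k, ‖weakPartial k u‖ ^ 2 + ∑ k, ∑ l, ‖weakPartial l (weakPartial k u)‖ ^ 2

/-- `G` is a Hilbert-Schmidt operator from `L²(D)³` into `H²(D)³` (`e` is an orthonormal basis
of `L²(D)³`). -/
def IsHilbertSchmidtH2 {D : Set E3} (e : HilbertBasis ℕ ℝ (L2 D)) (G : L2 D →L[ℝ] L2 D) : Prop :=
  (∀ f, MemH2 (G f)) ∧ Summable fun i => normSqH2 (G (e i))

/-! ### The noise -/

/-- `GW` is the process `G W(t) = ∑ i, β_i(t) G e_i`, with continuous paths in `L²(D)³`, where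
`W = ∑ i, β_i e_i` is a cylindrical Wiener process: the `β_i` are independent Brownian motions. -/
structure IsNoise {T : ℝ} {D : Set E3} {Ω : Type*} [MeasurableSpace Ω] (P : Measure Ω)
    (e : HilbertBasis ℕ ℝ (L2 D)) (G : L2 D →L[ℝ] L2 D)
    (β : ℕ → ℝ≥0 → Ω → ℝ) (GW : Ω → CT T D) : Prop where
  brownian : ∀ i, IsBrownianReal (β i) P
  indep : iIndepFun (fun i ω t => β i t ω) P
  series : ∀ t : Icc (0 : ℝ) T, ∀ᵐ ω ∂P,
    Tendsto (fun n => ∑ i ∈ Finset.range n, β i ⟨t.1, t.2.1⟩ ω • G (e i)) atTop (𝓝 (GW ω t))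

/-! ### The numerical scheme

In this section `Gi i` stands for `G_i = G e_i`, and `w` for a path of the process `G W`. -/

/-- The function `(m × G_i) × G_i`. -/
def corr {D : Set E3} (m Gi : L2 D) (x : E3) : E3 := cross (cross (m x) (Gi x)) (Gi x)

/-- `v` solves the variational problem of one step of the scheme, for the data `m` (the current
magnetization), `ξ` (the noise increment) and the time step `dt`: `v` belongs to the space of the
`ψ ∈ H¹(D)³` with `ψ ⊥ m` a.e., and the variational identity holds for every `φ` in this space. -/
def IsIncrement {D : Set E3} (Gi : ℕ → L2 D) (θ dt : ℝ) (m ξ v : L2 D) : Prop :=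
  (MemH1 v ∧ ∀ᵐ x ∂volume.restrict D, inner ℝ (v x) (m x) = 0) ∧
  ∀ φ : L2 D, (MemH1 φ ∧ ∀ᵐ x ∂volume.restrict D, inner ℝ (φ x) (m x) = 0) →
    (∫ x in D, inner ℝ (v x - cross (m x) (v x)) (φ x)) + 2 * θ * dt * gradInner v φ =
      - 2 * dt * gradInner m φ
      + (∫ x in D, inner ℝ
          (cross (m x) (ξ x) - cross (m x) (cross (m x) (ξ x))) (φ x))
      + dt / 2 * ∑' i, ∫ x in D, inner ℝ
          (corr m (Gi i) x - cross (m x) (corr m (Gi i) x)) (φ x)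

/-- The solution `v` of the variational problem of one step of the scheme (it is unique). -/
def increment {D : Set E3} (Gi : ℕ → L2 D) (θ dt : ℝ) (m ξ : L2 D) : L2 D :=
  open Classical in if h : ∃ v, IsIncrement Gi θ dt m ξ v then h.choose else 0

/-- The renormalization `(m + v) / |m + v|`. -/
def renorm {D : Set E3} (m v : L2 D) : L2 D :=
  mkL2 (volume.restrict D) fun x => ‖m x + v x‖⁻¹ • (m x + v x)

/-- The value `w(t)` of a path on `[0,T]`. -/
def pathAt {T : ℝ} {D : Set E3} (w : CT T D) (t : ℝ) : L2 D :=
  open Classical in if h : t ∈ Icc (0 : ℝ) T then w ⟨t, h⟩ else 0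

/-- The noise increment `G ΔW_N^n = w((n+1) Δt) - w(n Δt)`, where `Δt = T / N`. -/
def noiseInc {T : ℝ} {D : Set E3} (N n : ℕ) (w : CT T D) : L2 D :=
  pathAt w ((n + 1) * (T / N)) - pathAt w (n * (T / N))

/-- The iterates `m_N^n` of the scheme with `N` time steps. -/
def iterate {T : ℝ} {D : Set E3} (Gi : ℕ → L2 D) (θ : ℝ) (m0 : L2 D) (N : ℕ) (w : CT T D) :
    ℕ → L2 D
  | 0 => m0
  | n + 1 => renorm (iterate Gi θ m0 N w n)
      (increment Gi θ (T / N) (iterate Gi θ m0 N w n) (noiseInc N n w))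

/-- The piecewise constant process `m_N`, with `m_N(t) = m_N^n` for `n Δt ≤ t < (n+1) Δt`. -/
def mProc {T : ℝ} {D : Set E3} (Gi : ℕ → L2 D) (θ : ℝ) (m0 : L2 D) (N : ℕ) (w : CT T D) :
    L2T T D :=
  mkL2 (volume.restrict (Icc (0 : ℝ) T)) fun t => iterate Gi θ m0 N w ⌊t / (T / N)⌋₊

/-- The process `X_N(t) = ∑_{0 ≤ (n+1) Δt ≤ t} m_N^n × (G ΔW_N^n)`. -/
def XProc {T : ℝ} {D : Set E3} (Gi : ℕ → L2 D) (θ : ℝ) (m0 : L2 D) (N : ℕ) (w : CT T D) :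
    L2T T D :=
  mkL2 (volume.restrict (Icc (0 : ℝ) T)) fun t =>
    ∑ n ∈ (Finset.range N).filter (fun n : ℕ => ((n : ℝ) + 1) * (T / N) ≤ t),
      mkL2 (volume.restrict D) fun x => cross (iterate Gi θ m0 N w n x) (noiseInc N n w x)

/-! ### The drift -/

/-- `h ∈ L¹(D)³` is the weak Laplacian of `u ∈ H¹(D)³`. Test functions `φ` supported in `D` say
that `h` is the distributional Laplacian; the test functions that do not vanish at the boundary
express the homogeneous Neumann boundary condition. -/
def IsWeakLaplacian {D : Set E3} (u : L2 D) (h : E3 → E3) : Prop :=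
  IntegrableOn h D ∧ ∀ φ : E3 → ℝ, ContDiff ℝ (⊤ : ℕ∞) φ → HasCompactSupport φ →
    ∫ x in D, φ x • h x = - ∑ k, ∫ x in D, pderiv3 k φ x • weakPartial k u x

/-- `u ∈ H¹(D)³` and `a = Δu + u |∇u|² + u × Δu + ½ ∑ i, (u × G_i) × G_i` in `L²(D)³`. -/
def IsDrift {D : Set E3} (Gi : ℕ → L2 D) (u a : L2 D) : Prop :=
  MemH1 u ∧ ∃ h S : E3 → E3, IsWeakLaplacian u h ∧
    (∀ᵐ x ∂volume.restrict D, HasSum (fun i => corr u (Gi i) x) (S x)) ∧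
    ∀ᵐ x ∂volume.restrict D,
      a x = h x + (∑ k, ‖weakPartial k u x‖ ^ 2) • u x + cross (u x) (h x) + (1 / 2 : ℝ) • S x

end SLLG

end

open SLLG

noncomputable section

namespace SLLG

open ENNReal (ofReal ofReal_mul ofReal_add ofReal_le_ofReal ofReal_ne_top measurable_ofReal ofReal_pow ofReal_sum_of_nonneg)

/-- Lebesgue measure on a set. -/
local notation:max "ℒ" A:max => volume.restrict A

/-- Lebesgue measure on a time interval. -/
local notation:max "ℐ" T:max => volume.restrict (Icc (0 : ℝ) T)

variable {D : Set E3}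

instance : Fact ((2 : ENNReal) ≠ ⊤) := ⟨by norm_num⟩

instance (D : Set E3) : SecondCountableTopology (PiLp 2 fun _ : Option (Fin 3) => L2 D) :=
  (PiLp.homeomorph 2 fun _ : Option (Fin 3) => L2 D).secondCountableTopology

theorem inner_eq_coord (a b : E3) : inner ℝ a b = a 0 * b 0 + a 1 * b 1 + a 2 * b 2 := by
  simp [PiLp.inner_apply, Fin.sum_univ_three, mul_comm]

@[simp] theorem cross_zero_coord (a b : E3) : cross a b 0 = a 1 * b 2 - a 2 * b 1 := by
  simp [cross, crossProduct]
@[simp] theorem cross_one_coord (a b : E3) : cross a b 1 = a 2 * b 0 - a 0 * b 2 := by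
  simp [cross, crossProduct]
@[simp] theorem cross_two_coord (a b : E3) : cross a b 2 = a 0 * b 1 - a 1 * b 0 := by
  simp [cross, crossProduct]

theorem ext_coord {a b : E3} (h0 : a 0 = b 0) (h1 : a 1 = b 1) (h2 : a 2 = b 2) : a = b := by
  ext i; fin_cases i <;> assumption

theorem cross_add_left (a b c : E3) : cross (a + b) c = cross a c + cross b c := by
  apply ext_coord <;> simp <;> ring
theorem cross_add_right (a b c : E3) : cross a (b + c) = cross a b + cross a c := by
  apply ext_coord <;> simp <;> ring
theorem cross_smul_left (r : ℝ) (a b : E3) : cross (r • a) b = r • cross a b := by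
  apply ext_coord <;> simp <;> ring
theorem cross_smul_right (r : ℝ) (a b : E3) : cross a (r • b) = r • cross a b := by
  apply ext_coord <;> simp <;> ring
theorem cross_sub_left (a b c : E3) : cross (a - b) c = cross a c - cross b c := by
  apply ext_coord <;> simp <;> ring
theorem cross_sub_right (a b c : E3) : cross a (b - c) = cross a b - cross a c := by
  apply ext_coord <;> simp <;> ring
theorem cross_anticomm' (a b : E3) : cross a b = -cross b a := by
  apply ext_coord <;> simp [mul_comm]

theorem cross_cross_eq (a b c : E3) :
    cross a (cross b c) = inner ℝ a c • b - inner ℝ a b • c := by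
  apply ext_coord <;> simp [inner_eq_coord] <;> ring
theorem inner_cross_cross (a b c d : E3) :
    inner ℝ (cross a b) (cross c d) =
      inner ℝ a c * inner ℝ b d - inner ℝ a d * inner ℝ b c := by
  simp [inner_eq_coord]; ring
theorem inner_cross_swap (a b c : E3) : inner ℝ (cross a b) c = -inner ℝ b (cross a c) := by
  simp [inner_eq_coord]; ring
@[simp] theorem inner_cross_self_left (a b : E3) : inner ℝ a (cross a b) = 0 := by
  simp [inner_eq_coord]; ring
@[simp] theorem inner_cross_self_right (a b : E3) : inner ℝ b (cross a b) = 0 := by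
  simp [inner_eq_coord]; ring

theorem norm_cross_sq (a b : E3) :
    ‖cross a b‖ ^ 2 = ‖a‖ ^ 2 * ‖b‖ ^ 2 - inner ℝ a b ^ 2 := by
  rw [← real_inner_self_eq_norm_sq, ← real_inner_self_eq_norm_sq, ← real_inner_self_eq_norm_sq,
    inner_cross_cross, real_inner_comm a b]; ring
theorem norm_cross_le (a b : E3) : ‖cross a b‖ ≤ ‖a‖ * ‖b‖ := by
  apply le_of_sq_le_sq _ (by positivity)
  rw [norm_cross_sq, mul_pow]; nlinarith [sq_nonneg (inner ℝ a b : ℝ)]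

/-- The cross product as a continuous bilinear map. -/
def crossL : E3 →L[ℝ] E3 →L[ℝ] E3 :=
  LinearMap.mkContinuous₂ (LinearMap.mk₂ ℝ cross cross_add_left cross_smul_left cross_add_right
    (fun r a b => cross_smul_right r a b)) 1 (fun a b => by simpa using norm_cross_le a b)

theorem continuous_cross : Continuous fun p : E3 × E3 => cross p.1 p.2 :=
  (crossL.continuous.comp continuous_fst).clm_apply continuous_snd

/-- The radial retraction onto the unit ball. -/
def retract (y : E3) : E3 := (max 1 ‖y‖)⁻¹ • y

theorem retract_of_le {y : E3} (h : ‖y‖ ≤ 1) : retract y = y := by simp [retract, max_eq_left h]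
theorem retract_of_ge {y : E3} (h : 1 ≤ ‖y‖) : retract y = ‖y‖⁻¹ • y := by
  simp [retract, max_eq_right h]
@[simp] theorem retract_zero : retract 0 = 0 := by simp [retract]
theorem norm_retract_le (y : E3) : ‖retract y‖ ≤ 1 := by
  rw [retract, norm_smul, norm_inv, Real.norm_of_nonneg (by positivity), inv_mul_le_iff₀ (by positivity)]
  simp

theorem lipschitz_retract : LipschitzWith 1 retract := by
  have key : ∀ a b : E3, ‖retract a - retract b‖ ^ 2 ≤ ‖a - b‖ ^ 2 := by
    intro a b
    have h1 : ∀ a b : E3, 0 ≤ inner ℝ (a - retract a) (retract a - retract b) := by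
      intro a b
      rcases le_total ‖a‖ 1 with h | h
      · simp [retract_of_le h]
      · have e : a - retract a = (‖a‖ - 1) • retract a := by
          rw [retract_of_ge h, sub_smul, smul_smul, mul_inv_cancel₀ (by positivity), one_smul, one_smul]
        rw [e, inner_smul_left]
        apply mul_nonneg (by simpa using h)
        rw [inner_sub_right, real_inner_self_eq_norm_sq]
        have h2 : ‖retract a‖ = 1 := by
          rw [retract_of_ge h, norm_smul, norm_inv, norm_norm, inv_mul_cancel₀ (by positivity)]
        have := real_inner_le_norm (retract a) (retract b)
        rw [h2] at this
        nlinarith [norm_retract_le b]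
    have ha := h1 a b
    have hb := h1 b a
    have e : a - b = (retract a - retract b) + ((a - retract a) - (b - retract b)) := by abel
    rw [e, ← real_inner_self_eq_norm_sq, ← real_inner_self_eq_norm_sq, inner_add_left, inner_add_right,
      inner_add_right]
    have h3 : 0 ≤ inner ℝ ((a - retract a) - (b - retract b)) ((a - retract a) - (b - retract b)) :=
      real_inner_self_nonneg
    have h4 : inner ℝ ((a - retract a) - (b - retract b)) (retract a - retract b) =
      inner ℝ (a - retract a) (retract a - retract b) + inner ℝ (b - retract b) (retract b - retract a) := by
      rw [inner_sub_left, ← neg_sub (retract b) (retract a), inner_neg_right, inner_neg_right]; ring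
    rw [real_inner_comm ((a - retract a) - (b - retract b))]
    linarith
  refine LipschitzWith.of_dist_le_mul fun a b => ?_
  rw [dist_eq_norm, dist_eq_norm, NNReal.coe_one, one_mul]
  exact le_of_sq_le_sq (key a b) (norm_nonneg _)

/-! ### Products in `L²(D)³` -/

theorem coeFn_mkL2 {α F : Type*} [MeasurableSpace α] [NormedAddCommGroup F] {μ : Measure α}
    {f : α → F} (h : MemLp f 2 μ) : mkL2 μ f =ᵐ[μ] f := by
  rw [mkL2, dif_pos h]; exact h.coeFn_toLp


theorem exists_bdd_approx (f : L2 D) {ε : ℝ} (hε : 0 < ε) :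
    ∃ g : L2 D, (∃ C, ∀ᵐ x ∂ℒ D, ‖g x‖ ≤ C) ∧ ‖f - g‖ ≤ ε := by
  obtain ⟨g, hg, hg2⟩ := (Lp.memLp f).exists_simpleFunc_eLpNorm_sub_lt (by norm_num)
    (ε := ofReal ε) (by simpa using hε)
  refine ⟨hg2.toLp g, ?_, ?_⟩
  · obtain ⟨C, hC⟩ := g.exists_forall_norm_le
    refine ⟨C, ?_⟩
    filter_upwards [hg2.coeFn_toLp] with x hx
    rw [hx]; exact hC x
  · rw [Lp.norm_def]
    apply ENNReal.toReal_le_of_le_ofReal hε.le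
    refine le_trans (le_of_eq ?_) hg.le
    apply eLpNorm_congr_ae
    filter_upwards [hg2.coeFn_toLp, Lp.coeFn_sub f (hg2.toLp g)] with x hx hx2
    rw [hx2, Pi.sub_apply, hx]; rfl

/-- The pointwise cross product of two functions. -/
def cr (u f : L2 D) : L2 D := mkL2 (ℒ D) fun x => cross (u x) (f x)

theorem aestronglyMeasurable_cross {α : Type*} [MeasurableSpace α] {μ : Measure α} {u f : α → E3}
    (hu : AEStronglyMeasurable u μ) (hf : AEStronglyMeasurable f μ) :
    AEStronglyMeasurable (fun x => cross (u x) (f x)) μ :=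
  continuous_cross.comp_aestronglyMeasurable (hu.prodMk hf)

theorem memLp_cross_left {u f : L2 D} {K : ℝ} (hu : ∀ᵐ x ∂ℒ D, ‖u x‖ ≤ K) :
    MemLp (fun x => cross (u x) (f x)) 2 (ℒ D) := by
  refine MemLp.of_le_mul (c := K) (Lp.memLp f)
    (aestronglyMeasurable_cross (Lp.aestronglyMeasurable u) (Lp.aestronglyMeasurable f)) ?_
  filter_upwards [hu] with x hx
  exact (norm_cross_le _ _).trans (by gcongr)

theorem memLp_cross_right {u f : L2 D} {K : ℝ} (hu : ∀ᵐ x ∂ℒ D, ‖f x‖ ≤ K) :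
    MemLp (fun x => cross (u x) (f x)) 2 (ℒ D) := by
  refine MemLp.of_le_mul (c := K) (Lp.memLp u)
    (aestronglyMeasurable_cross (Lp.aestronglyMeasurable u) (Lp.aestronglyMeasurable f)) ?_
  filter_upwards [hu] with x hx
  exact (norm_cross_le _ _).trans (by rw [mul_comm]; gcongr)

theorem coeFn_cr {u f : L2 D} {K : ℝ} (hu : ∀ᵐ x ∂ℒ D, ‖u x‖ ≤ K) :
    cr u f =ᵐ[ℒ D] fun x => cross (u x) (f x) := coeFn_mkL2 (memLp_cross_left hu)

theorem coeFn_cr_right {u f : L2 D} {K : ℝ} (hu : ∀ᵐ x ∂ℒ D, ‖f x‖ ≤ K) :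
    cr u f =ᵐ[ℒ D] fun x => cross (u x) (f x) := coeFn_mkL2 (memLp_cross_right hu)

theorem norm_cr_le {u f : L2 D} {K : ℝ}
    (hu : ∀ᵐ x ∂ℒ D, ‖u x‖ ≤ K) : ‖cr u f‖ ≤ K * ‖f‖ := by
  refine Lp.norm_le_mul_norm_of_ae_le_mul ?_
  filter_upwards [hu, coeFn_cr hu (f := f)] with x hx h2
  rw [h2]; exact (norm_cross_le _ _).trans (by gcongr)

theorem norm_cr_le_right {u f : L2 D} {K : ℝ}
    (hu : ∀ᵐ x ∂ℒ D, ‖f x‖ ≤ K) : ‖cr u f‖ ≤ K * ‖u‖ := by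
  refine Lp.norm_le_mul_norm_of_ae_le_mul ?_
  filter_upwards [hu, coeFn_cr_right hu (u := u)] with x hx h2
  rw [h2]; exact (norm_cross_le _ _).trans (by rw [mul_comm]; gcongr)

theorem cr_sub_right {u f g : L2 D} {K : ℝ} (hu : ∀ᵐ x ∂ℒ D, ‖u x‖ ≤ K) :
    cr u (f - g) = cr u f - cr u g := by
  apply Lp.ext
  filter_upwards [coeFn_cr hu (f := f), coeFn_cr hu (f := g), coeFn_cr hu (f := f - g),
    Lp.coeFn_sub f g, Lp.coeFn_sub (cr u f) (cr u g)] with x h1 h2 h3 h4 h5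
  rw [h3, h5, h4, Pi.sub_apply, Pi.sub_apply, h1, h2, cross_sub_right]

theorem cr_add_right {u f g : L2 D} {K : ℝ} (hu : ∀ᵐ x ∂ℒ D, ‖u x‖ ≤ K) :
    cr u (f + g) = cr u f + cr u g := by
  apply Lp.ext
  filter_upwards [coeFn_cr hu (f := f), coeFn_cr hu (f := g), coeFn_cr hu (f := f + g),
    Lp.coeFn_add f g, Lp.coeFn_add (cr u f) (cr u g)] with x h1 h2 h3 h4 h5
  rw [h3, h5, h4, Pi.add_apply, Pi.add_apply, h1, h2, cross_add_right]

theorem cr_smul_right {u f : L2 D} {K : ℝ} (c : ℝ) (hu : ∀ᵐ x ∂ℒ D, ‖u x‖ ≤ K) :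
    cr u (c • f) = c • cr u f := by
  apply Lp.ext
  filter_upwards [coeFn_cr hu (f := f), coeFn_cr hu (f := c • f),
    Lp.coeFn_smul c f, Lp.coeFn_smul c (cr u f)] with x h1 h2 h3 h4
  rw [h2, h4, h3, Pi.smul_apply, Pi.smul_apply, h1, cross_smul_right]

/-- The pointwise retraction onto the unit ball. -/
def retr (u : L2 D) : L2 D := lipschitz_retract.compLp retract_zero u

theorem coeFn_retr (u : L2 D) : retr u =ᵐ[ℒ D] fun x => retract (u x) :=
  lipschitz_retract.coeFn_compLp retract_zero u

theorem continuous_retr : Continuous (retr : L2 D → L2 D) :=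
  lipschitz_retract.continuous_compLp retract_zero

theorem norm_retr_apply_le (u : L2 D) : ∀ᵐ x ∂ℒ D, ‖retr u x‖ ≤ 1 := by
  filter_upwards [coeFn_retr u] with x hx
  rw [hx]; exact norm_retract_le _

theorem retr_of_le {u : L2 D} (h : ∀ᵐ x ∂ℒ D, ‖u x‖ ≤ 1) : retr u = u := by
  apply Lp.ext
  filter_upwards [coeFn_retr u, h] with x hx h
  rw [hx, retract_of_le h]

/-- The pointwise cross product, where the first factor is truncated to the unit ball. -/
def crt (u f : L2 D) : L2 D := cr (retr u) f

theorem crt_eq {u : L2 D} (h : ∀ᵐ x ∂ℒ D, ‖u x‖ ≤ 1) (f : L2 D) :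
    crt u f = cr u f := by rw [crt, retr_of_le h]

theorem norm_crt_le (u f : L2 D) : ‖crt u f‖ ≤ ‖f‖ := by
  simpa [crt] using norm_cr_le (norm_retr_apply_le u) (f := f)

theorem crt_sub_right (u f g : L2 D) : crt u (f - g) = crt u f - crt u g :=
  cr_sub_right (norm_retr_apply_le u)

theorem continuous_crt : Continuous fun p : L2 D × L2 D => crt p.1 p.2 := by
  refine continuous_prod_of_continuous_lipschitzWith' _ 1 (fun u => ?_) (fun f => ?_)
  · refine LipschitzWith.of_dist_le_mul fun f g => ?_
    rw [dist_eq_norm, dist_eq_norm, NNReal.coe_one, one_mul]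
    change ‖crt u f - crt u g‖ ≤ _
    rw [← crt_sub_right]; exact norm_crt_le _ _
  · refine continuous_of_uniform_approx_of_continuous fun s hs => ?_
    obtain ⟨ε, hε, h⟩ := Metric.mem_uniformity_dist.1 hs
    obtain ⟨g, ⟨C, hC⟩, hg⟩ := exists_bdd_approx f (half_pos hε)
    refine ⟨fun u => crt u g, ?_, fun u => h ?_⟩
    · have hC' : ∀ᵐ x ∂ℒ D, ‖g x‖ ≤ |C| := by
        filter_upwards [hC] with x hx using hx.trans (le_abs_self C)
      rw [continuous_iff_continuousAt]
      intro u
      rw [ContinuousAt, tendsto_iff_norm_sub_tendsto_zero]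
      have h0 : Tendsto (fun v => |C| * ‖retr v - retr u‖) (𝓝 u) (𝓝 0) := by
        have := (tendsto_iff_norm_sub_tendsto_zero.1 (continuous_retr.tendsto u)).const_mul |C|
        simpa using this
      refine squeeze_zero (fun _ => norm_nonneg _) (fun v => ?_) h0
      have : crt v g - crt u g = cr (retr v - retr u) g := by
        apply Lp.ext
        filter_upwards [coeFn_cr (norm_retr_apply_le v) (f := g),
          coeFn_cr (norm_retr_apply_le u) (f := g), coeFn_cr_right hC' (u := retr v - retr u),
          Lp.coeFn_sub (retr v) (retr u), Lp.coeFn_sub (crt v g) (crt u g)] with x h1 h2 h3 h4 h5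
        rw [h3, h5, h4, Pi.sub_apply, Pi.sub_apply, crt, crt, h1, h2, cross_sub_left]
      rw [this]
      exact norm_cr_le_right hC'
    · rw [dist_eq_norm, ← crt_sub_right]
      exact ((norm_crt_le _ _).trans hg).trans_lt (half_lt_self hε)

/-! ### Test functions -/

theorem contDiff_pderiv3 {φ : E3 → ℝ} (hφ : ContDiff ℝ (⊤ : ℕ∞) φ) (k : Fin 3) :
    ContDiff ℝ (⊤ : ℕ∞) (pderiv3 k φ) :=
  (hφ.fderiv_right (m := (⊤ : ℕ∞)) (by simp)).clm_apply contDiff_const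

theorem tsupport_pderiv3_subset (φ : E3 → ℝ) (k : Fin 3) : tsupport (pderiv3 k φ) ⊆ tsupport φ := by
  refine (closure_mono ?_).trans (tsupport_fderiv_subset ℝ (f := φ))
  intro x hx h
  exact hx (by simp [pderiv3, h])

theorem hasCompactSupport_pderiv3 {φ : E3 → ℝ} (hφ : HasCompactSupport φ) (k : Fin 3) :
    HasCompactSupport (pderiv3 k φ) :=
  IsCompact.of_isClosed_subset hφ (isClosed_tsupport _) (tsupport_pderiv3_subset φ k)


theorem memLp_test {c : E3 → ℝ} (hc : Continuous c) (hs : HasCompactSupport c) (e : E3)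
    (μ : Measure E3) [IsFiniteMeasureOnCompacts μ] : MemLp (fun x => c x • e) 2 μ :=
  (hc.smul continuous_const).memLp_of_hasCompactSupport (hs.smul_right)

/-- The element `c e` of `L²(D)³`, for a scalar function `c` and a vector `e`. -/
def tf (c : E3 → ℝ) (e : E3) : L2 D := mkL2 (ℒ D) fun x => c x • e

theorem coeFn_tf {c : E3 → ℝ} (hc : Continuous c) (hs : HasCompactSupport c) (e : E3) :
    (tf c e : L2 D) =ᵐ[ℒ D] fun x => c x • e := coeFn_mkL2 (memLp_test hc hs e _)

theorem integrable_test_smul {c : E3 → ℝ} (hc : Continuous c) (hs : HasCompactSupport c) (u : L2 D) :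
    IntegrableOn (fun x => c x • u x) D :=
  ((Lp.memLp u).locallyIntegrable (by norm_num)).integrable_smul_left_of_hasCompactSupport hc hs

theorem inner_tf {c : E3 → ℝ} (hc : Continuous c) (hs : HasCompactSupport c) (e : E3) (u : L2 D) :
    inner ℝ (tf c e) u = inner ℝ e (∫ x in D, c x • u x) := by
  rw [L2.inner_def, ← integral_inner (integrable_test_smul hc hs u)]
  apply integral_congr_ae
  filter_upwards [coeFn_tf hc hs e (D := D)] with x hx
  rw [hx, real_inner_smul_left, real_inner_smul_right]

theorem hasWeakPartial_iff {k : Fin 3} {u g : L2 D} : HasWeakPartial D k u g ↔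
    ∀ φ : E3 → ℝ, ContDiff ℝ (⊤ : ℕ∞) φ → HasCompactSupport φ → tsupport φ ⊆ D → ∀ e : E3,
      inner ℝ (tf (pderiv3 k φ) e) u = -inner ℝ (tf φ e) g := by
  refine forall_congr' fun φ => forall_congr' fun h1 => forall_congr' fun h2 => forall_congr' fun h3 => ?_
  simp only [inner_tf h1.continuous h2, inner_tf (contDiff_pderiv3 h1 k).continuous
    (hasCompactSupport_pderiv3 h2 k), ← inner_neg_right]
  exact ⟨fun h e => by rw [h], fun h => ext_inner_left ℝ h⟩

theorem HasWeakPartial.unique (hD : IsOpen D) {k : Fin 3} {u g g' : L2 D}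
    (h : HasWeakPartial D k u g) (h' : HasWeakPartial D k u g') : g = g' := by
  have key : ∀ᵐ x ∂volume, x ∈ D → (g - g' : L2 D) x = 0 := by
    refine hD.ae_eq_zero_of_integral_contDiff_smul_eq_zero ?_ fun φ h1 h2 h3 => ?_
    · exact locallyIntegrableOn_of_locallyIntegrable_restrict
        ((Lp.memLp (g - g')).locallyIntegrable (by norm_num))
    · have e1 : ∫ x, φ x • (g - g' : L2 D) x = ∫ x in D, φ x • (g - g' : L2 D) x := by
        rw [setIntegral_eq_integral_of_forall_compl_eq_zero]
        intro x hx
        rw [image_eq_zero_of_notMem_tsupport (fun h => hx (h3 h)), zero_smul]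
      rw [e1]
      have e2 : ∫ x in D, φ x • (g - g' : L2 D) x = (∫ x in D, φ x • g x) - ∫ x in D, φ x • g' x := by
        rw [← integral_sub (integrable_test_smul h1.continuous h2 g)
          (integrable_test_smul h1.continuous h2 g')]
        apply integral_congr_ae
        filter_upwards [Lp.coeFn_sub g g'] with x hx
        rw [hx, Pi.sub_apply, smul_sub]
      rw [e2, sub_eq_zero, ← neg_inj, ← h φ h1 h2 h3, ← h' φ h1 h2 h3]
  rw [← sub_eq_zero]
  apply (Lp.eq_zero_iff_ae_eq_zero).2
  exact (ae_restrict_iff' hD.measurableSet).2 key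

theorem HasWeakPartial.weakPartial_eq (hD : IsOpen D) {k : Fin 3} {u g : L2 D}
    (h : HasWeakPartial D k u g) : weakPartial k u = g := by
  have h' : ∃ g : L2 D, HasWeakPartial D k u g := ⟨g, h⟩
  rw [weakPartial, dif_pos h']
  exact h'.choose_spec.unique hD h

theorem MemH1.hasWeakPartial {u : L2 D} (h : MemH1 u) (k : Fin 3) :
    HasWeakPartial D k u (weakPartial k u) := by
  rw [weakPartial, dif_pos (h k)]; exact (h k).choose_spec

/-! ### The Hilbert space `H¹(D)³` -/

/-- The Hilbert space `H¹(D)³`: families of a function and its weak partial derivatives. -/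
def H1 (D : Set E3) : Submodule ℝ (PiLp 2 fun _ : Option (Fin 3) => L2 D) where
  carrier := {p | ∀ k, HasWeakPartial D k (p none) (p (some k))}
  add_mem' := by
    intro p q hp hq k
    rw [hasWeakPartial_iff]
    intro φ h1 h2 h3 e
    rw [PiLp.add_apply, PiLp.add_apply, inner_add_right, inner_add_right,
      hasWeakPartial_iff.1 (hp k) φ h1 h2 h3 e, hasWeakPartial_iff.1 (hq k) φ h1 h2 h3 e]
    ring
  zero_mem' := by
    intro k
    rw [hasWeakPartial_iff]
    intro φ h1 h2 h3 e
    simp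
  smul_mem' := by
    intro c p hp k
    rw [hasWeakPartial_iff]
    intro φ h1 h2 h3 e
    rw [PiLp.smul_apply, PiLp.smul_apply, inner_smul_right, inner_smul_right,
      hasWeakPartial_iff.1 (hp k) φ h1 h2 h3 e]
    ring

theorem isClosed_H1 (D : Set E3) : IsClosed (H1 D : Set (PiLp 2 fun _ : Option (Fin 3) => L2 D)) := by
  have : (H1 D : Set (PiLp 2 fun _ : Option (Fin 3) => L2 D)) =
      ⋂ (k : Fin 3) (φ : E3 → ℝ) (_ : ContDiff ℝ (⊤ : ℕ∞) φ) (_ : HasCompactSupport φ)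
        (_ : tsupport φ ⊆ D) (e : E3), {p : PiLp 2 fun _ : Option (Fin 3) => L2 D |
          inner ℝ (tf (pderiv3 k φ) e) (p none) = -inner ℝ (tf φ e) (p (some k))} := by
    ext p
    simp only [mem_iInter]
    exact forall_congr' fun k => hasWeakPartial_iff
  rw [this]
  refine isClosed_iInter fun k => isClosed_iInter fun φ => isClosed_iInter fun _ =>
    isClosed_iInter fun _ => isClosed_iInter fun _ => isClosed_iInter fun e => ?_
  exact isClosed_eq (by fun_prop) (by fun_prop)

instance : CompleteSpace (H1 D) := (isClosed_H1 D).completeSpace_coe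
instance : MeasurableSpace (H1 D) := borel _
instance : BorelSpace (H1 D) := ⟨rfl⟩

/-- The function underlying an element of `H¹(D)³`. -/
def H1.val : H1 D →L[ℝ] L2 D := (PiLp.proj 2 (fun _ : Option (Fin 3) => L2 D) none).comp (H1 D).subtypeL
/-- The weak partial derivatives of an element of `H¹(D)³`. -/
def H1.grad (k : Fin 3) : H1 D →L[ℝ] L2 D :=
  (PiLp.proj 2 (fun _ : Option (Fin 3) => L2 D) (some k)).comp (H1 D).subtypeL

theorem H1.hasWeakPartial (p : H1 D) (k : Fin 3) : HasWeakPartial D k (H1.val p) (H1.grad k p) := p.2 k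
theorem H1.memH1 (p : H1 D) : MemH1 (H1.val p) := fun k => ⟨_, H1.hasWeakPartial p k⟩
theorem H1.weakPartial_val (hD : IsOpen D) (p : H1 D) (k : Fin 3) :
    weakPartial k (H1.val p) = H1.grad k p := (H1.hasWeakPartial p k).weakPartial_eq hD

theorem H1.inner_eq (p q : H1 D) : inner ℝ p q =
    inner ℝ (H1.val p) (H1.val q) + ∑ k, inner ℝ (H1.grad k p) (H1.grad k q) := by
  rw [Submodule.coe_inner, PiLp.inner_apply, Fintype.sum_option]; rfl

theorem H1.norm_sq_eq (p : H1 D) : ‖p‖ ^ 2 = ‖H1.val p‖ ^ 2 + ∑ k, ‖H1.grad k p‖ ^ 2 := by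
  simp only [← real_inner_self_eq_norm_sq, H1.inner_eq]

/-- The element of `H¹(D)³` defined by a function. -/
def MemH1.lift {u : L2 D} (h : MemH1 u) : H1 D :=
  ⟨WithLp.toLp 2 fun o => o.elim u fun k => weakPartial k u, fun k => h.hasWeakPartial k⟩

@[simp] theorem MemH1.val_lift {u : L2 D} (h : MemH1 u) : H1.val h.lift = u := rfl
@[simp] theorem MemH1.grad_lift {u : L2 D} (h : MemH1 u) (k : Fin 3) :
    H1.grad k h.lift = weakPartial k u := rfl

theorem H1.val_injective (hD : IsOpen D) : Function.Injective (H1.val : H1 D → L2 D) := by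
  intro p q h
  rw [← sub_eq_zero, ← norm_eq_zero, ← sq_eq_zero_iff, H1.norm_sq_eq]
  have : ∀ k, H1.grad k p = H1.grad k q := fun k => by
    rw [← H1.weakPartial_val hD, ← H1.weakPartial_val hD, h]
  simp [map_sub, h, this]

theorem MemH1.add {u v : L2 D} (hu : MemH1 u) (hv : MemH1 v) : MemH1 (u + v) := by
  simpa using H1.memH1 (hu.lift + hv.lift)
theorem MemH1.sub {u v : L2 D} (hu : MemH1 u) (hv : MemH1 v) : MemH1 (u - v) := by
  simpa using H1.memH1 (hu.lift - hv.lift)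
theorem weakPartial_add (hD : IsOpen D) {u v : L2 D} (hu : MemH1 u) (hv : MemH1 v) (k : Fin 3) :
    weakPartial k (u + v) = weakPartial k u + weakPartial k v := by
  simpa using H1.weakPartial_val hD (hu.lift + hv.lift) k
theorem weakPartial_sub (hD : IsOpen D) {u v : L2 D} (hu : MemH1 u) (hv : MemH1 v) (k : Fin 3) :
    weakPartial k (u - v) = weakPartial k u - weakPartial k v := by
  simpa using H1.weakPartial_val hD (hu.lift - hv.lift) k

theorem sq_lintegral_le {α : Type*} [MeasurableSpace α] (ν : Measure α) {g : α → ENNReal}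
    (hg : AEMeasurable g ν) : (∫⁻ x, g x ∂ν) ^ 2 ≤ ν univ * ∫⁻ x, g x ^ 2 ∂ν := by
  have h := ENNReal.lintegral_mul_le_Lp_mul_Lq ν (p := 2) (q := 2) Real.HolderConjugate.two_two
    (f := fun _ => 1) (g := g) aemeasurable_const hg
  simp only [Pi.mul_apply, one_mul, ENNReal.one_rpow, lintegral_const] at h
  calc (∫⁻ x, g x ∂ν) ^ 2 ≤ ((ν univ) ^ (1 / 2 : ℝ) * (∫⁻ a, g a ^ (2 : ℝ) ∂ν) ^ (1 / 2 : ℝ)) ^ 2 := by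
        simpa using pow_le_pow_left' h 2
    _ = _ := by
        rw [mul_pow, ← ENNReal.rpow_natCast, ← ENNReal.rpow_mul, ← ENNReal.rpow_natCast,
          ← ENNReal.rpow_mul]
        norm_num

/-! ### Mollification -/

/-- A sequence of smooth bumps that concentrate at the origin. -/
def bump (j : ℕ) : ContDiffBump (0 : E3) where
  rIn := 1 / ((j : ℝ) + 1)
  rOut := 2 / ((j : ℝ) + 1)
  rIn_pos := by positivity
  rIn_lt_rOut := by gcongr; norm_num

theorem tendsto_bump_rOut : Tendsto (fun j => (bump j).rOut) atTop (𝓝 0) := by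
  have := (tendsto_one_div_add_atTop_nhds_zero_nat (𝕜 := ℝ)).const_mul 2
  simpa [bump, div_eq_mul_inv] using this

/-- The smooth density of mass `1` associated with a bump. -/
def rho (j : ℕ) : E3 → ℝ := (bump j).normed volume

theorem rho_nonneg (j : ℕ) (x : E3) : 0 ≤ rho j x := (bump j).nonneg_normed x
theorem contDiff_rho (j : ℕ) : ContDiff ℝ (⊤ : ℕ∞) (rho j) := (bump j).contDiff_normed
theorem hasCompactSupport_rho (j : ℕ) : HasCompactSupport (rho j) := (bump j).hasCompactSupport_normed
theorem integral_rho (j : ℕ) : ∫ x, rho j x = 1 := (bump j).integral_normed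
theorem integrable_rho (j : ℕ) : Integrable (rho j) := (bump j).integrable_normed
theorem tsupport_rho (j : ℕ) : tsupport (rho j) = Metric.closedBall 0 (bump j).rOut :=
  (bump j).tsupport_normed_eq
theorem lintegral_rho (j : ℕ) : ∫⁻ x, ofReal (rho j x) = 1 := by
  rw [← ofReal_integral_eq_lintegral_ofReal (integrable_rho j)
    (Eventually.of_forall (rho_nonneg j)), integral_rho, ENNReal.ofReal_one]

/-- The mollification of a function. -/
def mol (j : ℕ) (f : E3 → ℝ) : E3 → ℝ :=
  convolution (rho j) f (ContinuousLinearMap.lsmul ℝ ℝ) volume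

theorem mol_apply (j : ℕ) (f : E3 → ℝ) (x : E3) : mol j f x = ∫ y, rho j (x - y) * f y := by
  rw [mol, convolution_eq_swap]; rfl

theorem mol_apply' (j : ℕ) (f : E3 → ℝ) (x : E3) : mol j f x = ∫ y, rho j y * f (x - y) := rfl

theorem contDiff_mol (j : ℕ) {f : E3 → ℝ} (hf : LocallyIntegrable f) :
    ContDiff ℝ (⊤ : ℕ∞) (mol j f) :=
  (hasCompactSupport_rho j).contDiff_convolution_left _ (contDiff_rho j) hf

theorem integrable_rho_mul (j : ℕ) {f : E3 → ℝ} (hf : LocallyIntegrable f) (x : E3) :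
    Integrable fun y => rho j (x - y) * f y := by
  refine hf.integrable_smul_left_of_hasCompactSupport (g := fun y => rho j (x - y)) ?_ ?_
  · exact (contDiff_rho j).continuous.comp (by fun_prop)
  · exact (hasCompactSupport_rho j).comp_homeomorph (Homeomorph.subLeft x)

theorem mol_sub (j : ℕ) {f g : E3 → ℝ} (hf : LocallyIntegrable f) (hg : LocallyIntegrable g) (x : E3) :
    mol j (f - g) x = mol j f x - mol j g x := by
  simp only [mol_apply, Pi.sub_apply, mul_sub]
  exact integral_sub (integrable_rho_mul j hf x) (integrable_rho_mul j hg x)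

theorem sq_enorm_mol_le (j : ℕ) {f : E3 → ℝ} (hf : AEStronglyMeasurable f) (x : E3) :
    ‖mol j f x‖ₑ ^ 2 ≤ ∫⁻ y, ofReal (rho j y) * ‖f (x - y)‖ₑ ^ 2 := by
  set ν := volume.withDensity fun y => ofReal (rho j y) with hν
  have hm : Measurable fun y => ofReal (rho j y) :=
    (contDiff_rho j).continuous.measurable.ennreal_ofReal
  have hf' : AEMeasurable (fun y => ‖f (x - y)‖ₑ) volume :=
    (hf.comp_quasiMeasurePreserving
      (quasiMeasurePreserving_sub_left volume x)).enorm
  have h1 : ν univ = 1 := by rw [hν, withDensity_apply _ MeasurableSet.univ]; simp [lintegral_rho]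
  calc ‖mol j f x‖ₑ ^ 2 ≤ (∫⁻ y, ofReal (rho j y) * ‖f (x - y)‖ₑ) ^ 2 := by
        gcongr
        rw [mol_apply']
        refine (enorm_integral_le_lintegral_enorm _).trans (le_of_eq ?_)
        congr 1; ext y
        rw [enorm_mul, Real.enorm_of_nonneg (rho_nonneg j y)]
    _ = (∫⁻ y, ‖f (x - y)‖ₑ ∂ν) ^ 2 := by
        rw [hν, lintegral_withDensity_eq_lintegral_mul₀ hm.aemeasurable hf']; rfl
    _ ≤ ν univ * ∫⁻ y, ‖f (x - y)‖ₑ ^ 2 ∂ν :=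
        sq_lintegral_le ν (hf'.mono_ac (withDensity_absolutelyContinuous _ _))
    _ = _ := by
        rw [h1, one_mul, hν, lintegral_withDensity_eq_lintegral_mul₀ hm.aemeasurable (hf'.pow_const 2)]
        rfl

theorem eLpNorm_two_sq {α F : Type*} [MeasurableSpace α] [NormedAddCommGroup F] (μ : Measure α)
    (f : α → F) : eLpNorm f 2 μ ^ 2 = ∫⁻ x, ‖f x‖ₑ ^ 2 ∂μ := by
  rw [eLpNorm_eq_lintegral_rpow_enorm_toReal (by norm_num) (by norm_num), ← ENNReal.rpow_natCast,
    ← ENNReal.rpow_mul]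
  norm_num

theorem eLpNorm_mol_le (j : ℕ) {f : E3 → ℝ} (hf : AEStronglyMeasurable f) :
    eLpNorm (mol j f) 2 volume ≤ eLpNorm f 2 volume := by
  have hm : Measurable fun y => ofReal (rho j y) :=
    (contDiff_rho j).continuous.measurable.ennreal_ofReal
  rw [← ENNReal.pow_le_pow_left_iff (n := 2) (by norm_num), eLpNorm_two_sq, eLpNorm_two_sq]
  calc ∫⁻ x, ‖mol j f x‖ₑ ^ 2 ≤ ∫⁻ x, ∫⁻ y, ofReal (rho j y) * ‖f (x - y)‖ₑ ^ 2 :=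
        lintegral_mono fun x => sq_enorm_mol_le j hf x
    _ = ∫⁻ y, ∫⁻ x, ofReal (rho j y) * ‖f (x - y)‖ₑ ^ 2 := by
        apply lintegral_lintegral_swap
        refine (hm.comp measurable_snd).aemeasurable.mul ?_
        exact ((hf.comp_quasiMeasurePreserving
          (quasiMeasurePreserving_sub volume volume)).enorm.pow_const 2)
    _ = ∫⁻ y, ofReal (rho j y) * ∫⁻ x, ‖f x‖ₑ ^ 2 := by
        congr 1; ext y
        rw [lintegral_const_mul' _ _ ofReal_ne_top,
          lintegral_sub_right_eq_self (fun x => ‖f x‖ₑ ^ 2) y]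
    _ = _ := by rw [lintegral_mul_const _ hm, lintegral_rho, one_mul]

theorem tendsto_eLpNorm_mol_of_continuous {g : E3 → ℝ} (hg : Continuous g) (hs : HasCompactSupport g) :
    Tendsto (fun j => eLpNorm (mol j g - g) 2 volume) atTop (𝓝 0) := by
  obtain ⟨R, hR⟩ := hs.isCompact.isBounded.subset_closedBall (0 : E3)
  set B := Metric.closedBall (0 : E3) (R + 2) with hB
  have hsupp : ∀ j, Function.support (mol j g - g) ⊆ B := by
    intro j x hx
    by_contra hxB
    have hx' : R + 2 < ‖x‖ := by simpa [hB] using hxB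
    apply hx
    have h1 : ∀ y, ‖y‖ ≤ 2 → g (x - y) = 0 := by
      intro y hy
      apply image_eq_zero_of_notMem_tsupport
      intro h
      have h2 : ‖x - y‖ ≤ R := by simpa using hR h
      have := norm_sub_norm_le x y
      linarith
    have h2 : mol j g x = 0 := by
      rw [mol_apply']
      rw [integral_eq_zero_of_ae]
      refine Eventually.of_forall fun y => ?_
      by_cases hy : ‖y‖ ≤ 2
      · simp [h1 y hy]
      · have : rho j y = 0 := by
          apply image_eq_zero_of_notMem_tsupport
          rw [tsupport_rho]
          intro h
          apply hy
          have h3 : ‖y‖ ≤ 2 / ((j : ℝ) + 1) := by simpa [bump] using h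
          refine h3.trans ?_
          rw [div_le_iff₀ (by positivity)]
          have : (0 : ℝ) ≤ j := by positivity
          linarith
        simp [this]
    have h3 : g x = 0 := by simpa using h1 0 (by simp)
    simp [h2, h3]
  have hfin : volume B ≠ ⊤ := (isCompact_closedBall _ _).measure_lt_top.ne
  rw [ENNReal.tendsto_nhds_zero]
  intro ε hε
  have huc := hs.uniformContinuous_of_continuous hg
  obtain ⟨δ, hδ, hδε⟩ : ∃ δ : ℝ, 0 < δ ∧ volume B ^ (2 : ENNReal).toReal⁻¹ * ofReal δ ≤ ε := by
    have hne : volume B ^ (2 : ENNReal).toReal⁻¹ ≠ ⊤ := ENNReal.rpow_ne_top_of_nonneg (by positivity) hfin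
    rcases eq_or_ne ε ⊤ with rfl | hεt
    · exact ⟨1, one_pos, le_top⟩
    obtain ⟨δ, hδ, h⟩ := ENNReal.exists_nnreal_pos_mul_lt hne hε.ne'
    refine ⟨δ, hδ, ?_⟩
    rw [mul_comm] at h
    simpa using h.le
  obtain ⟨r, hr, hr'⟩ := Metric.uniformContinuous_iff.1 huc δ hδ
  filter_upwards [tendsto_bump_rOut.eventually (gt_mem_nhds hr)] with j hj
  have hb : ∀ x, ‖(mol j g - g) x‖ ≤ δ := by
    intro x
    rw [Pi.sub_apply, ← dist_eq_norm]
    refine ContDiffBump.dist_normed_convolution_le hg.aestronglyMeasurable fun y hy => ?_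
    exact (hr' ((Metric.mem_ball.1 hy).trans hj)).le
  rw [← eLpNorm_restrict_eq_of_support_subset (hsupp j)]
  refine (eLpNorm_le_of_ae_bound (C := δ) (Eventually.of_forall hb)).trans ?_
  rw [Measure.restrict_apply_univ]
  exact hδε

theorem tendsto_eLpNorm_mol {f : E3 → ℝ} (hf : MemLp f 2 volume) :
    Tendsto (fun j => eLpNorm (mol j f - f) 2 volume) atTop (𝓝 0) := by
  rw [ENNReal.tendsto_nhds_zero]
  intro ε hε
  have h3 : ε / 3 ≠ 0 := by simpa using hε.ne'
  obtain ⟨g, hgs, hfg, hgc, hg2⟩ := hf.exists_hasCompactSupport_eLpNorm_sub_le (by norm_num) h3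
  filter_upwards [(ENNReal.tendsto_nhds_zero.1 (tendsto_eLpNorm_mol_of_continuous hgc hgs)) (ε / 3)
    (pos_iff_ne_zero.2 h3)] with j hj
  have hfl := hf.locallyIntegrable (by norm_num)
  have hgl := hg2.locallyIntegrable (by norm_num)
  have e : mol j f - f = mol j (f - g) + ((mol j g - g) + (g - f)) := by
    ext x
    simp only [Pi.sub_apply, Pi.add_apply, mol_sub j hfl hgl]
    ring
  have m1 : AEStronglyMeasurable (mol j (f - g)) volume :=
    (contDiff_mol j (hfl.sub hgl)).continuous.aestronglyMeasurable
  have m2 : AEStronglyMeasurable (mol j g - g) volume :=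
    ((contDiff_mol j hgl).continuous.sub hgc).aestronglyMeasurable
  have m3 : AEStronglyMeasurable (g - f) volume := hgc.aestronglyMeasurable.sub hf.1
  rw [e]
  calc _ ≤ eLpNorm (mol j (f - g)) 2 volume + eLpNorm ((mol j g - g) + (g - f)) 2 volume :=
        eLpNorm_add_le m1 (m2.add m3) (by norm_num)
    _ ≤ eLpNorm (f - g) 2 volume + (eLpNorm (mol j g - g) 2 volume + eLpNorm (g - f) 2 volume) := by
        gcongr
        · exact eLpNorm_mol_le j (hf.1.sub hgc.aestronglyMeasurable)
        · exact eLpNorm_add_le m2 m3 (by norm_num)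
    _ ≤ ε / 3 + (ε / 3 + ε / 3) := by
        gcongr
        rw [eLpNorm_sub_comm]; exact hfg
    _ = ε := by rw [← add_assoc]; exact ENNReal.add_thirds ε


theorem tendsto_integral_mol_smul {c : E3 → ℝ} (hc : Continuous c) (hs : HasCompactSupport c)
    {f : E3 → ℝ} (hf : MemLp f 2 volume) (w : L2 D) :
    Tendsto (fun j => ∫ x in D, (c x * mol j f x) • w x) atTop (𝓝 (∫ x in D, (c x * f x) • w x)) := by
  obtain ⟨C, hC⟩ := hc.bounded_above_of_compact_support hs
  have hfl := hf.locallyIntegrable (by norm_num)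
  have hint : ∀ g : E3 → ℝ, MemLp g 2 volume → IntegrableOn (fun x => (c x * g x) • w x) D := by
    intro g hg
    have h1 : MemLp (fun x => c x * g x) 2 (ℒ D) :=
      (hg.restrict D).of_le_mul (c := C) (hc.aestronglyMeasurable.mul (hg.restrict D).1)
        (Eventually.of_forall fun x => by rw [norm_mul]; gcongr; exact hC x)
    exact memLp_one_iff_integrable.1 ((Lp.memLp w).smul h1)
  have hmol : ∀ j, MemLp (mol j f) 2 volume := fun j =>
    ⟨(contDiff_mol j hfl).continuous.aestronglyMeasurable, (eLpNorm_mol_le j hf.1).trans_lt hf.2⟩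
  refine tendsto_integral_of_L1' _ (hint f hf).aestronglyMeasurable (Eventually.of_forall fun j => hint _ (hmol j)) ?_
  have hw := (Lp.memLp w).eLpNorm_ne_top
  have h0 : Tendsto (fun j => ofReal C * eLpNorm (mol j f - f) 2 volume *
      eLpNorm w 2 (ℒ D)) atTop (𝓝 0) := by
    have := ENNReal.Tendsto.mul_const (ENNReal.Tendsto.const_mul (tendsto_eLpNorm_mol hf)
      (Or.inr (ofReal_ne_top (r := C)))) (b := eLpNorm w 2 (ℒ D)) (Or.inr hw)
    simpa using this
  refine tendsto_of_tendsto_of_tendsto_of_le_of_le tendsto_const_nhds h0 (fun _ => zero_le) fun j => ?_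
  have e : ((fun x => (c x * mol j f x) • w x) - fun x => (c x * f x) • w x) =
      (fun x => c x * (mol j f - f) x) • (w : E3 → E3) := by
    ext x
    simp only [Pi.sub_apply, Pi.smul_apply', mul_sub, sub_smul]
  have hd := (hmol j).sub hf
  simp only [e]
  refine (eLpNorm_smul_le_mul_eLpNorm (p := 2) (q := 2) (r := 1) (Lp.aestronglyMeasurable w)
    (hc.aestronglyMeasurable.mul (hd.restrict D).1)).trans ?_
  gcongr
  refine (eLpNorm_le_mul_eLpNorm_of_ae_le_mul (g := mol j f - f) (c := C)
    (Eventually.of_forall fun x => ?_) 2).trans ?_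
  · rw [Pi.mul_apply, norm_mul]; gcongr; exact hC x
  · gcongr
    exact Measure.restrict_le_self

/-! ### The product rule -/

/-- A coordinate of a function, extended by zero. -/
def coordExt (u : L2 D) (l : Fin 3) : E3 → ℝ := D.indicator fun x => u x l

theorem memLp_coordExt (hD : IsOpen D) (u : L2 D) (l : Fin 3) : MemLp (coordExt u l) 2 volume := by
  rw [coordExt, memLp_indicator_iff_restrict hD.measurableSet]
  refine (Lp.memLp u).of_le ?_ (Eventually.of_forall fun x => ?_)
  · exact (EuclideanSpace.proj (𝕜 := ℝ) l).continuous.comp_aestronglyMeasurable (Lp.aestronglyMeasurable u)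
  · exact PiLp.norm_apply_le (u x) l

theorem pderiv3_mul {φ ψ : E3 → ℝ} (k : Fin 3) {x : E3} (hφ : DifferentiableAt ℝ φ x)
    (hψ : DifferentiableAt ℝ ψ x) :
    pderiv3 k (fun y => φ y * ψ y) x = pderiv3 k φ x * ψ x + φ x * pderiv3 k ψ x := by
  simp only [pderiv3]
  rw [fderiv_fun_mul hφ hψ]
  simp; ring

theorem pderiv3_mol (hD : IsOpen D) {k : Fin 3} {u g : L2 D} (h : HasWeakPartial D k u g) (l : Fin 3)
    (j : ℕ) {x : E3} (hx : Metric.closedBall x (bump j).rOut ⊆ D) :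
    pderiv3 k (mol j (coordExt u l)) x = mol j (coordExt g l) x := by
  have hul := (memLp_coordExt hD u l).locallyIntegrable (by norm_num)
  set η : E3 → ℝ := fun y => rho j (x - y) with hη
  have η1 : ContDiff ℝ (⊤ : ℕ∞) η := (contDiff_rho j).comp (contDiff_const.sub contDiff_id)
  have η2 : HasCompactSupport η := (hasCompactSupport_rho j).comp_homeomorph (Homeomorph.subLeft x)
  have η3 : tsupport η ⊆ D := by
    refine subset_trans ?_ hx
    refine closure_minimal (fun y hy => ?_) Metric.isClosed_closedBall
    have : x - y ∈ tsupport (rho j) := subset_tsupport _ hy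
    rw [tsupport_rho] at this
    simpa [dist_comm, dist_eq_norm] using this
  have hder : ∀ y, pderiv3 k η y = -(fderiv ℝ (rho j) (x - y) (EuclideanSpace.single k 1)) := by
    intro y
    have h1 : HasFDerivAt η ((fderiv ℝ (rho j) (x - y)).comp (-(ContinuousLinearMap.id ℝ E3))) y :=
      (((contDiff_rho j).differentiable (by simp)) (x - y)).hasFDerivAt.comp y
        ((hasFDerivAt_id y).const_sub x)
    rw [pderiv3, h1.fderiv]; simp
  have hw := h η η1 η2 η3
  have hcoord : ∀ (c : E3 → ℝ) (v : L2 D), Continuous c → HasCompactSupport c →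
      (∫ y in D, c y • v y) l = ∫ y, c y * coordExt v l y := by
    intro c v hc hs
    have := (EuclideanSpace.proj (𝕜 := ℝ) l).integral_comp_comm (integrable_test_smul hc hs v)
    simp only [PiLp.proj_apply] at this
    rw [← this, ← integral_indicator hD.measurableSet]
    congr 1; ext y
    by_cases hy : y ∈ D <;> simp [coordExt, hy]
  have hwl := congrArg (fun v : E3 => v l) hw
  simp only [PiLp.neg_apply] at hwl
  rw [hcoord _ _ (contDiff_pderiv3 η1 k).continuous (hasCompactSupport_pderiv3 η2 k),
    hcoord _ _ η1.continuous η2] at hwl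
  have hconv := (hasCompactSupport_rho j).hasFDerivAt_convolution_left (ContinuousLinearMap.lsmul ℝ ℝ)
    ((contDiff_rho j).of_le (by simp)) hul x
  rw [pderiv3]
  change fderiv ℝ (convolution (rho j) (coordExt u l) (ContinuousLinearMap.lsmul ℝ ℝ) volume) x _ = _
  rw [hconv.fderiv, convolution_eq_swap, ContinuousLinearMap.integral_apply, mol_apply]
  · have e1 : ∫ y, ((ContinuousLinearMap.precompL E3 (ContinuousLinearMap.lsmul ℝ ℝ))
        (fderiv ℝ (rho j) (x - y)) (coordExt u l y)) (EuclideanSpace.single k 1) =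
        -∫ y, pderiv3 k η y * coordExt u l y := by
      rw [← integral_neg]
      congr 1; ext y
      rw [hder]; simp
    rw [e1, hwl, neg_neg]
  · have := ((hasCompactSupport_rho j).fderiv ℝ).convolutionExists_left
      (ContinuousLinearMap.precompL E3 (ContinuousLinearMap.lsmul ℝ ℝ))
      ((contDiff_rho j).continuous_fderiv (by simp)) hul x
    exact (this.integrable_swap)

theorem weak_product_scalar (hD : IsOpen D) {k : Fin 3} {u v gu gv : L2 D} (hu : HasWeakPartial D k u gu)
    (hv : HasWeakPartial D k v gv) (l : Fin 3) {φ : E3 → ℝ} (h1 : ContDiff ℝ (⊤ : ℕ∞) φ)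
    (h2 : HasCompactSupport φ) (h3 : tsupport φ ⊆ D) :
    (∫ x in D, (pderiv3 k φ x * coordExt u l x) • v x) + (∫ x in D, (φ x * coordExt gu l x) • v x) =
      -∫ x in D, (φ x * coordExt u l x) • gv x := by
  have m1 := memLp_coordExt hD u l
  have m2 := memLp_coordExt hD gu l
  have c1 := h1.continuous
  have c2 := (contDiff_pderiv3 h1 k).continuous
  have s2 := hasCompactSupport_pderiv3 h2 k
  have t1 := (tendsto_integral_mol_smul c2 s2 m1 v).add (tendsto_integral_mol_smul c1 h2 m2 v)
  have t2 := (tendsto_integral_mol_smul c1 h2 m1 gv).neg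
  refine tendsto_nhds_unique_of_eventuallyEq t1 t2 ?_
  obtain ⟨δ, hδ, hδD⟩ := h2.isCompact.exists_cthickening_subset_open hD h3
  filter_upwards [tendsto_bump_rOut.eventually (gt_mem_nhds hδ)] with j hj
  have a1 : ContDiff ℝ (⊤ : ℕ∞) (mol j (coordExt u l)) := contDiff_mol j (m1.locallyIntegrable (by norm_num))
  have key := hv (fun x => φ x * mol j (coordExt u l) x) (h1.mul a1) h2.mul_right
    ((tsupport_mul_subset_left).trans h3)
  rw [← key, ← integral_add]
  · apply integral_congr_ae
    refine Eventually.of_forall fun x => ?_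
    simp only []
    rw [pderiv3_mul k (h1.differentiable (by simp) x) (a1.differentiable (by simp) x), add_smul]
    by_cases hx : x ∈ tsupport φ
    · rw [pderiv3_mol hD hu l j]
      refine subset_trans (fun y hy => ?_) hδD
      refine Metric.mem_cthickening_of_dist_le y x δ _ hx ?_
      exact (Metric.mem_closedBall.1 hy).trans hj.le
    · rw [image_eq_zero_of_notMem_tsupport hx]; simp
  · exact integrable_test_smul (c2.mul a1.continuous) s2.mul_right v
  · exact integrable_test_smul (c1.mul (contDiff_mol j (m2.locallyIntegrable (by norm_num))).continuous)
      h2.mul_right v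

theorem bilin_eq_sum {F : Type*} [NormedAddCommGroup F] [NormedSpace ℝ F] (B : E3 →L[ℝ] E3 →L[ℝ] F)
    (a b : E3) : B a b = ∑ l, B (EuclideanSpace.single l 1) (a l • b) := by
  have : a = ∑ l, a l • EuclideanSpace.single l (1 : ℝ) := by
    ext i; simp [Fin.sum_univ_three, PiLp.single_apply]; fin_cases i <;> simp
  conv_lhs => rw [this]
  simp [map_sum]

/-- The product rule for a bilinear product of two functions of `H¹(D)³`. -/
theorem weak_product (hD : IsOpen D) {F : Type*} [NormedAddCommGroup F] [NormedSpace ℝ F]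
    [CompleteSpace F] (B : E3 →L[ℝ] E3 →L[ℝ] F) {k : Fin 3} {u v gu gv : L2 D}
    (hu : HasWeakPartial D k u gu)
    (hv : HasWeakPartial D k v gv) {φ : E3 → ℝ} (h1 : ContDiff ℝ (⊤ : ℕ∞) φ)
    (h2 : HasCompactSupport φ) (h3 : tsupport φ ⊆ D) :
    ∫ x in D, pderiv3 k φ x • B (u x) (v x) =
      -∫ x in D, φ x • (B (gu x) (v x) + B (u x) (gv x)) := by
  have hint : ∀ (c : E3 → ℝ) (a w : L2 D) (l : Fin 3), Continuous c → HasCompactSupport c →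
      IntegrableOn (fun x => (c x * coordExt a l x) • w x) D := by
    intro c f w l hc hs
    obtain ⟨C, hC⟩ := hc.bounded_above_of_compact_support hs
    have hg := memLp_coordExt hD f l
    have h1 : MemLp (fun x => c x * coordExt f l x) 2 (ℒ D) :=
      (hg.restrict D).of_le_mul (c := C) (hc.aestronglyMeasurable.mul (hg.restrict D).1)
        (Eventually.of_forall fun x => by rw [norm_mul]; gcongr; exact hC x)
    exact memLp_one_iff_integrable.1 ((Lp.memLp w).smul h1)
  have hsum : ∀ (c : E3 → ℝ) (a w : L2 D), Continuous c → HasCompactSupport c →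
      IntegrableOn (fun x => c x • B (a x) (w x)) D ∧ ∫ x in D, c x • B (a x) (w x) =
        ∑ l, B (EuclideanSpace.single l 1) (∫ x in D, (c x * coordExt a l x) • w x) := by
    intro c a w hc hs
    have e : ∀ᵐ x ∂ℒ D, ∑ l, B (EuclideanSpace.single l 1)
        ((c x * coordExt a l x) • w x) = c x • B (a x) (w x) := by
      filter_upwards [ae_restrict_mem hD.measurableSet] with x hx
      rw [bilin_eq_sum B (a x) (w x), Finset.smul_sum]
      refine Finset.sum_congr rfl fun l _ => ?_
      rw [coordExt, indicator_of_mem hx, mul_smul, map_smul]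
    have hi : ∀ l, Integrable (fun x => B (EuclideanSpace.single l 1)
        ((c x * coordExt a l x) • w x)) (ℒ D) := fun l =>
      ContinuousLinearMap.integrable_comp _ (hint c a w l hc hs)
    refine ⟨(integrable_finsetSum _ fun l _ => hi l).congr e, ?_⟩
    rw [← integral_congr_ae e, integral_finsetSum _ fun l _ => hi l]
    refine Finset.sum_congr rfl fun l _ => ?_
    exact ContinuousLinearMap.integral_comp_comm _ (hint c a w l hc hs)
  have c1 := h1.continuous
  have c2 := (contDiff_pderiv3 h1 k).continuous
  have s2 := hasCompactSupport_pderiv3 h2 k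
  simp only [smul_add]
  rw [integral_add (hsum φ gu v c1 h2).1 (hsum φ u gv c1 h2).1, (hsum _ u v c2 s2).2,
    (hsum φ gu v c1 h2).2, (hsum φ u gv c1 h2).2, eq_neg_iff_add_eq_zero,
    ← Finset.sum_add_distrib, ← Finset.sum_add_distrib]
  refine Finset.sum_eq_zero fun l _ => ?_
  rw [← map_add, ← map_add, ← add_assoc, weak_product_scalar hD hu hv l h1 h2 h3, neg_add_cancel, map_zero]

theorem HasWeakPartial.cr (hD : IsOpen D) {k : Fin 3} {u v gu gv : L2 D} {K L : ℝ}
    (hu : HasWeakPartial D k u gu) (hv : HasWeakPartial D k v gv)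
    (bu : ∀ᵐ x ∂ℒ D, ‖u x‖ ≤ K) (bv : ∀ᵐ x ∂ℒ D, ‖v x‖ ≤ L) :
    HasWeakPartial D k (cr u v) (cr gu v + cr u gv) := by
  intro φ h1 h2 h3
  rw [integral_congr_ae (g := fun x => pderiv3 k φ x • crossL (u x) (v x)), weak_product hD crossL hu hv h1 h2 h3]
  · congr 1
    apply integral_congr_ae
    filter_upwards [coeFn_cr_right bv (u := gu), coeFn_cr bu (f := gv),
      Lp.coeFn_add (SLLG.cr gu v) (SLLG.cr u gv)] with x e1 e2 e3
    rw [e3, Pi.add_apply, e1, e2]; rfl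
  · filter_upwards [coeFn_cr bu (f := v)] with x e1
    rw [e1]; rfl

theorem MemH1.cr (hD : IsOpen D) {u v : L2 D} {K L : ℝ} (hu : MemH1 u) (hv : MemH1 v)
    (bu : ∀ᵐ x ∂ℒ D, ‖u x‖ ≤ K) (bv : ∀ᵐ x ∂ℒ D, ‖v x‖ ≤ L) :
    MemH1 (cr u v) := fun k => ⟨_, (hu.hasWeakPartial k).cr hD (hv.hasWeakPartial k) bu bv⟩

theorem weakPartial_cr (hD : IsOpen D) {u v : L2 D} {K L : ℝ} (hu : MemH1 u) (hv : MemH1 v)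
    (bu : ∀ᵐ x ∂ℒ D, ‖u x‖ ≤ K) (bv : ∀ᵐ x ∂ℒ D, ‖v x‖ ≤ L) (k : Fin 3) :
    weakPartial k (cr u v) = cr (weakPartial k u) v + cr u (weakPartial k v) :=
  ((hu.hasWeakPartial k).cr hD (hv.hasWeakPartial k) bu bv).weakPartial_eq hD

theorem integral_pderiv3_eq_zero {φ : E3 → ℝ} (h1 : ContDiff ℝ (⊤ : ℕ∞) φ)
    (h2 : HasCompactSupport φ) (k : Fin 3) : ∫ x, pderiv3 k φ x = 0 := by
  have := integral_mul_fderiv_eq_neg_fderiv_mul_of_integrable (μ := volume) (f := fun _ : E3 => (1 : ℝ))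
    (g := φ) (v := EuclideanSpace.single k 1) (by simp)
    (by simp only [one_mul]
        exact (contDiff_pderiv3 h1 k).continuous.integrable_of_hasCompactSupport
          (hasCompactSupport_pderiv3 h2 k))
    (by simpa using h1.continuous.integrable_of_hasCompactSupport h2)
    (fun _ _ => by fun_prop) (fun x _ => h1.differentiable (by simp) x)
  simpa [pderiv3] using this

/-- A field of constant length is orthogonal to its derivatives. -/
theorem inner_weakPartial_eq_zero (hD : IsOpen D) {k : Fin 3} {u g : L2 D} (hu : HasWeakPartial D k u g)
    (h1 : ∀ᵐ x ∂ℒ D, ‖u x‖ = 1) :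
    ∀ᵐ x ∂ℒ D, inner ℝ (u x) (g x) = 0 := by
  have hint : Integrable (fun x => inner ℝ (u x) (g x)) (ℒ D) := L2.integrable_inner u g
  rw [ae_restrict_iff' hD.measurableSet]
  refine hD.ae_eq_zero_of_integral_contDiff_smul_eq_zero
    (locallyIntegrableOn_of_locallyIntegrable_restrict hint.locallyIntegrable) fun φ c1 c2 c3 => ?_
  have e1 : ∫ x, φ x • inner ℝ (u x) (g x) = ∫ x in D, φ x • inner ℝ (u x) (g x) := by
    rw [setIntegral_eq_integral_of_forall_compl_eq_zero]
    intro x hx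
    rw [image_eq_zero_of_notMem_tsupport (fun h => hx (c3 h)), zero_smul]
  have e2 := weak_product hD (innerSL ℝ (E := E3)) hu hu c1 c2 c3
  have e3 : ∫ x in D, pderiv3 k φ x • (innerSL ℝ (E := E3)) (u x) (u x) = 0 := by
    rw [← integral_pderiv3_eq_zero c1 c2 k,
      ← setIntegral_eq_integral_of_forall_compl_eq_zero (s := D) (f := pderiv3 k φ)]
    · apply integral_congr_ae
      filter_upwards [h1] with x hx
      simp [hx]
    · intro x hx
      exact image_eq_zero_of_notMem_tsupport (fun h => hx (c3 (tsupport_pderiv3_subset φ k h)))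
  rw [e3] at e2
  have e4 : ∫ x in D, φ x • (innerSL ℝ (E := E3) (g x) (u x) + innerSL ℝ (u x) (g x)) =
      2 * ∫ x in D, φ x • inner ℝ (u x) (g x) := by
    rw [← integral_const_mul]
    congr 1; ext x
    simp only [innerSL_apply_apply, real_inner_comm (u x) (g x), smul_eq_mul]; ring
  rw [e4] at e2
  rw [e1]; linarith

/-! ### Weak compactness -/

theorem exists_weak_limit {H : Type*} [NormedAddCommGroup H] [InnerProductSpace ℝ H] [CompleteSpace H]
    [TopologicalSpace.SeparableSpace H] {x : ℕ → H} {C : ℝ} (h : ∀ n, ‖x n‖ ≤ C) :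
    ∃ (y : H) (ψ : ℕ → ℕ), StrictMono ψ ∧ ‖y‖ ≤ C ∧
      ∀ z, Tendsto (fun n => inner ℝ (x (ψ n)) z) atTop (𝓝 (inner ℝ y z)) := by
  have hc := WeakDual.isSeqCompact_closedBall ℝ H 0 C
  obtain ⟨f, hf, ψ, hψ, hlim⟩ := hc (x := fun n => StrongDual.toWeakDual (InnerProductSpace.toDual ℝ H (x n)))
    (fun n => by simpa using h n)
  refine ⟨(InnerProductSpace.toDual ℝ H).symm (WeakDual.toStrongDual f), ψ, hψ, by simpa using hf, fun z => ?_⟩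
  have := (WeakDual.eval_continuous z).tendsto f |>.comp hlim
  simp only [InnerProductSpace.toDual_symm_apply]
  exact this

/-! ### Difference quotients -/

/-- The points of `D` at distance larger than `r` from the complement. -/
def inset (D : Set E3) (r : ℝ) : Set E3 := {x | Metric.closedBall x r ⊆ D}

theorem measurableSet_inset (hD : IsOpen D) (r : ℝ) : MeasurableSet (inset D r) := by
  have : IsOpen (inset D r) := by
    rw [Metric.isOpen_iff]
    intro x hx
    obtain ⟨δ, hδ, h⟩ := (isCompact_closedBall x r).exists_cthickening_subset_open hD hx
    refine ⟨δ, hδ, fun y hy z hz => h ?_⟩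
    refine Metric.mem_cthickening_of_dist_le z (z - y + x) δ _ ?_ ?_
    · rw [Metric.mem_closedBall, dist_eq_norm, add_sub_cancel_right, ← dist_eq_norm]; exact hz
    · rw [dist_eq_norm, ← sub_sub, sub_sub_cancel, ← dist_eq_norm]
      exact (Metric.mem_ball.1 hy).le
  exact this.measurableSet

theorem ae_tendsto_mol {f : E3 → ℝ} (hf : LocallyIntegrable f) :
    ∀ᵐ x, Tendsto (fun j => mol j f x) atTop (𝓝 (f x)) := by
  refine ContDiffBump.ae_convolution_tendsto_right_of_locallyIntegrable (φ := bump) (K := 2)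
    tendsto_bump_rOut (Eventually.of_forall fun j => ?_) hf
  simp only [bump]; rw [mul_one_div]

theorem lintegral_diff_mol_le (hD : IsOpen D) {k : Fin 3} {u g : L2 D} (hu : HasWeakPartial D k u g)
    (l : Fin 3) {h : ℝ} (hh : 0 < h) {j : ℕ} (hj : (bump j).rOut < h) :
    ∫⁻ x in inset D (2 * h), ‖mol j (coordExt u l) (x + h • EuclideanSpace.single k 1) -
      mol j (coordExt u l) x‖ₑ ^ 2 ≤ ofReal (h ^ 2) * eLpNorm (coordExt g l) 2 volume ^ 2 := by
  set e : E3 := EuclideanSpace.single k 1 with he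
  have hen : ‖e‖ = 1 := by simp [he]
  set a := mol j (coordExt u l) with ha
  set b := mol j (coordExt g l) with hb
  have ca : ContDiff ℝ (⊤ : ℕ∞) a :=
    contDiff_mol j ((memLp_coordExt hD u l).locallyIntegrable (by norm_num))
  have cb : Continuous b :=
    (contDiff_mol j ((memLp_coordExt hD g l).locallyIntegrable (by norm_num))).continuous
  have hmeas : Measurable fun p : E3 × ℝ => ‖b (p.1 + p.2 • e)‖ₑ ^ 2 := by
    have : Continuous fun p : E3 × ℝ => b (p.1 + p.2 • e) := by fun_prop
    exact this.measurable.enorm.pow_const 2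
  have key : ∀ x ∈ inset D (2 * h), ‖a (x + h • e) - a x‖ₑ ^ 2 ≤
      ofReal h * ∫⁻ s in Ioc 0 h, ‖b (x + s • e)‖ₑ ^ 2 := by
    intro x hx
    have hder : ∀ s ∈ uIcc 0 h, HasDerivAt (fun s : ℝ => a (x + s • e)) (b (x + s • e)) s := by
      intro s hs
      rw [uIcc_of_le hh.le] at hs
      have h1 : HasDerivAt (fun s : ℝ => x + s • e) e s := by
        simpa using ((hasDerivAt_id s).smul_const e).const_add x
      have h2 := ((ca.differentiable (by simp)) (x + s • e)).hasFDerivAt.comp_hasDerivAt s h1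
      have h3 : fderiv ℝ a (x + s • e) e = b (x + s • e) := by
        refine pderiv3_mol hD hu l j (subset_trans (fun y hy => ?_) hx)
        rw [Metric.mem_closedBall] at hy ⊢
        have : dist (x + s • e) x = s := by
          rw [dist_eq_norm, add_sub_cancel_left, norm_smul, hen, mul_one, Real.norm_of_nonneg hs.1]
        linarith [dist_triangle y (x + s • e) x, hs.2]
      rw [h3] at h2; exact h2
    have hint := intervalIntegral.integral_eq_sub_of_hasDerivAt hder
      (Continuous.intervalIntegrable (by fun_prop) _ _)
    simp only [zero_smul, add_zero] at hint
    rw [← hint, intervalIntegral.integral_of_le hh.le]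
    calc _ ≤ (∫⁻ s in Ioc 0 h, ‖b (x + s • e)‖ₑ) ^ 2 := by
          exact pow_le_pow_left' (enorm_integral_le_lintegral_enorm _) 2
      _ ≤ _ := by
          refine (sq_lintegral_le _ ?_).trans (le_of_eq ?_)
          · exact (Continuous.aestronglyMeasurable (by fun_prop)).enorm
          · simp
  calc _ ≤ ∫⁻ x in inset D (2 * h), ofReal h * ∫⁻ s in Ioc 0 h, ‖b (x + s • e)‖ₑ ^ 2 :=
        setLIntegral_mono' (measurableSet_inset hD _) key
    _ ≤ ∫⁻ x, ofReal h * ∫⁻ s in Ioc 0 h, ‖b (x + s • e)‖ₑ ^ 2 := setLIntegral_le_lintegral _ _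
    _ = ofReal h * ∫⁻ s in Ioc 0 h, ∫⁻ x, ‖b (x + s • e)‖ₑ ^ 2 := by
        rw [lintegral_const_mul' _ _ ofReal_ne_top, lintegral_lintegral_swap hmeas.aemeasurable]
    _ = ofReal h * ∫⁻ _s in Ioc 0 h, eLpNorm b 2 volume ^ 2 := by
        congr 2; ext s
        rw [lintegral_add_right_eq_self (fun x => ‖b x‖ₑ ^ 2), eLpNorm_two_sq]
    _ = ofReal (h ^ 2) * eLpNorm b 2 volume ^ 2 := by
        rw [setLIntegral_const, Real.volume_Ioc, sub_zero, sq h, ofReal_mul hh.le]; ring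
    _ ≤ _ := by
        gcongr
        exact eLpNorm_mol_le j (memLp_coordExt hD g l).1

theorem lintegral_diff_le (hD : IsOpen D) {k : Fin 3} {u g : L2 D} (hu : HasWeakPartial D k u g)
    (l : Fin 3) {h : ℝ} (hh : 0 < h) :
    ∫⁻ x in inset D (2 * h), ‖coordExt u l (x + h • EuclideanSpace.single k 1) - coordExt u l x‖ₑ ^ 2
      ≤ ofReal (h ^ 2) * eLpNorm (coordExt g l) 2 volume ^ 2 := by
  set e : E3 := EuclideanSpace.single k 1 with he
  have hul := (memLp_coordExt hD u l).locallyIntegrable (by norm_num)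
  have h1 := ae_tendsto_mol hul
  have h2 : ∀ᵐ x : E3, Tendsto (fun j => mol j (coordExt u l) (x + h • e)) atTop
      (𝓝 (coordExt u l (x + h • e))) :=
    (quasiMeasurePreserving_add_right volume (h • e)).ae h1
  have cm : ∀ j, Continuous (mol j (coordExt u l)) := fun j => (contDiff_mol j hul).continuous
  calc _ = ∫⁻ x in inset D (2 * h), liminf (fun j => ‖mol j (coordExt u l) (x + h • e) -
        mol j (coordExt u l) x‖ₑ ^ 2) atTop := by
        apply lintegral_congr_ae
        filter_upwards [ae_restrict_of_ae h1, ae_restrict_of_ae h2] with x h1 h2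
        exact (((ENNReal.continuous_pow 2).tendsto _).comp (h2.sub h1).enorm).liminf_eq.symm
    _ ≤ liminf (fun j => ∫⁻ x in inset D (2 * h), ‖mol j (coordExt u l) (x + h • e) -
        mol j (coordExt u l) x‖ₑ ^ 2) atTop := by
        refine lintegral_liminf_le fun j => ?_
        have := cm j
        have : Continuous fun x => mol j (coordExt u l) (x + h • e) - mol j (coordExt u l) x := by fun_prop
        exact this.measurable.enorm.pow_const 2
    _ ≤ _ := by
        refine liminf_le_of_frequently_le' (Eventually.frequently ?_)
        filter_upwards [tendsto_bump_rOut.eventually (gt_mem_nhds hh)] with j hj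
        exact lintegral_diff_mol_le hD hu l hh hj

theorem enorm_sq_eq_sum (a : E3) : ‖a‖ₑ ^ 2 = ∑ l, ‖a l‖ₑ ^ 2 := by
  simp only [← ofReal_norm, ← ofReal_pow (norm_nonneg _)]
  rw [← ofReal_sum_of_nonneg (fun _ _ => by positivity), EuclideanSpace.norm_sq_eq]

/-- A function extended by zero. -/
def ext0 (u : L2 D) : E3 → E3 := D.indicator u

theorem ext0_apply (u : L2 D) (x : E3) (l : Fin 3) : ext0 u x l = coordExt u l x := by
  by_cases h : x ∈ D <;> simp [ext0, coordExt, h]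

theorem aestronglyMeasurable_ext0 (hD : IsOpen D) (u : L2 D) : AEStronglyMeasurable (ext0 u) volume :=
  (aestronglyMeasurable_indicator_iff hD.measurableSet).2 (Lp.aestronglyMeasurable u)

theorem memLp_ext0 (hD : IsOpen D) (u : L2 D) : MemLp (ext0 u) 2 volume :=
  (memLp_indicator_iff_restrict hD.measurableSet).2 (Lp.memLp u)

theorem eLpNorm_ext0 (hD : IsOpen D) (u : L2 D) : eLpNorm (ext0 u) 2 volume = ‖u‖ₑ := by
  rw [ext0, eLpNorm_indicator_eq_eLpNorm_restrict hD.measurableSet, Lp.enorm_def]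

theorem lintegral_diff_ext0_le (hD : IsOpen D) {k : Fin 3} {u g : L2 D} (hu : HasWeakPartial D k u g)
    {h : ℝ} (hh : 0 < h) :
    ∫⁻ x in inset D (2 * h), ‖ext0 u (x + h • EuclideanSpace.single k 1) - ext0 u x‖ₑ ^ 2
      ≤ ofReal (h ^ 2) * ‖g‖ₑ ^ 2 := by
  have hm : ∀ l, AEMeasurable (coordExt u l) := fun l => (memLp_coordExt hD u l).1.aemeasurable
  simp only [enorm_sq_eq_sum, PiLp.sub_apply, ext0_apply]
  rw [lintegral_finsetSum' _ fun l _ => ?_]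
  · refine (Finset.sum_le_sum fun l _ => lintegral_diff_le hD hu l hh).trans ?_
    rw [← Finset.mul_sum, ← eLpNorm_ext0 hD, eLpNorm_two_sq]
    simp only [enorm_sq_eq_sum, ext0_apply]
    rw [lintegral_finsetSum' _ fun l _ => (memLp_coordExt hD g l).1.enorm.pow_const 2]
    simp only [eLpNorm_two_sq]; rfl
  · exact (((hm l).comp_quasiMeasurePreserving
      (quasiMeasurePreserving_add_right volume _)).sub (hm l)).enorm.pow_const 2 |>.restrict

/-- The composition of a `1`-Lipschitz map with a function of `H¹(D)³`. -/
theorem HasWeakPartial.comp_lipschitz (hD : IsOpen D) (hDb : Bornology.IsBounded D) {F : E3 → E3}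
    (hF : LipschitzWith 1 F) (hF0 : F 0 = 0) {k : Fin 3} {u g : L2 D} (hu : HasWeakPartial D k u g) :
    ∃ g' : L2 D, HasWeakPartial D k (hF.compLp hF0 u) g' ∧ ‖g'‖ ≤ ‖g‖ := by
  set e : E3 := EuclideanSpace.single k 1 with he
  set w : E3 → E3 := fun x => F (ext0 u x) with hw
  have hwm : AEStronglyMeasurable w volume :=
    hF.continuous.comp_aestronglyMeasurable (aestronglyMeasurable_ext0 hD u)
  have hw2 : MemLp w 2 volume := (memLp_ext0 hD u).of_le hwm (Eventually.of_forall fun x => by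
    simpa [hF0] using hF.dist_le_mul (ext0 u x) 0)
  have hw0 : ∀ x ∉ D, w x = 0 := fun x hx => by simp [hw, ext0, hx, hF0]
  set h : ℕ → ℝ := fun n => 1 / ((n : ℝ) + 1) with hh
  have hpos : ∀ n, 0 < h n := fun n => by positivity
  have hlim : Tendsto h atTop (𝓝 0) := tendsto_one_div_add_atTop_nhds_zero_nat
  set q : ℕ → E3 → E3 := fun n => (inset D (2 * h n)).indicator
    (fun x => (h n)⁻¹ • (w (x + h n • e) - w x)) with hq
  have hms := fun n => measurableSet_inset hD (2 * h n)
  have hshift : ∀ n, AEStronglyMeasurable (fun x => w (x + h n • e)) volume := fun n =>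
    hwm.comp_quasiMeasurePreserving (quasiMeasurePreserving_add_right volume _)
  have hqm : ∀ n, AEStronglyMeasurable (q n) volume := fun n =>
    (((hshift n).sub hwm).const_smul (h n)⁻¹).indicator (hms n)
  have hqn : ∀ n, eLpNorm (q n) 2 (ℒ D) ≤ ‖g‖ₑ := by
    intro n
    refine (eLpNorm_mono_measure _ Measure.restrict_le_self).trans ?_
    rw [← ENNReal.pow_le_pow_left_iff (n := 2) (by norm_num), eLpNorm_two_sq]
    calc ∫⁻ x, ‖q n x‖ₑ ^ 2 = ∫⁻ x in inset D (2 * h n), ‖(h n)⁻¹ • (w (x + h n • e) - w x)‖ₑ ^ 2 := by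
          rw [← lintegral_indicator (hms n)]
          congr 1; ext x
          by_cases hx : x ∈ inset D (2 * h n) <;> simp [hq, hx]
      _ ≤ ∫⁻ x in inset D (2 * h n), ‖(h n)⁻¹‖ₑ ^ 2 * ‖ext0 u (x + h n • e) - ext0 u x‖ₑ ^ 2 := by
          refine lintegral_mono fun x => ?_
          rw [enorm_smul, mul_pow]
          gcongr
          simpa [edist_eq_enorm_sub] using hF (ext0 u (x + h n • e)) (ext0 u x)
      _ = ‖(h n)⁻¹‖ₑ ^ 2 * ∫⁻ x in inset D (2 * h n), ‖ext0 u (x + h n • e) - ext0 u x‖ₑ ^ 2 := by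
          rw [lintegral_const_mul' _ _ (by finiteness)]
      _ ≤ ‖(h n)⁻¹‖ₑ ^ 2 * (ofReal (h n ^ 2) * ‖g‖ₑ ^ 2) := by
          gcongr; exact lintegral_diff_ext0_le hD hu (hpos n)
      _ = ‖g‖ₑ ^ 2 := by
          rw [← mul_assoc, Real.enorm_of_nonneg (inv_pos.2 (hpos n)).le, ← ofReal_pow (inv_pos.2 (hpos n)).le,
            ← ofReal_mul (by positivity), ← mul_pow, inv_mul_cancel₀ (hpos n).ne']
          simp
  have hqL : ∀ n, MemLp (q n) 2 (ℒ D) := fun n =>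
    ⟨(hqm n).restrict, (hqn n).trans_lt (by finiteness)⟩
  obtain ⟨g', ψ, hψ, hg'n, hg'⟩ := exists_weak_limit (x := fun n => (hqL n).toLp (q n)) (C := ‖g‖) (fun n => by
    rw [Lp.norm_toLp]
    exact ENNReal.toReal_le_of_le_ofReal (norm_nonneg _) (by simpa using hqn n))
  refine ⟨g', ?_, hg'n⟩
  rw [hasWeakPartial_iff]
  intro φ h1 h2 h3 v
  have hlip : ∃ C, LipschitzWith C φ := by
    obtain ⟨C, hC⟩ := (h1.continuous_fderiv (by simp)).bounded_above_of_compact_support (h2.fderiv ℝ)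
    exact ⟨C.toNNReal, lipschitzWith_of_nnnorm_fderiv_le (h1.differentiable (by simp)) fun x =>
      NNReal.coe_le_coe.1 ((hC x).trans (by simp))⟩
  obtain ⟨L, hL⟩ := hlip
  obtain ⟨δ, hδ, hδD⟩ := h2.isCompact.exists_cthickening_subset_open hD h3
  have hwi : ∀ c : E3 → ℝ, Continuous c → HasCompactSupport c → Integrable (fun x => c x • w x) :=
    fun c hc hs => (hw2.locallyIntegrable (by norm_num)).integrable_smul_left_of_hasCompactSupport hc hs
  -- the difference quotients of the test function
  have hlimφ : Tendsto (fun n => ∫ x in D, ((h n)⁻¹ * (φ (x - h n • e) - φ x)) • w x) atTop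
      (𝓝 (∫ x in D, (-pderiv3 k φ x) • w x)) := by
    refine tendsto_integral_of_dominated_convergence (fun x => L * ‖w x‖) (fun n => ?_) ?_ (fun n => ?_) ?_
    · have hφc := h1.continuous
      have hc : Continuous fun x => (h n)⁻¹ * (φ (x - h n • e) - φ x) := by fun_prop
      exact hc.aestronglyMeasurable.smul hwm.restrict
    · have : IsFiniteMeasure (ℒ D) := ⟨by simpa using hDb.measure_lt_top⟩
      exact ((memLp_one_iff_integrable.1 ((hw2.restrict D).mono_exponent (by norm_num))).norm).const_mul _
    · refine Eventually.of_forall fun x => ?_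
      rw [norm_smul]
      gcongr
      rw [norm_mul, norm_inv, Real.norm_of_nonneg (hpos n).le, inv_mul_le_iff₀ (hpos n), ← dist_eq_norm]
      refine (hL.dist_le_mul _ _).trans (le_of_eq ?_)
      rw [dist_eq_norm, sub_sub_cancel_left, norm_neg, norm_smul, Real.norm_of_nonneg (hpos n).le]
      simp [he, mul_comm]
    · refine Eventually.of_forall fun x => ?_
      refine Tendsto.smul_const ?_ _
      have hd : HasDerivAt (fun t : ℝ => φ (x - t • e)) (-pderiv3 k φ x) 0 := by
        have h4 : HasDerivAt (fun t : ℝ => x - t • e) (-e) 0 := by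
          simpa using ((hasDerivAt_id (0 : ℝ)).smul_const e).const_sub x
        have h5 : HasFDerivAt φ (fderiv ℝ φ x) (x - (0 : ℝ) • e) := by
          simpa using (h1.differentiable (by simp) x).hasFDerivAt
        have h6 := h5.comp_hasDerivAt (0 : ℝ) h4
        rw [map_neg] at h6
        exact h6
      have := hd.tendsto_slope_zero.comp (tendsto_nhdsWithin_iff.2 ⟨hlim,
        Eventually.of_forall fun n => (hpos n).ne'⟩)
      simpa [Function.comp_def] using this
  have hD0 : ∀ c : E3 → ℝ, ∫ x in D, c x • w x = ∫ x, c x • w x := fun c =>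
    setIntegral_eq_integral_of_forall_compl_eq_zero fun x hx => by rw [hw0 x hx, smul_zero]
  have hquot : ∀ᶠ n in atTop, ∫ x in D, φ x • q n x =
      ∫ x in D, ((h n)⁻¹ * (φ (x - h n • e) - φ x)) • w x := by
    have : Tendsto (fun n => 2 * h n) atTop (𝓝 0) := by simpa using hlim.const_mul 2
    filter_upwards [this.eventually (gt_mem_nhds hδ)] with n hn
    have hsh : HasCompactSupport fun x => φ (x - h n • e) :=
      h2.comp_homeomorph (Homeomorph.subRight (h n • e))
    have hcs : Continuous fun x => φ (x - h n • e) := h1.continuous.comp (by fun_prop)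
    have hsupp : ∀ x, φ x ≠ 0 → x ∈ inset D (2 * h n) := by
      intro x hx y hy
      refine hδD (Metric.mem_cthickening_of_dist_le y x δ _ (subset_tsupport _ hx) ?_)
      exact (Metric.mem_closedBall.1 hy).trans hn.le
    have e1 : ∫ x in D, φ x • q n x = ∫ x, φ x • ((h n)⁻¹ • (w (x + h n • e) - w x)) := by
      rw [setIntegral_eq_integral_of_forall_compl_eq_zero]
      · congr 1; ext1 x
        by_cases hx : φ x = 0
        · simp [hx]
        · simp [hq, hsupp x hx]
      · intro x hx
        rw [image_eq_zero_of_notMem_tsupport (fun h => hx (h3 h)), zero_smul]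
    have e2 : Integrable fun x => φ x • w (x + h n • e) := by
      have := (hwi _ hcs hsh).comp_add_right (h n • e)
      simpa using this
    have e3 : ∫ x, φ x • w (x + h n • e) = ∫ x, φ (x - h n • e) • w x := by
      rw [← integral_add_right_eq_self (fun x => φ (x - h n • e) • w x) (h n • e)]
      simp
    rw [e1, hD0]
    have e4 : ∫ x, φ x • ((h n)⁻¹ • (w (x + h n • e) - w x)) =
        (h n)⁻¹ • ((∫ x, φ x • w (x + h n • e)) - ∫ x, φ x • w x) := by
      rw [← integral_sub e2 (hwi φ h1.continuous h2), ← integral_smul]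
      congr 1; ext1 x
      rw [smul_comm, smul_sub]
    rw [e4, e3, ← integral_sub (hwi _ hcs hsh) (hwi φ h1.continuous h2), ← integral_smul]
    congr 1; ext1 x
    rw [mul_smul, sub_smul]
  have hA : Tendsto (fun n => inner ℝ (tf φ v : L2 D) ((hqL n).toLp (q n))) atTop
      (𝓝 (inner ℝ v (∫ x in D, (-pderiv3 k φ x) • w x))) := by
    refine ((tendsto_const_nhds.inner hlimφ).congr' ?_)
    filter_upwards [hquot] with n hn
    rw [inner_tf h1.continuous h2, ← hn]
    congr 1
    apply integral_congr_ae
    filter_upwards [(hqL n).coeFn_toLp] with x hx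
    rw [hx]
  have hB := hg' (tf φ v)
  have hC := tendsto_nhds_unique (hB.congr fun n => real_inner_comm _ _) (hA.comp hψ.tendsto_atTop)
  rw [real_inner_comm g', hC, inner_tf (contDiff_pderiv3 h1 k).continuous (hasCompactSupport_pderiv3 h2 k),
    ← inner_neg_right, ← integral_neg]
  congr 1
  apply integral_congr_ae
  filter_upwards [hF.coeFn_compLp hF0 u, ae_restrict_mem hD.measurableSet] with x hx hxD
  rw [hx]; simp [hw, ext0, hxD]

/-! ### The embedding of `H²(D)³` into the bounded functions -/

theorem fderiv_apply_eq_sum (a : E3 → ℝ) (y z : E3) : fderiv ℝ a y z = ∑ k, z k * pderiv3 k a y := by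
  have : z = ∑ l, z l • EuclideanSpace.single l (1 : ℝ) := by
    ext i; simp [Fin.sum_univ_three]; fin_cases i <;> simp
  conv_lhs => rw [this]
  simp [map_sum, pderiv3]

theorem taylor_segment {a : E3 → ℝ} {b : Fin 3 → E3 → ℝ} {bb : Fin 3 → Fin 3 → E3 → ℝ} {x z : E3}
    (ha : Differentiable ℝ a) (hb : ∀ k, Differentiable ℝ (b k)) (hbb : ∀ k m, Continuous (bb k m))
    (h1 : ∀ t ∈ Icc (0 : ℝ) 1, ∀ k, pderiv3 k a (x + t • z) = b k (x + t • z))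
    (h2 : ∀ t ∈ Icc (0 : ℝ) 1, ∀ k m, pderiv3 m (b k) (x + t • z) = bb k m (x + t • z)) :
    a x = a (x + z) - ∑ k, z k * b k (x + z) +
      ∫ t in (0 : ℝ)..1, t * ∑ k, ∑ m, z k * z m * bb k m (x + t • z) := by
  have hl : ∀ s : ℝ, HasDerivAt (fun s : ℝ => x + s • z) z s := fun s => by
    simpa using ((hasDerivAt_id s).smul_const z).const_add x
  have d1 : ∀ s ∈ uIcc (0 : ℝ) 1, HasDerivAt (fun s : ℝ => a (x + s • z))
      (∑ k, z k * b k (x + s • z)) s := by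
    intro s hs
    rw [uIcc_of_le zero_le_one] at hs
    have := (ha (x + s • z)).hasFDerivAt.comp_hasDerivAt s (hl s)
    rw [fderiv_apply_eq_sum] at this
    simp only [h1 s hs] at this
    exact this
  have d2 : ∀ s ∈ uIcc (0 : ℝ) 1, HasDerivAt (fun s : ℝ => ∑ k, z k * b k (x + s • z))
      (∑ k, ∑ m, z k * z m * bb k m (x + s • z)) s := by
    intro s hs
    rw [uIcc_of_le zero_le_one] at hs
    refine HasDerivAt.fun_sum fun k _ => ?_
    have := (hb k (x + s • z)).hasFDerivAt.comp_hasDerivAt s (hl s)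
    rw [fderiv_apply_eq_sum] at this
    simp only [h2 s hs] at this
    have := this.const_mul (z k)
    rw [Finset.mul_sum] at this
    simpa [mul_assoc] using this
  have d3 : ∀ s ∈ uIcc (0 : ℝ) 1, HasDerivAt
      (fun s : ℝ => a (x + s • z) - s * ∑ k, z k * b k (x + s • z))
      (-(s * ∑ k, ∑ m, z k * z m * bb k m (x + s • z))) s := by
    intro s hs
    have := (d1 s hs).sub ((hasDerivAt_id s).mul (d2 s hs))
    convert! this using 1
    simp
  have := intervalIntegral.integral_eq_sub_of_hasDerivAt d3
    (Continuous.intervalIntegrable (by fun_prop) _ _)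
  rw [intervalIntegral.integral_neg] at this
  simp only [one_smul, zero_smul, add_zero, one_mul, zero_mul, sub_zero] at this
  linarith

theorem sq_setLIntegral_comp_le {f : E3 → ℝ} (hf : Continuous f) (x : E3) {s : ℝ} (hs : 0 < s)
    (B : Set E3) :
    (∫⁻ z in B, ‖f (x + s • z)‖ₑ) ^ 2 ≤
      volume B * (ofReal (s ^ 3)⁻¹ * eLpNorm f 2 volume ^ 2) := by
  have hm : Continuous fun z => f (x + s • z) := by fun_prop
  refine (sq_lintegral_le _ hm.measurable.enorm.aemeasurable).trans ?_
  rw [Measure.restrict_apply_univ]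
  gcongr
  refine (setLIntegral_le_lintegral _ _).trans (le_of_eq ?_)
  have h1 : Measurable fun z => ‖f (x + z)‖ₑ ^ 2 := by
    have : Continuous fun z => f (x + z) := by fun_prop
    exact this.measurable.enorm.pow_const 2
  rw [← lintegral_map h1 (measurable_const_smul s), Measure.map_addHaar_smul _ hs.ne',
    lintegral_smul_measure, lintegral_add_left_eq_self (fun z => ‖f z‖ₑ ^ 2) x, eLpNorm_two_sq]
  simp [abs_of_pos hs]

theorem setLIntegral_comp_le {f : E3 → ℝ} (hf : Continuous f) (x : E3) {s : ℝ} (hs : 0 < s)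
    (B : Set E3) (hB : volume B ≠ ⊤) :
    ∫⁻ z in B, ‖f (x + s • z)‖ₑ ≤
      ofReal (√(volume B).toReal * s ^ (-(3 / 2) : ℝ)) * eLpNorm f 2 volume := by
  rw [← ENNReal.pow_le_pow_left_iff (n := 2) (by norm_num), mul_pow]
  refine (sq_setLIntegral_comp_le hf x hs B).trans (le_of_eq ?_)
  rw [← mul_assoc, ← ofReal_pow (by positivity), mul_pow, Real.sq_sqrt ENNReal.toReal_nonneg,
    ofReal_mul ENNReal.toReal_nonneg, ENNReal.ofReal_toReal hB, ← Real.rpow_natCast (s ^ _),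
    ← Real.rpow_mul hs.le]
  congr 3
  rw [show -(3 / 2 : ℝ) * (2 : ℕ) = -(3 : ℕ) by norm_num, Real.rpow_neg hs.le, Real.rpow_natCast]

/-- The integral `∫₀¹ s^{-1/2} ds`. -/
def halfInt : ENNReal := ∫⁻ s in Ioc (0 : ℝ) 1, ofReal (s * s ^ (-(3 / 2) : ℝ))

theorem halfInt_ne_top : halfInt ≠ ⊤ := by
  have h : IntegrableOn (fun s : ℝ => s ^ (-(1 / 2) : ℝ)) (Ioc 0 1) :=
    (intervalIntegrable_iff_integrableOn_Ioc_of_le zero_le_one).1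
      (intervalIntegral.intervalIntegrable_rpow' (by norm_num))
  have e : halfInt = ∫⁻ s in Ioc (0 : ℝ) 1, ofReal (s ^ (-(1 / 2) : ℝ)) := by
    refine setLIntegral_congr_fun measurableSet_Ioc fun s hs => ?_
    congr 1
    nth_rw 1 [← Real.rpow_one s]
    rw [← Real.rpow_add hs.1]; norm_num
  rw [e]
  have := h.lintegral_lt_top
  exact this.ne

theorem enorm_le_of_taylor {a : E3 → ℝ} {b : Fin 3 → E3 → ℝ} {bb : Fin 3 → Fin 3 → E3 → ℝ} {x : E3}
    {B : Set E3} {r : ℝ} (hBm : MeasurableSet B) (hr : ∀ z ∈ B, ‖z‖ ≤ r) (hB : volume B ≠ ⊤)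
    (ha : Differentiable ℝ a) (hb : ∀ k, Differentiable ℝ (b k)) (hbb : ∀ k m, Continuous (bb k m))
    (h1 : ∀ z ∈ B, ∀ t ∈ Icc (0 : ℝ) 1, ∀ k, pderiv3 k a (x + t • z) = b k (x + t • z))
    (h2 : ∀ z ∈ B, ∀ t ∈ Icc (0 : ℝ) 1, ∀ k m, pderiv3 m (b k) (x + t • z) = bb k m (x + t • z)) :
    volume B * ‖a x‖ₑ ≤ ofReal √(volume B).toReal * (eLpNorm a 2 volume +
      ofReal r * ∑ k, eLpNorm (b k) 2 volume +
      ofReal r * ofReal r * halfInt * ∑ k, ∑ m, eLpNorm (bb k m) 2 volume) := by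
  have hz : ∀ z ∈ B, ∀ k, ‖z k‖ₑ ≤ ofReal r := fun z hzB k => by
    rw [← ofReal_norm]
    exact ofReal_le_ofReal ((PiLp.norm_apply_le z k).trans (hr z hzB))
  have pt : ∀ z ∈ B, ‖a x‖ₑ ≤ ‖a (x + (1 : ℝ) • z)‖ₑ + ofReal r * (∑ k, ‖b k (x + (1 : ℝ) • z)‖ₑ) +
      ofReal r * ofReal r * ∑ k, ∑ m, ∫⁻ t in Ioc (0 : ℝ) 1,
        ofReal t * ‖bb k m (x + t • z)‖ₑ := by
    intro z hzB
    have e := taylor_segment ha hb hbb (h1 z hzB) (h2 z hzB)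
    rw [e]
    refine (enorm_add_le _ _).trans (add_le_add ((enorm_sub_le).trans (add_le_add (by simp) ?_)) ?_)
    · refine (enorm_sum_le _ _).trans ?_
      rw [Finset.mul_sum]
      refine Finset.sum_le_sum fun k _ => ?_
      rw [enorm_mul, one_smul]
      gcongr
      exact hz z hzB k
    · rw [intervalIntegral.integral_of_le zero_le_one]
      refine (enorm_integral_le_lintegral_enorm _).trans ?_
      have hm : ∀ k m, Measurable fun t : ℝ => ofReal t * ‖bb k m (x + t • z)‖ₑ := fun k m => by
        have : Continuous fun t : ℝ => bb k m (x + t • z) := by have := hbb k m; fun_prop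
        exact ENNReal.measurable_ofReal.mul this.measurable.enorm
      have : ∑ k, ∑ m, ∫⁻ t in Ioc (0 : ℝ) 1, ofReal t * ‖bb k m (x + t • z)‖ₑ =
          ∫⁻ t in Ioc (0 : ℝ) 1, ∑ k, ∑ m, ofReal t * ‖bb k m (x + t • z)‖ₑ := by
        rw [lintegral_finsetSum _ fun k _ => Finset.measurable_fun_sum _ fun m _ => hm k m]
        refine Finset.sum_congr rfl fun k _ => ?_
        rw [lintegral_finsetSum _ fun m _ => hm k m]
      rw [this, ← lintegral_const_mul _ (Finset.measurable_fun_sum _ fun k _ =>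
        Finset.measurable_fun_sum _ fun m _ => hm k m)]
      refine setLIntegral_mono' measurableSet_Ioc fun t ht => ?_
      rw [enorm_mul, Real.enorm_of_nonneg ht.1.le]
      calc _ ≤ ofReal t * ∑ k, ∑ m, ofReal r * ofReal r * ‖bb k m (x + t • z)‖ₑ := by
            gcongr
            refine (enorm_sum_le _ _).trans (Finset.sum_le_sum fun k _ => ?_)
            refine (enorm_sum_le _ _).trans (Finset.sum_le_sum fun m _ => ?_)
            rw [enorm_mul, enorm_mul]
            gcongr <;> exact hz z hzB _
        _ = _ := by
            simp only [Finset.mul_sum]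
            refine Finset.sum_congr rfl fun k _ => Finset.sum_congr rfl fun m _ => ?_
            ring
  have ca : Continuous a := ha.continuous
  have cb : ∀ k, Continuous (b k) := fun k => (hb k).continuous
  have mA : Measurable fun z => ‖a (x + (1 : ℝ) • z)‖ₑ :=
    (show Continuous fun z => a (x + (1 : ℝ) • z) by fun_prop).measurable.enorm
  have mb : ∀ k, Measurable fun z => ‖b k (x + (1 : ℝ) • z)‖ₑ := fun k =>
    (show Continuous fun z => b k (x + (1 : ℝ) • z) by have := cb k; fun_prop).measurable.enorm
  have mbb : ∀ k m, Measurable fun p : E3 × ℝ => ofReal p.2 * ‖bb k m (x + p.2 • p.1)‖ₑ := fun k m =>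
    (ENNReal.measurable_ofReal.comp measurable_snd).mul
      (show Continuous fun p : E3 × ℝ => bb k m (x + p.2 • p.1) by
        have := hbb k m; fun_prop).measurable.enorm
  have mbi : ∀ k m, Measurable fun z => ∫⁻ t in Ioc (0 : ℝ) 1, ofReal t * ‖bb k m (x + t • z)‖ₑ :=
    fun k m => (mbb k m).lintegral_prod_right'
  have one : ∀ f : E3 → ℝ, Continuous f → ∫⁻ z in B, ‖f (x + (1 : ℝ) • z)‖ₑ ≤
      ofReal √(volume B).toReal * eLpNorm f 2 volume := fun f hf => by
    simpa using setLIntegral_comp_le hf x one_pos B hB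
  have two : ∀ f : E3 → ℝ, Continuous f → ∫⁻ z in B, ∫⁻ t in Ioc (0 : ℝ) 1,
      ofReal t * ‖f (x + t • z)‖ₑ ≤
      ofReal √(volume B).toReal * (halfInt * eLpNorm f 2 volume) := fun f hf => by
    have mf : Measurable fun p : E3 × ℝ => ofReal p.2 * ‖f (x + p.2 • p.1)‖ₑ :=
      (ENNReal.measurable_ofReal.comp measurable_snd).mul
      (show Continuous fun p : E3 × ℝ => f (x + p.2 • p.1) by fun_prop).measurable.enorm
    rw [lintegral_lintegral_swap mf.aemeasurable]
    calc _ ≤ ∫⁻ t in Ioc (0 : ℝ) 1, ofReal √(volume B).toReal *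
          (ofReal (t * t ^ (-(3 / 2) : ℝ)) * eLpNorm f 2 volume) := by
          refine setLIntegral_mono' measurableSet_Ioc fun t ht => ?_
          rw [lintegral_const_mul' _ _ ofReal_ne_top]
          refine (mul_le_mul_right (setLIntegral_comp_le hf x ht.1 B hB) _).trans (le_of_eq ?_)
          rw [ofReal_mul (by positivity), ofReal_mul ht.1.le]; ring
      _ = _ := by
          rw [lintegral_const_mul' _ _ ofReal_ne_top, lintegral_mul_const]
          · rfl
          · exact (measurable_id.mul (measurable_id.pow_const _)).ennreal_ofReal
  calc volume B * ‖a x‖ₑ = ∫⁻ _z in B, ‖a x‖ₑ := by rw [setLIntegral_const, mul_comm]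
    _ ≤ ∫⁻ z in B, (‖a (x + (1 : ℝ) • z)‖ₑ + ofReal r * (∑ k, ‖b k (x + (1 : ℝ) • z)‖ₑ) +
      ofReal r * ofReal r * ∑ k, ∑ m, ∫⁻ t in Ioc (0 : ℝ) 1,
        ofReal t * ‖bb k m (x + t • z)‖ₑ) := setLIntegral_mono' hBm pt
    _ = (∫⁻ z in B, ‖a (x + (1 : ℝ) • z)‖ₑ) + ofReal r * (∑ k, ∫⁻ z in B, ‖b k (x + (1 : ℝ) • z)‖ₑ) +
      ofReal r * ofReal r * ∑ k, ∑ m, ∫⁻ z in B, ∫⁻ t in Ioc (0 : ℝ) 1,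
        ofReal t * ‖bb k m (x + t • z)‖ₑ := by
        have mAb : Measurable fun z => ‖a (x + (1 : ℝ) • z)‖ₑ +
            ofReal r * (∑ k, ‖b k (x + (1 : ℝ) • z)‖ₑ) :=
          mA.add ((Finset.measurable_fun_sum _ fun k _ => mb k).const_mul _)
        rw [lintegral_add_left mAb, lintegral_add_left mA, lintegral_const_mul _ (Finset.measurable_fun_sum _ fun k _ => mb k),
          lintegral_const_mul _ (Finset.measurable_fun_sum _ fun k _ =>
            Finset.measurable_fun_sum _ fun m _ => mbi k m),
          lintegral_finsetSum _ fun k _ => mb k,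
          lintegral_finsetSum _ fun k _ => Finset.measurable_fun_sum _ fun m _ => mbi k m]
        simp only [lintegral_finsetSum _ fun m _ => mbi _ m]
    _ ≤ ofReal √(volume B).toReal * eLpNorm a 2 volume + ofReal r *
        (∑ k, ofReal √(volume B).toReal * eLpNorm (b k) 2 volume) +
        ofReal r * ofReal r * ∑ k, ∑ m, ofReal √(volume B).toReal *
          (halfInt * eLpNorm (bb k m) 2 volume) := by
        gcongr
        · exact one a ca
        · exact one _ (cb _)
        · exact two _ (hbb _ _)
    _ = _ := by
        simp only [← Finset.mul_sum]; ring

theorem eLpNorm_coordExt_le (hD : IsOpen D) (u : L2 D) (l : Fin 3) :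
    eLpNorm (coordExt u l) 2 volume ≤ ‖u‖ₑ := by
  rw [← eLpNorm_ext0 hD]
  refine eLpNorm_mono fun x => ?_
  rw [← ext0_apply]; exact PiLp.norm_apply_le _ _

theorem exists_sup_bound_aux (hD : IsOpen D) (hc : ConeCondition D) :
    ∃ C : ℝ, 0 < C ∧ ∀ u : L2 D, MemH2 u → ∀ l, ∀ᵐ x ∂ℒ D,
      ‖u x l‖ ≤ C * (‖u‖ + ∑ k, ‖weakPartial k u‖ + ∑ k, ∑ m, ‖weakPartial m (weakPartial k u)‖) := by
  obtain ⟨r, c, hr, hc0, hc1, hcone⟩ := hc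
  set d : ℝ := r / 2 * ((1 - c) / (1 + c)) with hd
  have hd0 : 0 < d := by have : 0 < 1 - c := by linarith
                         positivity
  have hd1 : d < r / 2 := by
    have : (1 - c) / (1 + c) < 1 := by rw [div_lt_one (by positivity)]; linarith
    rw [hd]; nlinarith
  have hdc : c * (r / 2 + d) = r / 2 - d := by rw [hd]; field_simp; ring
  set V := volume (Metric.closedBall (0 : E3) d) with hV
  have hVt : V ≠ ⊤ := (isCompact_closedBall _ _).measure_lt_top.ne
  have hV0 : V ≠ 0 := (Metric.measure_closedBall_pos _ _ hd0).ne'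
  set A : ENNReal := V⁻¹ * (ofReal √V.toReal * (1 + ofReal r +
    ofReal r * ofReal r * halfInt)) with hA
  have hAt : A ≠ ⊤ := by
    have := halfInt_ne_top
    have : V⁻¹ ≠ ⊤ := ENNReal.inv_ne_top.2 hV0
    finiteness
  refine ⟨A.toReal + 1, by positivity, fun u hu l => ?_⟩
  set Q := ‖u‖ + ∑ k, ‖weakPartial k u‖ + ∑ k, ∑ m, ‖weakPartial m (weakPartial k u)‖ with hQ
  have hul := (memLp_coordExt hD u l).locallyIntegrable (by norm_num)
  filter_upwards [ae_restrict_of_ae (ae_tendsto_mol hul), ae_restrict_mem hD.measurableSet] with x hx hxD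
  obtain ⟨ξ, hξ, hξD⟩ := hcone x hxD
  set B := Metric.closedBall ((r / 2) • ξ) d with hB
  have hBV : volume B = V := by
    rw [hB, hV, Measure.addHaar_closedBall_center]
  have hBr : ∀ z ∈ B, ‖z‖ < r := by
    intro z hz
    have h1 : ‖z‖ ≤ ‖(r / 2) • ξ‖ + ‖z - (r / 2) • ξ‖ := by
      simpa using norm_add_le ((r / 2) • ξ) (z - (r / 2) • ξ)
    rw [norm_smul, hξ, mul_one, Real.norm_of_nonneg (by positivity)] at h1
    have h2 : ‖z - (r / 2) • ξ‖ ≤ d := by simpa [hB, dist_eq_norm] using hz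
    linarith
  have hBc : ∀ z ∈ B, c * ‖z‖ ≤ inner ℝ z ξ := by
    intro z hz
    have h2 : ‖z - (r / 2) • ξ‖ ≤ d := by simpa [hB, dist_eq_norm] using hz
    have h1 : ‖z‖ ≤ ‖(r / 2) • ξ‖ + ‖z - (r / 2) • ξ‖ := by
      simpa using norm_add_le ((r / 2) • ξ) (z - (r / 2) • ξ)
    rw [norm_smul, hξ, mul_one, Real.norm_of_nonneg (by positivity)] at h1
    have h3 : inner ℝ z ξ = r / 2 + inner ℝ (z - (r / 2) • ξ) ξ := by
      rw [inner_sub_left, real_inner_smul_left, real_inner_self_eq_norm_sq, hξ]; ring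
    have h4 := abs_real_inner_le_norm (z - (r / 2) • ξ) ξ
    rw [hξ, mul_one] at h4
    have h5 := (abs_le.1 h4).1
    calc c * ‖z‖ ≤ c * (r / 2 + d) := by gcongr; linarith
      _ = r / 2 - d := hdc
      _ ≤ _ := by rw [h3]; linarith
  have hsub : (fun p : ℝ × E3 => x + p.1 • p.2) '' (Icc (0 : ℝ) 1 ×ˢ B) ⊆ D := by
    rintro _ ⟨⟨t, z⟩, ⟨ht, hz⟩, rfl⟩
    refine hξD _ ?_ ?_
    · simp only [add_sub_cancel_left, norm_smul, Real.norm_of_nonneg ht.1]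
      nlinarith [hBr z hz, norm_nonneg z, ht.2]
    · simp only [add_sub_cancel_left, norm_smul, Real.norm_of_nonneg ht.1, real_inner_smul_left]
      nlinarith [hBc z hz, ht.1]
  have hcomp : IsCompact ((fun p : ℝ × E3 => x + p.1 • p.2) '' (Icc (0 : ℝ) 1 ×ˢ B)) :=
    (isCompact_Icc.prod (isCompact_closedBall _ _)).image (by fun_prop)
  obtain ⟨δ, hδ, hδD⟩ := hcomp.exists_cthickening_subset_open hD hsub
  have hbound : ∀ᶠ j in atTop, ‖mol j (coordExt u l) x‖ₑ ≤ A * ofReal Q := by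
    filter_upwards [tendsto_bump_rOut.eventually (gt_mem_nhds hδ)] with j hj
    have hball : ∀ z ∈ B, ∀ t ∈ Icc (0 : ℝ) 1, Metric.closedBall (x + t • z) (bump j).rOut ⊆ D := by
      intro z hz t ht y hy
      exact hδD (Metric.mem_cthickening_of_dist_le y (x + t • z) δ _ ⟨(t, z), ⟨ht, hz⟩, rfl⟩
        ((Metric.mem_closedBall.1 hy).trans hj.le))
    have cd : ∀ v : L2 D, ContDiff ℝ (⊤ : ℕ∞) (mol j (coordExt v l)) := fun v =>
      contDiff_mol j ((memLp_coordExt hD v l).locallyIntegrable (by norm_num))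
    have hle : ∀ v : L2 D, eLpNorm (mol j (coordExt v l)) 2 volume ≤ ‖v‖ₑ := fun v =>
      (eLpNorm_mol_le j (memLp_coordExt hD v l).1).trans (eLpNorm_coordExt_le hD v l)
    have main := enorm_le_of_taylor (a := mol j (coordExt u l))
      (b := fun k => mol j (coordExt (weakPartial k u) l))
      (bb := fun k m => mol j (coordExt (weakPartial m (weakPartial k u)) l)) (x := x) (B := B) (r := r)
      Metric.isClosed_closedBall.measurableSet (fun z hz => (hBr z hz).le) (hBV ▸ hVt)
      ((cd u).differentiable (by simp)) (fun k => (cd _).differentiable (by simp))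
      (fun k m => (cd _).continuous)
      (fun z hz t ht k => pderiv3_mol hD (hu.1.hasWeakPartial k) l j (hball z hz t ht))
      (fun z hz t ht k m => pderiv3_mol hD ((hu.2 k).hasWeakPartial m) l j (hball z hz t ht))
    rw [hBV] at main
    have e1 : ‖mol j (coordExt u l) x‖ₑ = V⁻¹ * (V * ‖mol j (coordExt u l) x‖ₑ) := by
      rw [← mul_assoc, ENNReal.inv_mul_cancel hV0 hVt, one_mul]
    have n1 : ‖u‖ₑ ≤ ofReal Q := by
      rw [← ofReal_norm]; apply ofReal_le_ofReal
      have : 0 ≤ ∑ k, ‖weakPartial k u‖ := Finset.sum_nonneg fun _ _ => norm_nonneg _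
      have : 0 ≤ ∑ k, ∑ m, ‖weakPartial m (weakPartial k u)‖ :=
        Finset.sum_nonneg fun _ _ => Finset.sum_nonneg fun _ _ => norm_nonneg _
      linarith
    have n2 : ∑ k, ‖weakPartial k u‖ₑ ≤ ofReal Q := by
      simp only [← ofReal_norm]
      rw [← ofReal_sum_of_nonneg fun _ _ => norm_nonneg _]; apply ofReal_le_ofReal
      have : 0 ≤ ∑ k, ∑ m, ‖weakPartial m (weakPartial k u)‖ :=
        Finset.sum_nonneg fun _ _ => Finset.sum_nonneg fun _ _ => norm_nonneg _
      linarith [norm_nonneg u]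
    have n3 : ∑ k, ∑ m, ‖weakPartial m (weakPartial k u)‖ₑ ≤ ofReal Q := by
      simp only [← ofReal_norm]
      simp only [← ofReal_sum_of_nonneg fun _ _ => norm_nonneg _]
      rw [← ofReal_sum_of_nonneg fun _ _ => Finset.sum_nonneg fun _ _ => norm_nonneg _]
      apply ofReal_le_ofReal
      have : 0 ≤ ∑ k, ‖weakPartial k u‖ := Finset.sum_nonneg fun _ _ => norm_nonneg _
      linarith [norm_nonneg u]
    rw [e1, hA, mul_assoc, mul_assoc]
    refine mul_le_mul_right (main.trans (mul_le_mul_right ?_ _)) _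
    rw [add_mul, add_mul, one_mul]
    refine add_le_add (add_le_add ((hle u).trans n1) ?_) ?_
    · exact mul_le_mul_right ((Finset.sum_le_sum fun k _ => hle _).trans n2) _
    · exact mul_le_mul_right ((Finset.sum_le_sum fun k _ => Finset.sum_le_sum fun m _ => hle _).trans n3) _
  have hlim := le_of_tendsto hx.enorm hbound
  have hcoord : coordExt u l x = u x l := by simp [coordExt, hxD]
  rw [hcoord] at hlim
  have hQ0 : 0 ≤ Q := by positivity
  have h1 := ENNReal.toReal_mono (by finiteness) hlim
  rw [toReal_enorm, ENNReal.toReal_mul, ENNReal.toReal_ofReal hQ0] at h1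
  nlinarith

/-- The embedding of `H²(D)³` into the bounded functions, for a domain with the cone condition. -/
theorem exists_sup_bound (hD : IsOpen D) (hc : ConeCondition D) :
    ∃ C : ℝ, 0 < C ∧ ∀ u : L2 D, MemH2 u → ∀ᵐ x ∂ℒ D, ‖u x‖ ^ 2 ≤ C * normSqH2 u := by
  obtain ⟨C, hC, h⟩ := exists_sup_bound_aux hD hc
  refine ⟨3 * C ^ 2 * 39, by positivity, fun u hu => ?_⟩
  filter_upwards [ae_all_iff.2 (h u hu)] with x hx
  have num : ∀ p q s P1 P2 : ℝ, q ^ 2 ≤ 3 * P1 → s ^ 2 ≤ 9 * P2 → 0 ≤ P1 → 0 ≤ P2 →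
      (p + q + s) ^ 2 ≤ 39 * (p ^ 2 + P1 + P2) := fun p q s P1 P2 h1 h2 h3 h4 => by
    nlinarith [sq_nonneg (p - q), sq_nonneg (p - s), sq_nonneg (q - s), sq_nonneg p]
  have s1 : (∑ k, ‖weakPartial k u‖) ^ 2 ≤ 3 * ∑ k, ‖weakPartial k u‖ ^ 2 := by
    simpa using sq_sum_le_card_mul_sum_sq (s := (Finset.univ : Finset (Fin 3)))
      (f := fun k => ‖weakPartial k u‖)
  have s2 : (∑ k, ∑ m, ‖weakPartial m (weakPartial k u)‖) ^ 2 ≤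
      9 * ∑ k, ∑ m, ‖weakPartial m (weakPartial k u)‖ ^ 2 := by
    have := sq_sum_le_card_mul_sum_sq (s := (Finset.univ : Finset (Fin 3 × Fin 3)))
      (f := fun p => ‖weakPartial p.2 (weakPartial p.1 u)‖)
    rw [Fintype.sum_prod_type, Fintype.sum_prod_type, Finset.card_univ, Fintype.card_prod,
      Fintype.card_fin] at this
    norm_num only [Nat.cast_ofNat] at this
    exact this
  have hQ2 : (‖u‖ + ∑ k, ‖weakPartial k u‖ + ∑ k, ∑ m, ‖weakPartial m (weakPartial k u)‖) ^ 2 ≤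
      39 * normSqH2 u :=
    num _ _ _ _ _ s1 s2 (Finset.sum_nonneg fun _ _ => by positivity)
      (Finset.sum_nonneg fun _ _ => Finset.sum_nonneg fun _ _ => by positivity)
  generalize ‖u‖ + ∑ k, ‖weakPartial k u‖ + ∑ k, ∑ m, ‖weakPartial m (weakPartial k u)‖ = Q at hx hQ2
  generalize normSqH2 u = q at hQ2 ⊢
  rw [EuclideanSpace.norm_sq_eq, Fin.sum_univ_three]
  have hl : ∀ l, ‖u x l‖ ^ 2 ≤ C ^ 2 * Q ^ 2 := fun l => by
    rw [← mul_pow]; exact pow_le_pow_left₀ (norm_nonneg _) (hx l) 2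
  have := hl 0; have := hl 1; have := hl 2
  nlinarith [sq_nonneg C]

/-! ### The operator `u ↦ ∑ i, (u × G_i) × G_i` -/

/-- The functions `G_i` are bounded, with square summable bounds; `Cs` is the sum of the squares. -/
def SumBdd (Gi : ℕ → L2 D) (Cs : ℝ) : Prop :=
  ∃ c : ℕ → ℝ, (∀ i, 0 ≤ c i) ∧ HasSum c Cs ∧ ∀ i, ∀ᵐ x ∂ℒ D, ‖Gi i x‖ ^ 2 ≤ c i

theorem SumBdd.nonneg {Gi : ℕ → L2 D} {Cs : ℝ} (h : SumBdd Gi Cs) : 0 ≤ Cs := by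
  obtain ⟨c, h0, hs, -⟩ := h
  exact hs.nonneg h0

theorem norm_corr_le (u g : L2 D) (x : E3) : ‖corr u g x‖ ≤ ‖u x‖ * ‖g x‖ ^ 2 := by
  refine (norm_cross_le _ _).trans ?_
  rw [sq, ← mul_assoc]; gcongr; exact norm_cross_le _ _

theorem aestronglyMeasurable_corr (u g : L2 D) :
    AEStronglyMeasurable (corr u g) (ℒ D) :=
  aestronglyMeasurable_cross (aestronglyMeasurable_cross (Lp.aestronglyMeasurable u)
    (Lp.aestronglyMeasurable g)) (Lp.aestronglyMeasurable g)

/-- The function `∑ i, (u × G_i) × G_i`. -/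
def Sop (Gi : ℕ → L2 D) (u : L2 D) : L2 D :=
  mkL2 (ℒ D) fun x => ∑' i, corr u (Gi i) x

theorem SumBdd.summable_corr {Gi : ℕ → L2 D} {Cs : ℝ} (h : SumBdd Gi Cs) (u : L2 D) :
    ∀ᵐ x ∂ℒ D, Summable (fun i => corr u (Gi i) x) ∧
      ‖∑' i, corr u (Gi i) x‖ ≤ Cs * ‖u x‖ := by
  obtain ⟨c, h0, hs, hb⟩ := h
  filter_upwards [ae_all_iff.2 hb] with x hx
  have hle : ∀ i, ‖corr u (Gi i) x‖ ≤ c i * ‖u x‖ := fun i => (norm_corr_le _ _ _).trans (by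
    rw [mul_comm]; gcongr; exact hx i)
  have hsum := hs.mul_right ‖u x‖
  exact ⟨.of_norm_bounded hsum.summable hle, tsum_of_norm_bounded hsum hle⟩

theorem SumBdd.memLp {Gi : ℕ → L2 D} {Cs : ℝ} (h : SumBdd Gi Cs) (u : L2 D) :
    MemLp (fun x => ∑' i, corr u (Gi i) x) 2 (ℒ D) := by
  refine (Lp.memLp u).of_le_mul (c := Cs) ?_ ((h.summable_corr u).mono fun x hx => hx.2)
  refine aestronglyMeasurable_of_tendsto_ae atTop
    (f := fun n x => ∑ i ∈ Finset.range n, corr u (Gi i) x) (fun n => ?_) ?_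
  · exact Finset.aestronglyMeasurable_fun_sum _ fun i _ => aestronglyMeasurable_corr u (Gi i)
  · filter_upwards [h.summable_corr u] with x hx
    exact hx.1.hasSum.tendsto_sum_nat

theorem SumBdd.coeFn_Sop {Gi : ℕ → L2 D} {Cs : ℝ} (h : SumBdd Gi Cs) (u : L2 D) :
    ∀ᵐ x ∂ℒ D, HasSum (fun i => corr u (Gi i) x) (Sop Gi u x) ∧
      ‖Sop Gi u x‖ ≤ Cs * ‖u x‖ := by
  filter_upwards [h.summable_corr u, coeFn_mkL2 (h.memLp u)] with x hx e
  rw [Sop, e]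
  exact ⟨hx.1.hasSum, hx.2⟩

theorem SumBdd.Sop_sub {Gi : ℕ → L2 D} {Cs : ℝ} (h : SumBdd Gi Cs) (u v : L2 D) :
    Sop Gi (u - v) = Sop Gi u - Sop Gi v := by
  apply Lp.ext
  filter_upwards [h.coeFn_Sop u, h.coeFn_Sop v, h.coeFn_Sop (u - v), Lp.coeFn_sub u v,
    Lp.coeFn_sub (Sop Gi u) (Sop Gi v)] with x h1 h2 h3 h4 h5
  rw [h5, Pi.sub_apply]
  refine h3.1.unique ?_
  convert! h1.1.sub h2.1 using 2 with i
  simp only [corr, h4, Pi.sub_apply, cross_sub_left]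

theorem SumBdd.norm_Sop_le {Gi : ℕ → L2 D} {Cs : ℝ} (h : SumBdd Gi Cs) (u : L2 D) :
    ‖Sop Gi u‖ ≤ Cs * ‖u‖ :=
  Lp.norm_le_mul_norm_of_ae_le_mul ((h.coeFn_Sop u).mono fun _ hx => hx.2)

theorem SumBdd.continuous_Sop {Gi : ℕ → L2 D} {Cs : ℝ} (h : SumBdd Gi Cs) :
    Continuous (Sop Gi) := by
  refine LipschitzWith.continuous (K := Cs.toNNReal) (LipschitzWith.of_dist_le_mul fun u v => ?_)
  rw [dist_eq_norm, dist_eq_norm, ← h.Sop_sub, Real.coe_toNNReal _ h.nonneg]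
  exact h.norm_Sop_le _

/-! ### Existence and uniqueness of the increments -/

/-- The fields of `H¹(D)³` with values in the unit sphere. -/
def sphereH1 (D : Set E3) : Set (L2 D) := {m | MemH1 m ∧ ∀ᵐ x ∂ℒ D, ‖m x‖ = 1}

theorem sphereH1.le_one {m : L2 D} (hm : m ∈ sphereH1 D) : ∀ᵐ x ∂ℒ D, ‖m x‖ ≤ 1 :=
  hm.2.mono fun _ h => h.le

/-- The field `v` is pointwise orthogonal to `m`. -/
def Tang (m v : L2 D) : Prop := ∀ᵐ x ∂ℒ D, inner ℝ (v x) (m x) = 0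

/-- The linear operator `f ↦ m × f`, where `m` is truncated to the unit ball. -/
def crtL (m : L2 D) : L2 D →L[ℝ] L2 D :=
  LinearMap.mkContinuous
    { toFun := crt m
      map_add' := fun _ _ => cr_add_right (norm_retr_apply_le m)
      map_smul' := fun c _ => cr_smul_right c (norm_retr_apply_le m) } 1
    (fun f => by rw [one_mul]; exact norm_crt_le m f)

@[simp] theorem crtL_apply (m f : L2 D) : crtL m f = crt m f := rfl

theorem coeFn_crt {m : L2 D} (hm : ∀ᵐ x ∂ℒ D, ‖m x‖ ≤ 1) (f : L2 D) :
    crt m f =ᵐ[ℒ D] fun x => cross (m x) (f x) := by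
  rw [crt_eq hm]; exact coeFn_cr hm

/-- The linear operator `f ↦ f + m × (m × f)`; it is the projection `f ↦ (f · m) m` if `|m| = 1`. -/
def nrm (m : L2 D) : L2 D →L[ℝ] L2 D := ContinuousLinearMap.id ℝ _ + (crtL m).comp (crtL m)

theorem nrm_apply (m f : L2 D) : nrm m f = f + crt m (crt m f) := rfl

theorem coeFn_nrm {m : L2 D} (hm : ∀ᵐ x ∂ℒ D, ‖m x‖ = 1) (f : L2 D) :
    nrm m f =ᵐ[ℒ D] fun x => (inner ℝ (m x) (f x) : ℝ) • m x := by
  have hm' : ∀ᵐ x ∂ℒ D, ‖m x‖ ≤ 1 := hm.mono fun _ h => h.le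
  rw [nrm_apply]
  filter_upwards [hm, Lp.coeFn_add f (crt m (crt m f)), coeFn_crt hm' f, coeFn_crt hm' (crt m f)]
    with x h1 h2 h3 h4
  rw [h2, Pi.add_apply, h4, h3, cross_cross_eq, real_inner_self_eq_norm_sq, h1]
  simp

theorem nrm_eq_zero_iff {m : L2 D} (hm : ∀ᵐ x ∂ℒ D, ‖m x‖ = 1) (f : L2 D) :
    nrm m f = 0 ↔ Tang m f := by
  rw [Lp.eq_zero_iff_ae_eq_zero]
  constructor
  · intro h
    filter_upwards [h, coeFn_nrm hm f, hm] with x h1 h2 h3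
    have h4 : (inner ℝ (m x) (f x) : ℝ) • m x = 0 := by rw [← h2, h1]; rfl
    rcases smul_eq_zero.1 h4 with h5 | h5
    · rw [real_inner_comm, h5]
    · rw [h5, norm_zero] at h3; norm_num at h3
  · intro h
    filter_upwards [h, coeFn_nrm hm f] with x h1 h2
    rw [h2, real_inner_comm, h1, zero_smul]; rfl

/-- The elements of `H¹(D)³` that are pointwise orthogonal to `m`. -/
def tangH1 (m : L2 D) : Submodule ℝ (H1 D) := ((nrm m).comp H1.val).ker

theorem mem_tangH1 {m : L2 D} (hm : ∀ᵐ x ∂ℒ D, ‖m x‖ = 1) {p : H1 D} :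
    p ∈ tangH1 m ↔ Tang m (H1.val p) := nrm_eq_zero_iff hm _

instance (m : L2 D) : CompleteSpace (tangH1 m) :=
  (((nrm m).comp H1.val).isClosed_ker).completeSpace_coe

/-- The theorem of Lax and Milgram, for an operator that is coercive on a closed subspace. -/
theorem existsUnique_of_coercive_on {H : Type*} [NormedAddCommGroup H] [InnerProductSpace ℝ H]
    [CompleteSpace H] (W : Submodule ℝ H) [CompleteSpace W] (A : H →L[ℝ] H) {c : ℝ} (hc : 0 < c)
    (hA : ∀ v ∈ W, c * ‖v‖ ^ 2 ≤ inner ℝ (A v) v) (l : H) :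
    ∃! v, v ∈ W ∧ ∀ φ ∈ W, inner ℝ (A v) φ = inner ℝ l φ := by
  let B : W →L[ℝ] W →L[ℝ] ℝ := LinearMap.mkContinuous₂
    (LinearMap.mk₂ ℝ (fun v φ : W => inner ℝ (A v) (φ : H))
      (fun a b c => by simp [inner_add_left]) (fun r a b => by simp [real_inner_smul_left])
      (fun a b c => by simp [inner_add_right]) (fun r a b => by simp [real_inner_smul_right])) ‖A‖
    (fun v φ => (abs_real_inner_le_norm _ _).trans
      (mul_le_mul_of_nonneg_right (A.le_opNorm _) (norm_nonneg _)))
  have hBa : ∀ v φ : W, B v φ = inner ℝ (A v) (φ : H) := fun _ _ => rfl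
  have hB : IsCoercive B := ⟨c, hc, fun u => by
    rw [hBa]; simpa [sq, mul_assoc] using hA u u.2⟩
  refine ⟨(hB.continuousLinearEquivOfBilin.symm (W.orthogonalProjectionOnto l) : W),
    ⟨Subtype.mem _, fun φ hφ => ?_⟩, ?_⟩
  · have h1 := hBa (hB.continuousLinearEquivOfBilin.symm (W.orthogonalProjectionOnto l)) ⟨φ, hφ⟩
    rw [← hB.continuousLinearEquivOfBilin_apply, ContinuousLinearEquiv.apply_symm_apply,
      Submodule.inner_orthogonalProjectionOnto_eq_of_mem_right] at h1
    exact h1.symm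
  · rintro v ⟨hv, hv'⟩
    have h1 : hB.continuousLinearEquivOfBilin ⟨v, hv⟩ = W.orthogonalProjectionOnto l := by
      refine ext_inner_right ℝ fun φ => ?_
      rw [hB.continuousLinearEquivOfBilin_apply, hBa,
        Submodule.inner_orthogonalProjectionOnto_eq_of_mem_right]
      exact hv' φ φ.2
    rw [← h1, ContinuousLinearEquiv.symm_apply_apply]

/-- The operator of the variational problem of one step of the scheme. -/
def schemeA (θ dt : ℝ) (m : L2 D) : H1 D →L[ℝ] H1 D :=
  (ContinuousLinearMap.adjoint H1.val).comp ((ContinuousLinearMap.id ℝ _ - crtL m).comp H1.val) +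
    ∑ k, (ContinuousLinearMap.adjoint (H1.grad k)).comp ((2 * θ * dt) • H1.grad k)

/-- The terms without derivatives in the right-hand side of the variational problem. -/
def schemeF (Gi : ℕ → L2 D) (dt : ℝ) (m ξ : L2 D) : L2 D :=
  crt m ξ - crt m (crt m ξ) + (dt / 2) • (Sop Gi m - crt m (Sop Gi m))

/-- The right-hand side of the variational problem of one step of the scheme. -/
def schemeL (Gi : ℕ → L2 D) (dt : ℝ) (p : H1 D) (ξ : L2 D) : H1 D :=
  ContinuousLinearMap.adjoint H1.val (schemeF Gi dt (H1.val p) ξ) -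
    ∑ k, ContinuousLinearMap.adjoint (H1.grad k) ((2 * dt) • H1.grad k p)

theorem inner_schemeA (θ dt : ℝ) (m : L2 D) (q φ : H1 D) : inner ℝ (schemeA θ dt m q) φ =
    inner ℝ (H1.val q - crt m (H1.val q)) (H1.val φ) +
      2 * θ * dt * ∑ k, inner ℝ (H1.grad k q) (H1.grad k φ) := by
  simp only [schemeA, add_apply, ContinuousLinearMap.comp_apply, inner_add_left, Finset.mul_sum,
    ContinuousLinearMap.adjoint_inner_left, smul_apply, real_inner_smul_left,
    sum_apply, sum_inner, sub_apply, ContinuousLinearMap.id_apply, crtL_apply]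

theorem inner_schemeL (Gi : ℕ → L2 D) (dt : ℝ) (p φ : H1 D) (ξ : L2 D) :
    inner ℝ (schemeL Gi dt p ξ) φ = inner ℝ (schemeF Gi dt (H1.val p) ξ) (H1.val φ) -
      2 * dt * ∑ k, inner ℝ (H1.grad k p) (H1.grad k φ) := by
  simp only [schemeL, inner_sub_left, ContinuousLinearMap.adjoint_inner_left, real_inner_smul_left,
    sum_inner, Finset.mul_sum]

theorem integral_inner_eq {f : E3 → E3} {g φ : L2 D} (h : g =ᵐ[ℒ D] f) :
    ∫ x in D, inner ℝ (f x) (φ x) = inner ℝ g φ := by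
  rw [L2.inner_def]
  exact integral_congr_ae (h.mono fun x hx => by simp only [hx])

theorem coeFn_id_sub_crt {m : L2 D} (hm : ∀ᵐ x ∂ℒ D, ‖m x‖ ≤ 1) (f : L2 D) :
    (f - crt m f : L2 D) =ᵐ[ℒ D] fun x => f x - cross (m x) (f x) := by
  filter_upwards [coeFn_crt hm f, Lp.coeFn_sub f (crt m f)] with x h1 h2
  rw [h2, Pi.sub_apply, h1]

theorem SumBdd.tsum_integral {Gi : ℕ → L2 D} {Cs : ℝ} (h : SumBdd Gi Cs) {m : L2 D}
    (hm : ∀ᵐ x ∂ℒ D, ‖m x‖ ≤ 1) (φ : L2 D) :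
    ∑' i, ∫ x in D, inner ℝ (corr m (Gi i) x - cross (m x) (corr m (Gi i) x)) (φ x) =
      inner ℝ (Sop Gi m - crt m (Sop Gi m)) φ := by
  have hSS := h
  obtain ⟨c, h0, hs, hb⟩ := h
  have hmeas : ∀ i, AEStronglyMeasurable
      (fun x => corr m (Gi i) x - cross (m x) (corr m (Gi i) x)) (ℒ D) := fun i =>
    (aestronglyMeasurable_corr _ _).sub
      (aestronglyMeasurable_cross (Lp.aestronglyMeasurable m) (aestronglyMeasurable_corr _ _))
  have hint : Integrable (fun x => ‖m x‖ * ‖φ x‖) (ℒ D) :=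
    (Lp.memLp m).norm.integrable_mul (Lp.memLp φ).norm
  have hle : ∀ i, ∀ᵐ x ∂ℒ D,
      ‖(inner ℝ (corr m (Gi i) x - cross (m x) (corr m (Gi i) x)) (φ x) : ℝ)‖ ≤
        2 * c i * (‖m x‖ * ‖φ x‖) := by
    intro i
    filter_upwards [hm, hb i] with x h1 h2
    have e1 : ‖corr m (Gi i) x‖ ≤ ‖m x‖ * c i := (norm_corr_le _ _ _).trans (by gcongr)
    have e2 : ‖cross (m x) (corr m (Gi i) x)‖ ≤ ‖m x‖ * c i :=
      (norm_cross_le _ _).trans ((mul_le_mul h1 e1 (norm_nonneg _) zero_le_one).trans (by rw [one_mul]))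
    calc _ ≤ ‖corr m (Gi i) x - cross (m x) (corr m (Gi i) x)‖ * ‖φ x‖ := norm_inner_le_norm _ _
      _ ≤ (‖m x‖ * c i + ‖m x‖ * c i) * ‖φ x‖ := by
          gcongr; exact (norm_sub_le _ _).trans (add_le_add e1 e2)
      _ = _ := by ring
  have hI : ∀ i, Integrable (fun x => (inner ℝ (corr m (Gi i) x - cross (m x) (corr m (Gi i) x))
      (φ x) : ℝ)) (ℒ D) := fun i =>
    (hint.const_mul (2 * c i)).mono' ((hmeas i).inner (Lp.aestronglyMeasurable φ)) (hle i)
  have hsum := hasSum_integral_of_summable_integral_norm hI (by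
    refine Summable.of_nonneg_of_le (fun i => by positivity) (fun i => ?_)
      ((hs.mul_left 2).mul_right (∫ x in D, ‖m x‖ * ‖φ x‖)).summable
    rw [← integral_const_mul]
    exact integral_mono_ae (hI i).norm (hint.const_mul _) (hle i))
  rw [hsum.tsum_eq, ← integral_inner_eq (coeFn_id_sub_crt hm _)]
  refine integral_congr_ae ?_
  filter_upwards [hSS.coeFn_Sop m] with x hx
  refine HasSum.tsum_eq ?_
  have h1 : HasSum (fun i => corr m (Gi i) x - cross (m x) (corr m (Gi i) x))
    (Sop Gi m x - cross (m x) (Sop Gi m x)) := hx.1.sub (hx.1.mapL (crossL (m x)))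
  have h2 := h1.mapL (innerSL ℝ (φ x))
  simpa only [innerSL_apply_apply, real_inner_comm] using h2

theorem variational_iff (hD : IsOpen D) {Gi : ℕ → L2 D} {Cs : ℝ} (h : SumBdd Gi Cs) (θ dt : ℝ)
    {p : H1 D} (hp : ∀ᵐ x ∂ℒ D, ‖H1.val p x‖ ≤ 1) (ξ : L2 D) (q φ : H1 D) :
    ((∫ x in D, inner ℝ (H1.val q x - cross (H1.val p x) (H1.val q x)) (H1.val φ x)) +
        2 * θ * dt * gradInner (H1.val q) (H1.val φ) =
      - 2 * dt * gradInner (H1.val p) (H1.val φ)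
      + (∫ x in D, inner ℝ (cross (H1.val p x) (ξ x) - cross (H1.val p x) (cross (H1.val p x) (ξ x)))
          (H1.val φ x))
      + dt / 2 * ∑' i, ∫ x in D, inner ℝ (corr (H1.val p) (Gi i) x
          - cross (H1.val p x) (corr (H1.val p) (Gi i) x)) (H1.val φ x)) ↔
    inner ℝ (schemeA θ dt (H1.val p) q) φ = inner ℝ (schemeL Gi dt p ξ) φ := by
  have e2 : (crt (H1.val p) ξ - crt (H1.val p) (crt (H1.val p) ξ) : L2 D) =ᵐ[ℒ D]
      fun x => cross (H1.val p x) (ξ x) - cross (H1.val p x) (cross (H1.val p x) (ξ x)) := by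
    filter_upwards [coeFn_id_sub_crt hp (crt (H1.val p) ξ), coeFn_crt hp ξ] with x h1 h2
    rw [h1, h2]
  rw [integral_inner_eq (coeFn_id_sub_crt hp _), integral_inner_eq e2, h.tsum_integral hp,
    inner_schemeA, inner_schemeL, schemeF, inner_add_left, real_inner_smul_left]
  simp only [gradInner, H1.weakPartial_val hD]
  constructor <;> intro h <;> linarith

theorem inner_crt_self (m f : L2 D) : inner ℝ (crt m f) f = 0 := by
  rw [crt, L2.inner_def]
  refine integral_eq_zero_of_ae ?_
  filter_upwards [coeFn_cr (norm_retr_apply_le m) (f := f)] with x hx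
  rw [hx, real_inner_comm, inner_cross_self_right]; rfl

theorem coercive_schemeA (θ dt : ℝ) (m : L2 D) (q : H1 D) :
    min 1 (2 * θ * dt) * ‖q‖ ^ 2 ≤ inner ℝ (schemeA θ dt m q) q := by
  rw [inner_schemeA, inner_sub_left, inner_crt_self, H1.norm_sq_eq, real_inner_self_eq_norm_sq,
    mul_add]
  simp only [real_inner_self_eq_norm_sq, sub_zero]
  have := Finset.sum_nonneg fun k (_ : k ∈ Finset.univ) => sq_nonneg ‖H1.grad k q‖
  gcongr
  · exact mul_le_of_le_one_left (by positivity) (min_le_left _ _)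
  · exact min_le_right _ _

theorem existsUnique_variational {θ dt : ℝ} (hθ : 0 < θ) (hdt : 0 < dt) (Gi : ℕ → L2 D) (p : H1 D)
    (ξ : L2 D) : ∃! q, q ∈ tangH1 (H1.val p) ∧ ∀ φ ∈ tangH1 (H1.val p),
      inner ℝ (schemeA θ dt (H1.val p) q) φ = inner ℝ (schemeL Gi dt p ξ) φ :=
  existsUnique_of_coercive_on _ _ (c := min 1 (2 * θ * dt)) (by positivity)
    (fun q _ => coercive_schemeA θ dt _ q) _

theorem isIncrement_iff (hD : IsOpen D) {Gi : ℕ → L2 D} {Cs : ℝ} (h : SumBdd Gi Cs) (θ dt : ℝ)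
    {p : H1 D} (hp : ∀ᵐ x ∂ℒ D, ‖H1.val p x‖ = 1) (ξ : L2 D) (q : H1 D) :
    IsIncrement Gi θ dt (H1.val p) ξ (H1.val q) ↔ q ∈ tangH1 (H1.val p) ∧ ∀ φ ∈ tangH1 (H1.val p),
      inner ℝ (schemeA θ dt (H1.val p) q) φ = inner ℝ (schemeL Gi dt p ξ) φ := by
  have hp' : ∀ᵐ x ∂ℒ D, ‖H1.val p x‖ ≤ 1 := hp.mono fun _ h => h.le
  refine and_congr ⟨fun hq => (mem_tangH1 hp).2 hq.2, fun hq => ⟨H1.memH1 q, (mem_tangH1 hp).1 hq⟩⟩ ?_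
  constructor
  · intro hv φ hφ
    exact (variational_iff hD h θ dt hp' ξ q φ).1 (hv _ ⟨H1.memH1 φ, (mem_tangH1 hp).1 hφ⟩)
  · intro hv φ hφ
    exact (variational_iff hD h θ dt hp' ξ q hφ.1.lift).2 (hv _ ((mem_tangH1 hp).2 hφ.2))

theorem existsUnique_isIncrement (hD : IsOpen D) {Gi : ℕ → L2 D} {Cs : ℝ} (h : SumBdd Gi Cs)
    {θ dt : ℝ} (hθ : 0 < θ) (hdt : 0 < dt) {m : L2 D} (hm : m ∈ sphereH1 D) (ξ : L2 D) :
    ∃! v, IsIncrement Gi θ dt m ξ v := by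
  obtain ⟨q, hq, hu⟩ := existsUnique_variational hθ hdt Gi hm.1.lift ξ
  refine ⟨H1.val q, (isIncrement_iff hD h θ dt (p := hm.1.lift) hm.2 ξ q).2 hq, fun v hv => ?_⟩
  exact congrArg H1.val (hu hv.1.1.lift
    ((isIncrement_iff hD h θ dt (p := hm.1.lift) hm.2 ξ hv.1.1.lift).1 hv))

theorem isIncrement_increment (hD : IsOpen D) {Gi : ℕ → L2 D} {Cs : ℝ} (h : SumBdd Gi Cs)
    {θ dt : ℝ} (hθ : 0 < θ) (hdt : 0 < dt) {m : L2 D} (hm : m ∈ sphereH1 D) (ξ : L2 D) :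
    IsIncrement Gi θ dt m ξ (increment Gi θ dt m ξ) := by
  have h' := (existsUnique_isIncrement hD h hθ hdt hm ξ).exists
  rw [increment, dif_pos h']
  exact h'.choose_spec

/-! ### The renormalization -/

theorem norm_add_sq_of_tang {m v : L2 D} (hm : ∀ᵐ x ∂ℒ D, ‖m x‖ = 1) (hv : Tang m v) :
    ∀ᵐ x ∂ℒ D, ‖m x + v x‖ ^ 2 = 1 + ‖v x‖ ^ 2 := by
  filter_upwards [hm, hv] with x h1 h2
  rw [norm_add_sq_real, real_inner_comm, h2, h1]; ring

theorem coeFn_retr_add {m v : L2 D} (hm : ∀ᵐ x ∂ℒ D, ‖m x‖ = 1) (hv : Tang m v) :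
    retr (m + v) =ᵐ[ℒ D] fun x => ‖m x + v x‖⁻¹ • (m x + v x) := by
  filter_upwards [norm_add_sq_of_tang hm hv, coeFn_retr (m + v), Lp.coeFn_add m v] with x h1 h2 h3
  have : 1 ≤ ‖m x + v x‖ := by
    rw [← one_le_sq_iff₀ (norm_nonneg _), h1]; linarith [sq_nonneg ‖v x‖]
  rw [h2, h3, Pi.add_apply, retract_of_ge this]

theorem renorm_eq {m v : L2 D} (hm : ∀ᵐ x ∂ℒ D, ‖m x‖ = 1) (hv : Tang m v) :
    renorm m v = retr (m + v) := by
  have h := coeFn_retr_add hm hv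
  apply Lp.ext
  rw [renorm]
  exact (coeFn_mkL2 ((memLp_congr_ae h).1 (Lp.memLp _))).trans h.symm

theorem retr_add_mem_sphereH1 (hD : IsOpen D) (hDb : Bornology.IsBounded D) {m v : L2 D}
    (hm : m ∈ sphereH1 D) (hv : Tang m v) (hv1 : MemH1 v) : retr (m + v) ∈ sphereH1 D := by
  refine ⟨fun k => ?_, ?_⟩
  · obtain ⟨g, hg, -⟩ := ((hm.1.add hv1).hasWeakPartial k).comp_lipschitz hD hDb lipschitz_retract
      retract_zero
    exact ⟨g, hg⟩
  · filter_upwards [coeFn_retr_add hm.2 hv, norm_add_sq_of_tang hm.2 hv] with x h1 h2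
    have : ‖m x + v x‖ ≠ 0 := fun h => by rw [h] at h2; nlinarith [sq_nonneg ‖v x‖]
    rw [h1, norm_smul, norm_inv, norm_norm, inv_mul_cancel₀ this]

/-- The Dirichlet energy. -/
def dirichlet (u : L2 D) : ℝ := ∑ k, ‖weakPartial k u‖ ^ 2

theorem dirichlet_nonneg (u : L2 D) : 0 ≤ dirichlet u := Finset.sum_nonneg fun _ _ => sq_nonneg _

theorem dirichlet_retr_le (hD : IsOpen D) (hDb : Bornology.IsBounded D) {u : L2 D} (hu : MemH1 u) :
    dirichlet (retr u) ≤ dirichlet u := by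
  refine Finset.sum_le_sum fun k _ => ?_
  obtain ⟨g, hg, hle⟩ := (hu.hasWeakPartial k).comp_lipschitz hD hDb lipschitz_retract retract_zero
  rw [← retr] at hg
  rw [hg.weakPartial_eq hD]
  gcongr

/-! ### The energy estimate for one step -/

/-- The form `(∇m, m × ∇ξ)`. -/
def ell (m ξ : L2 D) : ℝ := ∑ k, inner ℝ (weakPartial k m) (crt m (weakPartial k ξ))

theorem norm_sq_of_unit {m : L2 D}
    (hm : ∀ᵐ x ∂ℒ D, ‖m x‖ = 1) : ‖m‖ ^ 2 = volume.real D := by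
  rw [← real_inner_self_eq_norm_sq, L2.inner_def]
  have : (fun x => (inner ℝ (m x) (m x) : ℝ)) =ᵐ[ℒ D] fun _ => 1 := by
    filter_upwards [hm] with x hx
    rw [real_inner_self_eq_norm_sq, hx, one_pow]
  rw [integral_congr_ae this]
  simp

theorem norm_add_sq_le_two {H : Type*} [NormedAddCommGroup H] (a b : H) :
    ‖a + b‖ ^ 2 ≤ 2 * (‖a‖ ^ 2 + ‖b‖ ^ 2) := by
  have := norm_add_le a b
  nlinarith [norm_nonneg (a + b), sq_nonneg (‖a‖ - ‖b‖)]

theorem gradInner_cr_self (hD : IsOpen D) {m ξ : L2 D} {K : ℝ} (hm : m ∈ sphereH1 D) (hξ : MemH1 ξ)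
    (hK : ∀ᵐ x ∂ℒ D, ‖ξ x‖ ≤ K) : gradInner m (cr m ξ) = ell m ξ := by
  refine Finset.sum_congr rfl fun k _ => ?_
  rw [weakPartial_cr hD hm.1 hξ (sphereH1.le_one hm) hK, inner_add_right, crt_eq (sphereH1.le_one hm),
    add_eq_right, L2.inner_def]
  refine integral_eq_zero_of_ae ?_
  filter_upwards [coeFn_cr_right hK (u := weakPartial k m)] with x hx
  rw [hx, inner_cross_self_left]; rfl

theorem dirichlet_cr_le (hD : IsOpen D) {m ξ : L2 D} {K : ℝ} (hm : m ∈ sphereH1 D) (hξ : MemH1 ξ)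
    (hK : ∀ᵐ x ∂ℒ D, ‖ξ x‖ ≤ K) :
    dirichlet (cr m ξ) ≤ 2 * (K ^ 2 * dirichlet m + dirichlet ξ) := by
  simp only [dirichlet, Finset.mul_sum, ← Finset.sum_add_distrib]
  refine Finset.sum_le_sum fun k _ => ?_
  rw [weakPartial_cr hD hm.1 hξ (sphereH1.le_one hm) hK]
  refine (norm_add_sq_le_two _ _).trans ?_
  have h1 := norm_cr_le_right hK (u := weakPartial k m)
  have h2 := norm_cr_le (sphereH1.le_one hm) (f := weakPartial k ξ)
  rw [one_mul] at h2
  have h3 := pow_le_pow_left₀ (norm_nonneg _) h1 2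
  have h4 := pow_le_pow_left₀ (norm_nonneg _) h2 2
  rw [mul_pow] at h3
  gcongr

theorem Tang.cr {m ξ : L2 D} (hm : ∀ᵐ x ∂ℒ D, ‖m x‖ ≤ 1) : Tang m (cr m ξ) := by
  filter_upwards [coeFn_cr hm (f := ξ)] with x hx
  rw [hx, real_inner_comm, inner_cross_self_left]

theorem Tang.sub {m u v : L2 D} (hu : Tang m u) (hv : Tang m v) : Tang m (u - v) := by
  filter_upwards [hu, hv, Lp.coeFn_sub u v] with x h1 h2 h3
  rw [h3, Pi.sub_apply, inner_sub_left, h1, h2, sub_zero]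

/-- The energy estimate for one step of the scheme. -/
theorem energy_step (hD : IsOpen D) (hDb : Bornology.IsBounded D) {Gi : ℕ → L2 D} {Cs : ℝ}
    (h : SumBdd Gi Cs) {θ dt : ℝ} (hθ : θ ∈ Ioc (1 / 2 : ℝ) 1) (hdt : 0 < dt) {m ξ v : L2 D} {K : ℝ}
    (hm : m ∈ sphereH1 D) (hξ : MemH1 ξ) (hK : ∀ᵐ x ∂ℒ D, ‖ξ x‖ ≤ K)
    (hv : IsIncrement Gi θ dt m ξ v) :
    dirichlet (retr (m + v)) + (2 * θ - 1) / 2 * dirichlet v + ‖v - cr m ξ‖ ^ 2 / (2 * dt) ≤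
      dirichlet m + 4 / (2 * θ - 1) * (K ^ 2 * dirichlet m + dirichlet ξ) + 2 * ell m ξ
        + Cs ^ 2 * volume.real D / 2 * dt := by
  obtain ⟨hθ1, hθ2⟩ := hθ
  have hm' := sphereH1.le_one hm
  have hz1 : MemH1 (cr m ξ) := hm.1.cr hD hξ hm' hK
  set z := cr m ξ with hz
  set w := v - z with hw
  have hw1 : MemH1 w := hv.1.1.sub hz1
  have hwt : Tang m w := Tang.sub hv.1.2 (Tang.cr hm')
  have key := (variational_iff hD h θ dt (p := hm.1.lift) hm' ξ hv.1.1.lift hw1.lift).1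
    (hv.2 w ⟨hw1, hwt⟩)
  have hcrt : crt m ξ = z := crt_eq hm' ξ
  have hvz : v - crt m v = (w - crt m w) + (z - crt m z) := by
    rw [hw, crt_sub_right]; abel
  rw [inner_schemeA, inner_schemeL, schemeF] at key
  simp only [MemH1.val_lift, MemH1.grad_lift, hcrt] at key
  set FS := Sop Gi m - crt m (Sop Gi m) with hFS
  have gw : ∀ u : L2 D, ∑ k, inner ℝ (weakPartial k u) (weakPartial k w) =
      gradInner u v - gradInner u z := fun u => by
    simp only [gradInner, ← Finset.sum_sub_distrib, hw, weakPartial_sub hD hv.1.1 hz1, inner_sub_right]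
  rw [gw, gw, hvz, inner_add_left, inner_add_left, inner_sub_left w, inner_crt_self, sub_zero,
    real_inner_self_eq_norm_sq, real_inner_smul_left] at key
  have hmz : gradInner m z = ell m ξ := gradInner_cr_self hD hm hξ hK
  have hvv : gradInner v v = dirichlet v := by simp [gradInner, dirichlet]
  have hE : dirichlet (retr (m + v)) ≤ dirichlet m + 2 * gradInner m v + dirichlet v := by
    refine (dirichlet_retr_le hD hDb (hm.1.add hv.1.1)).trans (le_of_eq ?_)
    simp only [dirichlet, gradInner, Finset.mul_sum, ← Finset.sum_add_distrib]
    exact Finset.sum_congr rfl fun k _ => by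
      rw [weakPartial_add hD hm.1 hv.1.1, norm_add_sq_real]
  have hvz2 : 2 * θ * gradInner v z ≤ (2 * θ - 1) / 2 * dirichlet v + 2 / (2 * θ - 1) * dirichlet z := by
    simp only [dirichlet, gradInner, Finset.mul_sum, ← Finset.sum_add_distrib]
    refine Finset.sum_le_sum fun k _ => ?_
    have hc : 0 < 2 * θ - 1 := by linarith
    have h1 := real_inner_le_norm (weakPartial k v) (weakPartial k z)
    set a := ‖weakPartial k v‖
    set b := ‖weakPartial k z‖
    have ha : 0 ≤ a := norm_nonneg _
    have hb : 0 ≤ b := norm_nonneg _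
    have h2 : (2 * θ - 1) / 2 * a ^ 2 + 2 / (2 * θ - 1) * b ^ 2 - 2 * (a * b) =
      ((2 * θ - 1) * a - 2 * b) ^ 2 / (2 * (2 * θ - 1)) := by field_simp; ring
    have h3 : 0 ≤ ((2 * θ - 1) * a - 2 * b) ^ 2 / (2 * (2 * θ - 1)) := by positivity
    have h4 : θ * (a * b) ≤ 1 * (a * b) := by gcongr
    nlinarith
  have hzz : dirichlet z ≤ 2 * (K ^ 2 * dirichlet m + dirichlet ξ) := dirichlet_cr_le hD hm hξ hK
  have hFn : ‖FS‖ ^ 2 ≤ 4 * (Cs ^ 2 * volume.real D) := by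
    have h1 : ‖FS‖ ≤ 2 * (Cs * ‖m‖) := by
      refine (norm_sub_le _ _).trans ?_
      have := norm_crt_le m (Sop Gi m)
      have := h.norm_Sop_le m
      linarith
    have := pow_le_pow_left₀ (norm_nonneg _) h1 2
    rw [← norm_sq_of_unit hm.2]
    linarith [this]
  have hFw : inner ℝ FS w / 2 ≤ ‖w‖ ^ 2 / (2 * dt) + dt * ‖FS‖ ^ 2 / 8 := by
    have h1 := real_inner_le_norm FS w
    have h2 : ‖w‖ ^ 2 / (2 * dt) + dt * ‖FS‖ ^ 2 / 8 - ‖FS‖ * ‖w‖ / 2 =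
      (2 * ‖w‖ - dt * ‖FS‖) ^ 2 / (8 * dt) := by field_simp; ring
    have h3 : 0 ≤ (2 * ‖w‖ - dt * ‖FS‖) ^ 2 / (8 * dt) := by positivity
    linarith
  have key2 : ‖w‖ ^ 2 / dt + 2 * θ * (dirichlet v - gradInner v z) =
      -2 * (gradInner m v - ell m ξ) + inner ℝ FS w / 2 := by
    rw [hvv, hmz] at key
    field_simp
    linarith
  have h5 : ‖w‖ ^ 2 / dt = ‖w‖ ^ 2 / (2 * dt) + ‖w‖ ^ 2 / (2 * dt) := by field_simp; ring
  have h6 : 2 / (2 * θ - 1) * dirichlet z ≤ 4 / (2 * θ - 1) * (K ^ 2 * dirichlet m + dirichlet ξ) := by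
    have hc : 0 < 2 * θ - 1 := by linarith
    calc _ ≤ 2 / (2 * θ - 1) * (2 * (K ^ 2 * dirichlet m + dirichlet ξ)) := by gcongr
      _ = _ := by ring
  have h7 : dt * ‖FS‖ ^ 2 / 8 ≤ Cs ^ 2 * volume.real D / 2 * dt := by
    have := mul_le_mul_of_nonneg_left hFn hdt.le
    linarith
  nlinarith

/-! ### Expansion of the renormalization -/

theorem renorm_expansion {V : Type*} [AddCommGroup V] [Module ℝ V] (m v : V) (a b c : ℝ) :
    a • (m + v) - m - v + b • m = (c - (1 - a)) • m + (b - c) • m - (1 - a) • v := by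
  module

/-- The second order expansion of the renormalization of `m + z + w`. -/
theorem norm_renorm_sub_le {m z w : E3} (hm : ‖m‖ = 1) (h : inner ℝ (z + w) m = 0) :
    ‖‖m + (z + w)‖⁻¹ • (m + (z + w)) - m - z - w + (‖z‖ ^ 2 / 2) • m‖ ≤
      12 * ‖z‖ ^ 3 + 9 * ‖w‖ ^ 2 + ‖w‖ * ‖z‖ := by
  obtain ⟨v, hv⟩ : ∃ v, v = z + w := ⟨_, rfl⟩
  rw [← hv] at h ⊢
  obtain ⟨r, hr⟩ : ∃ r, r = ‖m + v‖ := ⟨_, rfl⟩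
  rw [← hr]
  have hr2 : r ^ 2 = 1 + ‖v‖ ^ 2 := by rw [hr, norm_add_sq_real, real_inner_comm, h, hm]; ring
  have hr0 : 0 ≤ r := hr ▸ norm_nonneg _
  have hr1 : 1 ≤ r := by nlinarith [sq_nonneg ‖v‖]
  have hrv : r ≤ 1 + ‖v‖ := by rw [hr, ← hm]; exact norm_add_le m v
  have hvle : ‖v‖ ≤ ‖z‖ + ‖w‖ := hv ▸ norm_add_le _ _
  have hz := norm_nonneg z
  have hw := norm_nonneg w
  have hv0 := norm_nonneg v
  have ha0 : 0 ≤ 1 - r⁻¹ := by have := inv_le_one_of_one_le₀ hr1; linarith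
  have ha1 : 1 - r⁻¹ ≤ 1 := by have : 0 ≤ r⁻¹ := by positivity
                               linarith
  have hri : r * r⁻¹ = 1 := mul_inv_cancel₀ (by positivity)
  have ha2 : 1 - r⁻¹ ≤ ‖v‖ ^ 2 / 2 := by
    have : 0 ≤ r⁻¹ := by positivity
    nlinarith [mul_nonneg this (sq_nonneg (r - 1)), mul_nonneg this (mul_nonneg hr0 (sq_nonneg (r-1)))]
  have hb0 : 0 ≤ ‖v‖ ^ 2 / 2 - (1 - r⁻¹) := by linarith
  have hb1 : ‖v‖ ^ 2 / 2 - (1 - r⁻¹) ≤ ‖v‖ ^ 2 := by nlinarith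
  have hb2 : ‖v‖ ^ 2 / 2 - (1 - r⁻¹) ≤ ‖v‖ ^ 3 := by
    have h1 : ‖v‖ ^ 2 / 2 - (1 - r⁻¹) ≤ ‖v‖ ^ 2 * (r - 1) := by
      have e : ‖v‖ ^ 2 = r ^ 2 - 1 := by linarith
      have e2 : r⁻¹ ≤ 1 := inv_le_one_of_one_le₀ hr1
      rw [e]
      have e4 : r⁻¹ - 1 = -(r - 1) * r⁻¹ := by linear_combination hri
      nlinarith [mul_nonneg (sub_nonneg.2 hr1) (sub_nonneg.2 e2)]
    have h2 : ‖v‖ ^ 2 * (r - 1) ≤ ‖v‖ ^ 2 * ‖v‖ := by gcongr; linarith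
    linarith [h1, h2, (by ring : ‖v‖ ^ 2 * ‖v‖ = ‖v‖ ^ 3)]
  have hA : ‖v‖ * (1 - r⁻¹) ≤ 4 * ‖z‖ ^ 3 + 4 * ‖w‖ ^ 2 := by
    rcases le_total ‖w‖ ‖z‖ with hc | hc
    · have h1 : ‖v‖ ≤ 2 * ‖z‖ := by linarith
      have h2 : ‖v‖ * (1 - r⁻¹) ≤ ‖v‖ * (‖v‖ ^ 2 / 2) := by gcongr
      have h3 : ‖v‖ ^ 3 ≤ (2 * ‖z‖) ^ 3 := by gcongr
      nlinarith [sq_nonneg ‖w‖]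
    · have h1 : ‖v‖ ≤ 2 * ‖w‖ := by linarith
      have h3 : ‖v‖ ^ 2 ≤ (2 * ‖w‖) ^ 2 := by gcongr
      have h4 : 0 ≤ ‖z‖ ^ 3 := by positivity
      have h2 : ‖v‖ * (1 - r⁻¹) ≤ ‖v‖ ^ 2 := by
        rw [sq]; gcongr
        rcases le_total ‖v‖ 1 with h5 | h5
        · nlinarith
        · linarith
      nlinarith
  have hB : ‖v‖ ^ 2 / 2 - (1 - r⁻¹) ≤ 8 * ‖z‖ ^ 3 + 4 * ‖w‖ ^ 2 := by
    rcases le_total ‖w‖ ‖z‖ with hc | hc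
    · have h1 : ‖v‖ ≤ 2 * ‖z‖ := by linarith
      have h3 : ‖v‖ ^ 3 ≤ (2 * ‖z‖) ^ 3 := by gcongr
      nlinarith [sq_nonneg ‖w‖]
    · have h1 : ‖v‖ ≤ 2 * ‖w‖ := by linarith
      have h3 : ‖v‖ ^ 2 ≤ (2 * ‖w‖) ^ 2 := by gcongr
      have h4 : 0 ≤ ‖z‖ ^ 3 := by positivity
      nlinarith
  have hC : |‖z‖ ^ 2 / 2 - ‖v‖ ^ 2 / 2| ≤ ‖w‖ * ‖z‖ + ‖w‖ ^ 2 / 2 := by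
    have h1 : ‖v‖ ^ 2 = ‖z‖ ^ 2 + 2 * inner ℝ z w + ‖w‖ ^ 2 := hv ▸ norm_add_sq_real z w
    have h2 := abs_real_inner_le_norm z w
    rw [abs_le] at h2 ⊢
    constructor <;> nlinarith [sq_nonneg ‖w‖]
  rw [sub_sub _ z w, ← hv, renorm_expansion _ _ _ _ (‖v‖ ^ 2 / 2)]
  refine (norm_sub_le _ _).trans ((add_le_add (norm_add_le _ _) le_rfl).trans ?_)
  rw [norm_smul, norm_smul, norm_smul, hm, Real.norm_of_nonneg hb0, Real.norm_of_nonneg ha0,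
    Real.norm_eq_abs, mul_comm (1 - r⁻¹)]
  nlinarith [sq_nonneg ‖w‖]

/-! ### Measurability of the derivatives -/

theorem measurableEmbedding_val (hD : IsOpen D) : MeasurableEmbedding (H1.val : H1 D → L2 D) :=
  Continuous.measurableEmbedding H1.val.continuous (H1.val_injective hD)

theorem range_val : range (H1.val : H1 D → L2 D) = {u | MemH1 u} :=
  Set.ext fun _ => ⟨fun ⟨p, hp⟩ => hp ▸ H1.memH1 p, fun h => ⟨MemH1.lift h, rfl⟩⟩

theorem measurableSet_memH1 (hD : IsOpen D) : MeasurableSet {u : L2 D | MemH1 u} :=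
  range_val ▸ (measurableEmbedding_val hD).measurableSet_range

/-- The weak partial derivative on `H¹(D)³`, and `0` elsewhere. -/
def dpart (k : Fin 3) : L2 D → L2 D := Function.extend H1.val (H1.grad k) 0

theorem measurable_dpart (hD : IsOpen D) (k : Fin 3) : Measurable (dpart k : L2 D → L2 D) :=
  (measurableEmbedding_val hD).measurable_extend (H1.grad k).continuous.measurable measurable_const

theorem MemH1.dpart_eq (hD : IsOpen D) {u : L2 D} (h : MemH1 u) (k : Fin 3) :
    dpart k u = weakPartial k u := by
  have := (H1.val_injective hD).extend_apply (H1.grad k) 0 h.lift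
  simpa [dpart] using this

theorem measurableSet_memH2 (hD : IsOpen D) : MeasurableSet {u : L2 D | MemH2 u} := by
  have : {u : L2 D | MemH2 u} = {u | MemH1 u} ∩ ⋂ k, dpart k ⁻¹' {u | MemH1 u} := by
    ext u
    simp only [mem_inter_iff, mem_iInter, mem_preimage, mem_ofPred_eq, MemH2]
    exact and_congr_right fun h => forall_congr' fun k => by rw [h.dpart_eq hD]
  rw [this]
  exact (measurableSet_memH1 hD).inter
    (MeasurableSet.iInter fun k => measurable_dpart hD k (measurableSet_memH1 hD))

theorem measurableSet_unit : MeasurableSet {m : L2 D | ∀ᵐ x ∂ℒ D, ‖m x‖ = 1} := by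
  refine IsClosed.measurableSet (IsSeqClosed.isClosed fun u m hu hm => ?_)
  obtain ⟨ns, -, hns⟩ := (tendstoInMeasure_of_tendsto_Lp hm).exists_seq_tendsto_ae
  filter_upwards [hns, ae_all_iff.2 hu] with x h1 h2
  refine tendsto_nhds_unique h1.norm ?_
  simp only [h2]
  exact tendsto_const_nhds

theorem measurableSet_sphereH1 (hD : IsOpen D) : MeasurableSet (sphereH1 D) :=
  (measurableSet_memH1 hD).inter measurableSet_unit

/-! ### Measurability of the increments -/

theorem continuous_nrm : Continuous fun p : L2 D × L2 D => nrm p.1 p.2 := by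
  simp only [nrm_apply]
  exact continuous_snd.add (continuous_crt.comp (continuous_fst.prodMk continuous_crt))

theorem inner_crt_left (m f g : L2 D) : inner ℝ (crt m f) g = -inner ℝ f (crt m g) := by
  rw [crt, crt, L2.inner_def, L2.inner_def, ← integral_neg]
  refine integral_congr_ae ?_
  filter_upwards [coeFn_cr (norm_retr_apply_le m) (f := f), coeFn_cr (norm_retr_apply_le m) (f := g)]
    with x h1 h2
  simp only [h1, h2, inner_cross_swap]

theorem inner_nrm_left (m f g : L2 D) : inner ℝ (nrm m f) g = inner ℝ f (nrm m g) := by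
  rw [nrm_apply, nrm_apply, inner_add_left, inner_add_right, inner_crt_left, inner_crt_left, neg_neg]

theorem adjoint_nrm_comp_val (m : L2 D) : ContinuousLinearMap.adjoint ((nrm m).comp H1.val) =
    (ContinuousLinearMap.adjoint H1.val).comp (nrm m) := by
  symm
  rw [ContinuousLinearMap.eq_adjoint_iff]
  intro f p
  rw [ContinuousLinearMap.comp_apply, ContinuousLinearMap.comp_apply,
    ContinuousLinearMap.adjoint_inner_left, inner_nrm_left]

theorem forall_ker_inner_eq_iff {H F : Type*} [NormedAddCommGroup H] [InnerProductSpace ℝ H]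
    [CompleteSpace H] [NormedAddCommGroup F] [InnerProductSpace ℝ F] [CompleteSpace F]
    (K : H →L[ℝ] F) (u l : H) {s : ℕ → F} (hs : DenseRange s) :
    (∀ φ ∈ K.ker, inner ℝ u φ = inner ℝ l φ) ↔
      ∀ n : ℕ, ∃ j, ‖u - l - ContinuousLinearMap.adjoint K (s j)‖ < 1 / ((n : ℝ) + 1) := by
  have h1 : (∀ φ ∈ K.ker, inner ℝ u φ = inner ℝ l φ) ↔ u - l ∈ K.kerᗮ := by
    rw [Submodule.mem_orthogonal']
    exact forall₂_congr fun φ _ => by rw [inner_sub_left, sub_eq_zero]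
  rw [h1, ContinuousLinearMap.orthogonal_ker, ← SetLike.mem_coe,
    Submodule.topologicalClosure_coe, Metric.mem_closure_iff]
  constructor
  · intro h n
    obtain ⟨_, ⟨f, rfl⟩, hf⟩ := h (1 / ((n : ℝ) + 1)) (by positivity)
    have hc : Continuous fun f => ‖u - l - ContinuousLinearMap.adjoint K f‖ := by fun_prop
    rw [dist_eq_norm] at hf
    exact hs.exists_mem_open (hc.isOpen_preimage _ (isOpen_Iio (a := 1 / ((n : ℝ) + 1)))) ⟨f, hf⟩
  · intro h ε hε
    obtain ⟨n, hn⟩ := exists_nat_one_div_lt hε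
    obtain ⟨j, hj⟩ := h n
    exact ⟨_, ⟨s j, rfl⟩, by rw [dist_eq_norm]; exact hj.trans hn⟩

theorem forall_tangH1_inner_eq_iff (m : L2 D) (u l : H1 D) {s : ℕ → L2 D} (hs : DenseRange s) :
    (∀ φ ∈ tangH1 m, inner ℝ u φ = inner ℝ l φ) ↔
      ∀ n : ℕ, ∃ j, ‖u - l - ContinuousLinearMap.adjoint H1.val (nrm m (s j))‖ < 1 / ((n : ℝ) + 1) := by
  have h := forall_ker_inner_eq_iff ((nrm m).comp H1.val) u l hs
  rw [adjoint_nrm_comp_val] at h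
  exact h

theorem continuous_schemeA (θ dt : ℝ) :
    Continuous fun p : L2 D × H1 D => schemeA θ dt p.1 p.2 := by
  have : (fun p : L2 D × H1 D => schemeA θ dt p.1 p.2) = fun p =>
      ContinuousLinearMap.adjoint H1.val (H1.val p.2 - crt p.1 (H1.val p.2)) +
        ∑ k, ContinuousLinearMap.adjoint (H1.grad k) ((2 * θ * dt) • H1.grad k p.2) := by
    ext1 p
    simp only [schemeA, add_apply, ContinuousLinearMap.comp_apply, smul_apply, sum_apply, sub_apply,
      ContinuousLinearMap.id_apply, crtL_apply]
  rw [this]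
  have h := continuous_crt (D := D).comp
    (continuous_fst.prodMk (H1.val.continuous.comp (continuous_snd (X := L2 D) (Y := H1 D))))
  have h' : Continuous fun p : L2 D × H1 D => crt p.1 (H1.val p.2) := h
  fun_prop

theorem continuous_schemeF {Gi : ℕ → L2 D} {Cs : ℝ} (h : SumBdd Gi Cs) (dt : ℝ) :
    Continuous fun p : L2 D × L2 D => schemeF Gi dt p.1 p.2 := by
  have h1 : Continuous fun p : L2 D × L2 D => crt p.1 p.2 := continuous_crt
  have h2 : Continuous fun p : L2 D × L2 D => crt p.1 (crt p.1 p.2) :=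
    continuous_crt.comp (continuous_fst.prodMk h1)
  have h3 : Continuous fun p : L2 D × L2 D => Sop Gi p.1 := h.continuous_Sop.comp continuous_fst
  have h4 : Continuous fun p : L2 D × L2 D => crt p.1 (Sop Gi p.1) :=
    continuous_crt.comp (continuous_fst.prodMk h3)
  unfold schemeF
  fun_prop

theorem continuous_schemeL {Gi : ℕ → L2 D} {Cs : ℝ} (h : SumBdd Gi Cs) (dt : ℝ) :
    Continuous fun p : H1 D × L2 D => schemeL Gi dt p.1 p.2 := by
  have h0 : Continuous fun p : H1 D × L2 D => H1.val p.1 := H1.val.continuous.comp continuous_fst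
  have h1 := (continuous_schemeF h dt).comp (h0.prodMk continuous_snd)
  simp only [Function.comp_def] at h1
  have h2 : ∀ k, Continuous fun p : H1 D × L2 D =>
      ContinuousLinearMap.adjoint (H1.grad k) ((2 * dt) • H1.grad k p.1) := fun k => by
    have h3 : Continuous fun p : H1 D × L2 D => H1.grad k p.1 :=
      (H1.grad k).continuous.comp continuous_fst
    exact (ContinuousLinearMap.adjoint (H1.grad k)).continuous.comp (h3.fun_const_smul _)
  have h3 := (ContinuousLinearMap.adjoint (H1.val (D := D))).continuous.comp h1
  have h4 := h3.fun_sub (continuous_finsetSum Finset.univ fun k _ => h2 k)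
  simpa only [schemeL, Function.comp_def] using h4

/-- The increments, as a function defined to be zero for inadmissible data. -/
def incT (Gi : ℕ → L2 D) (θ dt : ℝ) (p : L2 D × L2 D) : L2 D :=
  open Classical in if p.1 ∈ sphereH1 D then increment Gi θ dt p.1 p.2 else 0

instance : StandardBorelSpace (L2 D) :=
  have : PolishSpace (L2 D) := inferInstance
  inferInstance

instance : StandardBorelSpace (H1 D) :=
  have : PolishSpace (H1 D) := inferInstance
  standardBorel_of_polish

instance : MeasurableSpace.CountablySeparated (L2 D × L2 D) :=
  have : StandardBorelSpace (L2 D × L2 D) := StandardBorelSpace.prod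
  inferInstance

instance : StandardBorelSpace (H1 D × L2 D × H1 D) :=
  have : StandardBorelSpace (L2 D × H1 D) := StandardBorelSpace.prod
  StandardBorelSpace.prod

theorem measurable_incT (hD : IsOpen D) {Gi : ℕ → L2 D} {Cs : ℝ} (h : SumBdd Gi Cs) {θ dt : ℝ}
    (hθ : 0 < θ) (hdt : 0 < dt) : Measurable (incT Gi θ dt) := by
  classical
  obtain ⟨s, hs⟩ := TopologicalSpace.exists_dense_seq (L2 D)
  let F : ℕ → H1 D × L2 D × H1 D → H1 D := fun j p =>
    schemeA θ dt (H1.val p.1) p.2.2 - schemeL Gi dt p.1 p.2.1 -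
      ContinuousLinearMap.adjoint H1.val (nrm (H1.val p.1) (s j))
  let Γ : Set (H1 D × L2 D × H1 D) := {p | ∀ᵐ x ∂ℒ D, ‖H1.val p.1 x‖ = 1} ∩
    ({p | nrm (H1.val p.1) (H1.val p.2.2) = 0} ∩ ⋂ n : ℕ, ⋃ j, {p | ‖F j p‖ < 1 / ((n : ℝ) + 1)})
  have hv : Continuous fun p : H1 D × L2 D × H1 D => H1.val p.1 :=
    H1.val.continuous.comp continuous_fst
  have hv' : Continuous fun p : H1 D × L2 D × H1 D => H1.val p.2.2 :=
    H1.val.continuous.comp (continuous_snd.comp continuous_snd)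
  have hF : ∀ j, Continuous (F j) := fun j => by
    have h1 := (continuous_schemeA (D := D) θ dt).comp (hv.prodMk (continuous_snd.comp continuous_snd))
    have h2 := (continuous_schemeL h dt).comp
      ((continuous_fst (X := H1 D) (Y := L2 D × H1 D)).prodMk (continuous_fst.comp continuous_snd))
    have h3 := (ContinuousLinearMap.adjoint (H1.val (D := D))).continuous.comp
      (continuous_nrm.comp (hv.prodMk (continuous_const (y := s j))))
    exact (h1.fun_sub h2).fun_sub h3
  have hΓ : MeasurableSet Γ := by
    refine (hv.measurable measurableSet_unit).inter (MeasurableSet.inter ?_ ?_)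
    · have := continuous_nrm.comp (hv.prodMk hv')
      exact (isClosed_eq this continuous_const).measurableSet
    · exact MeasurableSet.iInter fun n => MeasurableSet.iUnion fun j =>
        (isOpen_lt (hF j).norm continuous_const).measurableSet
  have hmem : ∀ p, p ∈ Γ ↔ (∀ᵐ x ∂ℒ D, ‖H1.val p.1 x‖ = 1) ∧
      IsIncrement Gi θ dt (H1.val p.1) p.2.1 (H1.val p.2.2) := fun p =>
    and_congr_right fun hp => by
      rw [isIncrement_iff hD h θ dt hp, forall_tangH1_inner_eq_iff _ _ _ hs, mem_inter_iff,
        mem_iInter]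
      simp only [mem_iUnion]
      rfl
  have key : ∀ p ∈ Γ, H1.val p.1 ∈ sphereH1 D ∧
      increment Gi θ dt (H1.val p.1) p.2.1 = H1.val p.2.2 := fun p hp => by
    have hp' := (hmem p).1 hp
    have hsp : H1.val p.1 ∈ sphereH1 D := ⟨H1.memH1 _, hp'.1⟩
    exact ⟨hsp, (existsUnique_isIncrement hD h hθ hdt hsp p.2.1).unique
      (isIncrement_increment hD h hθ hdt hsp _) hp'.2⟩
  let π : H1 D × L2 D × H1 D → L2 D × L2 D := fun p => (H1.val p.1, p.2.1)
  have hπ : Measurable π := (hv.prodMk (continuous_fst.comp continuous_snd)).measurable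
  have hinj : InjOn π Γ := by
    rintro ⟨p, ξ, q⟩ hp ⟨p', ξ', q'⟩ hp' he
    obtain ⟨e1, e2⟩ := Prod.ext_iff.1 he
    have e1' := H1.val_injective hD e1
    change ξ = ξ' at e2
    subst e1' e2
    have e3 : q = q' := H1.val_injective hD ((key _ hp).2.symm.trans (key _ hp').2)
    rw [e3]
  have hset : ∀ B : Set (L2 D), {p : L2 D × L2 D | p.1 ∈ sphereH1 D ∧ increment Gi θ dt p.1 p.2 ∈ B} =
      π '' (Γ ∩ {p | H1.val p.2.2 ∈ B}) := by
    intro B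
    ext ⟨m, ξ⟩
    constructor
    · rintro ⟨h1, h2⟩
      have h3 := isIncrement_increment hD h hθ hdt h1 ξ
      exact ⟨(h1.1.lift, ξ, h3.1.1.lift), ⟨(hmem _).2 ⟨h1.2, h3⟩, h2⟩, rfl⟩
    · rintro ⟨p, ⟨hp, hB⟩, he⟩
      obtain ⟨e1, e2⟩ := Prod.ext_iff.1 he
      have := key p hp
      simp only [π] at e1 e2
      rw [e1, e2] at this
      exact ⟨this.1, by rw [this.2]; exact hB⟩
  have hmeas : ∀ B : Set (L2 D), MeasurableSet B →
      MeasurableSet {p : L2 D × L2 D | p.1 ∈ sphereH1 D ∧ increment Gi θ dt p.1 p.2 ∈ B} := by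
    intro B hB
    rw [hset]
    refine MeasurableSet.image_of_measurable_injOn (hΓ.inter ?_) hπ (hinj.mono inter_subset_left)
    exact hv'.measurable hB
  intro B hB
  have : incT Gi θ dt ⁻¹' B = {p : L2 D × L2 D | p.1 ∈ sphereH1 D ∧ increment Gi θ dt p.1 p.2 ∈ B} ∪
      ({p | p.1 ∉ sphereH1 D} ∩ {p | (0 : L2 D) ∈ B}) := by
    ext p
    by_cases hp : p.1 ∈ sphereH1 D <;> simp [incT, hp]
  rw [this]
  exact (hmeas B hB).union
    (((measurable_fst (measurableSet_sphereH1 hD)).compl).inter (MeasurableSet.const _))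

/-! ### The iterates as functions of the noise increments -/

/-- The iterates of the scheme driven by a sequence of noise increments. -/
def iterSeq (Gi : ℕ → L2 D) (θ dt : ℝ) (m0 : L2 D) (a : ℕ → L2 D) : ℕ → L2 D
  | 0 => m0
  | n + 1 => renorm (iterSeq Gi θ dt m0 a n) (increment Gi θ dt (iterSeq Gi θ dt m0 a n) (a n))

theorem iterate_eq_iterSeq {T : ℝ} (Gi : ℕ → L2 D) (θ : ℝ) (m0 : L2 D) (N : ℕ) (w : CT T D) (n : ℕ) :
    iterate Gi θ m0 N w n = iterSeq Gi θ (T / N) m0 (fun n => noiseInc N n w) n := by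
  induction n with
  | zero => rfl
  | succ n ih => rw [iterate, iterSeq, ih]

theorem iterSeq_congr {Gi : ℕ → L2 D} {θ dt : ℝ} {m0 : L2 D} {a b : ℕ → L2 D} {n : ℕ}
    (h : ∀ i < n, a i = b i) : iterSeq Gi θ dt m0 a n = iterSeq Gi θ dt m0 b n := by
  induction n with
  | zero => rfl
  | succ n ih => rw [iterSeq, iterSeq, ih fun i hi => h i (by omega), h n (by omega)]

theorem iterSeq_mem (hD : IsOpen D) (hDb : Bornology.IsBounded D) {Gi : ℕ → L2 D} {Cs : ℝ}
    (h : SumBdd Gi Cs) {θ dt : ℝ} (hθ : 0 < θ) (hdt : 0 < dt) {m0 : L2 D} (hm0 : m0 ∈ sphereH1 D)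
    (a : ℕ → L2 D) (n : ℕ) : iterSeq Gi θ dt m0 a n ∈ sphereH1 D := by
  induction n with
  | zero => exact hm0
  | succ n ih =>
    have hv := isIncrement_increment hD h hθ hdt ih (a n)
    rw [iterSeq, renorm_eq ih.2 hv.1.2]
    exact retr_add_mem_sphereH1 hD hDb ih hv.1.2 hv.1.1

theorem iterSeq_succ (hD : IsOpen D) (hDb : Bornology.IsBounded D) {Gi : ℕ → L2 D} {Cs : ℝ}
    (h : SumBdd Gi Cs) {θ dt : ℝ} (hθ : 0 < θ) (hdt : 0 < dt) {m0 : L2 D} (hm0 : m0 ∈ sphereH1 D)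
    (a : ℕ → L2 D) (n : ℕ) : iterSeq Gi θ dt m0 a (n + 1) =
      retr (iterSeq Gi θ dt m0 a n + incT Gi θ dt (iterSeq Gi θ dt m0 a n, a n)) := by
  have ih := iterSeq_mem hD hDb h hθ hdt hm0 a n
  have hv := isIncrement_increment hD h hθ hdt ih (a n)
  rw [iterSeq, renorm_eq ih.2 hv.1.2, incT, if_pos ih]

theorem measurable_iterSeq (hD : IsOpen D) (hDb : Bornology.IsBounded D) {Gi : ℕ → L2 D} {Cs : ℝ}
    (h : SumBdd Gi Cs) {θ dt : ℝ} (hθ : 0 < θ) (hdt : 0 < dt) {m0 : L2 D} (hm0 : m0 ∈ sphereH1 D)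
    (n : ℕ) : Measurable fun a => iterSeq Gi θ dt m0 a n := by
  induction n with
  | zero => exact measurable_const
  | succ n ih =>
    simp only [iterSeq_succ hD hDb h hθ hdt hm0]
    exact continuous_retr.measurable.comp
      (ih.add ((measurable_incT hD h hθ hdt).comp (ih.prodMk (measurable_pi_apply n))))

/-! ### Measurability of the processes -/

theorem continuous_pathAt {T : ℝ} (t : ℝ) : Continuous fun w : CT T D => pathAt w t := by
  unfold pathAt
  split_ifs with h
  · exact continuous_eval_const _
  · exact continuous_const

theorem continuous_noiseInc {T : ℝ} (N n : ℕ) : Continuous fun w : CT T D => noiseInc N n w :=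
  (continuous_pathAt _).sub (continuous_pathAt _)

theorem measurable_iterate {T : ℝ} (hT : 0 < T) (hD : IsOpen D) (hDb : Bornology.IsBounded D)
    {Gi : ℕ → L2 D} {Cs : ℝ} (h : SumBdd Gi Cs) {θ : ℝ} (hθ : 0 < θ) {m0 : L2 D}
    (hm0 : m0 ∈ sphereH1 D) {N : ℕ} (hN : 0 < N) (n : ℕ) :
    Measurable fun w : CT T D => iterate Gi θ m0 N w n := by
  simp only [iterate_eq_iterSeq]
  exact (measurable_iterSeq hD hDb h hθ (by positivity) hm0 n).comp
    (measurable_pi_lambda _ fun i => (continuous_noiseInc N i).measurable)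

/-- The element `∑ n < N, 1_{I n} c n` of `L²(μ; F)`. -/
def stepL {α F : Type*} [MeasurableSpace α] [NormedAddCommGroup F] (μ : Measure α)
    (I : ℕ → Set α) (N : ℕ) (c : ℕ → F) : Lp F 2 μ :=
  mkL2 μ fun t => ∑ n ∈ Finset.range N, (I n).indicator (fun _ => c n) t

theorem mkL2_congr {α F : Type*} [MeasurableSpace α] [NormedAddCommGroup F] {μ : Measure α}
    {f g : α → F} (h : f =ᵐ[μ] g) : mkL2 μ f = mkL2 μ g := by
  by_cases hf : MemLp f 2 μ
  · have hg := (memLp_congr_ae h).1 hf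
    rw [mkL2, mkL2, dif_pos hf, dif_pos hg]
    exact (MemLp.toLp_eq_toLp_iff _ _).2 h
  · have hg : ¬ MemLp g 2 μ := fun hg => hf ((memLp_congr_ae h).2 hg)
    rw [mkL2, mkL2, dif_neg hf, dif_neg hg]

theorem memLp_step {α F : Type*} [MeasurableSpace α] [NormedAddCommGroup F] {μ : Measure α}
    [IsFiniteMeasure μ] {I : ℕ → Set α} (hI : ∀ n, MeasurableSet (I n)) (N : ℕ) (c : ℕ → F) :
    MemLp (fun t => ∑ n ∈ Finset.range N, (I n).indicator (fun _ => c n) t) 2 μ :=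
  memLp_finsetSum (Finset.range N) fun n _ =>
    memLp_indicator_const 2 (hI n) (c n) (Or.inr (measure_ne_top μ _))

theorem coeFn_stepL {α F : Type*} [MeasurableSpace α] [NormedAddCommGroup F] {μ : Measure α}
    [IsFiniteMeasure μ] {I : ℕ → Set α} (hI : ∀ n, MeasurableSet (I n)) (N : ℕ) (c : ℕ → F) :
    stepL μ I N c =ᵐ[μ] fun t => ∑ n ∈ Finset.range N, (I n).indicator (fun _ => c n) t :=
  coeFn_mkL2 (memLp_step hI N c)

theorem stepL_eq_sum {α F : Type*} [MeasurableSpace α] [NormedAddCommGroup F] {μ : Measure α}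
    [IsFiniteMeasure μ] {I : ℕ → Set α} (hI : ∀ n, MeasurableSet (I n)) (N : ℕ) (c : ℕ → F) :
    stepL μ I N c = ∑ n ∈ Finset.range N, indicatorConstLp 2 (hI n) (measure_ne_top μ _) (c n) := by
  apply Lp.ext
  have h1 : ∀ᵐ t ∂μ, ∀ n, indicatorConstLp 2 (hI n) (measure_ne_top μ (I n)) (c n) t =
      (I n).indicator (fun _ => c n) t := ae_all_iff.2 fun n => indicatorConstLp_coeFn
  have h2 := Lp.coeFn_fun_finsetSum (Finset.range N)
    (fun n => indicatorConstLp 2 (hI n) (measure_ne_top μ (I n)) (c n))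
  filter_upwards [h1, h2, coeFn_stepL hI N c] with t h3 h4 h5
  rw [h4, h5]
  exact Finset.sum_congr rfl fun n _ => (h3 n).symm

theorem continuous_stepL {α F : Type*} [MeasurableSpace α] [NormedAddCommGroup F] {μ : Measure α}
    [IsFiniteMeasure μ] {I : ℕ → Set α} (hI : ∀ n, MeasurableSet (I n)) (N : ℕ) :
    Continuous fun c : ℕ → F => stepL μ I N c := by
  simp only [stepL_eq_sum hI]
  refine continuous_finsetSum _ fun n _ => ?_
  have : Continuous fun c : F => indicatorConstLp 2 (hI n) (measure_ne_top μ (I n)) c := by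
    refine LipschitzWith.continuous (K := (μ.real (I n) ^ (1 / (2 : ENNReal).toReal)).toNNReal)
      (LipschitzWith.of_dist_le_mul fun c c' => ?_)
    rw [dist_eq_norm, dist_eq_norm, indicatorConstLp_sub, mul_comm,
      Real.coe_toNNReal _ (by positivity)]
    exact norm_indicatorConstLp_le
  exact this.comp (continuous_apply n)

theorem ae_floor_mem {T : ℝ} (hT : 0 < T) {N : ℕ} (hN : 0 < N) :
    ∀ᵐ t ∂ℐ T, 0 ≤ t ∧ t < T ∧ ⌊t / (T / N)⌋₊ < N := by
  have h1 : ∀ᵐ t ∂ℐ T, t ≠ T := by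
    refine ae_restrict_of_ae ?_
    rw [ae_iff]; simp
  filter_upwards [h1, ae_restrict_mem measurableSet_Icc] with t h2 h3
  have h4 : t < T := lt_of_le_of_ne h3.2 h2
  have hNR : (0 : ℝ) < N := by exact_mod_cast hN
  refine ⟨h3.1, h4, ?_⟩
  rw [Nat.floor_lt (by have := h3.1; positivity), div_lt_iff₀ (by positivity)]
  rwa [mul_div_cancel₀ _ hNR.ne']

/-- The time intervals of the scheme. -/
def tI (T : ℝ) (N n : ℕ) : Set ℝ := Ico (n * (T / N)) ((n + 1) * (T / N))

theorem mem_tI_iff {T : ℝ} (hT : 0 < T) {N : ℕ} (hN : 0 < N) {t : ℝ} (ht : 0 ≤ t) (n : ℕ) :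
    t ∈ tI T N n ↔ ⌊t / (T / N)⌋₊ = n := by
  have hNR : (0 : ℝ) < N := by exact_mod_cast hN
  have : 0 < T / N := by positivity
  rw [Nat.floor_eq_iff (by positivity), tI, mem_Ico, le_div_iff₀ this, div_lt_iff₀ this]

theorem sum_indicator_tI {T : ℝ} (hT : 0 < T) {N : ℕ} (hN : 0 < N) {F : Type*} [AddCommMonoid F]
    (c : ℕ → F) : ∀ᵐ t ∂ℐ T,
      ∑ n ∈ Finset.range N, (tI T N n).indicator (fun _ => c n) t = c ⌊t / (T / N)⌋₊ := by
  filter_upwards [ae_floor_mem hT hN] with t ⟨h1, h2, h3⟩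
  rw [Finset.sum_eq_single_of_mem ⌊t / (T / N)⌋₊ (Finset.mem_range.2 h3)]
  · rw [indicator_of_mem ((mem_tI_iff hT hN h1 _).2 rfl)]
  · intro n _ hn
    exact indicator_of_notMem (fun h => hn ((mem_tI_iff hT hN h1 _).1 h).symm) _

theorem measurableSet_tI (T : ℝ) (N n : ℕ) : MeasurableSet (tI T N n) := measurableSet_Ico

theorem mProc_eq_stepL {T : ℝ} (hT : 0 < T) {N : ℕ} (hN : 0 < N) (Gi : ℕ → L2 D) (θ : ℝ) (m0 : L2 D)
    (w : CT T D) : mProc Gi θ m0 N w =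
      stepL (ℐ T) (tI T N) N (iterate Gi θ m0 N w) :=
  mkL2_congr ((sum_indicator_tI hT hN _).mono fun _ h => h.symm)

theorem XProc_eq_stepL {T : ℝ} {N : ℕ} (Gi : ℕ → L2 D) (θ : ℝ) (m0 : L2 D) (w : CT T D) :
    XProc Gi θ m0 N w = stepL (ℐ T) (fun n => Ici (((n : ℝ) + 1) * (T / N)))
      N fun n => cr (iterate Gi θ m0 N w n) (noiseInc N n w) := by
  unfold XProc stepL
  congr 1
  ext1 t
  rw [Finset.sum_filter]
  exact Finset.sum_congr rfl fun n _ => by simp only [indicator, mem_Ici]; rfl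

theorem measurable_mProc {T : ℝ} (hT : 0 < T) (hD : IsOpen D) (hDb : Bornology.IsBounded D)
    {Gi : ℕ → L2 D} {Cs : ℝ} (h : SumBdd Gi Cs) {θ : ℝ} (hθ : 0 < θ) {m0 : L2 D}
    (hm0 : m0 ∈ sphereH1 D) {N : ℕ} (hN : 0 < N) : Measurable (mProc (T := T) Gi θ m0 N) := by
  have : (mProc (T := T) Gi θ m0 N) = fun w =>
    stepL (ℐ T) (tI T N) N (iterate Gi θ m0 N w) := by
    ext1 w; exact mProc_eq_stepL hT hN _ _ _ _
  rw [this]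
  exact (continuous_stepL (measurableSet_tI T N) N).measurable.comp
    (measurable_pi_lambda _ fun n => measurable_iterate hT hD hDb h hθ hm0 hN n)

theorem measurable_XProc {T : ℝ} (hT : 0 < T) (hD : IsOpen D) (hDb : Bornology.IsBounded D)
    {Gi : ℕ → L2 D} {Cs : ℝ} (h : SumBdd Gi Cs) {θ : ℝ} (hθ : 0 < θ) {m0 : L2 D}
    (hm0 : m0 ∈ sphereH1 D) {N : ℕ} (hN : 0 < N) : Measurable (XProc (T := T) Gi θ m0 N) := by
  have hmem : ∀ w n, iterate Gi θ m0 N (w : CT T D) n ∈ sphereH1 D := fun w n => by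
    rw [iterate_eq_iterSeq]; exact iterSeq_mem hD hDb h hθ (by positivity) hm0 _ _
  have : (XProc (T := T) Gi θ m0 N) = fun w =>
    stepL (ℐ T) (fun n => Ici (((n : ℝ) + 1) * (T / N)))
      N fun n => crt (iterate Gi θ m0 N w n) (noiseInc N n w) := by
    ext1 w
    rw [XProc_eq_stepL]
    congr 1
    ext1 n
    rw [crt_eq (sphereH1.le_one (hmem w n))]
  rw [this]
  refine (continuous_stepL (fun _ => measurableSet_Ici) N).measurable.comp
    (measurable_pi_lambda _ fun n => ?_)
  have := (continuous_crt (D := D)).measurable.comp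
    ((measurable_iterate hT hD hDb h hθ hm0 hN n).prodMk
      (continuous_noiseInc (T := T) N n).measurable)
  simpa only [Function.comp_def] using this

/-! ### Series with independent Gaussian coefficients -/

/-- The random variables `b i` are independent, centered and Gaussian of variance `v`. -/
structure IsGaussSeq {Ω : Type*} [MeasurableSpace Ω] (P : Measure Ω) (b : ℕ → Ω → ℝ) (v : ℝ≥0) :
    Prop where
  meas : ∀ i, Measurable (b i)
  indep : iIndepFun b P
  law : ∀ i, P.map (b i) = gaussianReal 0 v

namespace IsGaussSeq
variable {Ω : Type*} [MeasurableSpace Ω] {P : Measure Ω} [IsProbabilityMeasure P]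
  {b : ℕ → Ω → ℝ} {v : ℝ≥0}

theorem memLp (h : IsGaussSeq P b v) (i : ℕ) : MemLp (b i) 2 P := by
  have h1 : MemLp id 2 (P.map (b i)) := by rw [h.law]; exact memLp_id_gaussianReal 2
  exact h1.comp_of_map (h.meas i).aemeasurable

theorem integral_eq_zero (h : IsGaussSeq P b v) (i : ℕ) : ∫ ω, b i ω ∂P = 0 := by
  have h1 := integral_map (μ := P) (h.meas i).aemeasurable (f := fun x : ℝ => x) (by fun_prop)
  rw [← h1, h.law, integral_id_gaussianReal]

theorem integral_sq (h : IsGaussSeq P b v) (i : ℕ) : ∫ ω, b i ω * b i ω ∂P = v := by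
  have h1 := integral_map (μ := P) (h.meas i).aemeasurable (f := fun x : ℝ => x * x) (by fun_prop)
  rw [← h1, h.law]
  have h2 := variance_fun_id_gaussianReal (μ := 0) (v := v)
  rw [variance_eq_integral measurable_id'.aemeasurable, integral_id_gaussianReal] at h2
  simpa [sq] using h2

theorem integrable_mul (h : IsGaussSeq P b v) (i j : ℕ) : Integrable (fun ω => b i ω * b j ω) P :=
  (h.memLp i).integrable_mul (h.memLp j)

theorem integral_mul (h : IsGaussSeq P b v) (i j : ℕ) :
    ∫ ω, b i ω * b j ω ∂P = if i = j then (v : ℝ) else 0 := by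
  split_ifs with hij
  · rw [hij]; exact h.integral_sq j
  · rw [(h.indep.indepFun hij).integral_fun_mul_eq_mul_integral (h.meas i).aestronglyMeasurable
      (h.meas j).aestronglyMeasurable, h.integral_eq_zero, zero_mul]

theorem integrable_quad (h : IsGaussSeq P b v) (C : ℕ → ℕ → ℝ) (s : Finset ℕ) :
    Integrable (fun ω => ∑ i ∈ s, ∑ j ∈ s, b i ω * b j ω * C i j) P :=
  integrable_finsetSum _ fun i _ => integrable_finsetSum _ fun j _ =>
    (h.integrable_mul i j).mul_const _

theorem integral_quad (h : IsGaussSeq P b v) (C : ℕ → ℕ → ℝ) (s : Finset ℕ) :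
    ∫ ω, ∑ i ∈ s, ∑ j ∈ s, b i ω * b j ω * C i j ∂P = v * ∑ i ∈ s, C i i := by
  rw [integral_finsetSum _ fun i _ => integrable_finsetSum _ fun j _ =>
    (h.integrable_mul i j).mul_const _, Finset.mul_sum]
  refine Finset.sum_congr rfl fun i hi => ?_
  rw [integral_finsetSum _ fun j _ => (h.integrable_mul i j).mul_const _]
  simp only [integral_mul_const, h.integral_mul, ite_mul, zero_mul]
  rw [Finset.sum_ite_eq, if_pos hi]

variable {F : Type*} [NormedAddCommGroup F] [InnerProductSpace ℝ F]

theorem bilin_sum_smul (B : F →L[ℝ] F →L[ℝ] ℝ) (c : ℕ → ℝ) (g : ℕ → F) (s : Finset ℕ) :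
    B (∑ i ∈ s, c i • g i) (∑ i ∈ s, c i • g i) = ∑ i ∈ s, ∑ j ∈ s, c i * c j * B (g i) (g j) := by
  simp only [map_sum, sum_apply, map_smul, smul_apply, smul_eq_mul, Finset.mul_sum]
  rw [Finset.sum_comm]
  exact Finset.sum_congr rfl fun i _ => Finset.sum_congr rfl fun j _ => by ring

theorem integrable_bilin (h : IsGaussSeq P b v) (B : F →L[ℝ] F →L[ℝ] ℝ) (g : ℕ → F) (s : Finset ℕ) :
    Integrable (fun ω => B (∑ i ∈ s, b i ω • g i) (∑ i ∈ s, b i ω • g i)) P := by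
  simp only [bilin_sum_smul]
  exact h.integrable_quad _ s

theorem integral_bilin (h : IsGaussSeq P b v) (B : F →L[ℝ] F →L[ℝ] ℝ) (g : ℕ → F) (s : Finset ℕ) :
    ∫ ω, B (∑ i ∈ s, b i ω • g i) (∑ i ∈ s, b i ω • g i) ∂P = v * ∑ i ∈ s, B (g i) (g i) := by
  simp only [bilin_sum_smul]
  exact h.integral_quad _ s

theorem lintegral_norm_sq (h : IsGaussSeq P b v) (g : ℕ → F) (s : Finset ℕ) :
    ∫⁻ ω, ofReal (‖∑ i ∈ s, b i ω • g i‖ ^ 2) ∂P = ofReal (v * ∑ i ∈ s, ‖g i‖ ^ 2) := by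
  obtain ⟨B, hB⟩ : ∃ B : F →L[ℝ] F →L[ℝ] ℝ, ∀ x, B x x = ‖x‖ ^ 2 :=
    ⟨innerSL ℝ, fun x => real_inner_self_eq_norm_sq x⟩
  have h1 := h.integrable_bilin B g s
  have h2 := h.integral_bilin B g s
  simp only [hB] at h1 h2
  rw [← ofReal_integral_eq_lintegral_ofReal h1 (Eventually.of_forall fun _ => by positivity), h2]

/-- The fourth moment of the standard Gaussian law, or `3` if this is larger. -/
def K4 : ℝ := max 3 (∫ x, x ^ 4 ∂gaussianReal 0 1)

theorem lintegral_pow_four (h : IsGaussSeq P b v) (i : ℕ) :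
    ∫⁻ ω, ofReal (b i ω ^ 4) ∂P ≤ ofReal (K4 * (v : ℝ) ^ 2) := by
  have h1 : P.map (b i) = (gaussianReal 0 1).map (fun x => √v * x) := by
    rw [h.law, gaussianReal_map_const_mul, mul_zero, mul_one]
    congr 1
    ext
    simp
  have hint : Integrable (fun x : ℝ => x ^ 4) (gaussianReal 0 1) := by
    have := (memLp_id_gaussianReal (μ := 0) (v := 1) 4).integrable_norm_pow (by norm_num)
    simpa [Even.pow_abs (show Even 4 by decide)] using this
  rw [← lintegral_map (f := fun x : ℝ => ofReal (x ^ 4)) (by fun_prop) (h.meas i), h1,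
    lintegral_map (by fun_prop) (by fun_prop)]
  have h2 : ∀ x : ℝ, (√v * x) ^ 4 = (v : ℝ) ^ 2 * x ^ 4 := fun x => by
    rw [mul_pow, show (√(v : ℝ)) ^ 4 = (√(v : ℝ) ^ 2) ^ 2 by ring, Real.sq_sqrt v.coe_nonneg]
  simp only [h2]
  rw [← ofReal_integral_eq_lintegral_ofReal (hint.const_mul _)
    (Eventually.of_forall fun x => by positivity), integral_const_mul, mul_comm]
  gcongr
  exact le_max_right _ _

variable [MeasurableSpace F] [BorelSpace F] [SecondCountableTopology F]

theorem measurable_sum (h : IsGaussSeq P b v) (g : ℕ → F) (s : Finset ℕ) :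
    Measurable fun ω => ∑ i ∈ s, b i ω • g i :=
  Finset.measurable_fun_sum _ fun i _ => (h.meas i).smul_const _

theorem indepFun_sum (h : IsGaussSeq P b v) (g : ℕ → F) (k : ℕ) :
    IndepFun (fun ω => ∑ i ∈ Finset.range k, b i ω • g i) (b k) P := by
  have h1 := h.indep.indepFun_finset (Finset.range k) {k} (by simp) h.meas
  have h2 := h1.comp (φ := fun c : (Finset.range k → ℝ) => ∑ i, c i • g i) (ψ := fun c : (({k} : Finset ℕ) → ℝ) => c ⟨k, Finset.mem_singleton_self k⟩)
    (Finset.measurable_fun_sum _ fun i _ => (measurable_pi_apply i).smul_const _)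
    (measurable_pi_apply (X := fun _ : ({k} : Finset ℕ) => ℝ) _)
  convert! h2 using 1
  ext1 ω
  simp only [Function.comp_apply]
  rw [← Finset.sum_coe_sort (Finset.range k) fun i => b i ω • g i]

theorem map_neg (h : IsGaussSeq P b v) (i : ℕ) : P.map (fun ω => -b i ω) = P.map (b i) := by
  have := Measure.map_map (μ := P) (f := b i) (g := fun x : ℝ => -x) measurable_neg (h.meas i)
  rw [Function.comp_def] at this
  rw [← this, h.law, gaussianReal_map_neg, neg_zero]

theorem map_prod_neg {X : Ω → F} {c : Ω → ℝ} (hX : Measurable X) (hc : Measurable c)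
    (hi : IndepFun X c P) (hn : P.map (fun ω => -c ω) = P.map c) :
    P.map (fun ω => (X ω, -c ω)) = P.map fun ω => (X ω, c ω) := by
  have h2 : IndepFun X (fun ω => -c ω) P := hi.comp measurable_id measurable_neg
  rw [(indepFun_iff_map_prod_eq_prod_map_map hX.aemeasurable hc.aemeasurable).1 hi,
    (indepFun_iff_map_prod_eq_prod_map_map hX.aemeasurable (show Measurable fun ω => -c ω from hc.neg).aemeasurable).1 h2]
  congr 1

theorem norm_pow_four_add (x y : F) : ‖x + y‖ ^ 4 + ‖x + -y‖ ^ 4 ≤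
    2 * (‖x‖ ^ 4 + 6 * ‖x‖ ^ 2 * ‖y‖ ^ 2 + ‖y‖ ^ 4) := by
  have h1 := norm_add_sq_real x y
  have h2 := norm_sub_sq_real x y
  rw [← sub_eq_add_neg]
  have h3 : (inner ℝ x y) ^ 2 ≤ ‖x‖ ^ 2 * ‖y‖ ^ 2 := by
    rw [← mul_pow, ← sq_abs]
    gcongr
    exact abs_real_inner_le_norm x y
  rw [show ‖x + y‖ ^ 4 = (‖x + y‖ ^ 2) ^ 2 by ring, show ‖x - y‖ ^ 4 = (‖x - y‖ ^ 2) ^ 2 by ring, h1, h2]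
  nlinarith

theorem lintegral_norm_pow_four (h : IsGaussSeq P b v) (g : ℕ → F) (k : ℕ) :
    ∫⁻ ω, ofReal (‖∑ i ∈ Finset.range k, b i ω • g i‖ ^ 4) ∂P ≤
      ofReal (K4 * (v * ∑ i ∈ Finset.range k, ‖g i‖ ^ 2) ^ 2) := by
  induction k with
  | zero => simp
  | succ k ih =>
    set S : Ω → F := fun ω => ∑ i ∈ Finset.range k, b i ω • g i with hS
    have hSm : Measurable S := h.measurable_sum g _
    have hsym : ∫⁻ ω, ofReal (‖S ω + -(b k ω • g k)‖ ^ 4) ∂P =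
        ∫⁻ ω, ofReal (‖S ω + b k ω • g k‖ ^ 4) ∂P := by
      let f : F × ℝ → ENNReal := fun p => ofReal (‖p.1 + p.2 • g k‖ ^ 4)
      have hf : Measurable f := by
        refine ENNReal.measurable_ofReal.comp ((Measurable.norm ?_).pow_const _)
        exact measurable_fst.add (measurable_snd.smul_const _)
      have e1 := lintegral_map (μ := P) hf (hSm.prodMk (h.meas k))
      have e2 := lintegral_map (μ := P) hf (hSm.prodMk (h.meas k).neg)
      have e3 := map_prod_neg hSm (h.meas k) (h.indepFun_sum g k) (h.map_neg k)
      have e4 : P.map (fun ω => (S ω, (-b k) ω)) = P.map fun ω => (S ω, b k ω) := e3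
      rw [e4, e1] at e2
      simpa [f] using e2.symm
    have key : 2 * ∫⁻ ω, ofReal (‖S ω + b k ω • g k‖ ^ 4) ∂P ≤
        2 * (∫⁻ ω, ofReal (‖S ω‖ ^ 4) ∂P +
          ofReal (6 * ‖g k‖ ^ 2) * (∫⁻ ω, ofReal (‖S ω‖ ^ 2) * ofReal (b k ω * b k ω) ∂P)
          + ofReal (‖g k‖ ^ 4) * ∫⁻ ω, ofReal (b k ω ^ 4) ∂P) := by
      have hm1 : Measurable fun ω => ofReal (‖S ω‖ ^ 4) := by fun_prop
      have hm2 : Measurable fun ω => ofReal (‖S ω‖ ^ 2) * ofReal (b k ω * b k ω) := by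
        have := h.meas k
        fun_prop
      have hm3 : Measurable fun ω => ofReal (b k ω ^ 4) := by
        have := h.meas k
        fun_prop
      have hm4 : Measurable fun ω => ofReal (‖S ω + b k ω • g k‖ ^ 4) := by
        have := (hSm.add ((h.meas k).smul_const (g k))).norm.pow_const 4
        exact ENNReal.measurable_ofReal.comp this
      calc _ = ∫⁻ ω, ofReal (‖S ω + b k ω • g k‖ ^ 4) +
            ofReal (‖S ω + -(b k ω • g k)‖ ^ 4) ∂P := by
            rw [lintegral_add_left hm4, hsym, two_mul]
        _ ≤ ∫⁻ ω, 2 * (ofReal (‖S ω‖ ^ 4) +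
            ofReal (6 * ‖g k‖ ^ 2) * (ofReal (‖S ω‖ ^ 2) * ofReal (b k ω * b k ω)) +
            ofReal (‖g k‖ ^ 4) * ofReal (b k ω ^ 4)) ∂P := by
            refine lintegral_mono fun ω => ?_
            have h0 : 0 ≤ b k ω * b k ω := mul_self_nonneg _
            rw [← ofReal_add (by positivity) (by positivity),
              ← ofReal_mul (by positivity), ← ofReal_mul (by positivity),
              ← ofReal_mul (by positivity), ← ofReal_add (by positivity) (by positivity),
              ← ofReal_add (by positivity) (by positivity),
              show (2 : ENNReal) = ofReal 2 by simp, ← ofReal_mul (by positivity)]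
            apply ofReal_le_ofReal
            refine (norm_pow_four_add _ _).trans (le_of_eq ?_)
            rw [norm_smul, mul_pow, mul_pow, Real.norm_eq_abs, sq_abs, Even.pow_abs (by decide)]
            ring
        _ = _ := by
            rw [lintegral_const_mul _ (by fun_prop), lintegral_add_left (by fun_prop),
              lintegral_add_left (by fun_prop), lintegral_const_mul _ hm2, lintegral_const_mul _ hm3]
    rw [ENNReal.mul_le_mul_iff_right (by norm_num) (by norm_num)] at key
    have hind : ∫⁻ ω, ofReal (‖S ω‖ ^ 2) * ofReal (b k ω * b k ω) ∂P =
        ofReal (v * ∑ i ∈ Finset.range k, ‖g i‖ ^ 2) * ofReal v := by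
      have h1 := lintegral_mul_eq_lintegral_mul_lintegral_of_indepFun
        (f := fun ω => ofReal (‖S ω‖ ^ 2)) (g := fun ω => ofReal (b k ω * b k ω))
        (by fun_prop) (by have := h.meas k; fun_prop)
        ((h.indepFun_sum g k).comp (φ := fun x : F => ofReal (‖x‖ ^ 2))
          (ψ := fun c : ℝ => ofReal (c * c)) (by fun_prop) (by fun_prop))
      have h2 : ∫⁻ ω, ofReal (b k ω * b k ω) ∂P = ofReal v := by
        rw [← ofReal_integral_eq_lintegral_ofReal (h.integrable_mul k k)
          (Eventually.of_forall fun _ => mul_self_nonneg _), h.integral_sq]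
      simp only [Pi.mul_apply] at h1
      rw [h1, h2, h.lintegral_norm_sq]
    rw [hind] at key
    simp only [Finset.sum_range_succ]
    refine key.trans ((add_le_add (add_le_add ih le_rfl)
      (mul_le_mul_right (h.lintegral_pow_four k) _)).trans ?_)
    set A := ∑ i ∈ Finset.range k, ‖g i‖ ^ 2
    have hA : 0 ≤ A := Finset.sum_nonneg fun i _ => sq_nonneg _
    have hK : 3 ≤ K4 := le_max_left _ _
    rw [← ofReal_mul (by positivity), ← ofReal_mul (by positivity),
      ← ofReal_mul (by positivity), ← ofReal_add (by positivity) (by positivity),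
      ← ofReal_add (by positivity) (by positivity)]
    apply ofReal_le_ofReal
    have hp : 0 ≤ (v : ℝ) ^ 2 * A * ‖g k‖ ^ 2 := by positivity
    nlinarith [mul_nonneg (sub_nonneg.2 hK) hp]

end IsGaussSeq

namespace IsGaussSeq
variable {Ω : Type*} [MeasurableSpace Ω] {P : Measure Ω} [IsProbabilityMeasure P]
  {b : ℕ → Ω → ℝ} {v : ℝ≥0}
variable {F : Type*} [NormedAddCommGroup F] [InnerProductSpace ℝ F]
  [MeasurableSpace F] [BorelSpace F] [SecondCountableTopology F]

theorem lintegral_norm_sub_sq (h : IsGaussSeq P b v) {g : ℕ → F} {A : ℝ}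
    (hA : HasSum (fun i => ‖g i‖ ^ 2) A) {ξ : Ω → F}
    (hξ : ∀ᵐ ω ∂P, Tendsto (fun k => ∑ i ∈ Finset.range k, b i ω • g i) atTop (𝓝 (ξ ω))) (l : ℕ) :
    ∫⁻ ω, ofReal (‖ξ ω - ∑ i ∈ Finset.range l, b i ω • g i‖ ^ 2) ∂P ≤
      ofReal (v * (A - ∑ i ∈ Finset.range l, ‖g i‖ ^ 2)) := by
  set S : ℕ → Ω → F := fun k ω => ∑ i ∈ Finset.range k, b i ω • g i with hS
  have hSm : ∀ k, Measurable (S k) := fun k => h.measurable_sum g _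
  have h1 : ∀ᵐ ω ∂P, ofReal (‖ξ ω - S l ω‖ ^ 2) =
      liminf (fun k => ofReal (‖S k ω - S l ω‖ ^ 2)) atTop := by
    filter_upwards [hξ] with ω hω
    refine (Tendsto.liminf_eq ?_).symm
    exact ENNReal.tendsto_ofReal (((hω.sub_const _).norm).pow 2)
  rw [lintegral_congr_ae h1]
  refine (lintegral_liminf_le fun k => ?_).trans ?_
  · have := ((hSm k).sub (hSm l)).norm.pow_const 2
    exact ENNReal.measurable_ofReal.comp this
  · refine liminf_le_of_frequently_le' (Eventually.frequently ?_)
    filter_upwards [eventually_ge_atTop l] with k hk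
    have h2 : ∀ ω, S k ω - S l ω = ∑ i ∈ Finset.Ico l k, b i ω • g i := fun ω =>
      (Finset.sum_Ico_eq_sub _ hk).symm
    simp only [h2, h.lintegral_norm_sq]
    apply ofReal_le_ofReal
    rw [Finset.sum_Ico_eq_sub _ hk]
    have := sum_le_hasSum (Finset.range k) (fun i _ => sq_nonneg ‖g i‖) hA
    gcongr

theorem lintegral_lim_pow_four (h : IsGaussSeq P b v) {g : ℕ → F} {A : ℝ}
    (hA : HasSum (fun i => ‖g i‖ ^ 2) A) {ξ : Ω → F}
    (hξ : ∀ᵐ ω ∂P, Tendsto (fun k => ∑ i ∈ Finset.range k, b i ω • g i) atTop (𝓝 (ξ ω))) :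
    ∫⁻ ω, ofReal (‖ξ ω‖ ^ 4) ∂P ≤ ofReal (K4 * (v * A) ^ 2) := by
  set S : ℕ → Ω → F := fun k ω => ∑ i ∈ Finset.range k, b i ω • g i with hS
  have hSm : ∀ k, Measurable (S k) := fun k => h.measurable_sum g _
  have h1 : ∀ᵐ ω ∂P, ofReal (‖ξ ω‖ ^ 4) =
      liminf (fun k => ofReal (‖S k ω‖ ^ 4)) atTop := by
    filter_upwards [hξ] with ω hω
    exact (ENNReal.tendsto_ofReal (hω.norm.pow 4)).liminf_eq.symm
  rw [lintegral_congr_ae h1]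
  refine (lintegral_liminf_le fun k => by fun_prop).trans ?_
  refine liminf_le_of_frequently_le' (Frequently.of_forall fun k => ?_)
  refine (h.lintegral_norm_pow_four g k).trans (ofReal_le_ofReal ?_)
  have := sum_le_hasSum (Finset.range k) (fun i _ => sq_nonneg ‖g i‖) hA
  have h0 := Finset.sum_nonneg fun i (_ : i ∈ Finset.range k) => sq_nonneg ‖g i‖
  have hK : 3 ≤ K4 := le_max_left _ _
  gcongr

theorem bilin_lim (h : IsGaussSeq P b v) {g : ℕ → F} {A : ℝ}
    (hA : HasSum (fun i => ‖g i‖ ^ 2) A) {ξ : Ω → F} (hξm : Measurable ξ)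
    (hξ : ∀ᵐ ω ∂P, Tendsto (fun k => ∑ i ∈ Finset.range k, b i ω • g i) atTop (𝓝 (ξ ω)))
    (B : F →L[ℝ] F →L[ℝ] ℝ) :
    HasSum (fun i => v * B (g i) (g i)) (∫ ω, B (ξ ω) (ξ ω) ∂P) := by
  have hA0 : 0 ≤ A := hA.nonneg fun i => sq_nonneg _
  have hsum : Summable fun i => v * B (g i) (g i) := by
    refine Summable.mul_left _ (Summable.of_norm_bounded (hA.summable.mul_left ‖B‖) fun i => ?_)
    rw [sq, ← mul_assoc]
    exact B.le_opNorm₂ _ _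
  rw [hsum.hasSum_iff_tendsto_nat]
  set S : ℕ → Ω → F := fun k ω => ∑ i ∈ Finset.range k, b i ω • g i with hS
  have h1 : ∀ k, ∑ i ∈ Finset.range k, v * B (g i) (g i) = ∫ ω, B (S k ω) (S k ω) ∂P := fun k => by
    rw [h.integral_bilin, Finset.mul_sum]
  simp only [h1]
  have hBc : Continuous fun x : F => B x x := by fun_prop
  refine tendsto_integral_of_L1 _ (hBc.measurable.comp hξm).aestronglyMeasurable
    (Eventually.of_forall fun k => h.integrable_bilin B g _) ?_
  set r : ℕ → ℝ := fun k => v * (A - ∑ i ∈ Finset.range k, ‖g i‖ ^ 2) with hr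
  have hr0 : ∀ k, 0 ≤ r k := fun k => by
    have := sum_le_hasSum (Finset.range k) (fun i _ => sq_nonneg ‖g i‖) hA
    exact mul_nonneg v.2 (by linarith)
  have hrt : Tendsto r atTop (𝓝 0) := by
    have := (hA.tendsto_sum_nat.const_sub A).const_mul (v : ℝ)
    simpa [hr] using this
  set δ : ℕ → ℝ := fun k => √(r k) + 1 / ((k : ℝ) + 1) with hδ
  have hδ0 : ∀ k, 0 < δ k := fun k => by positivity
  have hδt : Tendsto δ atTop (𝓝 0) := by
    have h2 := hrt.sqrt
    rw [Real.sqrt_zero] at h2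
    simpa [hδ] using h2.add (tendsto_one_div_add_atTop_nhds_zero_nat (𝕜 := ℝ))
  have hrδ : ∀ k, r k / δ k ≤ √(r k) := fun k => by
    rw [div_le_iff₀ (hδ0 k)]
    have : √(r k) * √(r k) = r k := Real.mul_self_sqrt (hr0 k)
    have h3 : 0 ≤ √(r k) * (1 / ((k : ℝ) + 1)) := by positivity
    rw [hδ]; nlinarith
  have hlim : Tendsto (fun k => ofReal (‖B‖ * (δ k * (v * A) + √(r k) + r k))) atTop (𝓝 0) := by
    rw [show (0 : ENNReal) = ofReal (‖B‖ * (0 * (v * A) + 0 + 0)) by simp]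
    have h2 := hrt.sqrt
    rw [Real.sqrt_zero] at h2
    exact ENNReal.tendsto_ofReal ((((hδt.mul_const _).add h2).add hrt).const_mul _)
  refine tendsto_of_tendsto_of_tendsto_of_le_of_le tendsto_const_nhds hlim (fun _ => zero_le) fun k => ?_
  have hSm : Measurable (S k) := h.measurable_sum g _
  have e0 := h.lintegral_norm_sub_sq hA hξ 0
  have ek := h.lintegral_norm_sub_sq hA hξ k
  simp only [Finset.range_zero, Finset.sum_empty, sub_zero] at e0
  have hm1 : Measurable fun ω => ofReal (‖ξ ω‖ ^ 2) := by fun_prop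
  have hm2 : Measurable fun ω => ofReal (‖ξ ω - S k ω‖ ^ 2) :=
    ENNReal.measurable_ofReal.comp ((hξm.sub hSm).norm.pow_const 2)
  calc ∫⁻ ω, ‖B (S k ω) (S k ω) - B (ξ ω) (ξ ω)‖ₑ ∂P
      ≤ ∫⁻ ω, ofReal (‖B‖ * δ k) * ofReal (‖ξ ω‖ ^ 2) +
        ofReal (‖B‖ * (1 / δ k + 1)) * ofReal (‖ξ ω - S k ω‖ ^ 2) ∂P := by
        refine lintegral_mono fun ω => ?_
        have hd := hδ0 k
        rw [← ofReal_mul (by positivity), ← ofReal_mul (by positivity),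
          ← ofReal_add (by positivity) (by positivity), ← ofReal_norm]
        apply ofReal_le_ofReal
        set x := ξ ω
        set e := x - S k ω with he
        have hSe : S k ω = x - e := by rw [he]; abel
        rw [hSe]
        have e1 : B (x - e) (x - e) - B x x = B e e - B x e - B e x := by
          simp only [map_sub, sub_apply]; ring
        have b1 := B.le_opNorm₂ e e
        have b2 := B.le_opNorm₂ x e
        have b3 := B.le_opNorm₂ e x
        have hb := norm_nonneg B
        rw [e1]
        refine (norm_sub_le _ _).trans ((add_le_add (norm_sub_le _ _) le_rfl).trans ?_)
        have h5 : 2 * (‖x‖ * ‖e‖) ≤ δ k * ‖x‖ ^ 2 + 1 / δ k * ‖e‖ ^ 2 := by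
          have h6 : δ k * ‖x‖ ^ 2 + 1 / δ k * ‖e‖ ^ 2 - 2 * (‖x‖ * ‖e‖) =
            (δ k * ‖x‖ - ‖e‖) ^ 2 / δ k := by field_simp; ring
          have h7 : 0 ≤ (δ k * ‖x‖ - ‖e‖) ^ 2 / δ k := by positivity
          linarith
        nlinarith [mul_le_mul_of_nonneg_left h5 hb]
    _ ≤ ofReal (‖B‖ * δ k) * ofReal (v * A) +
        ofReal (‖B‖ * (1 / δ k + 1)) * ofReal (r k) := by
        rw [lintegral_add_left (by fun_prop), lintegral_const_mul _ hm1, lintegral_const_mul _ hm2]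
        gcongr
    _ ≤ _ := by
        have hd := hδ0 k
        have h9 := hr0 k
        rw [← ofReal_mul (by positivity), ← ofReal_mul (by positivity),
          ← ofReal_add (by positivity) (by positivity)]
        apply ofReal_le_ofReal
        have h8 := mul_le_mul_of_nonneg_left (hrδ k) (norm_nonneg B)
        have h10 : ‖B‖ * (1 / δ k + 1) * r k = ‖B‖ * (r k / δ k) + ‖B‖ * r k := by ring
        rw [h10]
        linarith

variable [CompleteSpace F]

/-- The sum of a series, as a function of the coefficients. -/
def seriesLim (g : ℕ → F) (c : ℕ → ℝ) : F :=
  limUnder atTop fun k => ∑ i ∈ Finset.range k, c i • g i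

theorem measurable_seriesLim (g : ℕ → F) : Measurable (seriesLim g) := by
  have : Nonempty F := ⟨0⟩
  refine (StronglyMeasurable.limUnder fun k => Measurable.stronglyMeasurable ?_).measurable
  exact Finset.measurable_fun_sum _ fun i _ => (measurable_pi_apply i).smul_const _

theorem map_neg_pi (h : IsGaussSeq P b v) :
    P.map (fun ω i => -b i ω) = P.map fun ω i => b i ω := by
  rw [h.indep.map_fun_eq_infinitePi_map h.meas]
  have h2 : iIndepFun (fun i ω => -b i ω) P :=
    h.indep.comp (fun _ x => -x) fun _ => measurable_neg
  rw [h2.map_fun_eq_infinitePi_map fun i => (show Measurable fun ω => -b i ω from (h.meas i).neg)]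
  congr 1
  ext1 i
  exact h.map_neg i

theorem map_lim_neg (h : IsGaussSeq P b v) {g : ℕ → F} {ξ : Ω → F}
    (hξ : ∀ᵐ ω ∂P, Tendsto (fun k => ∑ i ∈ Finset.range k, b i ω • g i) atTop (𝓝 (ξ ω))) :
    P.map (fun ω => -ξ ω) = P.map ξ := by
  have h1 : ξ =ᵐ[P] fun ω => seriesLim g fun i => b i ω :=
    hξ.mono fun ω hω => hω.limUnder_eq.symm
  have h2 : (fun ω => -ξ ω) =ᵐ[P] fun ω => seriesLim g fun i => -b i ω := by
    filter_upwards [hξ] with ω hω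
    have := hω.neg
    simp only [← Finset.sum_neg_distrib, ← neg_smul] at this
    exact this.limUnder_eq.symm
  have m1 : Measurable fun ω i => b i ω := measurable_pi_lambda _ h.meas
  have m2 : Measurable fun ω i => -b i ω := measurable_pi_lambda _ fun i => (h.meas i).neg
  rw [Measure.map_congr h1, Measure.map_congr h2]
  have e1 := Measure.map_map (μ := P) (measurable_seriesLim g) m1
  have e2 := Measure.map_map (μ := P) (measurable_seriesLim g) m2
  rw [Function.comp_def] at e1 e2
  rw [← e1, ← e2, h.map_neg_pi]

end IsGaussSeq

/-! ### Weak limits in `H²(D)³` -/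

theorem hasWeakPartial_of_weak {k : Fin 3} {a g : ℕ → L2 D} {a' g' : L2 D}
    (h : ∀ n, HasWeakPartial D k (a n) (g n))
    (ha : ∀ z, Tendsto (fun n => inner ℝ (a n) z) atTop (𝓝 (inner ℝ a' z)))
    (hg : ∀ z, Tendsto (fun n => inner ℝ (g n) z) atTop (𝓝 (inner ℝ g' z))) :
    HasWeakPartial D k a' g' := by
  rw [hasWeakPartial_iff]
  intro φ h1 h2 h3 e
  have t1 := ha (tf (pderiv3 k φ) e)
  have t2 := (hg (tf φ e)).neg
  have e1 : ∀ n, inner ℝ (a n) (tf (pderiv3 k φ) e) = -inner ℝ (g n) (tf φ e) := fun n => by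
    rw [real_inner_comm, hasWeakPartial_iff.1 (h n) φ h1 h2 h3 e, real_inner_comm]
  simp only [e1] at t1
  rw [real_inner_comm, tendsto_nhds_unique t1 t2, real_inner_comm]

/-- The function and its weak partial derivatives of first and second order. -/
def dcomp : Option (Fin 3 ⊕ Fin 3 × Fin 3) → L2 D → L2 D
  | none, u => u
  | some (.inl k), u => weakPartial k u
  | some (.inr (k, l)), u => weakPartial l (weakPartial k u)

theorem normSqH2_eq_sum (u : L2 D) : normSqH2 u = ∑ j, ‖dcomp j u‖ ^ 2 := by
  rw [Fintype.sum_option, Fintype.sum_sum_type, Fintype.sum_prod_type, normSqH2, add_assoc]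
  rfl

theorem normSqH2_nonneg (u : L2 D) : 0 ≤ normSqH2 u := by
  rw [normSqH2_eq_sum]; positivity

theorem MemH1.sum_smul {g : ℕ → L2 D} (hg : ∀ i, MemH1 (g i)) (c : ℕ → ℝ) (s : Finset ℕ) :
    MemH1 (∑ i ∈ s, c i • g i) := by
  have := H1.memH1 (∑ i ∈ s, c i • (hg i).lift)
  simpa only [map_sum, map_smul, MemH1.val_lift] using this

theorem weakPartial_sum_smul (hD : IsOpen D) {g : ℕ → L2 D} (hg : ∀ i, MemH1 (g i)) (c : ℕ → ℝ)
    (s : Finset ℕ) (k : Fin 3) :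
    weakPartial k (∑ i ∈ s, c i • g i) = ∑ i ∈ s, c i • weakPartial k (g i) := by
  have := H1.weakPartial_val hD (∑ i ∈ s, c i • (hg i).lift) k
  simpa only [map_sum, map_smul, MemH1.val_lift, MemH1.grad_lift] using this

theorem MemH2.sum_smul (hD : IsOpen D) {g : ℕ → L2 D} (hg : ∀ i, MemH2 (g i)) (c : ℕ → ℝ)
    (s : Finset ℕ) : MemH2 (∑ i ∈ s, c i • g i) :=
  ⟨MemH1.sum_smul (fun i => (hg i).1) c s, fun k => by
    rw [weakPartial_sum_smul hD fun i => (hg i).1]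
    exact MemH1.sum_smul (fun i => (hg i).2 k) c s⟩

theorem dcomp_sum_smul (hD : IsOpen D) {g : ℕ → L2 D} (hg : ∀ i, MemH2 (g i)) (c : ℕ → ℝ)
    (s : Finset ℕ) (j) : dcomp j (∑ i ∈ s, c i • g i) = ∑ i ∈ s, c i • dcomp j (g i) := by
  rcases j with _ | k | ⟨k, l⟩
  · rfl
  · exact weakPartial_sum_smul hD (fun i => (hg i).1) c s k
  · simp only [dcomp]
    rw [weakPartial_sum_smul hD fun i => (hg i).1, weakPartial_sum_smul hD fun i => (hg i).2 k]

instance (D : Set E3) :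
    SecondCountableTopology (PiLp 2 fun _ : Option (Fin 3 ⊕ Fin 3 × Fin 3) => L2 D) :=
  (PiLp.homeomorph 2 fun _ : Option (Fin 3 ⊕ Fin 3 × Fin 3) => L2 D).secondCountableTopology

theorem memH2_of_tendsto (hD : IsOpen D) {u : ℕ → L2 D} {w : L2 D} (hu : Tendsto u atTop (𝓝 w))
    (h2 : ∀ n, MemH2 (u n)) {C : ℝ} (hC : ∃ᶠ n in atTop, normSqH2 (u n) ≤ C) :
    MemH2 w ∧ normSqH2 w ≤ C := by
  obtain ⟨φ, hφ, hφC⟩ := extraction_of_frequently_atTop hC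
  let x : ℕ → PiLp 2 fun _ : Option (Fin 3 ⊕ Fin 3 × Fin 3) => L2 D := fun n =>
    WithLp.toLp 2 fun j => dcomp j (u (φ n))
  have hx : ∀ n, ‖x n‖ ^ 2 = normSqH2 (u (φ n)) := fun n => by
    rw [PiLp.norm_sq_eq_of_L2, normSqH2_eq_sum]
  have hC0 : 0 ≤ C := (normSqH2_nonneg _).trans (hφC 0)
  obtain ⟨y, ψ, hψ, hy, hlim⟩ := exists_weak_limit (x := x) (C := √C) fun n =>
    Real.le_sqrt_of_sq_le (by rw [hx]; exact hφC n)
  have hc : ∀ j z, Tendsto (fun n => inner ℝ (dcomp j (u (φ (ψ n)))) z) atTop (𝓝 (inner ℝ (y j) z)) := by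
    intro j z
    have := hlim (ContinuousLinearMap.adjoint
      (PiLp.proj 2 (𝕜 := ℝ) (fun _ : Option (Fin 3 ⊕ Fin 3 × Fin 3) => L2 D) j) z)
    simp only [ContinuousLinearMap.adjoint_inner_right] at this
    exact this
  have hw : y none = w := by
    refine ext_inner_right ℝ fun z => tendsto_nhds_unique (hc none z) ?_
    have h1 : Tendsto (fun n => u (φ (ψ n))) atTop (𝓝 w) :=
      hu.comp (hφ.comp hψ).tendsto_atTop
    exact h1.inner tendsto_const_nhds
  have d1 : ∀ k, HasWeakPartial D k w (y (some (.inl k))) := fun k => by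
    rw [← hw]
    exact hasWeakPartial_of_weak (a := fun n => u (φ (ψ n))) (g := fun n => weakPartial k (u (φ (ψ n))))
      (fun n => (h2 (φ (ψ n))).1.hasWeakPartial k) (hc none) (hc (some (.inl k)))
  have d2 : ∀ k l, HasWeakPartial D l (y (some (.inl k))) (y (some (.inr (k, l)))) := fun k l =>
    hasWeakPartial_of_weak (a := fun n => weakPartial k (u (φ (ψ n))))
      (g := fun n => weakPartial l (weakPartial k (u (φ (ψ n)))))
      (fun n => ((h2 (φ (ψ n))).2 k).hasWeakPartial l) (hc (some (.inl k))) (hc (some (.inr (k, l))))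
  have e1 : ∀ k, weakPartial k w = y (some (.inl k)) := fun k => (d1 k).weakPartial_eq hD
  have e2 : ∀ k l, weakPartial l (weakPartial k w) = y (some (.inr (k, l))) := fun k l => by
    rw [e1]; exact (d2 k l).weakPartial_eq hD
  refine ⟨⟨fun k => ⟨_, d1 k⟩, fun k l => ⟨_, by rw [e1]; exact d2 k l⟩⟩, ?_⟩
  have : normSqH2 w = ‖y‖ ^ 2 := by
    rw [PiLp.norm_sq_eq_of_L2, normSqH2_eq_sum]
    refine Finset.sum_congr rfl fun j _ => ?_
    rcases j with _ | k | ⟨k, l⟩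
    · rw [hw]; rfl
    · rw [← e1]; rfl
    · rw [← e2]; rfl
  rw [this, ← Real.sq_sqrt hC0]
  gcongr

theorem IsGaussSeq.memH2_lim {Ω : Type*} [MeasurableSpace Ω] {P : Measure Ω} [IsProbabilityMeasure P]
    {b : ℕ → Ω → ℝ} {v : ℝ≥0} (h : IsGaussSeq P b v) (hD : IsOpen D) {g : ℕ → L2 D}
    (hg : ∀ i, MemH2 (g i)) {Q : ℝ} (hQ : HasSum (fun i => normSqH2 (g i)) Q) {ξ : Ω → L2 D}
    (hξ : ∀ᵐ ω ∂P, Tendsto (fun k => ∑ i ∈ Finset.range k, b i ω • g i) atTop (𝓝 (ξ ω))) :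
    (∀ᵐ ω ∂P, MemH2 (ξ ω)) ∧
      ∫⁻ ω, ofReal (normSqH2 (ξ ω)) ∂P ≤ ofReal (v * Q) := by
  let q : ℕ → Ω → ENNReal := fun k ω =>
    ∑ j, ofReal (‖∑ i ∈ Finset.range k, b i ω • dcomp j (g i)‖ ^ 2)
  have hq : ∀ k ω, q k ω = ofReal (normSqH2 (∑ i ∈ Finset.range k, b i ω • g i)) := fun k ω => by
    rw [normSqH2_eq_sum, ofReal_sum_of_nonneg fun _ _ => sq_nonneg _]
    simp only [dcomp_sum_smul hD hg]
    rfl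
  have hqm : ∀ k j, Measurable fun ω =>
      ofReal (‖∑ i ∈ Finset.range k, b i ω • dcomp j (g i)‖ ^ 2) := fun k j =>
    ENNReal.measurable_ofReal.comp ((h.measurable_sum _ _).norm.pow_const 2)
  have hint : ∫⁻ ω, liminf (fun k => q k ω) atTop ∂P ≤ ofReal (v * Q) := by
    refine (lintegral_liminf_le fun k => Finset.measurable_fun_sum _ fun j _ => hqm k j).trans ?_
    refine liminf_le_of_frequently_le' (Frequently.of_forall fun k => ?_)
    rw [lintegral_finsetSum _ fun j _ => hqm k j]
    simp only [h.lintegral_norm_sq]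
    rw [← ofReal_sum_of_nonneg fun _ _ => by positivity, ← Finset.mul_sum, Finset.sum_comm]
    apply ofReal_le_ofReal
    simp only [← normSqH2_eq_sum]
    have := sum_le_hasSum (Finset.range k) (fun i _ => normSqH2_nonneg (g i)) hQ
    gcongr
  have hfin : ∀ᵐ ω ∂P, liminf (fun k => q k ω) atTop < ⊤ := by
    refine ae_lt_top (Measurable.liminf fun k => Finset.measurable_fun_sum _ fun j _ => hqm k j) ?_
    exact (hint.trans_lt ENNReal.ofReal_lt_top).ne
  have key : ∀ᵐ ω ∂P, MemH2 (ξ ω) ∧ ofReal (normSqH2 (ξ ω)) ≤ liminf (fun k => q k ω) atTop := by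
    filter_upwards [hξ, hfin] with ω h1 h2
    have h3 : ∀ C : ℝ≥0, liminf (fun k => q k ω) atTop < C → MemH2 (ξ ω) ∧ normSqH2 (ξ ω) ≤ C := by
      intro C hC
      have h4 := frequently_lt_of_liminf_lt (by isBoundedDefault) hC
      refine memH2_of_tendsto hD h1 (fun n => MemH2.sum_smul hD hg _ _) (h4.mono fun n hn => ?_)
      rw [hq] at hn
      have := hn.le
      rwa [ENNReal.ofReal_le_iff_le_toReal ENNReal.coe_ne_top, ENNReal.coe_toReal] at this
    refine ⟨?_, ENNReal.le_of_forall_pos_le_add fun ε hε _ => ?_⟩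
    · obtain ⟨C, hC, -⟩ := ENNReal.lt_iff_exists_nnreal_btwn.1 h2
      exact (h3 C hC).1
    · have h5 : liminf (fun k => q k ω) atTop <
          ((liminf (fun k => q k ω) atTop).toNNReal + ε : ℝ≥0) := by
        rw [ENNReal.coe_add, ENNReal.coe_toNNReal h2.ne]
        exact ENNReal.lt_add_right h2.ne (by simpa using hε.ne')
      have h6 := (h3 _ h5).2
      rw [← ENNReal.ofReal_le_ofReal_iff (NNReal.coe_nonneg _), ENNReal.ofReal_coe_nnreal, ENNReal.coe_add,
        ENNReal.coe_toNNReal h2.ne] at h6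
      exact h6
  exact ⟨key.mono fun _ h => h.1, (lintegral_mono_ae (key.mono fun _ h => h.2)).trans hint⟩

/-! ### The noise increments -/

/-- A measurable function that is equal to `normSqH2` on `H²(D)³`. -/
def sqH2 (u : L2 D) : ℝ :=
  ‖u‖ ^ 2 + ∑ k, ‖dpart k u‖ ^ 2 + ∑ k, ∑ l, ‖dpart l (dpart k u)‖ ^ 2

theorem sqH2_nonneg (u : L2 D) : 0 ≤ sqH2 u := by unfold sqH2; positivity

theorem norm_sq_le_sqH2 (u : L2 D) : ‖u‖ ^ 2 ≤ sqH2 u := by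
  unfold sqH2
  rw [add_assoc]
  exact le_add_of_nonneg_right (by positivity)

theorem norm_sq_le_normSqH2 (u : L2 D) : ‖u‖ ^ 2 ≤ normSqH2 u := by
  unfold normSqH2
  rw [add_assoc]
  exact le_add_of_nonneg_right (by positivity)

theorem dirichlet_le_normSqH2 (u : L2 D) : dirichlet u ≤ normSqH2 u := by
  unfold normSqH2 dirichlet
  have h1 : 0 ≤ ∑ k, ∑ l, ‖weakPartial l (weakPartial k u)‖ ^ 2 := by positivity
  have h2 := sq_nonneg ‖u‖
  linarith

theorem measurable_sqH2 (hD : IsOpen D) : Measurable (sqH2 : L2 D → ℝ) := by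
  have h := measurable_dpart (D := D) hD
  refine ((measurable_norm.pow_const 2).add (Finset.measurable_fun_sum _ fun k _ =>
    (h k).norm.pow_const 2)).add (Finset.measurable_fun_sum _ fun k _ =>
      Finset.measurable_fun_sum _ fun l _ => ((h l).comp (h k)).norm.pow_const 2)

theorem MemH2.sqH2_eq (hD : IsOpen D) {u : L2 D} (h : MemH2 u) : sqH2 u = normSqH2 u := by
  have h1 : ∀ k, dpart k u = weakPartial k u := h.1.dpart_eq hD
  have h2 : ∀ k l, dpart l (weakPartial k u) = weakPartial l (weakPartial k u) :=
    fun k => (h.2 k).dpart_eq hD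
  simp only [sqH2, normSqH2, h1, h2]

/-- The first `n` terms of a sequence. -/
def past {α : Type*} [Zero α] (n : ℕ) (a : ℕ → α) (i : ℕ) : α := if i < n then a i else 0

theorem past_apply {α : Type*} [Zero α] {n i : ℕ} (a : ℕ → α) (h : i < n) : past n a i = a i := if_pos h

theorem measurable_past {α : Type*} [Zero α] [MeasurableSpace α] (n : ℕ) :
    Measurable (past n : (ℕ → α) → ℕ → α) :=
  measurable_pi_lambda _ fun i => by
    unfold past; split_ifs
    · exact measurable_pi_apply i
    · exact measurable_const

/-- The properties of the increments `ξ 0, …, ξ (N - 1)` of the noise over intervals of length `dt`. -/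
structure IsNoiseSeq {Ω : Type*} [MeasurableSpace Ω] (μ : Measure Ω) (Gi : ℕ → L2 D) (Q dt : ℝ)
    (N : ℕ) (ξ : ℕ → Ω → L2 D) : Prop where
  meas : ∀ n, Measurable (ξ n)
  indep : ∀ n < N, IndepFun (fun ω => past n fun i => ξ i ω) (ξ n) μ
  symm : ∀ n < N, μ.map (fun ω => -ξ n ω) = μ.map (ξ n)
  memH2 : ∀ n < N, ∀ᵐ ω ∂μ, MemH2 (ξ n ω)
  lintegral_sqH2 : ∀ n < N, ∫⁻ ω, ofReal (sqH2 (ξ n ω)) ∂μ ≤ ofReal (dt * Q)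
  lintegral_pow_four : ∀ n < N,
    ∫⁻ ω, ofReal (‖ξ n ω‖ ^ 4) ∂μ ≤ ofReal (IsGaussSeq.K4 * (dt * Q) ^ 2)
  bilin : ∀ n < N, ∀ B : L2 D →L[ℝ] L2 D →L[ℝ] ℝ,
    HasSum (fun i => dt * B (Gi i) (Gi i)) (∫ ω, B (ξ n ω) (ξ n ω) ∂μ)

theorem IsNoiseSeq.map {Ω α : Type*} [MeasurableSpace Ω] [MeasurableSpace α] {P : Measure Ω}
    [IsProbabilityMeasure P] (hD : IsOpen D)
    {Gi : ℕ → L2 D} {Q dt : ℝ} {N : ℕ} {g : Ω → α} (hg : Measurable g) {η : ℕ → α → L2 D}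
    (hη : ∀ n, Measurable (η n)) (h : IsNoiseSeq P Gi Q dt N fun n ω => η n (g ω)) :
    IsNoiseSeq (P.map g) Gi Q dt N η where
  meas := hη
  indep n hn := by
    have : IsProbabilityMeasure (P.map g) := Measure.isProbabilityMeasure_map hg.aemeasurable
    have m1 : Measurable fun a => past n fun i => η i a :=
      (measurable_past n).comp (measurable_pi_lambda _ hη)
    have h1 := h.indep n hn
    have m2 : Measurable fun ω => past n fun i => η i (g ω) := m1.comp hg
    have m3 : Measurable fun ω => η n (g ω) := (hη n).comp hg
    rw [indepFun_iff_map_prod_eq_prod_map_map m2.aemeasurable m3.aemeasurable] at h1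
    rw [indepFun_iff_map_prod_eq_prod_map_map m1.aemeasurable (hη n).aemeasurable,
      Measure.map_map (m1.prodMk (hη n)) hg, Measure.map_map m1 hg, Measure.map_map (hη n) hg]
    exact h1
  symm n hn := by
    have m1 : Measurable fun a => -η n a := (hη n).neg
    rw [Measure.map_map m1 hg, Measure.map_map (hη n) hg]
    exact h.symm n hn
  memH2 n hn := (ae_map_iff hg.aemeasurable ((hη n) (measurableSet_memH2 hD))).2 (h.memH2 n hn)
  lintegral_sqH2 n hn := (lintegral_map_le _ _).trans (h.lintegral_sqH2 n hn)
  lintegral_pow_four n hn := (lintegral_map_le _ _).trans (h.lintegral_pow_four n hn)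
  bilin n hn B := by
    have hBc : Continuous fun x : L2 D => B x x := by fun_prop
    have hBm : Measurable fun a => B (η n a) (η n a) := hBc.measurable.comp (hη n)
    rw [integral_map hg.aemeasurable hBm.aestronglyMeasurable]
    exact h.bilin n hn B

/-- A family of independent sequences of independent variables, with the two indices exchanged. -/
theorem iIndepFun_swap {Ω : Type*} [MeasurableSpace Ω] {P : Measure Ω} [IsProbabilityMeasure P]
    {b : ℕ → ℕ → Ω → ℝ} (hb : ∀ n i, Measurable (b n i))
    (h1 : iIndepFun (fun i ω n => b n i ω) P) (h2 : ∀ i, iIndepFun (fun n => b n i) P) :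
    (∀ n, iIndepFun (b n) P) ∧ iIndepFun (fun n ω i => b n i ω) P := by
  have h3 := iIndepFun_uncurry' (X := fun i n => b n i) (fun i n => hb n i) h1 h2
  have h4 : iIndepFun (fun p : ℕ × ℕ => b p.1 p.2) P :=
    h3.precomp (g := Prod.swap) Prod.swap_injective
  have h5 : ∀ n, iIndepFun (b n) P := fun n =>
    h4.precomp (g := fun i => (n, i)) fun i j hij => (Prod.mk.inj hij).2
  refine ⟨h5, ?_⟩
  have hm : ∀ n, Measurable fun ω i => b n i ω := fun n => measurable_pi_lambda _ (hb n)
  have : ∀ n i, IsProbabilityMeasure (P.map (b n i)) := fun n i =>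
    Measure.isProbabilityMeasure_map (hb n i).aemeasurable
  rw [iIndepFun_iff_map_fun_eq_infinitePi_map hm]
  have h6 := h4.map_fun_eq_infinitePi_map fun p : ℕ × ℕ => hb p.1 p.2
  have h7 := Measure.infinitePi_map_curry fun n i => P.map (b n i)
  rw [← h6, Measure.map_map (by fun_prop) (measurable_pi_lambda _ fun p : ℕ × ℕ => hb p.1 p.2)] at h7
  simp only [(h5 _).map_fun_eq_infinitePi_map (hb _)]
  exact h7

theorem IsNoise.isNoiseSeq {T : ℝ} (hT : 0 < T) (hD : IsOpen D) {e : HilbertBasis ℕ ℝ (L2 D)}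
    {G : L2 D →L[ℝ] L2 D} (hG : IsHilbertSchmidtH2 e G) {Ω : Type*} [MeasurableSpace Ω]
    {P : Measure Ω} [IsProbabilityMeasure P] {β : ℕ → ℝ≥0 → Ω → ℝ} {GW : Ω → CT T D}
    (h : IsNoise P e G β GW) (hm : Measurable GW) {N : ℕ} (hN : 0 < N) :
    IsNoiseSeq P (fun i => G (e i)) (∑' i, normSqH2 (G (e i))) (T / N) N
      fun n ω => noiseInc N n (GW ω) := by
  set Gi : ℕ → L2 D := fun i => G (e i) with hGi
  set Q : ℝ := ∑' i, normSqH2 (G (e i)) with hQ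
  have hdt : 0 < T / N := by positivity
  let t : ℕ → ℝ≥0 := fun n => ⟨n * (T / N), by positivity⟩
  have ht : Monotone t := fun a b hab => by
    have : (a : ℝ) ≤ b := by exact_mod_cast hab
    exact NNReal.coe_le_coe.1 (mul_le_mul_of_nonneg_right this hdt.le)
  let b0 : ℕ → ℕ → Ω → ℝ := fun n i ω => β i (t (n + 1)) ω - β i (t n) ω
  have hb0 : ∀ n i, AEMeasurable (b0 n i) P := fun n i =>
    ((h.brownian i).aemeasurable _).sub ((h.brownian i).aemeasurable _)
  let b : ℕ → ℕ → Ω → ℝ := fun n i => (hb0 n i).mk (b0 n i)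
  have hb : ∀ n i, Measurable (b n i) := fun n i => (hb0 n i).measurable_mk
  have hbb : ∀ n i, b0 n i =ᵐ[P] b n i := fun n i => (hb0 n i).ae_eq_mk
  have h1 : iIndepFun (fun i ω n => b n i ω) P := by
    have h2 := h.indep.comp (fun _ (f : ℝ≥0 → ℝ) (n : ℕ) => f (t (n + 1)) - f (t n)) fun _ =>
      measurable_pi_lambda _ fun n => (measurable_pi_apply _).sub (measurable_pi_apply _)
    refine h2.congr fun i => ?_
    filter_upwards [ae_all_iff.2 fun n => hbb n i] with ω hω
    exact funext hω
  have h2 : ∀ i, iIndepFun (fun n => b n i) P := fun i =>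
    ((h.brownian i).hasIndepIncrements.nat ht).congr fun n => hbb n i
  obtain ⟨h3, h4⟩ := iIndepFun_swap hb h1 h2
  have hgauss : ∀ n, IsGaussSeq P (b n) ⟨T / N, hdt.le⟩ := fun n => by
    refine ⟨hb n, h3 n, fun i => ?_⟩
    rw [← Measure.map_congr (hbb n i)]
    have h5 := ((h.brownian i).hasLaw_sub (t (n + 1)) (t n)).map_eq
    refine h5.trans ?_
    congr 1
    apply NNReal.eq
    rw [coe_nndist, Real.dist_eq]
    change |((n + 1 : ℕ) : ℝ) * (T / N) - n * (T / N)| = T / N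
    push_cast
    rw [show ((n : ℝ) + 1) * (T / N) - n * (T / N) = T / N by ring, abs_of_pos hdt]
  have htI : ∀ n ≤ N, (n : ℝ) * (T / N) ∈ Icc 0 T := fun n hn => by
    refine ⟨by positivity, ?_⟩
    have h1 : (n : ℝ) ≤ N := by exact_mod_cast hn
    have h2 : (0 : ℝ) < N := by exact_mod_cast hN
    calc (n : ℝ) * (T / N) ≤ N * (T / N) := by gcongr
      _ = T := by field_simp
  have hlim : ∀ n < N, ∀ᵐ ω ∂P, Tendsto (fun k => ∑ i ∈ Finset.range k, b n i ω • Gi i) atTop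
      (𝓝 (noiseInc N n (GW ω))) := fun n hn => by
    have i1 := htI n hn.le
    have i2 := htI (n + 1) hn
    filter_upwards [h.series ⟨_, i1⟩, h.series ⟨_, i2⟩, ae_all_iff.2 fun i => hbb n i] with ω a1 a2 a3
    have := a2.sub a1
    simp only [← Finset.sum_sub_distrib, ← sub_smul] at this
    simp only [← a3]
    unfold noiseInc pathAt
    have i2' : ((n : ℝ) + 1) * (T / N) ∈ Icc 0 T := by exact_mod_cast i2
    rw [dif_pos i1, dif_pos i2']
    convert this using 2
    simp
  have hsumQ : Summable fun i => normSqH2 (Gi i) := hG.2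
  have hsA : Summable fun i => ‖Gi i‖ ^ 2 :=
    hsumQ.of_nonneg_of_le (fun _ => sq_nonneg _) fun i => norm_sq_le_normSqH2 _
  have hAQ : ∑' i, ‖Gi i‖ ^ 2 ≤ Q := hsA.tsum_le_tsum (fun i => norm_sq_le_normSqH2 _) hsumQ
  have hA0 : 0 ≤ ∑' i, ‖Gi i‖ ^ 2 := tsum_nonneg fun _ => sq_nonneg _
  have hmn : ∀ n, Measurable fun ω => noiseInc N n (GW ω) := fun n =>
    (continuous_noiseInc N n).measurable.comp hm
  have hH2 := fun n hn => (hgauss n).memH2_lim hD (g := Gi) (fun i => hG.1 _) hsumQ.hasSum (hlim n hn)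
  refine ⟨hmn, fun n hn => ?_, fun n hn => (hgauss n).map_lim_neg (hlim n hn), fun n hn => (hH2 n hn).1,
    fun n hn => ?_, fun n hn => ?_, fun n hn B => (hgauss n).bilin_lim hsA.hasSum (hmn n) (hlim n hn) B⟩
  · let X : ℕ → Ω → L2 D := fun n ω => IsGaussSeq.seriesLim Gi fun i => b n i ω
    have hX : ∀ n, Measurable (X n) := fun n =>
      (IsGaussSeq.measurable_seriesLim Gi).comp (measurable_pi_lambda _ (hb n))
    have hXe : ∀ n < N, X n =ᵐ[P] fun ω => noiseInc N n (GW ω) := fun n hn =>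
      (hlim n hn).mono fun ω (hω : Tendsto _ _ _) => (hω.limUnder_eq : _ = _)
    have hXi : iIndepFun X P := h4.comp (fun _ => IsGaussSeq.seriesLim Gi) fun _ => IsGaussSeq.measurable_seriesLim Gi
    have h5 := hXi.indepFun_finset (Finset.range n) {n} (by simp) hX
    have h6 := h5.comp
      (φ := fun (c : Finset.range n → L2 D) (i : ℕ) =>
        if hi : i < n then c ⟨i, Finset.mem_range.2 hi⟩ else 0)
      (ψ := fun c : ({n} : Finset ℕ) → L2 D => c ⟨n, Finset.mem_singleton_self n⟩)
      (measurable_pi_lambda _ fun i => by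
        split_ifs
        · exact measurable_pi_apply _
        · exact measurable_const)
      (measurable_pi_apply (X := fun _ : ({n} : Finset ℕ) => L2 D) _)
    refine h6.congr ?_ (hXe n hn)
    have h7 : ∀ᵐ ω ∂P, ∀ i, i < n → X i ω = noiseInc N i (GW ω) := by
      refine ae_all_iff.2 fun i => ?_
      by_cases hi : i < n
      · filter_upwards [hXe i (hi.trans hn)] with ω hω _ using hω
      · exact Eventually.of_forall fun ω h => absurd h hi
    filter_upwards [h7] with ω hω
    ext1 i
    simp only [Function.comp_apply, past]
    split_ifs with hi
    · exact hω i hi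
    · rfl
  · refine le_trans (lintegral_mono_ae ?_) (hH2 n hn).2
    filter_upwards [(hH2 n hn).1] with ω hω
    rw [hω.sqH2_eq hD]
  · refine ((hgauss n).lintegral_lim_pow_four hsA.hasSum (hlim n hn)).trans (ofReal_le_ofReal ?_)
    have hK : 3 ≤ IsGaussSeq.K4 := le_max_left _ _
    change IsGaussSeq.K4 * (T / N * _) ^ 2 ≤ _
    gcongr

theorem IsNoise.congr {T : ℝ} {e : HilbertBasis ℕ ℝ (L2 D)}
    {G : L2 D →L[ℝ] L2 D} {Ω : Type*} [MeasurableSpace Ω]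
    {P : Measure Ω} {β : ℕ → ℝ≥0 → Ω → ℝ} {GW GW' : Ω → CT T D}
    (h : IsNoise P e G β GW) (hc : GW =ᵐ[P] GW') : IsNoise P e G β GW' := by
  refine ⟨h.brownian, h.indep, fun t => ?_⟩
  filter_upwards [h.series t, hc] with ω h1 h2
  rwa [← h2]

/-- The increments of the noise, on the space of its paths. -/
theorem IsNoise.isNoiseSeq_map {T : ℝ} (hT : 0 < T) (hD : IsOpen D) {e : HilbertBasis ℕ ℝ (L2 D)}
    {G : L2 D →L[ℝ] L2 D} (hG : IsHilbertSchmidtH2 e G) {Ω : Type*} [MeasurableSpace Ω]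
    {P : Measure Ω} [IsProbabilityMeasure P] {β : ℕ → ℝ≥0 → Ω → ℝ} {GW : Ω → CT T D}
    (h : IsNoise P e G β GW) (hm : AEMeasurable GW P) {N : ℕ} (hN : 0 < N) :
    IsNoiseSeq (P.map GW) (fun i => G (e i)) (∑' i, normSqH2 (G (e i))) (T / N) N
      fun n (w : CT T D) => noiseInc N n w := by
  rw [Measure.map_congr hm.ae_eq_mk]
  exact ((h.congr hm.ae_eq_mk).isNoiseSeq hT hD hG hm.measurable_mk hN).map hD hm.measurable_mk
    fun n => (continuous_noiseInc N n).measurable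

/-! ### Expectations of functions of the past and of an increment -/

namespace IsNoiseSeq
variable {Ω : Type*} [MeasurableSpace Ω] {μ : Measure Ω} [IsProbabilityMeasure μ] {Gi : ℕ → L2 D}
  {Q dt : ℝ} {N : ℕ} {ξ : ℕ → Ω → L2 D}

theorem measurable_past (h : IsNoiseSeq μ Gi Q dt N ξ) (n : ℕ) :
    Measurable fun ω => past n fun i => ξ i ω :=
  (SLLG.measurable_past n).comp (measurable_pi_lambda _ h.meas)

theorem map_prod (h : IsNoiseSeq μ Gi Q dt N ξ) {n : ℕ} (hn : n < N) :
    μ.map (fun ω => (past n fun i => ξ i ω, ξ n ω)) =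
      (μ.map fun ω => past n fun i => ξ i ω).prod (μ.map (ξ n)) :=
  (indepFun_iff_map_prod_eq_prod_map_map (h.measurable_past n).aemeasurable
    (h.meas n).aemeasurable).1 (h.indep n hn)

theorem map_prod_neg (h : IsNoiseSeq μ Gi Q dt N ξ) {n : ℕ} (hn : n < N) :
    μ.map (fun ω => (past n fun i => ξ i ω, -ξ n ω)) =
      μ.map fun ω => (past n fun i => ξ i ω, ξ n ω) := by
  have hm : Measurable fun ω => -ξ n ω := (h.meas n).neg
  have h2 : IndepFun (fun ω => past n fun i => ξ i ω) (fun ω => -ξ n ω) μ :=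
    (h.indep n hn).comp measurable_id measurable_neg
  rw [h.map_prod hn, (indepFun_iff_map_prod_eq_prod_map_map (h.measurable_past n).aemeasurable
    hm.aemeasurable).1 h2, h.symm n hn]

/-- Symmetrization in the last increment. -/
theorem lintegral_le_of_symm (h : IsNoiseSeq μ Gi Q dt N ξ) {n : ℕ} (hn : n < N)
    {f g : (ℕ → L2 D) × L2 D → ENNReal} (hf : Measurable f)
    (hfg : ∀ u x, f (u, x) + f (u, -x) ≤ 2 * g (u, x)) :
    ∫⁻ ω, f (past n fun i => ξ i ω, ξ n ω) ∂μ ≤ ∫⁻ ω, g (past n fun i => ξ i ω, ξ n ω) ∂μ := by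
  have hm1 : Measurable fun ω => (past n fun i => ξ i ω, ξ n ω) := (h.measurable_past n).prodMk (h.meas n)
  have hm2 : Measurable fun ω => (past n fun i => ξ i ω, -ξ n ω) :=
    (h.measurable_past n).prodMk (show Measurable fun ω => -ξ n ω from (h.meas n).neg)
  have e1 := lintegral_map (μ := μ) hf hm1
  have e2 := lintegral_map (μ := μ) hf hm2
  rw [h.map_prod_neg hn, e1] at e2
  have : 2 * ∫⁻ ω, f (past n fun i => ξ i ω, ξ n ω) ∂μ ≤
      2 * ∫⁻ ω, g (past n fun i => ξ i ω, ξ n ω) ∂μ := by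
    calc _ = ∫⁻ ω, f (past n fun i => ξ i ω, ξ n ω) + f (past n fun i => ξ i ω, -ξ n ω) ∂μ := by
          have hf1 : Measurable fun ω => f (past n fun i => ξ i ω, ξ n ω) := hf.comp hm1
          rw [lintegral_add_left hf1, ← e2, two_mul]
      _ ≤ ∫⁻ ω, 2 * g (past n fun i => ξ i ω, ξ n ω) ∂μ := lintegral_mono fun ω => hfg _ _
      _ = _ := lintegral_const_mul' _ _ (by norm_num)
  exact (ENNReal.mul_le_mul_iff_right (by norm_num) (by norm_num)).1 this

theorem lintegral_mul_indep (h : IsNoiseSeq μ Gi Q dt N ξ) {n : ℕ} (hn : n < N)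
    {f : (ℕ → L2 D) → ENNReal} {g : L2 D → ENNReal} (hf : Measurable f) (hg : Measurable g) :
    ∫⁻ ω, f (past n fun i => ξ i ω) * g (ξ n ω) ∂μ =
      (∫⁻ ω, f (past n fun i => ξ i ω) ∂μ) * ∫⁻ ω, g (ξ n ω) ∂μ :=
  lintegral_mul_eq_lintegral_mul_lintegral_of_indepFun (hf.comp (h.measurable_past n))
    (hg.comp (h.meas n)) ((h.indep n hn).comp hf hg)

theorem integral_eq_zero_of_forall (h : IsNoiseSeq μ Gi Q dt N ξ) {n : ℕ} (hn : n < N)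
    {f : (ℕ → L2 D) × L2 D → ℝ} (hf : Measurable f) (h0 : ∀ u, ∫ ω, f (u, ξ n ω) ∂μ = 0)
    (hi : Integrable (fun ω => f (past n fun i => ξ i ω, ξ n ω)) μ) :
    ∫ ω, f (past n fun i => ξ i ω, ξ n ω) ∂μ = 0 := by
  have hm1 : Measurable fun ω => (past n fun i => ξ i ω, ξ n ω) := (h.measurable_past n).prodMk (h.meas n)
  have : IsProbabilityMeasure (μ.map (ξ n)) := Measure.isProbabilityMeasure_map (h.meas n).aemeasurable
  have : IsProbabilityMeasure (μ.map fun ω => past n fun i => ξ i ω) :=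
    Measure.isProbabilityMeasure_map (h.measurable_past n).aemeasurable
  have e1 := integral_map (μ := μ) hm1.aemeasurable (f := f) hf.aestronglyMeasurable
  have i1 := (integrable_map_measure (μ := μ) hf.aestronglyMeasurable hm1.aemeasurable).2 hi
  rw [h.map_prod hn] at e1 i1
  rw [← e1, integral_prod _ i1]
  refine integral_eq_zero_of_ae (Eventually.of_forall fun u => ?_)
  have hfu : Measurable fun x => f (u, x) := hf.comp measurable_prodMk_left
  exact (integral_map (h.meas n).aemeasurable hfu.aestronglyMeasurable).trans (h0 u)

theorem lintegral_norm_sq (h : IsNoiseSeq μ Gi Q dt N ξ) {n : ℕ} (hn : n < N) :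
    ∫⁻ ω, ofReal (‖ξ n ω‖ ^ 2) ∂μ ≤ ofReal (dt * Q) :=
  (lintegral_mono fun _ => ofReal_le_ofReal (norm_sq_le_sqH2 _)).trans (h.lintegral_sqH2 n hn)

end IsNoiseSeq

/-! ### The energy estimate -/

/-- The assumptions on the data of the scheme. -/
structure SchemeData (Gi : ℕ → L2 D) (θ dt : ℝ) (m0 : L2 D) (Cs Cb : ℝ) : Prop where
  isOpen : IsOpen D
  isBounded : Bornology.IsBounded D
  sumBdd : SumBdd Gi Cs
  theta : θ ∈ Ioc (1 / 2 : ℝ) 1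
  dt_pos : 0 < dt
  init : m0 ∈ sphereH1 D
  pos : 0 < Cb
  sup : ∀ u : L2 D, MemH2 u → ∀ᵐ x ∂ℒ D, ‖u x‖ ^ 2 ≤ Cb * normSqH2 u

/-- A measurable function that is equal to `dirichlet` on `H¹(D)³`. -/
def dir (u : L2 D) : ℝ := ∑ k, ‖dpart k u‖ ^ 2

theorem dir_nonneg (u : L2 D) : 0 ≤ dir u := by unfold dir; positivity

theorem MemH1.dir_eq (hD : IsOpen D) {u : L2 D} (h : MemH1 u) : dir u = dirichlet u := by
  have h1 : ∀ k, dpart k u = weakPartial k u := h.dpart_eq hD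
  simp only [dir, dirichlet, h1]

theorem measurable_dir (hD : IsOpen D) : Measurable (dir : L2 D → ℝ) :=
  Finset.measurable_fun_sum _ fun k _ => (measurable_dpart hD k).norm.pow_const 2

theorem dir_le_sqH2 (u : L2 D) : dir u ≤ sqH2 u := by
  unfold sqH2 dir
  have h1 : 0 ≤ ∑ k, ∑ l, ‖dpart l (dpart k u)‖ ^ 2 := by positivity
  have h2 := sq_nonneg ‖u‖
  linarith

/-- A measurable function that is equal to `ell` on `H¹(D)³ × H¹(D)³`. -/
def ellT (m ξ : L2 D) : ℝ := ∑ k, inner ℝ (dpart k m) (crt m (dpart k ξ))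

theorem ellT_eq (hD : IsOpen D) {m ξ : L2 D} (hm : MemH1 m) (hξ : MemH1 ξ) : ellT m ξ = ell m ξ := by
  have h1 : ∀ k, dpart k m = weakPartial k m := hm.dpart_eq hD
  have h2 : ∀ k, dpart k ξ = weakPartial k ξ := hξ.dpart_eq hD
  simp only [ellT, ell, h1, h2]

theorem dpart_neg (hD : IsOpen D) (k : Fin 3) (u : L2 D) : dpart k (-u) = -dpart k u := by
  have hinj : Function.Injective (H1.val : H1 D → L2 D) := (measurableEmbedding_val hD).injective
  by_cases h : MemH1 u
  · have e1 : u = H1.val h.lift := h.val_lift.symm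
    rw [e1, ← map_neg, dpart, hinj.extend_apply, hinj.extend_apply, map_neg]
  · have h' : ¬ MemH1 (-u) := fun h' => h (by
      have := H1.memH1 (-h'.lift)
      rwa [map_neg, h'.val_lift, neg_neg] at this)
    have hr : ∀ v : L2 D, ¬ MemH1 v → dpart k v = 0 := fun v hv =>
      Function.extend_apply' _ _ _ fun ⟨p, hp⟩ => hv (hp ▸ H1.memH1 p)
    rw [hr _ h, hr _ h', neg_zero]

theorem ellT_neg (hD : IsOpen D) (m ξ : L2 D) : ellT m (-ξ) = -ellT m ξ := by
  have : ∀ f : L2 D, crt m (-f) = -crt m f := fun f => (crtL m).map_neg f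
  simp only [ellT, dpart_neg hD, this, inner_neg_right, Finset.sum_neg_distrib]

theorem abs_ellT_le (m ξ : L2 D) : 2 * |ellT m ξ| ≤ dir m + dir ξ := by
  unfold ellT dir
  rw [← Finset.sum_add_distrib]
  calc _ ≤ 2 * ∑ k, |inner ℝ (dpart k m) (crt m (dpart k ξ))| := by
        gcongr; exact Finset.abs_sum_le_sum_abs _ _
    _ ≤ _ := by
        rw [Finset.mul_sum]
        refine Finset.sum_le_sum fun k _ => ?_
        have h1 := abs_real_inner_le_norm (dpart k m) (crt m (dpart k ξ))
        have h2 := norm_crt_le m (dpart k ξ)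
        have h3 := mul_le_mul_of_nonneg_left h2 (norm_nonneg (dpart k m))
        nlinarith [sq_nonneg (‖dpart k m‖ - ‖dpart k ξ‖)]

theorem measurable_ellT (hD : IsOpen D) : Measurable fun p : L2 D × L2 D => ellT p.1 p.2 := by
  refine Finset.measurable_fun_sum _ fun k _ => ?_
  have h1 : Measurable fun p : L2 D × L2 D => dpart k p.1 := (measurable_dpart hD k).comp measurable_fst
  have h2 : Measurable fun p : L2 D × L2 D => dpart k p.2 := (measurable_dpart hD k).comp measurable_snd
  have h3 : Measurable fun p : L2 D × L2 D => crt p.1 (dpart k p.2) := by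
    have := (continuous_crt (D := D)).measurable.comp (measurable_fst.prodMk h2)
    simpa only [Function.comp_def] using this
  exact h1.inner h3

section
variable (Gi : ℕ → L2 D) (θ dt : ℝ) (m0 : L2 D)

/-- The increment of the scheme at step `n`. -/
def incS (a : ℕ → L2 D) (n : ℕ) : L2 D := incT Gi θ dt (iterSeq Gi θ dt m0 a n, a n)

/-- The increment of the scheme at step `n`, without its stochastic part. -/
def remS (a : ℕ → L2 D) (n : ℕ) : L2 D :=
  incS Gi θ dt m0 a n - crt (iterSeq Gi θ dt m0 a n) (a n)

end

namespace SchemeData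
variable {Gi : ℕ → L2 D} {θ dt : ℝ} {m0 : L2 D} {Cs Cb : ℝ}

theorem theta_pos (S : SchemeData Gi θ dt m0 Cs Cb) : 0 < θ := by linarith [S.theta.1]

theorem mem (S : SchemeData Gi θ dt m0 Cs Cb) (a : ℕ → L2 D) (n : ℕ) :
    iterSeq Gi θ dt m0 a n ∈ sphereH1 D :=
  iterSeq_mem S.isOpen S.isBounded S.sumBdd S.theta_pos S.dt_pos S.init a n

theorem succ (S : SchemeData Gi θ dt m0 Cs Cb) (a : ℕ → L2 D) (n : ℕ) :
    iterSeq Gi θ dt m0 a (n + 1) = retr (iterSeq Gi θ dt m0 a n + incS Gi θ dt m0 a n) :=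
  iterSeq_succ S.isOpen S.isBounded S.sumBdd S.theta_pos S.dt_pos S.init a n

theorem isIncrement (S : SchemeData Gi θ dt m0 Cs Cb) (a : ℕ → L2 D) (n : ℕ) :
    IsIncrement Gi θ dt (iterSeq Gi θ dt m0 a n) (a n) (incS Gi θ dt m0 a n) := by
  rw [incS, incT, if_pos (S.mem a n)]
  exact isIncrement_increment S.isOpen S.sumBdd S.theta_pos S.dt_pos (S.mem a n) (a n)

theorem measurable_iter (S : SchemeData Gi θ dt m0 Cs Cb) (n : ℕ) :
    Measurable fun a => iterSeq Gi θ dt m0 a n :=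
  measurable_iterSeq S.isOpen S.isBounded S.sumBdd S.theta_pos S.dt_pos S.init n

theorem measurable_crt_iter (S : SchemeData Gi θ dt m0 Cs Cb) (n : ℕ) :
    Measurable fun p : (ℕ → L2 D) × L2 D => crt (iterSeq Gi θ dt m0 p.1 n) p.2 := by
  have := (continuous_crt (D := D)).measurable.comp
    (((S.measurable_iter n).comp measurable_fst).prodMk (measurable_snd (α := ℕ → L2 D) (β := L2 D)))
  simpa only [Function.comp_def] using this

theorem measurable_incS (S : SchemeData Gi θ dt m0 Cs Cb) (n : ℕ) :
    Measurable fun a => incS Gi θ dt m0 a n :=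
  (measurable_incT S.isOpen S.sumBdd S.theta_pos S.dt_pos).comp
    ((S.measurable_iter n).prodMk (measurable_pi_apply n))

theorem measurable_remS (S : SchemeData Gi θ dt m0 Cs Cb) (n : ℕ) :
    Measurable fun a => remS Gi θ dt m0 a n := by
  have h1 : Measurable fun a : ℕ → L2 D => (a, a n) := measurable_id.prodMk (measurable_pi_apply n)
  have h2 : Measurable fun a : ℕ → L2 D => crt (iterSeq Gi θ dt m0 a n) (a n) := by
    have := (S.measurable_crt_iter n).comp h1
    simpa only [Function.comp_def] using this
  exact (S.measurable_incS n).sub h2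

theorem iter_past (n : ℕ) (a : ℕ → L2 D) :
    iterSeq Gi θ dt m0 a n = iterSeq Gi θ dt m0 (past n a) n :=
  iterSeq_congr fun _ hi => (past_apply a hi).symm

/-- The constants of the energy estimate. -/
def C1 (θ Cb : ℝ) : ℝ := 4 / (2 * θ - 1) * (Cb + 1)

theorem four_le_C1 (S : SchemeData Gi θ dt m0 Cs Cb) : 4 ≤ C1 θ Cb := by
  have h1 := S.theta.1
  have h2 := S.theta.2
  have h3 := S.pos
  have : 4 ≤ 4 / (2 * θ - 1) := by rw [le_div_iff₀ (by linarith)]; linarith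
  unfold C1
  nlinarith

/-- The energy estimate for one step of the scheme. -/
theorem energy (S : SchemeData Gi θ dt m0 Cs Cb) {a : ℕ → L2 D} {n : ℕ} (ha : MemH2 (a n)) :
    dir (iterSeq Gi θ dt m0 a (n + 1)) + ((2 * θ - 1) / 2 * dir (incS Gi θ dt m0 a n) +
        ‖remS Gi θ dt m0 a n‖ ^ 2 / (2 * dt)) ≤
      dir (iterSeq Gi θ dt m0 a n) * (1 + C1 θ Cb * sqH2 (a n)) + C1 θ Cb * sqH2 (a n) +
        Cs ^ 2 * volume.real D / 2 * dt + 2 * ellT (iterSeq Gi θ dt m0 a n) (a n) := by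
  have hm := S.mem a n
  have hm' := S.mem a (n + 1)
  have hv := S.isIncrement a n
  have hq := normSqH2_nonneg (a n)
  have hK : ∀ᵐ x ∂ℒ D, ‖a n x‖ ≤ √(Cb * normSqH2 (a n)) := by
    filter_upwards [S.sup _ ha] with x hx using Real.le_sqrt_of_sq_le hx
  have key := energy_step S.isOpen S.isBounded S.sumBdd S.theta S.dt_pos hm ha.1 hK hv
  rw [← S.succ, Real.sq_sqrt (mul_nonneg S.pos.le hq)] at key
  rw [hm'.1.dir_eq S.isOpen, hm.1.dir_eq S.isOpen, hv.1.1.dir_eq S.isOpen, ha.sqH2_eq S.isOpen,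
    ellT_eq S.isOpen hm.1 ha.1, remS, crt_eq (sphereH1.le_one hm)]
  have hd := dirichlet_le_normSqH2 (a n)
  have hd0 := dirichlet_nonneg (iterSeq Gi θ dt m0 a n)
  have h1 : 0 < 2 * θ - 1 := by linarith [S.theta.1]
  have h2 : 4 / (2 * θ - 1) * (Cb * normSqH2 (a n) * dirichlet (iterSeq Gi θ dt m0 a n) + dirichlet (a n)) ≤
      4 / (2 * θ - 1) * ((Cb + 1) * normSqH2 (a n) * dirichlet (iterSeq Gi θ dt m0 a n) +
        (Cb + 1) * normSqH2 (a n)) := by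
    have h3 := S.pos
    gcongr
    · linarith
    · nlinarith
  unfold C1
  linarith

/-- The dissipation at step `n`. -/
def diss (Gi : ℕ → L2 D) (θ dt : ℝ) (m0 : L2 D) (a : ℕ → L2 D) (n : ℕ) : ℝ :=
  (2 * θ - 1) / 2 * dir (incS Gi θ dt m0 a n) + ‖remS Gi θ dt m0 a n‖ ^ 2 / (2 * dt)

theorem diss_nonneg (S : SchemeData Gi θ dt m0 Cs Cb) (a : ℕ → L2 D) (n : ℕ) :
    0 ≤ diss Gi θ dt m0 a n := by
  have h1 : 0 < 2 * θ - 1 := by linarith [S.theta.1]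
  have h2 := S.dt_pos
  have h3 := dir_nonneg (incS Gi θ dt m0 a n)
  unfold diss
  positivity

theorem measurable_diss (S : SchemeData Gi θ dt m0 Cs Cb) (n : ℕ) :
    Measurable fun a => diss Gi θ dt m0 a n := by
  have h1 : Measurable fun a => dir (incS Gi θ dt m0 a n) :=
    (measurable_dir S.isOpen).comp (S.measurable_incS n)
  have h2 := (S.measurable_remS n).norm
  exact (h1.const_mul _).add ((h2.pow_const 2).div_const _)

theorem measurable_dir_iter (S : SchemeData Gi θ dt m0 Cs Cb) (n : ℕ) :
    Measurable fun a => dir (iterSeq Gi θ dt m0 a n) :=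
  (measurable_dir S.isOpen).comp (S.measurable_iter n)

variable {Ω : Type*} [MeasurableSpace Ω] {μ : Measure Ω} [IsProbabilityMeasure μ]
  {Q : ℝ} {N : ℕ} {ξ : ℕ → Ω → L2 D}

theorem lintegral_affine {A p q : Ω → ENNReal} {k : ENNReal} (hA : Measurable A) (hp : Measurable p)
    (hq : Measurable q) : ∫⁻ ω, (A ω + p ω * q ω) + (q ω + k) ∂μ =
      (∫⁻ ω, A ω ∂μ + ∫⁻ ω, p ω * q ω ∂μ) + (∫⁻ ω, q ω ∂μ + k) := by
  have h1 : Measurable fun ω => p ω * q ω := hp.mul hq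
  have h2 : Measurable fun ω => A ω + p ω * q ω := hA.add h1
  rw [lintegral_add_left h2, lintegral_add_left hA, lintegral_add_left hq, lintegral_const, measure_univ,
    mul_one]

theorem lintegral_energy (S : SchemeData Gi θ dt m0 Cs Cb) (h : IsNoiseSeq μ Gi Q dt N ξ) (hQ : 0 ≤ Q)
    {n : ℕ} (hn : n < N) :
    ∫⁻ ω, ofReal (dir (iterSeq Gi θ dt m0 (fun i => ξ i ω) (n + 1))) ∂μ +
        ∫⁻ ω, ofReal (diss Gi θ dt m0 (fun i => ξ i ω) n) ∂μ ≤
      (∫⁻ ω, ofReal (dir (iterSeq Gi θ dt m0 (fun i => ξ i ω) n)) ∂μ) *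
        (1 + ofReal (C1 θ Cb * Q * dt)) +
        ofReal ((C1 θ Cb * Q + Cs ^ 2 * volume.real D / 2) * dt) := by
  have hdt := S.dt_pos
  have hC := S.four_le_C1
  set C2 := Cs ^ 2 * volume.real D / 2 with hC2
  have hC20 : 0 ≤ C2 := by positivity
  have hξ : Measurable fun ω i => ξ i ω := measurable_pi_lambda _ h.meas
  let base : (ℕ → L2 D) × L2 D → ℝ := fun p =>
    dir (iterSeq Gi θ dt m0 p.1 n) * (1 + C1 θ Cb * sqH2 p.2) + C1 θ Cb * sqH2 p.2 + C2 * dt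
  have hd1 : Measurable fun p : (ℕ → L2 D) × L2 D => dir (iterSeq Gi θ dt m0 p.1 n) :=
    (S.measurable_dir_iter n).comp measurable_fst
  have hq1 : Measurable fun p : (ℕ → L2 D) × L2 D => sqH2 p.2 :=
    (measurable_sqH2 S.isOpen).comp measurable_snd
  have hq2 : Measurable fun p : (ℕ → L2 D) × L2 D => C1 θ Cb * sqH2 p.2 := hq1.const_mul _
  have hq3 : Measurable fun p : (ℕ → L2 D) × L2 D => 1 + C1 θ Cb * sqH2 p.2 := hq2.const_add _
  have hbm : Measurable base := ((hd1.mul hq3).add hq2).add_const (C2 * dt)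
  have hi1 : Measurable fun p : (ℕ → L2 D) × L2 D => (iterSeq Gi θ dt m0 p.1 n, p.2) :=
    ((S.measurable_iter n).comp measurable_fst).prodMk measurable_snd
  have hl1 : Measurable fun p : (ℕ → L2 D) × L2 D => ellT (iterSeq Gi θ dt m0 p.1 n) p.2 := by
    have := (measurable_ellT S.isOpen).comp hi1
    simpa only [Function.comp_def] using this
  have hdm : ∀ k, Measurable fun ω => ofReal (dir (iterSeq Gi θ dt m0 (fun i => ξ i ω) k)) :=
    fun k => ENNReal.measurable_ofReal.comp ((S.measurable_dir_iter k).comp hξ)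
  have hbase : ∀ u x, 2 * |ellT (iterSeq Gi θ dt m0 u n) x| ≤ base (u, x) := fun u x => by
    have h0 := abs_ellT_le (iterSeq Gi θ dt m0 u n) x
    have h1 := dir_le_sqH2 x
    have h2 := sqH2_nonneg x
    have h3 := dir_nonneg (iterSeq Gi θ dt m0 u n)
    have h4 : 0 ≤ dir (iterSeq Gi θ dt m0 u n) * (C1 θ Cb * sqH2 x) := by positivity
    have h5 : 0 ≤ C2 * dt := by positivity
    have h6 : sqH2 x ≤ C1 θ Cb * sqH2 x := le_mul_of_one_le_left h2 (by linarith)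
    simp only [base]
    linarith
  obtain ⟨L, hL⟩ : ∃ L : (ℕ → L2 D) × L2 D → ℝ, L = fun p => ellT (iterSeq Gi θ dt m0 p.1 n) p.2 := ⟨_, rfl⟩
  have hLm : Measurable L := by rw [hL]; exact hl1
  let F : (ℕ → L2 D) × L2 D → ENNReal := fun p => ofReal (base p + 2 * L p)
  have hF : Measurable F := ENNReal.measurable_ofReal.comp (hbm.add (hLm.const_mul 2))
  rw [← lintegral_add_left (hdm _)]
  calc _ ≤ ∫⁻ ω, F (past n fun i => ξ i ω, ξ n ω) ∂μ := by
        refine lintegral_mono_ae ?_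
        filter_upwards [h.memH2 n hn] with ω hω
        rw [← ofReal_add (dir_nonneg _) (S.diss_nonneg _ _)]
        have key := S.energy (a := fun i => ξ i ω) (n := n) hω
        rw [← diss] at key
        refine ofReal_le_ofReal ?_
        simp only [base, hL, ← iter_past]
        exact key
    _ ≤ ∫⁻ ω, ofReal (base (past n fun i => ξ i ω, ξ n ω)) ∂μ := by
        refine h.lintegral_le_of_symm hn (f := F) (g := fun p => ofReal (base p)) hF fun u x => ?_
        have h1 := hbase u x
        have h2 : base (u, -x) = base (u, x) := by
          simp only [base, sqH2, dpart_neg S.isOpen, norm_neg]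
        have h3 := abs_le.1 (le_refl |ellT (iterSeq Gi θ dt m0 u n) x|)
        simp only [F, hL, h2, ellT_neg S.isOpen]
        rw [← ofReal_add (by linarith) (by linarith),
          show (2 : ENNReal) = ofReal 2 by simp, ← ofReal_mul (by norm_num)]
        exact ofReal_le_ofReal (by linarith)
    _ = ∫⁻ ω, (ofReal (dir (iterSeq Gi θ dt m0 (fun i => ξ i ω) n)) +
          ofReal (dir (iterSeq Gi θ dt m0 (past n fun i => ξ i ω) n)) *
            ofReal (C1 θ Cb * sqH2 (ξ n ω))) +
          (ofReal (C1 θ Cb * sqH2 (ξ n ω)) + ofReal (C2 * dt)) ∂μ := by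
        refine lintegral_congr fun ω => ?_
        have h2 := sqH2_nonneg (ξ n ω)
        have h3 := dir_nonneg (iterSeq Gi θ dt m0 (fun i => ξ i ω) n)
        have h4 : 0 ≤ C1 θ Cb * sqH2 (ξ n ω) := by positivity
        simp only [base, ← iter_past]
        rw [← ofReal_mul h3, ← ofReal_add h3 (by positivity),
          ← ofReal_add h4 (by positivity), ← ofReal_add (by positivity) (by positivity)]
        congr 1
        ring
    _ ≤ _ := by
        have hq : Measurable fun x : L2 D => ofReal (C1 θ Cb * sqH2 x) :=
          ENNReal.measurable_ofReal.comp ((measurable_sqH2 S.isOpen).const_mul _)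
        have hi : ∫⁻ ω, ofReal (C1 θ Cb * sqH2 (ξ n ω)) ∂μ ≤ ofReal (C1 θ Cb * Q * dt) := by
          simp only [ofReal_mul (show 0 ≤ C1 θ Cb by linarith), mul_assoc]
          rw [lintegral_const_mul' _ _ ofReal_ne_top, mul_comm Q]
          gcongr
          exact h.lintegral_sqH2 n hn
        have hqξ : Measurable fun ω => ofReal (C1 θ Cb * sqH2 (ξ n ω)) := hq.comp (h.meas n)
        have hdp : Measurable fun u => ofReal (dir (iterSeq Gi θ dt m0 u n)) :=
          ENNReal.measurable_ofReal.comp (S.measurable_dir_iter n)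
        have hdp' : Measurable fun ω => ofReal (dir (iterSeq Gi θ dt m0 (past n fun i => ξ i ω) n)) :=
          hdp.comp (h.measurable_past n)
        rw [lintegral_affine (hdm n) hdp' hqξ,
          h.lintegral_mul_indep hn hdp hq, mul_add, mul_one]
        simp only [← iter_past]
        rw [add_mul (C1 θ Cb * Q), ofReal_add (by positivity) (by positivity)]
        gcongr

theorem ennreal_gronwall {a r : ℕ → ENNReal} {δ b : ENNReal} {N : ℕ}
    (h : ∀ n < N, a (n + 1) + r n ≤ a n * (1 + δ) + b) {n : ℕ} (hn : n ≤ N) :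
    a n + ∑ i ∈ Finset.range n, r i ≤ (a 0 + n * b) * (1 + δ) ^ n := by
  induction n with
  | zero => simp
  | succ n ih =>
    have h1 : (1 : ENNReal) ≤ 1 + δ := le_self_add
    calc a (n + 1) + ∑ i ∈ Finset.range (n + 1), r i
        = a (n + 1) + r n + ∑ i ∈ Finset.range n, r i := by rw [Finset.sum_range_succ]; ring
      _ ≤ a n * (1 + δ) + b + (∑ i ∈ Finset.range n, r i) * (1 + δ) := by
          exact add_le_add (h n hn) (le_mul_of_one_le_right' h1)
      _ = (a n + ∑ i ∈ Finset.range n, r i) * (1 + δ) + b * 1 := by ring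
      _ ≤ (a 0 + n * b) * (1 + δ) ^ n * (1 + δ) + b * (1 + δ) ^ (n + 1) := by
          gcongr
          · exact ih (by omega)
          · exact one_le_pow₀ h1
      _ = _ := by push_cast; ring

/-- The bound of the energy. -/
def CE (θ Cs Cb Q T : ℝ) (m0 : L2 D) : ℝ :=
  (dir m0 + (C1 θ Cb * Q + Cs ^ 2 * volume.real D / 2) * T) * Real.exp (C1 θ Cb * Q * T)

theorem CE_nonneg (S : SchemeData Gi θ dt m0 Cs Cb) (hQ : 0 ≤ Q) {T : ℝ} (hT : 0 ≤ T) :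
    0 ≤ CE θ Cs Cb Q T m0 := by
  have := S.four_le_C1
  have := dir_nonneg m0
  unfold CE
  positivity

theorem lintegral_energy_le (S : SchemeData Gi θ dt m0 Cs Cb) (h : IsNoiseSeq μ Gi Q dt N ξ) (hQ : 0 ≤ Q)
    {n : ℕ} (hn : n ≤ N) :
    ∫⁻ ω, ofReal (dir (iterSeq Gi θ dt m0 (fun i => ξ i ω) n)) ∂μ +
        ∑ i ∈ Finset.range n, ∫⁻ ω, ofReal (diss Gi θ dt m0 (fun i => ξ i ω) i) ∂μ ≤
      ofReal (CE θ Cs Cb Q (N * dt) m0) := by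
  have hdt := S.dt_pos
  have hC := S.four_le_C1
  refine (ennreal_gronwall (a := fun n => ∫⁻ ω, ofReal (dir (iterSeq Gi θ dt m0 (fun i => ξ i ω) n)) ∂μ)
    (fun n hn => S.lintegral_energy h hQ hn) hn).trans ?_
  have h0 : ∫⁻ ω, ofReal (dir (iterSeq Gi θ dt m0 (fun i => ξ i ω) 0)) ∂μ = ofReal (dir m0) := by
    simp only [iterSeq, lintegral_const, measure_univ, mul_one]
  have h1 := dir_nonneg m0
  have hnN : (n : ℝ) ≤ N := by exact_mod_cast hn
  set c := C1 θ Cb * Q + Cs ^ 2 * volume.real D / 2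
  have hc : 0 ≤ c := by positivity
  have hδ : 0 ≤ C1 θ Cb * Q * dt := by positivity
  rw [h0, ← ENNReal.ofReal_one, ← ENNReal.ofReal_natCast, ← ofReal_mul (by positivity),
    ← ofReal_add h1 (by positivity), ← ofReal_add zero_le_one hδ,
    ← ofReal_pow (by positivity), ← ofReal_mul (by positivity)]
  apply ofReal_le_ofReal
  unfold CE
  have h2 : (1 + C1 θ Cb * Q * dt) ^ n ≤ Real.exp (C1 θ Cb * Q * (N * dt)) := by
    calc _ ≤ Real.exp (C1 θ Cb * Q * dt) ^ n := by
          gcongr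
          linarith [Real.add_one_le_exp (C1 θ Cb * Q * dt)]
      _ = Real.exp (n * (C1 θ Cb * Q * dt)) := (Real.exp_nat_mul _ _).symm
      _ ≤ _ := by
          apply Real.exp_le_exp.2
          calc (n : ℝ) * (C1 θ Cb * Q * dt) ≤ N * (C1 θ Cb * Q * dt) := by gcongr
            _ = _ := by ring
  have h3 : (n : ℝ) * (c * dt) ≤ c * (N * dt) := by
    calc (n : ℝ) * (c * dt) ≤ N * (c * dt) := by gcongr
      _ = _ := by ring
  gcongr

theorem lintegral_sum_three {A B C : ℕ → Ω → ENNReal} {c : ENNReal} (hA : ∀ n, Measurable (A n))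
    (hB : ∀ n, Measurable (B n)) (hC : ∀ n, Measurable (C n)) :
    ∫⁻ ω, ∑ n ∈ Finset.range N, (c * A n ω + B n ω + C n ω) ∂μ =
      ∑ n ∈ Finset.range N, c * ∫⁻ ω, A n ω ∂μ + ∑ n ∈ Finset.range N, ∫⁻ ω, B n ω ∂μ +
        ∑ n ∈ Finset.range N, ∫⁻ ω, C n ω ∂μ := by
  have h1 : ∀ n, Measurable fun ω => c * A n ω := fun n => (hA n).const_mul c
  have h2 : ∀ n, Measurable fun ω => c * A n ω + B n ω := fun n => (h1 n).add (hB n)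
  have h3 : ∀ n, Measurable fun ω => c * A n ω + B n ω + C n ω := fun n => (h2 n).add (hC n)
  rw [lintegral_finsetSum _ fun n _ => h3 n, ← Finset.sum_add_distrib, ← Finset.sum_add_distrib]
  refine Finset.sum_congr rfl fun n _ => ?_
  rw [lintegral_add_left (h2 n), lintegral_add_left (h1 n), lintegral_const_mul _ (hA n)]

/-- The quantity controlled by the energy estimate. -/
def energyF (Gi : ℕ → L2 D) (θ dt : ℝ) (m0 : L2 D) (N : ℕ) (a : ℕ → L2 D) : ℝ :=
  ∑ n ∈ Finset.range N, (dt * dir (iterSeq Gi θ dt m0 a n) + diss Gi θ dt m0 a n + sqH2 (a n))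

theorem measurable_energyF (S : SchemeData Gi θ dt m0 Cs Cb) (N : ℕ) :
    Measurable (energyF Gi θ dt m0 N) :=
  Finset.measurable_fun_sum _ fun n _ => (((S.measurable_dir_iter n).const_mul _).add
    (S.measurable_diss n)).add ((measurable_sqH2 S.isOpen).comp (measurable_pi_apply n))

theorem lintegral_energyF (S : SchemeData Gi θ dt m0 Cs Cb) (h : IsNoiseSeq μ Gi Q dt N ξ) (hQ : 0 ≤ Q) :
    ∫⁻ ω, ofReal (energyF Gi θ dt m0 N fun i => ξ i ω) ∂μ ≤
      ofReal (N * dt * CE θ Cs Cb Q (N * dt) m0 + CE θ Cs Cb Q (N * dt) m0 + N * dt * Q) := by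
  have hdt := S.dt_pos
  have hξ : Measurable fun ω i => ξ i ω := measurable_pi_lambda _ h.meas
  have m1 : ∀ n, Measurable fun ω => ofReal (dir (iterSeq Gi θ dt m0 (fun i => ξ i ω) n)) :=
    fun n => ENNReal.measurable_ofReal.comp ((S.measurable_dir_iter n).comp hξ)
  have m2 : ∀ n, Measurable fun ω => ofReal (diss Gi θ dt m0 (fun i => ξ i ω) n) :=
    fun n => ENNReal.measurable_ofReal.comp ((S.measurable_diss n).comp hξ)
  have m3 : ∀ n, Measurable fun ω => ofReal (sqH2 (ξ n ω)) :=
    fun n => ENNReal.measurable_ofReal.comp ((measurable_sqH2 S.isOpen).comp (h.meas n))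
  have e : ∀ ω, ofReal (energyF Gi θ dt m0 N fun i => ξ i ω) = ∑ n ∈ Finset.range N,
      (ofReal dt * ofReal (dir (iterSeq Gi θ dt m0 (fun i => ξ i ω) n)) +
        ofReal (diss Gi θ dt m0 (fun i => ξ i ω) n) + ofReal (sqH2 (ξ n ω))) := fun ω => by
    have h1 : ∀ n, 0 ≤ dt * dir (iterSeq Gi θ dt m0 (fun i => ξ i ω) n) := fun n =>
      mul_nonneg hdt.le (dir_nonneg _)
    have h2 : ∀ n, 0 ≤ diss Gi θ dt m0 (fun i => ξ i ω) n := S.diss_nonneg _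
    rw [energyF, ofReal_sum_of_nonneg fun n _ =>
      add_nonneg (add_nonneg (h1 n) (h2 n)) (sqH2_nonneg _)]
    refine Finset.sum_congr rfl fun n _ => ?_
    rw [ofReal_add (add_nonneg (h1 n) (h2 n)) (sqH2_nonneg _), ofReal_add (h1 n) (h2 n),
      ofReal_mul hdt.le]
  have hCE := S.CE_nonneg hQ (show 0 ≤ (N : ℝ) * dt by positivity)
  set E := CE θ Cs Cb Q (N * dt) m0
  simp only [e]
  rw [lintegral_sum_three m1 m2 m3]
  rw [ofReal_add (by positivity) (by positivity), ofReal_add (by positivity) hCE]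
  refine add_le_add (add_le_add ?_ ?_) ?_
  · calc _ ≤ ∑ n ∈ Finset.range N, ofReal dt * ofReal E :=
          Finset.sum_le_sum fun n hn => by
            gcongr
            exact le_self_add.trans (S.lintegral_energy_le h hQ (Finset.mem_range.1 hn).le)
      _ = _ := by
          rw [Finset.sum_const, Finset.card_range, nsmul_eq_mul, ← ENNReal.ofReal_natCast,
            ← ofReal_mul hdt.le, ← ofReal_mul (by positivity), mul_assoc]
  · exact le_add_self.trans (S.lintegral_energy_le h hQ le_rfl)
  · calc _ ≤ ∑ n ∈ Finset.range N, ofReal (dt * Q) :=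
          Finset.sum_le_sum fun n hn => h.lintegral_sqH2 n (Finset.mem_range.1 hn)
      _ = _ := by
          rw [Finset.sum_const, Finset.card_range, nsmul_eq_mul, ← ENNReal.ofReal_natCast,
            ← ofReal_mul (by positivity), mul_assoc]

end SchemeData

/-! ### The quadratic variation -/

/-- The bilinear form `(f, g) ↦ ∫ (χ · m) (m × f) · (m × g)`, for `|m| = 1` and `|χ| ≤ 1`. -/
def quad (χ m : L2 D) : L2 D →L[ℝ] L2 D →L[ℝ] ℝ :=
  (-(innerSL ℝ : L2 D →L[ℝ] L2 D →L[ℝ] ℝ)).bilinearComp ((crtL m).comp ((crtL χ).comp (crtL m))) (crtL m)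

theorem quad_apply (χ m f g : L2 D) :
    quad χ m f g = -inner ℝ (crt m (crt χ (crt m f))) (crt m g) := rfl

theorem abs_quad_le (χ m f : L2 D) : |quad χ m f f| ≤ ‖f‖ ^ 2 := by
  rw [quad_apply, abs_neg, sq]
  refine (abs_real_inner_le_norm _ _).trans (mul_le_mul ?_ (norm_crt_le _ _) (norm_nonneg _) (norm_nonneg _))
  exact (norm_crt_le _ _).trans ((norm_crt_le _ _).trans (norm_crt_le _ _))

theorem quad_eq {χ m : L2 D} (hχ : ∀ᵐ x ∂ℒ D, ‖χ x‖ ≤ 1)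
    (hm : ∀ᵐ x ∂ℒ D, ‖m x‖ = 1) (f : L2 D) :
    quad χ m f f = ∫ x in D, inner ℝ (χ x) (m x) * ‖cross (m x) (f x)‖ ^ 2 := by
  have hm' : ∀ᵐ x ∂ℒ D, ‖m x‖ ≤ 1 := hm.mono fun _ h => h.le
  rw [quad_apply, L2.inner_def, ← integral_neg]
  refine integral_congr_ae ?_
  filter_upwards [coeFn_crt hm' f, coeFn_crt hχ (crt m f), coeFn_crt hm' (crt χ (crt m f))] with x h1 h2 h3
  rw [h3, h2, h1, ← real_inner_self_eq_norm_sq]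
  simp only [inner_eq_coord, cross_zero_coord, cross_one_coord, cross_two_coord]
  ring

theorem quad_corr {χ m : L2 D} (hχ : ∀ᵐ x ∂ℒ D, ‖χ x‖ ≤ 1)
    (hm : ∀ᵐ x ∂ℒ D, ‖m x‖ = 1) (f : L2 D) :
    ∫ x in D, inner ℝ (corr m f x - cross (m x) (corr m f x)) (nrm m χ x) = -quad χ m f f := by
  rw [quad_eq hχ hm, ← integral_neg]
  refine integral_congr_ae ?_
  filter_upwards [coeFn_nrm hm χ, hm] with x h1 h2
  rw [h1, corr, ← real_inner_self_eq_norm_sq]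
  simp only [inner_eq_coord, cross_zero_coord, cross_one_coord, cross_two_coord, PiLp.smul_apply,
    PiLp.sub_apply, smul_eq_mul]
  ring

/-- The function `∑ i, ((m × G_i) × G_i · m) m`. -/
def nSop (Gi : ℕ → L2 D) (m : L2 D) : L2 D := nrm m (Sop Gi m)

theorem SumBdd.tsum_quad {Gi : ℕ → L2 D} {Cs : ℝ} (h : SumBdd Gi Cs) {χ m : L2 D}
    (hχ : ∀ᵐ x ∂ℒ D, ‖χ x‖ ≤ 1) (hm : ∀ᵐ x ∂ℒ D, ‖m x‖ = 1) :
    ∑' i, quad χ m (Gi i) (Gi i) = -inner ℝ (nSop Gi m) χ := by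
  have hm' : ∀ᵐ x ∂ℒ D, ‖m x‖ ≤ 1 := hm.mono fun _ h => h.le
  have h1 := h.tsum_integral hm' (nrm m χ)
  simp only [quad_corr hχ hm, tsum_neg] at h1
  rw [nSop, inner_nrm_left]
  have h2 : inner ℝ (crt m (Sop Gi m)) (nrm m χ) = 0 := by
    rw [L2.inner_def]
    refine integral_eq_zero_of_ae ?_
    filter_upwards [coeFn_crt hm' (Sop Gi m), coeFn_nrm hm χ] with x e1 e2
    rw [e1, e2, inner_smul_right]
    simp only [inner_eq_coord, cross_zero_coord, cross_one_coord, cross_two_coord, Pi.zero_apply]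
    ring
  rw [inner_sub_left, h2, sub_zero] at h1
  rw [← h1, neg_neg]

theorem norm_nrm_le (m f : L2 D) : ‖nrm m f‖ ≤ 2 * ‖f‖ := by
  rw [nrm_apply]
  have h1 := norm_add_le f (crt m (crt m f))
  have h2 := (norm_crt_le m (crt m f)).trans (norm_crt_le m f)
  linarith

theorem continuous_nSop {Gi : ℕ → L2 D} {Cs : ℝ} (h : SumBdd Gi Cs) : Continuous (nSop Gi) := by
  have := (continuous_nrm (D := D)).comp (continuous_id.prodMk h.continuous_Sop)
  exact this

theorem SumBdd.norm_nSop_le {Gi : ℕ → L2 D} {Cs : ℝ} (h : SumBdd Gi Cs) (m : L2 D) :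
    ‖nSop Gi m‖ ≤ 2 * (Cs * ‖m‖) :=
  (norm_nrm_le _ _).trans (by have := h.norm_Sop_le m; linarith)

theorem continuous_quad (χ : L2 D) : Continuous fun p : L2 D × L2 D => quad χ p.1 p.2 p.2 := by
  have h1 : Continuous fun p : L2 D × L2 D => crt p.1 p.2 := continuous_crt
  have h2 : Continuous fun p : L2 D × L2 D => crt χ (crt p.1 p.2) := (crtL χ).continuous.comp h1
  have h3 : Continuous fun p : L2 D × L2 D => crt p.1 (crt χ (crt p.1 p.2)) := by
    have := (continuous_crt (D := D)).comp (continuous_fst.prodMk h2)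
    simpa only [Function.comp_def] using this
  simp only [quad_apply]
  exact (h3.inner h1).neg

namespace SchemeData
variable {Gi : ℕ → L2 D} {θ dt : ℝ} {m0 : L2 D} {Cs Cb : ℝ}

/-- The compensated quadratic variation at step `n`, tested with `χ`. -/
def defS (Gi : ℕ → L2 D) (θ dt : ℝ) (m0 χ : L2 D) (n : ℕ) (p : (ℕ → L2 D) × L2 D) : ℝ :=
  quad χ (iterSeq Gi θ dt m0 p.1 n) p.2 p.2 + dt * inner ℝ (nSop Gi (iterSeq Gi θ dt m0 p.1 n)) χ

theorem measurable_defS (S : SchemeData Gi θ dt m0 Cs Cb) (χ : L2 D) (n : ℕ) :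
    Measurable (defS Gi θ dt m0 χ n) := by
  have h0 : Measurable fun p : (ℕ → L2 D) × L2 D => iterSeq Gi θ dt m0 p.1 n :=
    (S.measurable_iter n).comp measurable_fst
  have h1 : Measurable fun p : (ℕ → L2 D) × L2 D => (iterSeq Gi θ dt m0 p.1 n, p.2) :=
    h0.prodMk measurable_snd
  have h2 : Measurable fun p : (ℕ → L2 D) × L2 D => quad χ (iterSeq Gi θ dt m0 p.1 n) p.2 p.2 := by
    have := (continuous_quad χ).measurable.comp h1
    simpa only [Function.comp_def] using this
  have h3 : Measurable fun p : (ℕ → L2 D) × L2 D => nSop Gi (iterSeq Gi θ dt m0 p.1 n) :=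
    (continuous_nSop S.sumBdd).measurable.comp h0
  exact h2.add ((h3.inner measurable_const).const_mul dt)

/-- A bound of the compensator. -/
def Kd (Cs : ℝ) (χ : L2 D) : ℝ := 2 * (Cs * √(volume.real D)) * ‖χ‖

theorem abs_inner_nSop_le (S : SchemeData Gi θ dt m0 Cs Cb) (χ : L2 D) (a : ℕ → L2 D) (n : ℕ) :
    |inner ℝ (nSop Gi (iterSeq Gi θ dt m0 a n)) χ| ≤ Kd Cs χ := by
  have h1 := S.sumBdd.norm_nSop_le (iterSeq Gi θ dt m0 a n)
  rw [← Real.sqrt_sq (norm_nonneg (iterSeq Gi θ dt m0 a n)), norm_sq_of_unit (S.mem a n).2] at h1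
  exact (abs_real_inner_le_norm _ _).trans (mul_le_mul_of_nonneg_right h1 (norm_nonneg _))

theorem defS_sq_le (S : SchemeData Gi θ dt m0 Cs Cb) (χ : L2 D) (n : ℕ) (p : (ℕ → L2 D) × L2 D) :
    defS Gi θ dt m0 χ n p ^ 2 ≤ 2 * (‖p.2‖ ^ 4 + (dt * Kd Cs χ) ^ 2) := by
  have h1 := abs_quad_le χ (iterSeq Gi θ dt m0 p.1 n) p.2
  have h2 := mul_le_mul_of_nonneg_left (S.abs_inner_nSop_le χ p.1 n) S.dt_pos.le
  rw [← abs_of_pos S.dt_pos, ← abs_mul, abs_of_pos S.dt_pos] at h2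
  unfold defS
  obtain ⟨a, ha⟩ : ∃ a, a = quad χ (iterSeq Gi θ dt m0 p.1 n) p.2 p.2 := ⟨_, rfl⟩
  obtain ⟨b, hb⟩ : ∃ b, b = dt * inner ℝ (nSop Gi (iterSeq Gi θ dt m0 p.1 n)) χ := ⟨_, rfl⟩
  rw [← ha] at h1
  rw [← hb] at h2
  rw [← ha, ← hb]
  have h3 : a ^ 2 ≤ ‖p.2‖ ^ 4 := by
    rw [← sq_abs, show ‖p.2‖ ^ 4 = (‖p.2‖ ^ 2) ^ 2 by ring]; gcongr
  have h4 : b ^ 2 ≤ (dt * Kd Cs χ) ^ 2 := by rw [← sq_abs]; gcongr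
  nlinarith [sq_nonneg (a - b)]

variable {Ω : Type*} [MeasurableSpace Ω] {μ : Measure Ω} [IsProbabilityMeasure μ]
  {Q : ℝ} {N : ℕ} {ξ : ℕ → Ω → L2 D}

theorem _root_.SLLG.IsNoiseSeq.integrable_pow_four (h : IsNoiseSeq μ Gi Q dt N ξ) {n : ℕ} (hn : n < N) :
    Integrable (fun ω => ‖ξ n ω‖ ^ 4) μ ∧ ∫ ω, ‖ξ n ω‖ ^ 4 ∂μ ≤ IsGaussSeq.K4 * (dt * Q) ^ 2 := by
  have hm : Measurable fun ω => ‖ξ n ω‖ ^ 4 := (h.meas n).norm.pow_const 4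
  have h1 := h.lintegral_pow_four n hn
  have hK : 3 ≤ IsGaussSeq.K4 := le_max_left _ _
  refine ⟨⟨hm.aestronglyMeasurable, ?_⟩, ?_⟩
  · rw [hasFiniteIntegral_iff_ofReal (Eventually.of_forall fun ω => by positivity)]
    exact h1.trans_lt ENNReal.ofReal_lt_top
  · rw [integral_eq_lintegral_of_nonneg_ae (Eventually.of_forall fun ω => by positivity)
      hm.aestronglyMeasurable]
    exact ENNReal.toReal_le_of_le_ofReal (by positivity) h1

theorem integral_defS (S : SchemeData Gi θ dt m0 Cs Cb) (h : IsNoiseSeq μ Gi Q dt N ξ) {χ : L2 D}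
    (hχ : ∀ᵐ x ∂ℒ D, ‖χ x‖ ≤ 1) {n : ℕ} (hn : n < N) (u : ℕ → L2 D) :
    ∫ ω, defS Gi θ dt m0 χ n (u, ξ n ω) ∂μ = 0 := by
  have hi := (h.integrable_pow_four hn).1
  have hm : Measurable fun ω => quad χ (iterSeq Gi θ dt m0 u n) (ξ n ω) (ξ n ω) := by
    have h1 : Measurable fun ω => (iterSeq Gi θ dt m0 u n, ξ n ω) := measurable_const.prodMk (h.meas n)
    have := (continuous_quad χ).measurable.comp h1
    simpa only [Function.comp_def] using this
  have hq : Integrable (fun ω => quad χ (iterSeq Gi θ dt m0 u n) (ξ n ω) (ξ n ω)) μ := by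
    refine ((integrable_const (1 : ℝ)).add hi).mono' hm.aestronglyMeasurable (Eventually.of_forall fun ω => ?_)
    rw [Real.norm_eq_abs, Pi.add_apply]
    refine (abs_quad_le _ _ _).trans ?_
    nlinarith [sq_nonneg (‖ξ n ω‖ ^ 2 - 1)]
  simp only [defS]
  rw [integral_add hq (integrable_const _), integral_const, probReal_univ, one_smul,
    ← (h.bilin n hn (quad χ (iterSeq Gi θ dt m0 u n))).tsum_eq, tsum_mul_left,
    S.sumBdd.tsum_quad hχ (S.mem u n).2]
  ring

/-- The sum of the first `k` compensated quadratic variations. -/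
def defSum (Gi : ℕ → L2 D) (θ dt : ℝ) (m0 χ : L2 D) (k : ℕ) (a : ℕ → L2 D) : ℝ :=
  ∑ n ∈ Finset.range k, defS Gi θ dt m0 χ n (a, a n)

theorem defS_past (χ : L2 D) {n k : ℕ} (hnk : n ≤ k) (a : ℕ → L2 D) (x : L2 D) :
    defS Gi θ dt m0 χ n (past k a, x) = defS Gi θ dt m0 χ n (a, x) := by
  have : iterSeq Gi θ dt m0 (past k a) n = iterSeq Gi θ dt m0 a n :=
    iterSeq_congr fun i hi => past_apply a (by omega)
  simp only [defS, this]

theorem defSum_past (χ : L2 D) (k : ℕ) (a : ℕ → L2 D) :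
    defSum Gi θ dt m0 χ k (past k a) = defSum Gi θ dt m0 χ k a := by
  refine Finset.sum_congr rfl fun n hn => ?_
  have hn' := Finset.mem_range.1 hn
  rw [past_apply a hn', defS_past χ hn'.le]

theorem measurable_defSum (S : SchemeData Gi θ dt m0 Cs Cb) (χ : L2 D) (k : ℕ) :
    Measurable (defSum Gi θ dt m0 χ k) := by
  refine Finset.measurable_fun_sum _ fun n _ => ?_
  have h1 : Measurable fun a : ℕ → L2 D => (a, a n) := measurable_id.prodMk (measurable_pi_apply n)
  exact (S.measurable_defS χ n).comp h1

theorem memLp_defS (S : SchemeData Gi θ dt m0 Cs Cb) (h : IsNoiseSeq μ Gi Q dt N ξ) (χ : L2 D)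
    {n : ℕ} (hn : n < N) :
    MemLp (fun ω => defS Gi θ dt m0 χ n (fun i => ξ i ω, ξ n ω)) 2 μ ∧
      ∫ ω, defS Gi θ dt m0 χ n (fun i => ξ i ω, ξ n ω) ^ 2 ∂μ ≤
        2 * (IsGaussSeq.K4 * Q ^ 2 + Kd Cs χ ^ 2) * dt ^ 2 := by
  have hi := h.integrable_pow_four hn
  have h1 : Measurable fun ω => ((fun i => ξ i ω : ℕ → L2 D), ξ n ω) :=
    (measurable_pi_lambda _ h.meas).prodMk (h.meas n)
  have hm : Measurable fun ω => defS Gi θ dt m0 χ n (fun i => ξ i ω, ξ n ω) := (S.measurable_defS χ n).comp h1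
  have hb : Integrable (fun ω => 2 * (‖ξ n ω‖ ^ 4 + (dt * Kd Cs χ) ^ 2)) μ :=
    (hi.1.add (integrable_const ((dt * Kd Cs χ) ^ 2))).const_mul 2
  have hsq : Integrable (fun ω => defS Gi θ dt m0 χ n (fun i => ξ i ω, ξ n ω) ^ 2) μ := by
    refine hb.mono' (hm.pow_const 2).aestronglyMeasurable (Eventually.of_forall fun ω => ?_)
    rw [Real.norm_eq_abs, abs_of_nonneg (sq_nonneg _)]
    exact S.defS_sq_le χ n _
  refine ⟨(memLp_two_iff_integrable_sq hm.aestronglyMeasurable).2 hsq, ?_⟩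
  calc _ ≤ ∫ ω, 2 * (‖ξ n ω‖ ^ 4 + (dt * Kd Cs χ) ^ 2) ∂μ :=
        integral_mono hsq hb fun ω => S.defS_sq_le χ n _
    _ = 2 * (∫ ω, ‖ξ n ω‖ ^ 4 ∂μ + (dt * Kd Cs χ) ^ 2) := by
        rw [integral_const_mul, integral_add hi.1 (integrable_const _), integral_const, probReal_univ, one_smul]
    _ ≤ _ := by linarith [hi.2]

/-- The compensated quadratic variations are orthogonal. -/
theorem integral_defSum_sq (S : SchemeData Gi θ dt m0 Cs Cb) (h : IsNoiseSeq μ Gi Q dt N ξ) {χ : L2 D}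
    (hχ : ∀ᵐ x ∂ℒ D, ‖χ x‖ ≤ 1) {k : ℕ} (hk : k ≤ N) :
    MemLp (fun ω => defSum Gi θ dt m0 χ k fun i => ξ i ω) 2 μ ∧
      ∫ ω, (defSum Gi θ dt m0 χ k fun i => ξ i ω) ^ 2 ∂μ ≤
        k * (2 * (IsGaussSeq.K4 * Q ^ 2 + Kd Cs χ ^ 2) * dt ^ 2) := by
  induction k with
  | zero => simp [defSum]
  | succ k ih =>
    obtain ⟨ih1, ih2⟩ := ih (by omega)
    obtain ⟨hd1, hd2⟩ := S.memLp_defS h χ (show k < N by omega)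
    have e : ∀ ω, (defSum Gi θ dt m0 χ (k + 1) fun i => ξ i ω) =
        (defSum Gi θ dt m0 χ k fun i => ξ i ω) + defS Gi θ dt m0 χ k (fun i => ξ i ω, ξ k ω) := fun ω =>
      Finset.sum_range_succ _ _
    simp only [e]
    refine ⟨ih1.add hd1, ?_⟩
    have i1 := ih1.integrable_sq
    have i2 := hd1.integrable_sq
    have i3 : Integrable (fun ω => (defSum Gi θ dt m0 χ k fun i => ξ i ω) *
      defS Gi θ dt m0 χ k (fun i => ξ i ω, ξ k ω)) μ := ih1.integrable_mul hd1
    have hz : ∫ ω, (defSum Gi θ dt m0 χ k fun i => ξ i ω) *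
        defS Gi θ dt m0 χ k (fun i => ξ i ω, ξ k ω) ∂μ = 0 := by
      have hm : Measurable fun p : (ℕ → L2 D) × L2 D =>
          defSum Gi θ dt m0 χ k p.1 * defS Gi θ dt m0 χ k p :=
        ((S.measurable_defSum χ k).comp measurable_fst).mul (S.measurable_defS χ k)
      have := h.integral_eq_zero_of_forall (show k < N by omega) hm (fun u => by
        simp only [integral_const_mul, S.integral_defS h hχ (show k < N by omega) u, mul_zero]) (by
          simp only [defSum_past, defS_past χ le_rfl]; exact i3)
      simpa only [defSum_past, defS_past χ le_rfl] using this
    have e2 : ∀ ω, ((defSum Gi θ dt m0 χ k fun i => ξ i ω) +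
        defS Gi θ dt m0 χ k (fun i => ξ i ω, ξ k ω)) ^ 2 =
        (defSum Gi θ dt m0 χ k fun i => ξ i ω) ^ 2 + (2 * ((defSum Gi θ dt m0 χ k fun i => ξ i ω) *
        defS Gi θ dt m0 χ k (fun i => ξ i ω, ξ k ω)) + defS Gi θ dt m0 χ k (fun i => ξ i ω, ξ k ω) ^ 2) :=
      fun ω => by ring
    simp only [e2]
    have i4 := (i3.const_mul 2).fun_add i2
    rw [integral_add i1 i4, integral_add (i3.const_mul 2) i2, integral_const_mul, hz]
    push_cast
    linarith

/-- The sums of the compensated quadratic variations, in the norm of `L²(0,T)`. -/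
def defF (Gi : ℕ → L2 D) (θ dt : ℝ) (m0 χ : L2 D) (N : ℕ) (a : ℕ → L2 D) : ℝ :=
  dt * ∑ k ∈ Finset.range N, defSum Gi θ dt m0 χ k a ^ 2

theorem measurable_defF (S : SchemeData Gi θ dt m0 Cs Cb) (χ : L2 D) (N : ℕ) :
    Measurable (defF Gi θ dt m0 χ N) :=
  (Finset.measurable_fun_sum _ fun k _ => (S.measurable_defSum χ k).pow_const 2).const_mul dt

theorem lintegral_defF (S : SchemeData Gi θ dt m0 Cs Cb) (h : IsNoiseSeq μ Gi Q dt N ξ) {χ : L2 D}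
    (hχ : ∀ᵐ x ∂ℒ D, ‖χ x‖ ≤ 1) :
    ∫⁻ ω, ofReal (defF Gi θ dt m0 χ N fun i => ξ i ω) ∂μ ≤
      ofReal ((N * dt) ^ 2 * (2 * (IsGaussSeq.K4 * Q ^ 2 + Kd Cs χ ^ 2)) * dt) := by
  have hdt := S.dt_pos
  have hK : 3 ≤ IsGaussSeq.K4 := le_max_left _ _
  set c := 2 * (IsGaussSeq.K4 * Q ^ 2 + Kd Cs χ ^ 2) with hc
  have hc0 : 0 ≤ c := by positivity
  have hi : ∀ k ∈ Finset.range N, Integrable (fun ω => (defSum Gi θ dt m0 χ k fun i => ξ i ω) ^ 2) μ :=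
    fun k hk => (S.integral_defSum_sq h hχ (Finset.mem_range.1 hk).le).1.integrable_sq
  have hI := (integrable_finsetSum (Finset.range N) hi).const_mul dt
  have h1 := ofReal_integral_eq_lintegral_ofReal hI (Eventually.of_forall fun ω => by positivity)
  simp only [defF]
  rw [← h1, integral_const_mul, integral_finsetSum _ hi]
  apply ofReal_le_ofReal
  calc _ ≤ dt * ∑ k ∈ Finset.range N, N * (c * dt ^ 2) := by
        gcongr with k hk
        have hk' := (Finset.mem_range.1 hk).le
        refine (S.integral_defSum_sq h hχ hk').2.trans ?_
        gcongr
    _ = _ := by rw [Finset.sum_const, Finset.card_range, nsmul_eq_mul]; ring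

/-! ### The stochastic integral -/

/-- The discrete stochastic integral. -/
def XS (Gi : ℕ → L2 D) (θ dt : ℝ) (m0 : L2 D) (a : ℕ → L2 D) (k : ℕ) : L2 D :=
  ∑ n ∈ Finset.range k, crt (iterSeq Gi θ dt m0 a n) (a n)

theorem measurable_XS (S : SchemeData Gi θ dt m0 Cs Cb) (k : ℕ) :
    Measurable fun a => XS Gi θ dt m0 a k := by
  refine Finset.measurable_fun_sum _ fun n _ => ?_
  have h1 : Measurable fun a : ℕ → L2 D => (a, a n) := measurable_id.prodMk (measurable_pi_apply n)
  have := (S.measurable_crt_iter n).comp h1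
  simpa only [Function.comp_def] using this

theorem XS_past {l k : ℕ} (hlk : l ≤ k) (a : ℕ → L2 D) :
    XS Gi θ dt m0 (past k a) l = XS Gi θ dt m0 a l := by
  refine Finset.sum_congr rfl fun n hn => ?_
  have hn' := Finset.mem_range.1 hn
  rw [past_apply a (by omega), iterSeq_congr (b := a) fun i hi => past_apply a (by omega)]

theorem ofReal_le_two_mul {a b : ℝ} (h : a ≤ 2 * b) : ofReal a ≤ 2 * ofReal b := by
  rw [show (2 : ENNReal) = ofReal 2 by simp, ← ofReal_mul (by norm_num)]
  exact ofReal_le_ofReal h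

theorem crt_neg (m f : L2 D) : crt m (-f) = -crt m f := (crtL m).map_neg f

set_option maxHeartbeats 1000000 in
theorem lintegral_XS_sub (S : SchemeData Gi θ dt m0 Cs Cb) (h : IsNoiseSeq μ Gi Q dt N ξ) (hQ : 0 ≤ Q)
    (l : ℕ) {j : ℕ} (hj : l + j ≤ N) :
    ∫⁻ ω, ofReal (‖XS Gi θ dt m0 (fun i => ξ i ω) (l + j) - XS Gi θ dt m0 (fun i => ξ i ω) l‖ ^ 2) ∂μ ≤
        ofReal (j * (dt * Q)) ∧
    ∫⁻ ω, ofReal (‖XS Gi θ dt m0 (fun i => ξ i ω) (l + j) - XS Gi θ dt m0 (fun i => ξ i ω) l‖ ^ 4) ∂μ ≤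
        ofReal (IsGaussSeq.K4 * (j * (dt * Q)) ^ 2) := by
  have hdt := S.dt_pos
  have hK : 3 ≤ IsGaussSeq.K4 := le_max_left _ _
  induction j with
  | zero => simp
  | succ j ih =>
    obtain ⟨ih2, ih4⟩ := ih (by omega)
    have hn : l + j < N := by omega
    obtain ⟨A, hA⟩ : ∃ A : (ℕ → L2 D) → L2 D,
      A = fun a => XS Gi θ dt m0 a (l + j) - XS Gi θ dt m0 a l := ⟨_, rfl⟩
    obtain ⟨Y, hY⟩ : ∃ Y : (ℕ → L2 D) × L2 D → L2 D,
      Y = fun p => crt (iterSeq Gi θ dt m0 p.1 (l + j)) p.2 := ⟨_, rfl⟩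
    have hAm : Measurable A := by rw [hA]; exact (S.measurable_XS _).sub (S.measurable_XS _)
    have hYm : Measurable Y := by rw [hY]; exact S.measurable_crt_iter _
    have hYle : ∀ p, ‖Y p‖ ≤ ‖p.2‖ := fun p => by rw [hY]; exact norm_crt_le _ _
    have hYneg : ∀ u x, Y (u, -x) = -Y (u, x) := fun u x => by rw [hY]; exact crt_neg _ _
    have hAp : ∀ a, A (past (l + j) a) = A a := fun a => by
      simp only [hA, XS_past (le_refl (l + j)), XS_past (Nat.le_add_right l j)]
    have hsucc : ∀ ω, XS Gi θ dt m0 (fun i => ξ i ω) (l + (j + 1)) - XS Gi θ dt m0 (fun i => ξ i ω) l =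
        A (past (l + j) fun i => ξ i ω) + Y (past (l + j) fun i => ξ i ω, ξ (l + j) ω) := fun ω => by
      rw [hAp, hA, hY]
      simp only [← iter_past]
      rw [← add_assoc, XS, Finset.sum_range_succ]
      change XS Gi θ dt m0 (fun i => ξ i ω) (l + j) + _ - _ = _
      abel
    have ih2' : ∫⁻ ω, ofReal (‖A (past (l + j) fun i => ξ i ω)‖ ^ 2) ∂μ ≤
        ofReal (j * (dt * Q)) := by simp only [hAp]; rw [hA]; exact ih2
    have ih4' : ∫⁻ ω, ofReal (‖A (past (l + j) fun i => ξ i ω)‖ ^ 4) ∂μ ≤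
        ofReal (IsGaussSeq.K4 * (j * (dt * Q)) ^ 2) := by simp only [hAp]; rw [hA]; exact ih4
    have hA1 : Measurable fun p : (ℕ → L2 D) × L2 D => A p.1 := hAm.comp measurable_fst
    have hAY : Measurable fun p : (ℕ → L2 D) × L2 D => A p.1 + Y p := hA1.add hYm
    have m2 : Measurable fun u => ofReal (‖A u‖ ^ 2) :=
      ENNReal.measurable_ofReal.comp (hAm.norm.pow_const 2)
    have m4 : Measurable fun u => ofReal (‖A u‖ ^ 4) :=
      ENNReal.measurable_ofReal.comp (hAm.norm.pow_const 4)
    have p2 : Measurable fun ω => ofReal (‖A (past (l + j) fun i => ξ i ω)‖ ^ 2) :=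
      m2.comp (h.measurable_past _)
    have p4 : Measurable fun ω => ofReal (‖A (past (l + j) fun i => ξ i ω)‖ ^ 4) :=
      m4.comp (h.measurable_past _)
    have q2 : Measurable fun x : L2 D => ofReal (6 * ‖x‖ ^ 2) := by fun_prop
    have q2' : Measurable fun ω => ofReal (6 * ‖ξ (l + j) ω‖ ^ 2) := q2.comp (h.meas _)
    have pq : Measurable fun ω => ofReal (‖A (past (l + j) fun i => ξ i ω)‖ ^ 2) *
      ofReal (6 * ‖ξ (l + j) ω‖ ^ 2) := p2.mul q2'
    have n2 := h.lintegral_norm_sq hn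
    have n4 := h.lintegral_pow_four _ hn
    simp only [hsucc]
    constructor
    · refine (h.lintegral_le_of_symm hn (f := fun p => ofReal (‖A p.1 + Y p‖ ^ 2))
        (g := fun p => ofReal (‖A p.1‖ ^ 2) + ofReal (‖p.2‖ ^ 2))
        (ENNReal.measurable_ofReal.comp (hAY.norm.pow_const 2)) fun u x => ?_).trans ?_
      · simp only [hYneg]
        rw [← ofReal_add (by positivity) (by positivity), ← ofReal_add (by positivity)
          (by positivity)]
        apply ofReal_le_two_mul
        have h1 := parallelogram_law_with_norm ℝ (A u) (Y (u, x))
        rw [← sub_eq_add_neg]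
        have h2 := pow_le_pow_left₀ (norm_nonneg _) (hYle (u, x)) 2
        simp only at h2
        nlinarith
      · rw [lintegral_add_left p2]
        refine (add_le_add ih2' n2).trans ?_
        rw [← ofReal_add (by positivity) (by positivity)]
        apply ofReal_le_ofReal
        push_cast
        linarith
    · refine (h.lintegral_le_of_symm hn (f := fun p => ofReal (‖A p.1 + Y p‖ ^ 4))
        (g := fun p => (ofReal (‖A p.1‖ ^ 4) +
          ofReal (‖A p.1‖ ^ 2) * ofReal (6 * ‖p.2‖ ^ 2)) + ofReal (‖p.2‖ ^ 4))
        (ENNReal.measurable_ofReal.comp (hAY.norm.pow_const 4)) fun u x => ?_).trans ?_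
      · simp only [hYneg]
        rw [← ofReal_mul (by positivity), ← ofReal_add (by positivity) (by positivity),
          ← ofReal_add (by positivity) (by positivity), ← ofReal_add (by positivity)
          (by positivity)]
        apply ofReal_le_two_mul
        refine (IsGaussSeq.norm_pow_four_add _ _).trans ?_
        have h2 := hYle (u, x)
        simp only at h2
        have h3 : ‖Y (u, x)‖ ^ 2 ≤ ‖x‖ ^ 2 := by gcongr
        have h4 : ‖Y (u, x)‖ ^ 4 ≤ ‖x‖ ^ 4 := by gcongr
        have h5 := mul_le_mul_of_nonneg_left h3 (sq_nonneg ‖A u‖)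
        linarith
      · have p5 : Measurable fun ω => ofReal (‖A (past (l + j) fun i => ξ i ω)‖ ^ 4) +
          ofReal (‖A (past (l + j) fun i => ξ i ω)‖ ^ 2) *
            ofReal (6 * ‖ξ (l + j) ω‖ ^ 2) := p4.add pq
        have n2' : ∫⁻ ω, ofReal (6 * ‖ξ (l + j) ω‖ ^ 2) ∂μ ≤ ofReal (6 * (dt * Q)) := by
          simp only [ofReal_mul (show (0 : ℝ) ≤ 6 by norm_num)]
          rw [lintegral_const_mul' _ _ ofReal_ne_top]
          gcongr
        rw [lintegral_add_left p5, lintegral_add_left p4, h.lintegral_mul_indep hn m2 q2]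
        refine (add_le_add (add_le_add ih4' (mul_le_mul' ih2' n2')) n4).trans ?_
        rw [← ofReal_mul (by positivity), ← ofReal_add (by positivity) (by positivity),
          ← ofReal_add (by positivity) (by positivity)]
        apply ofReal_le_ofReal
        push_cast
        have h6 : 0 ≤ (IsGaussSeq.K4 - 3) * (2 * j * (dt * Q) ^ 2) :=
          mul_nonneg (by linarith) (by positivity)
        nlinarith
end SchemeData

/-! ### Step functions of time -/

theorem stronglyMeasurable_floor {F : Type*} [TopologicalSpace F] (c : ℕ → F) (d : ℝ) :
    StronglyMeasurable fun t : ℝ => c ⌊t / d⌋₊ :=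
  (StronglyMeasurable.of_discrete (f := c)).comp_measurable
    (Nat.measurable_floor.comp (measurable_id.div_const d))

theorem stepL_floor {T : ℝ} (hT : 0 < T) {N : ℕ} (hN : 0 < N) {F : Type*} [NormedAddCommGroup F]
    (c : ℕ → F) : stepL (ℐ T) (tI T N) N c
      =ᵐ[ℐ T] fun t => c ⌊t / (T / N)⌋₊ := by
  filter_upwards [coeFn_stepL (measurableSet_tI T N) N c, sum_indicator_tI hT hN c] with t h1 h2
  rw [h1, h2]

theorem volume_real_tI {T : ℝ} (hT : 0 < T) {N n : ℕ} (hn : n < N) :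
    (ℐ T).real (tI T N n) = T / N := by
  have hN : (0 : ℝ) < N := by exact_mod_cast (Nat.zero_le n).trans_lt hn
  have h1 : tI T N n ⊆ Icc 0 T := by
    intro t ht
    refine ⟨le_trans (by positivity) ht.1, ht.2.le.trans ?_⟩
    have : (n : ℝ) + 1 ≤ N := by exact_mod_cast hn
    calc ((n : ℝ) + 1) * (T / N) ≤ N * (T / N) := by gcongr
      _ = T := by field_simp
  rw [measureReal_restrict_apply (measurableSet_tI T N n), inter_eq_left.2 h1, tI, Real.volume_real_Ico_of_le]
  · ring
  · have : 0 ≤ T / N := by positivity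
    nlinarith

theorem integrable_floor {T : ℝ} (hT : 0 < T) {N : ℕ} (hN : 0 < N) (g : ℕ → ℝ) :
    IntegrableOn (fun t => g ⌊t / (T / N)⌋₊) (Icc 0 T) := by
  refine Integrable.congr ?_ (sum_indicator_tI hT hN g)
  exact integrable_finsetSum _ fun n _ => (integrable_const _).indicator (measurableSet_tI T N n)

theorem integral_floor {T : ℝ} (hT : 0 < T) {N : ℕ} (hN : 0 < N) (g : ℕ → ℝ) :
    ∫ t in Icc 0 T, g ⌊t / (T / N)⌋₊ = T / N * ∑ n ∈ Finset.range N, g n := by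
  rw [← integral_congr_ae (sum_indicator_tI hT hN g), integral_finsetSum, Finset.mul_sum]
  · refine Finset.sum_congr rfl fun n hn => ?_
    rw [integral_indicator (measurableSet_tI T N n), setIntegral_const,
      volume_real_tI hT (Finset.mem_range.1 hn), smul_eq_mul]
  · exact fun n _ => (integrable_const _).indicator (measurableSet_tI T N n)

theorem norm_sq_Lp {α F : Type*} [MeasurableSpace α] [NormedAddCommGroup F] [InnerProductSpace ℝ F]
    {μ : Measure α} (f : Lp F 2 μ) : ‖f‖ ^ 2 = ∫ t, ‖f t‖ ^ 2 ∂μ := by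
  rw [← real_inner_self_eq_norm_sq, L2.inner_def]
  simp only [real_inner_self_eq_norm_sq]

theorem norm_stepL_sq {T : ℝ} (hT : 0 < T) {N : ℕ} (hN : 0 < N) {F : Type*} [NormedAddCommGroup F]
    [InnerProductSpace ℝ F] (c : ℕ → F) :
    ‖stepL (ℐ T) (tI T N) N c‖ ^ 2 =
      T / N * ∑ n ∈ Finset.range N, ‖c n‖ ^ 2 := by
  rw [norm_sq_Lp, ← integral_floor hT hN]
  refine integral_congr_ae ?_
  filter_upwards [stepL_floor hT hN c] with t h
  rw [h]

/-! ### Weak convergence -/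

/-- Weak sequential convergence in a real inner product space. -/
def WeakTendsto {H : Type*} [NormedAddCommGroup H] [InnerProductSpace ℝ H] (x : ℕ → H) (y : H) : Prop :=
  ∀ z, Tendsto (fun k => inner ℝ (x k) z) atTop (𝓝 (inner ℝ y z))

theorem WeakTendsto.map {H F : Type*} [NormedAddCommGroup H] [InnerProductSpace ℝ H] [CompleteSpace H]
    [NormedAddCommGroup F] [InnerProductSpace ℝ F] [CompleteSpace F] {x : ℕ → H} {y : H}
    (h : WeakTendsto x y) (A : H →L[ℝ] F) : WeakTendsto (fun k => A (x k)) (A y) := fun z => by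
  simpa only [ContinuousLinearMap.adjoint_inner_right] using h (ContinuousLinearMap.adjoint A z)

theorem WeakTendsto.comp {H : Type*} [NormedAddCommGroup H] [InnerProductSpace ℝ H] {x : ℕ → H} {y : H}
    (h : WeakTendsto x y) {ψ : ℕ → ℕ} (hψ : StrictMono ψ) : WeakTendsto (fun k => x (ψ k)) y := fun z =>
  (h z).comp hψ.tendsto_atTop

theorem WeakTendsto.unique {H : Type*} [NormedAddCommGroup H] [InnerProductSpace ℝ H] {x : ℕ → H} {y y' : H}
    (h : WeakTendsto x y) (h' : Tendsto x atTop (𝓝 y')) : y = y' := by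
  refine ext_inner_right ℝ fun z => tendsto_nhds_unique (h z) ?_
  exact h'.inner tendsto_const_nhds

theorem WeakTendsto.tendsto_inner {H : Type*} [NormedAddCommGroup H] [InnerProductSpace ℝ H] {x : ℕ → H} {y : H}
    (h : WeakTendsto x y) {C : ℝ} (hC : ∀ k, ‖x k‖ ≤ C) {f : ℕ → H} {g : H}
    (hf : Tendsto f atTop (𝓝 g)) :
    Tendsto (fun k => inner ℝ (x k) (f k)) atTop (𝓝 (inner ℝ y g)) := by
  have h1 : Tendsto (fun k => inner ℝ (x k) (f k - g)) atTop (𝓝 0) := by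
    have h2 : Tendsto (fun k => C * ‖f k - g‖) atTop (𝓝 0) := by
      simpa using (tendsto_iff_norm_sub_tendsto_zero.1 hf).const_mul C
    refine squeeze_zero_norm (fun k => (norm_inner_le_norm _ _).trans ?_) h2
    exact mul_le_mul_of_nonneg_right (hC k) (norm_nonneg _)
  have := h1.add (h g)
  simpa only [← inner_add_right, sub_add_cancel, zero_add] using this

section
variable {α F : Type*} [MeasurableSpace α] {μ : Measure α} [NormedAddCommGroup F]

theorem tendsto_mkL2 {f : ℕ → α → F} {g : α → F} {b : α → ℝ}
    (hm : ∀ k, AEStronglyMeasurable (f k) μ) (hb : MemLp b 2 μ)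
    (hle : ∀ k, ∀ᵐ t ∂μ, ‖f k t‖ ≤ b t) (hlim : ∀ᵐ t ∂μ, Tendsto (fun k => f k t) atTop (𝓝 (g t))) :
    (∀ k, MemLp (f k) 2 μ) ∧ MemLp g 2 μ ∧ Tendsto (fun k => mkL2 μ (f k)) atTop (𝓝 (mkL2 μ g)) := by
  have hgm : AEStronglyMeasurable g μ := aestronglyMeasurable_of_tendsto_ae atTop hm hlim
  have hgle : ∀ᵐ t ∂μ, ‖g t‖ ≤ b t := by
    filter_upwards [ae_all_iff.2 hle, hlim] with t h1 h2
    exact le_of_tendsto h2.norm (Eventually.of_forall h1)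
  have h1 : ∀ k, MemLp (f k) 2 μ := fun k => hb.mono' (hm k) (hle k)
  have h2 : MemLp g 2 μ := hb.mono' hgm hgle
  refine ⟨h1, h2, ?_⟩
  have e : ∀ k, mkL2 μ (f k) = (h1 k).toLp _ := fun k => dif_pos (h1 k)
  have e' : mkL2 μ g = h2.toLp _ := dif_pos h2
  simp only [e, e']
  rw [Lp.tendsto_Lp_iff_tendsto_eLpNorm'']
  have h3 : Tendsto (fun k => eLpNorm (f k - g) 2 μ ^ 2) atTop (𝓝 0) := by
    simp only [eLpNorm_two_sq]
    have h4 : Tendsto (fun k => ∫⁻ t, ‖(f k - g) t‖ₑ ^ 2 ∂μ) atTop (𝓝 (∫⁻ _, 0 ∂μ)) := by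
      refine tendsto_lintegral_of_dominated_convergence' (fun t => ‖2 * b t‖ₑ ^ 2)
        (fun k => ((hm k).sub hgm).enorm.pow_const 2) (fun k => ?_) ?_ ?_
      · filter_upwards [hle k, hgle] with t h5 h6
        gcongr
        refine enorm_le_iff_norm_le.2 ?_
        rw [Real.norm_of_nonneg (by linarith [norm_nonneg (g t)])]
        exact (norm_sub_le _ _).trans (by linarith)
      · rw [← eLpNorm_two_sq]
        exact ENNReal.pow_ne_top (hb.const_mul 2).2.ne
      · filter_upwards [hlim] with t h5
        have h6 : Tendsto (fun k => ‖f k t - g t‖ₑ ^ 2) atTop (𝓝 (‖g t - g t‖ₑ ^ 2)) :=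
          ENNReal.Tendsto.pow (h5.sub_const (g t)).enorm
        simpa using h6
    simpa using h4
  have h7 := (ENNReal.continuous_rpow_const (y := (1 / 2 : ℝ))).continuousAt.tendsto.comp h3
  have h8 : (0 : ENNReal) ^ (1 / 2 : ℝ) = 0 := ENNReal.zero_rpow_of_pos (by norm_num)
  rw [h8] at h7
  refine h7.congr fun k => ?_
  simp only [Function.comp_def]
  rw [← ENNReal.rpow_natCast, ← ENNReal.rpow_mul]
  norm_num

theorem WeakTendsto.integral_inner [InnerProductSpace ℝ F] {x : ℕ → Lp F 2 μ} {y : Lp F 2 μ}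
    (h : WeakTendsto x y) {C : ℝ} (hC : ∀ k, ‖x k‖ ≤ C) {f : ℕ → α → F} {g : α → F} {b : α → ℝ}
    (hm : ∀ k, AEStronglyMeasurable (f k) μ) (hb : MemLp b 2 μ)
    (hle : ∀ k, ∀ᵐ t ∂μ, ‖f k t‖ ≤ b t) (hlim : ∀ᵐ t ∂μ, Tendsto (fun k => f k t) atTop (𝓝 (g t))) :
    (∀ k, Integrable (fun t => inner ℝ (x k t) (f k t)) μ) ∧ Integrable (fun t => inner ℝ (y t) (g t)) μ ∧
    Tendsto (fun k => ∫ t, inner ℝ (x k t) (f k t) ∂μ) atTop (𝓝 (∫ t, inner ℝ (y t) (g t) ∂μ)) := by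
  obtain ⟨h1, h2, h3⟩ := tendsto_mkL2 hm hb hle hlim
  have key : ∀ (z : Lp F 2 μ) {u : α → F}, MemLp u 2 μ →
      (fun t => inner ℝ (z t) (mkL2 μ u t)) =ᵐ[μ] fun t => inner ℝ (z t) (u t) := fun z u hu => by
    filter_upwards [coeFn_mkL2 hu] with t e
    rw [e]
  refine ⟨fun k => (L2.integrable_inner (𝕜 := ℝ) (x k) (mkL2 μ (f k))).congr (key _ (h1 k)),
    (L2.integrable_inner (𝕜 := ℝ) y (mkL2 μ g)).congr (key _ h2), ?_⟩
  have := h.tendsto_inner hC h3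
  simp only [L2.inner_def, integral_congr_ae (key _ (h1 _)), integral_congr_ae (key _ h2)] at this
  exact this

theorem WeakTendsto.setIntegral_inner [InnerProductSpace ℝ F] {x : ℕ → Lp F 2 μ} {y : Lp F 2 μ}
    (h : WeakTendsto x y) {C : ℝ} (hC : ∀ k, ‖x k‖ ≤ C) {f : ℕ → α → F} {g : α → F} {b : α → ℝ}
    (hm : ∀ k, AEStronglyMeasurable (f k) μ) (hb : MemLp b 2 μ)
    (hle : ∀ k, ∀ᵐ t ∂μ, ‖f k t‖ ≤ b t) (hlim : ∀ᵐ t ∂μ, Tendsto (fun k => f k t) atTop (𝓝 (g t)))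
    {E : Set α} (hE : MeasurableSet E) :
    Tendsto (fun k => ∫ t in E, inner ℝ (x k t) (f k t) ∂μ) atTop (𝓝 (∫ t in E, inner ℝ (y t) (g t) ∂μ)) := by
  have key : ∀ (z : Lp F 2 μ) (u : α → F), ∫ t in E, inner ℝ (z t) (u t) ∂μ =
      ∫ t, inner ℝ (z t) (E.indicator u t) ∂μ := fun z u => by
    rw [← integral_indicator hE]
    refine integral_congr_ae (Eventually.of_forall fun t => ?_)
    by_cases ht : t ∈ E <;> simp [ht]
  simp only [key]
  refine (h.integral_inner hC (b := b) (fun k => (hm k).indicator hE) hb (fun k => ?_) ?_).2.2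
  · filter_upwards [hle k] with t h1
    exact (norm_indicator_le_norm_self _ _).trans h1
  · filter_upwards [hlim] with t h1
    by_cases ht : t ∈ E <;> simp [ht, h1]

end

/-! ### The variational problem with rotated test functions -/

theorem inner_crt_sub (m f g : L2 D) :
    inner ℝ (f - crt m f) g = inner ℝ f (g + crt m g) := by
  rw [inner_sub_left, inner_crt_left, inner_add_right, sub_neg_eq_add]

theorem Tang.crt {m ξ : L2 D} (hm : ∀ᵐ x ∂ℒ D, ‖m x‖ ≤ 1) : Tang m (crt m ξ) := by
  rw [crt_eq hm]; exact Tang.cr hm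

/-- The weak gradients of `m × ψ`. -/
def dcr (k : Fin 3) (m ψ : L2 D) : L2 D := crt m (weakPartial k ψ) - crt ψ (weakPartial k m)

theorem cr_comm {u v : L2 D} (bu : ∀ᵐ x ∂ℒ D, ‖u x‖ ≤ 1) :
    cr v u = -crt u v := by
  rw [crt_eq bu]
  refine Lp.ext ?_
  filter_upwards [coeFn_cr_right (u := v) bu, coeFn_cr (f := v) bu, Lp.coeFn_neg (cr u v)] with x h1 h2 h3
  rw [h1, h3, Pi.neg_apply, h2, cross_anticomm']

theorem weakPartial_crt (hD : IsOpen D) {u v : L2 D} (hu : MemH1 u) (hv : MemH1 v)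
    (bu : ∀ᵐ x ∂ℒ D, ‖u x‖ ≤ 1) (bv : ∀ᵐ x ∂ℒ D, ‖v x‖ ≤ 1) (k : Fin 3) :
    weakPartial k (crt u v) = dcr k u v := by
  rw [crt_eq bu, weakPartial_cr hD hu hv bu bv, dcr, cr_comm bv, crt_eq bu]
  abel

theorem MemH1.crt (hD : IsOpen D) {u v : L2 D} (hu : MemH1 u) (hv : MemH1 v)
    (bu : ∀ᵐ x ∂ℒ D, ‖u x‖ ≤ 1) (bv : ∀ᵐ x ∂ℒ D, ‖v x‖ ≤ 1) :
    MemH1 (crt u v) := by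
  rw [crt_eq bu]; exact hu.cr hD hv bu bv

theorem norm_crt_apply_le (u : L2 D) {v : L2 D} (bu : ∀ᵐ x ∂ℒ D, ‖u x‖ ≤ 1)
    (bv : ∀ᵐ x ∂ℒ D, ‖v x‖ ≤ 1) : ∀ᵐ x ∂ℒ D, ‖crt u v x‖ ≤ 1 := by
  filter_upwards [coeFn_crt bu v, bu, bv] with x h1 h2 h3
  rw [h1]
  exact (norm_cross_le _ _).trans (mul_le_one₀ h2 (norm_nonneg _) h3)

/-- The identity of one step of the scheme, tested with `m × Ψ`. -/
theorem step_identity (hD : IsOpen D) {Gi : ℕ → L2 D} {Cs : ℝ} (h : SumBdd Gi Cs) {θ dt : ℝ} (hdt : 0 < dt)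
    {m ξ v : L2 D} (hm : m ∈ sphereH1 D) (hv : IsIncrement Gi θ dt m ξ v)
    {Ψ : L2 D} (hΨ : MemH1 Ψ) (bΨ : ∀ᵐ x ∂ℒ D, ‖Ψ x‖ ≤ 1) :
    inner ℝ (dt⁻¹ • (v - crt m ξ)) (crt m Ψ + crt m (crt m Ψ)) +
      2 * ∑ k, inner ℝ (weakPartial k m) (crt m (weakPartial k Ψ)) -
      (1 / 2) * inner ℝ (Sop Gi m) (crt m Ψ + crt m (crt m Ψ)) =
    -(2 * θ * ∑ k, inner ℝ (weakPartial k v) (dcr k m Ψ)) := by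
  have hm1 := sphereH1.le_one hm
  have hφ : MemH1 (crt m Ψ) := hm.1.crt hD hΨ hm1 bΨ
  have h1 := hv.2 (crt m Ψ) ⟨hφ, Tang.crt hm1⟩
  have h2 := (variational_iff hD h θ dt (p := hm.1.lift) (by simpa using hm1) ξ hv.1.1.lift hφ.lift).1 (by simpa using h1)
  simp only [inner_schemeA, inner_schemeL, MemH1.val_lift, MemH1.grad_lift, schemeF] at h2
  have h3 : ∀ k, inner ℝ (weakPartial k m) (dcr k m Ψ) =
      inner ℝ (weakPartial k m) (crt m (weakPartial k Ψ)) := fun k => by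
    rw [dcr, inner_sub_right, real_inner_comm (crt Ψ _), inner_crt_self,
      sub_zero]
  simp only [weakPartial_crt hD hm.1 hΨ hm1 bΨ, h3] at h2
  rw [inner_add_left, real_inner_smul_left, inner_crt_sub, inner_crt_sub, inner_crt_sub] at h2
  rw [real_inner_smul_left, inner_sub_left]
  have e : inner ℝ v (crt m Ψ + crt m (crt m Ψ)) - inner ℝ (crt m ξ) (crt m Ψ + crt m (crt m Ψ)) =
      dt * (1 / 2 * inner ℝ (Sop Gi m) (crt m Ψ + crt m (crt m Ψ)) -
        2 * ∑ k, inner ℝ (weakPartial k m) (crt m (weakPartial k Ψ)) -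
        2 * θ * ∑ k, inner ℝ (weakPartial k v) (dcr k m Ψ)) := by linear_combination h2
  rw [e, ← mul_assoc, inv_mul_cancel₀ hdt.ne']
  ring

/-! ### Continuity of functions with a finite Slobodeckij seminorm -/

theorem pow_four_lintegral_le {α : Type*} [MeasurableSpace α] (ν : Measure α) {g : α → ENNReal}
    (hg : AEMeasurable g ν) : (∫⁻ x, g x ∂ν) ^ 4 ≤ ν univ ^ 3 * ∫⁻ x, g x ^ 4 ∂ν := by
  have h1 := sq_lintegral_le ν hg
  have h2 := sq_lintegral_le ν (hg.pow_const 2)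
  calc (∫⁻ x, g x ∂ν) ^ 4 = ((∫⁻ x, g x ∂ν) ^ 2) ^ 2 := by ring
    _ ≤ (ν univ * ∫⁻ x, g x ^ 2 ∂ν) ^ 2 := by gcongr
    _ = ν univ ^ 2 * (∫⁻ x, g x ^ 2 ∂ν) ^ 2 := by ring
    _ ≤ ν univ ^ 2 * (ν univ * ∫⁻ x, (g x ^ 2) ^ 2 ∂ν) := by gcongr
    _ = ν univ ^ 3 * ∫⁻ x, g x ^ 4 ∂ν := by
      rw [← mul_assoc, ← pow_succ]
      congr 2
      ext1 x
      ring

section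
variable {E : Type*} [NormedAddCommGroup E] [NormedSpace ℝ E] [CompleteSpace E]

/-- The kernel `|u|^(-5/2)`. -/
def slobK (u : ℝ) : ENNReal := ofReal (u ^ 2 * √|u|)⁻¹

/-- The fourth power of a Slobodeckij seminorm. -/
def slob (T : ℝ) (f : ℝ → E) : ENNReal :=
  ∫⁻ p : ℝ × ℝ, slobK (p.1 - p.2) * ‖f p.1 - f p.2‖ₑ ^ 4
    ∂(ℐ T).prod (ℐ T)

theorem lintegral_diff_le_slob {T h a b : ℝ} (f : ℝ → E) (hh : 0 < h) (ha : 0 ≤ a)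
    (haT : a + h ≤ T) (hab : a ≤ b) (hb : b + h / 2 ≤ a + h) :
    ∫⁻ p, ‖f p.1 - f p.2‖ₑ ^ 4 ∂(volume.restrict (Icc a (a + h))).prod (volume.restrict (Icc b (b + h / 2))) ≤
      ofReal (h ^ 2 * √h) * slob T f := by
  rw [slob, ← lintegral_const_mul' _ _ ofReal_ne_top, Measure.prod_restrict, Measure.prod_restrict]
  have hs : Icc a (a + h) ×ˢ Icc b (b + h / 2) ⊆ Icc 0 T ×ˢ Icc 0 T :=
    prod_mono (Icc_subset_Icc ha haT) (Icc_subset_Icc (ha.trans hab) (hb.trans haT))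
  refine le_trans ?_ (lintegral_mono_set hs)
  refine setLIntegral_mono' (measurableSet_Icc.prod measurableSet_Icc) fun p hp => ?_
  obtain ⟨⟨h1, h2⟩, h3, h4⟩ := hp
  by_cases he : p.1 = p.2
  · rw [he, sub_self, enorm_zero]; simp
  · rw [← mul_assoc]
    refine le_mul_of_one_le_left' ?_
    rw [slobK, ← ofReal_mul (by positivity)]
    refine ENNReal.one_le_ofReal.2 ?_
    have h5 : 0 < |p.1 - p.2| := abs_pos.2 (sub_ne_zero.2 he)
    have h6 : |p.1 - p.2| ≤ h := abs_le.2 ⟨by linarith, by linarith⟩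
    have h7 : 0 < √|p.1 - p.2| := Real.sqrt_pos.2 h5
    rw [← sq_abs (p.1 - p.2), ← div_eq_mul_inv, one_le_div (by positivity)]
    gcongr

/-- The mean value of `f` on the interval `[a, a + h]`. -/
def mean (f : ℝ → E) (h a : ℝ) : E := h⁻¹ • ∫ y in Icc a (a + h), f y

theorem continuous_mean {f : ℝ → E} (hf : Integrable f) {h : ℝ} (hh : 0 ≤ h) : Continuous (mean f h) := by
  have h1 := hf.continuous_primitive 0
  have e : mean f h = fun a => h⁻¹ • ((∫ y in (0 : ℝ)..a + h, f y) - ∫ y in (0 : ℝ)..a, f y) := by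
    ext1 a
    rw [mean, integral_Icc_eq_integral_Ioc, ← intervalIntegral.integral_of_le (by linarith),
      intervalIntegral.integral_interval_sub_left hf.intervalIntegrable hf.intervalIntegrable]
  rw [e]
  have h2 : Continuous fun a => ∫ y in (0 : ℝ)..a + h, f y := by
    have := h1.comp (continuous_add_const h)
    exact this
  exact (h2.sub h1).const_smul _

theorem enorm_mean_sub_le {T h a b : ℝ} {f : ℝ → E} (hf : Integrable f) (hh : 0 < h) (ha : 0 ≤ a)
    (haT : a + h ≤ T) (hab : a ≤ b) (hb : b + h / 2 ≤ a + h) :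
    ‖mean f (h / 2) b - mean f h a‖ₑ ^ 4 ≤ ofReal (2 * √h) * slob T f := by
  obtain ⟨μ, hμ⟩ : ∃ μ, μ = (volume : Measure ℝ).restrict (Icc a (a + h)) := ⟨_, rfl⟩
  obtain ⟨ν, hν⟩ : ∃ ν, ν = (volume : Measure ℝ).restrict (Icc b (b + h / 2)) := ⟨_, rfl⟩
  have : IsFiniteMeasure μ := by rw [hμ]; infer_instance
  have : IsFiniteMeasure ν := by rw [hν]; infer_instance
  have eμ : μ univ = ofReal h := by rw [hμ]; simp
  have eν : ν univ = ofReal (h / 2) := by rw [hν]; simp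
  have i1 : Integrable f μ := by rw [hμ]; exact hf.integrableOn
  have i2 : Integrable f ν := by rw [hν]; exact hf.integrableOn
  have e : mean f h a - mean f (h / 2) b = (h * (h / 2))⁻¹ • ∫ p, (f p.1 - f p.2) ∂μ.prod ν := by
    rw [integral_sub (i1.comp_fst ν) (i2.comp_snd μ), integral_fun_fst, integral_fun_snd, mean, mean, ← hμ, ← hν,
      Measure.real, Measure.real, eμ, eν, ENNReal.toReal_ofReal hh.le, ENNReal.toReal_ofReal (by positivity),
      smul_sub, smul_smul, smul_smul]
    congr 2 <;> field_simp
  have hm : AEMeasurable (fun p : ℝ × ℝ => ‖f p.1 - f p.2‖ₑ) (μ.prod ν) :=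
    ((i1.comp_fst ν).sub (i2.comp_snd μ)).aestronglyMeasurable.enorm
  have h1 := pow_four_lintegral_le (μ.prod ν) hm
  have h2 : ∫⁻ p, ‖f p.1 - f p.2‖ₑ ^ 4 ∂μ.prod ν ≤ ofReal (h ^ 2 * √h) * slob T f := by
    rw [hμ, hν]; exact lintegral_diff_le_slob f hh ha haT hab hb
  have e3 : (μ.prod ν) univ = ofReal (h * (h / 2)) := by
    rw [← univ_prod_univ, Measure.prod_prod, eμ, eν, ← ofReal_mul hh.le]
  rw [← enorm_neg, neg_sub, e, enorm_smul, mul_pow]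
  calc ‖(h * (h / 2))⁻¹‖ₑ ^ 4 * ‖∫ p, (f p.1 - f p.2) ∂μ.prod ν‖ₑ ^ 4
      ≤ ‖(h * (h / 2))⁻¹‖ₑ ^ 4 * (ofReal (h * (h / 2)) ^ 3 * (ofReal (h ^ 2 * √h) * slob T f)) := by
        gcongr
        refine le_trans ?_ (h1.trans ?_)
        · gcongr; exact enorm_integral_le_lintegral_enorm _
        · rw [e3]; gcongr
    _ = ofReal (2 * √h) * slob T f := by
      rw [← mul_assoc, ← mul_assoc, Real.enorm_eq_ofReal (by positivity), ← ofReal_pow (by positivity),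
        ← ofReal_pow (by positivity), ← ofReal_mul (by positivity), ← ofReal_mul (by positivity)]
      congr 2
      field_simp

theorem exists_continuous_of_slob {T : ℝ} (hT : 0 < T) {f : ℝ → E} (hf : Integrable f) (hs : slob T f ≠ ⊤) :
    ∃ c : ℝ → E, ContinuousOn c (Icc 0 T) ∧ ∀ᵐ t, t ∈ Icc 0 T → f t = c t := by
  obtain ⟨h, hh⟩ : ∃ h : ℕ → ℝ, ∀ k, h k = T * (1 / 2) ^ k := ⟨_, fun _ => rfl⟩
  have h0 : ∀ k, 0 < h k := fun k => by rw [hh]; positivity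
  have h1 : ∀ k, h (k + 1) = h k / 2 := fun k => by rw [hh, hh]; ring
  have hle : ∀ k, h k ≤ T := fun k => by
    rw [hh]; exact mul_le_of_le_one_right hT.le (pow_le_one₀ (by norm_num) (by norm_num))
  obtain ⟨u, hu⟩ : ∃ u : ℕ → ℝ → E, ∀ k t, u k t = mean f (h k) (t * (1 - h k / T)) := ⟨_, fun _ _ => rfl⟩
  have cu : ∀ k, Continuous (u k) := fun k => by
    have := (continuous_mean hf (h0 k).le).comp (continuous_mul_const (1 - h k / T))
    have e : u k = fun t => mean f (h k) (t * (1 - h k / T)) := funext (hu k)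
    rw [e]; exact this
  obtain ⟨K, hK⟩ : ∃ K : ℝ, K = 2 * √T * (slob T f).toReal := ⟨_, rfl⟩
  have hK0 : 0 ≤ K := by rw [hK]; positivity
  obtain ⟨r, hr⟩ : ∃ r : ℝ, r = (1 / 2) ^ (1 / 8 : ℝ) := ⟨_, rfl⟩
  have r0 : 0 ≤ r := by rw [hr]; positivity
  have r1 : r < 1 := by rw [hr]; exact Real.rpow_lt_one (by norm_num) (by norm_num) (by norm_num)
  have r8 : r ^ 8 = 1 / 2 := by
    rw [hr, ← Real.rpow_natCast, ← Real.rpow_mul (by norm_num)]; norm_num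
  have hd : ∀ k, ∀ t ∈ Icc 0 T, ‖u (k + 1) t - u k t‖ ≤ (K + 1) * r ^ k := fun k t ht => by
    have b1 : t * (h k / T) ≤ h k := by
      rw [mul_div_assoc', div_le_iff₀ hT, mul_comm]; exact mul_le_mul_of_nonneg_left ht.2 (h0 k).le
    have b2 : 0 ≤ t * (h k / T) := mul_nonneg ht.1 (div_nonneg (h0 k).le hT.le)
    have b3 : 0 ≤ t * (1 - h k / T) := mul_nonneg ht.1 (sub_nonneg.2 ((div_le_one hT).2 (hle k)))
    have b4 : 0 ≤ (T - t) * (1 - h k / T) :=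
      mul_nonneg (sub_nonneg.2 ht.2) (sub_nonneg.2 ((div_le_one hT).2 (hle k)))
    have b5 : T * (h k / T) = h k := by field_simp
    have h2 := enorm_mean_sub_le (T := T) (a := t * (1 - h k / T)) (b := t * (1 - h (k + 1) / T)) hf (h0 k) b3
      (by linarith) (by rw [h1, div_right_comm]; linarith) (by rw [h1, div_right_comm]; linarith)
    rw [← h1, ← hu, ← hu, ← ENNReal.ofReal_toReal hs, ← ofReal_mul (by positivity), ← ofReal_norm,
      ← ofReal_pow (norm_nonneg _), ENNReal.ofReal_le_ofReal_iff (by positivity)] at h2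
    have h3 : √(h k) = √T * (r ^ k) ^ 4 := by
      rw [hh, Real.sqrt_mul hT.le]
      congr 1
      rw [← r8, ← pow_mul, mul_comm 8 k, show r ^ (k * 8) = ((r ^ k) ^ 4) ^ 2 by ring, Real.sqrt_sq (by positivity)]
    rw [h3] at h2
    refine le_of_pow_le_pow_left₀ (n := 4) (by norm_num) (by positivity) (h2.trans ?_)
    rw [mul_pow, show 2 * (√T * (r ^ k) ^ 4) * (slob T f).toReal = K * (r ^ k) ^ 4 by rw [hK]; ring]
    gcongr
    nlinarith [pow_pos (by linarith : 0 < K + 1) 2, pow_pos (by linarith : 0 < K + 1) 3, mul_nonneg hK0 hK0]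
  have hsum : Summable fun k => (K + 1) * r ^ k := (summable_geometric_of_lt_one r0 r1).mul_left _
  refine ⟨fun t => u 0 t + ∑' k, (u (k + 1) t - u k t), (cu 0).continuousOn.add
    (continuousOn_tsum (fun k => ((cu (k + 1)).sub (cu k)).continuousOn) hsum hd), ?_⟩
  filter_upwards [IsUnifLocDoublingMeasure.ae_tendsto_average volume hf.locallyIntegrable 1] with t h2 ht
  have hs1 : HasSum (fun k => u (k + 1) t - u k t) (∑' k, (u (k + 1) t - u k t)) :=
    (Summable.of_norm_bounded hsum fun k => hd k t ht).hasSum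
  have l1 := hs1.tendsto_sum_nat.const_add (u 0 t)
  simp only [Finset.sum_range_sub (fun k => u k t), add_sub_cancel] at l1
  have lh : Tendsto h atTop (𝓝 0) := by
    have := (tendsto_pow_atTop_nhds_zero_of_lt_one (r := (1 / 2 : ℝ)) (by norm_num) (by norm_num)).const_mul T
    rw [mul_zero] at this
    exact this.congr fun k => (hh k).symm
  have h3 := h2 (fun k => t * (1 - h k / T) + h k / 2) (fun k => h k / 2) (l := atTop) ?_ ?_
  · refine tendsto_nhds_unique h3 (l1.congr fun k => ?_)
    rw [setAverage_eq, Real.closedBall_eq_Icc, hu, mean, add_sub_cancel_right, add_assoc, add_halves,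
      Real.volume_real_Icc_of_le (by linarith [h0 k]), add_sub_cancel_left]
  · refine tendsto_nhdsWithin_iff.2 ⟨by simpa using lh.div_const 2, Eventually.of_forall fun k => ?_⟩
    exact half_pos (h0 k)
  · refine Eventually.of_forall fun k => ?_
    have b1 : t * (h k / T) ≤ h k := by
      rw [mul_div_assoc', div_le_iff₀ hT, mul_comm]; exact mul_le_mul_of_nonneg_left ht.2 (h0 k).le
    have b2 : 0 ≤ t * (h k / T) := mul_nonneg ht.1 (div_nonneg (h0 k).le hT.le)
    rw [one_mul, Real.closedBall_eq_Icc]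
    constructor <;> linarith

end

/-! ### Time regularity of the stochastic part -/

theorem lintegral_inv_sqrt_ne_top (T : ℝ) :
    ∫⁻ p : ℝ × ℝ, ofReal (√|p.1 - p.2|)⁻¹
      ∂(ℐ T).prod (ℐ T) ≠ ⊤ := by
  obtain ⟨g, hg⟩ : ∃ g : ℝ → ENNReal, g = fun u => ofReal (√|u|)⁻¹ := ⟨_, rfl⟩
  have hgm : Measurable g := by
    rw [hg]; exact (Real.continuous_sqrt.measurable.comp measurable_abs).inv.ennreal_ofReal
  have h1 : ∫⁻ u in Icc 0 T, g u ≠ ⊤ := by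
    have h : IntervalIntegrable (fun s : ℝ => s ^ (-(1 / 2) : ℝ)) volume 0 T :=
      intervalIntegral.intervalIntegrable_rpow' (by norm_num)
    have h2 := (h.1).lintegral_lt_top.ne
    rw [setLIntegral_congr Ioc_ae_eq_Icc.symm]
    refine ne_top_of_le_ne_top h2 (le_of_eq (setLIntegral_congr_fun measurableSet_Ioc fun s hs => ?_))
    rw [hg]
    dsimp only
    rw [abs_of_pos hs.1, Real.sqrt_eq_rpow, ← Real.rpow_neg hs.1.le]
  have h2 : ∫⁻ u in Icc (-T) T, g u ≠ ⊤ := by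
    have e1 : ∫⁻ u in Icc (-T) 0, g u = ∫⁻ u in Icc 0 T, g u := by
      have e2 := (Measure.measurePreserving_neg (volume : Measure ℝ)).setLIntegral_comp_preimage
        (measurableSet_Icc (a := 0) (b := T)) hgm
      rw [← e2]
      have e3 : (Neg.neg : ℝ → ℝ) ⁻¹' Icc 0 T = Icc (-T) 0 := by simp
      rw [e3]
      refine lintegral_congr fun u => ?_
      simp only [hg, abs_neg]
    have h3 : Icc (-T) T ⊆ Icc (-T) 0 ∪ Icc 0 T := fun u hu => by
      rcases le_total u 0 with h | h
      · exact Or.inl ⟨hu.1, h⟩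
      · exact Or.inr ⟨h, hu.2⟩
    refine ne_top_of_le_ne_top ?_ ((lintegral_mono_set h3).trans (lintegral_union_le _ _ _))
    rw [e1]
    exact ENNReal.add_ne_top.2 ⟨h1, h1⟩
  have h4 : Measurable fun p : ℝ × ℝ => g (p.1 - p.2) := hgm.comp (measurable_fst.sub measurable_snd)
  have e : (fun p : ℝ × ℝ => ofReal (√|p.1 - p.2|)⁻¹) = fun p => g (p.1 - p.2) := by rw [hg]
  rw [e, lintegral_prod _ h4.aemeasurable]
  refine ne_top_of_le_ne_top (b := ∫⁻ _ in Icc 0 T, ∫⁻ u in Icc (-T) T, g u) ?_ ?_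
  · rw [lintegral_const]
    exact ENNReal.mul_ne_top h2 (measure_ne_top _ _)
  · refine setLIntegral_mono' measurableSet_Icc fun s hs => ?_
    rw [← lintegral_indicator measurableSet_Icc, ← lintegral_indicator measurableSet_Icc,
      ← lintegral_sub_left_eq_self ((Icc (-T) T).indicator g) s]
    refine lintegral_mono fun r => ?_
    by_cases hr : r ∈ Icc 0 T
    · rw [indicator_of_mem hr, indicator_of_mem]
      exact ⟨by linarith [hs.1, hr.2], by linarith [hs.2, hr.1]⟩
    · rw [indicator_of_notMem hr]; exact zero_le

/-- The kernel `|u|^(-5/2)`, cut off for `|u| < d`. -/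
def slobN (d u : ℝ) : ENNReal := if d ≤ |u| then slobK u else 0

theorem measurable_slobK : Measurable slobK :=
  ((measurable_id.pow_const 2).mul (Real.continuous_sqrt.measurable.comp measurable_abs)).inv.ennreal_ofReal

theorem measurable_slobN (d : ℝ) : Measurable (slobN d) :=
  Measurable.ite (measurableSet_le measurable_const measurable_abs) measurable_slobK measurable_const

/-- The discrete version of the Slobodeckij seminorm of the stochastic part of the scheme. -/
def holderF (T : ℝ) (Gi : ℕ → L2 D) (θ : ℝ) (m0 : L2 D) (N : ℕ) (a : ℕ → L2 D) : ENNReal :=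
  ∫⁻ p : ℝ × ℝ, slobN (T / N) (p.1 - p.2) * ‖SchemeData.XS Gi θ (T / N) m0 a ⌊p.1 / (T / N)⌋₊ -
      SchemeData.XS Gi θ (T / N) m0 a ⌊p.2 / (T / N)⌋₊‖ₑ ^ 4
    ∂(ℐ T).prod (ℐ T)

section
variable {T : ℝ} {Gi : ℕ → L2 D} {θ : ℝ} {m0 : L2 D} {Cs Cb : ℝ} {N : ℕ}

theorem measurable_XS_floor (S : SchemeData Gi θ (T / N) m0 Cs Cb) :
    Measurable fun q : (ℕ → L2 D) × ℝ => SchemeData.XS Gi θ (T / N) m0 q.1 ⌊q.2 / (T / N)⌋₊ := by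
  have h1 : Measurable fun q : (ℕ → L2 D) × ℕ => SchemeData.XS Gi θ (T / N) m0 q.1 q.2 :=
    measurable_from_prod_countable_left fun k => S.measurable_XS k
  have h2 : Measurable fun q : (ℕ → L2 D) × ℝ => (q.1, ⌊q.2 / (T / N)⌋₊) :=
    measurable_fst.prodMk (Nat.measurable_floor.comp (measurable_snd.div_const _))
  have := h1.comp h2
  simpa only [Function.comp_def] using this

theorem measurable_holder_integrand (S : SchemeData Gi θ (T / N) m0 Cs Cb) :
    Measurable fun q : (ℕ → L2 D) × ℝ × ℝ => slobN (T / N) (q.2.1 - q.2.2) *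
      ‖SchemeData.XS Gi θ (T / N) m0 q.1 ⌊q.2.1 / (T / N)⌋₊ -
      SchemeData.XS Gi θ (T / N) m0 q.1 ⌊q.2.2 / (T / N)⌋₊‖ₑ ^ 4 := by
  have h1 : Measurable fun q : (ℕ → L2 D) × ℝ × ℝ => SchemeData.XS Gi θ (T / N) m0 q.1 ⌊q.2.1 / (T / N)⌋₊ := by
    have := (measurable_XS_floor S).comp (measurable_fst.prodMk (measurable_fst.comp measurable_snd) :
      Measurable fun q : (ℕ → L2 D) × ℝ × ℝ => (q.1, q.2.1))
    simpa only [Function.comp_def] using this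
  have h2 : Measurable fun q : (ℕ → L2 D) × ℝ × ℝ => SchemeData.XS Gi θ (T / N) m0 q.1 ⌊q.2.2 / (T / N)⌋₊ := by
    have := (measurable_XS_floor S).comp (measurable_fst.prodMk (measurable_snd.comp measurable_snd) :
      Measurable fun q : (ℕ → L2 D) × ℝ × ℝ => (q.1, q.2.2))
    simpa only [Function.comp_def] using this
  have h3 : Measurable fun q : (ℕ → L2 D) × ℝ × ℝ => slobN (T / N) (q.2.1 - q.2.2) :=
    (measurable_slobN _).comp ((measurable_fst.comp measurable_snd).sub (measurable_snd.comp measurable_snd))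
  exact h3.mul ((h1.sub h2).enorm.pow_const 4)

theorem measurable_holderF (S : SchemeData Gi θ (T / N) m0 Cs Cb) : Measurable (holderF T Gi θ m0 N) :=
  (measurable_holder_integrand S).lintegral_prod_right'

theorem K4_nonneg : 0 ≤ IsGaussSeq.K4 := (by norm_num : (0 : ℝ) ≤ 3).trans (le_max_left _ _)

theorem abs_floor_sub_le {x y : ℝ} (hx : 0 ≤ x) (hy : 0 ≤ y) : |(⌊x⌋₊ : ℝ) - ⌊y⌋₊| ≤ |x - y| + 1 := by
  have h1 := Nat.floor_le hx
  have h2 := Nat.floor_le hy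
  have h3 := Nat.lt_floor_add_one x
  have h4 := Nat.lt_floor_add_one y
  rw [abs_le]
  constructor <;> cases abs_cases (x - y) <;> linarith

theorem lintegral_holderF {Ω : Type*} [MeasurableSpace Ω] {μ : Measure Ω} [IsProbabilityMeasure μ] {Q : ℝ}
    {ξ : ℕ → Ω → L2 D} (hT : 0 < T) (hN : 0 < N) (S : SchemeData Gi θ (T / N) m0 Cs Cb)
    (h : IsNoiseSeq μ Gi Q (T / N) N ξ) (hQ : 0 ≤ Q) :
    ∫⁻ ω, holderF T Gi θ m0 N (fun i => ξ i ω) ∂μ ≤ ofReal (4 * (IsGaussSeq.K4 * Q ^ 2)) *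
      ∫⁻ p : ℝ × ℝ, ofReal (√|p.1 - p.2|)⁻¹
        ∂(ℐ T).prod (ℐ T) := by
  have hdt := S.dt_pos
  have key : ∀ i j : ℕ, i ≤ N → j ≤ N → ∫⁻ ω, ‖SchemeData.XS Gi θ (T / N) m0 (fun i => ξ i ω) i -
      SchemeData.XS Gi θ (T / N) m0 (fun i => ξ i ω) j‖ₑ ^ 4 ∂μ ≤
      ofReal (IsGaussSeq.K4 * (|(i : ℝ) - j| * (T / N * Q)) ^ 2) := fun i j hi hj => by
    wlog hij : j ≤ i generalizing i j
    · have := this j i hj hi (le_of_not_ge hij)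
      simpa only [enorm_sub_rev, abs_sub_comm] using this
    obtain ⟨l, rfl⟩ := Nat.exists_eq_add_of_le hij
    have h1 := (S.lintegral_XS_sub h hQ j hi).2
    have e : |((j + l : ℕ) : ℝ) - j| = l := by push_cast; rw [add_sub_cancel_left, abs_of_nonneg (Nat.cast_nonneg l)]
    rw [e]
    simpa only [← ofReal_norm, ← ofReal_pow (norm_nonneg _)] using h1
  have hξ : Measurable fun ω => fun i => ξ i ω := measurable_pi_lambda _ h.meas
  have hm : Measurable fun q : Ω × ℝ × ℝ => slobN (T / N) (q.2.1 - q.2.2) *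
      ‖SchemeData.XS Gi θ (T / N) m0 (fun i => ξ i q.1) ⌊q.2.1 / (T / N)⌋₊ -
      SchemeData.XS Gi θ (T / N) m0 (fun i => ξ i q.1) ⌊q.2.2 / (T / N)⌋₊‖ₑ ^ 4 := by
    have := (measurable_holder_integrand S).comp ((hξ.comp measurable_fst).prodMk measurable_snd :
      Measurable fun q : Ω × ℝ × ℝ => ((fun i => ξ i q.1), q.2))
    simpa only [Function.comp_def] using this
  unfold holderF
  rw [lintegral_lintegral_swap hm.aemeasurable, ← lintegral_const_mul' _ _ ofReal_ne_top]
  refine lintegral_mono_ae ?_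
  filter_upwards [Measure.quasiMeasurePreserving_fst.ae (ae_floor_mem hT hN),
    Measure.quasiMeasurePreserving_snd.ae (ae_floor_mem hT hN)] with p ⟨h1, h2, h3⟩ ⟨h4, h5, h6⟩
  by_cases hd : T / N ≤ |p.1 - p.2|
  · have e1 : slobN (T / N) (p.1 - p.2) = slobK (p.1 - p.2) := if_pos hd
    have hK : slobK (p.1 - p.2) ≠ ⊤ := ofReal_ne_top
    rw [e1, lintegral_const_mul' _ _ hK]
    refine (mul_le_mul_right (key _ _ h3.le h6.le) _).trans ?_
    have h7 : |(⌊p.1 / (T / N)⌋₊ : ℝ) - ⌊p.2 / (T / N)⌋₊| * (T / N) ≤ 2 * |p.1 - p.2| := by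
      have h8 := mul_le_mul_of_nonneg_right
        (abs_floor_sub_le (div_nonneg h1 hdt.le) (div_nonneg h4 hdt.le)) hdt.le
      rw [← sub_div, abs_div, abs_of_pos hdt, add_mul, div_mul_cancel₀ _ hdt.ne', one_mul] at h8
      linarith
    have h0 : 0 < |p.1 - p.2| := hdt.trans_le hd
    have h9 : 0 < √|p.1 - p.2| := Real.sqrt_pos.2 h0
    have hK4 := K4_nonneg
    rw [slobK, ← ofReal_mul (by positivity), ← ofReal_mul (by positivity)]
    refine ofReal_le_ofReal ?_
    calc ((p.1 - p.2) ^ 2 * √|p.1 - p.2|)⁻¹ * (IsGaussSeq.K4 * (|(⌊p.1 / (T / N)⌋₊ : ℝ) - ⌊p.2 / (T / N)⌋₊| * (T / N * Q)) ^ 2)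
        = (|p.1 - p.2| ^ 2 * √|p.1 - p.2|)⁻¹ * (IsGaussSeq.K4 * ((|(⌊p.1 / (T / N)⌋₊ : ℝ) - ⌊p.2 / (T / N)⌋₊| * (T / N)) * Q) ^ 2) := by
          rw [sq_abs, mul_assoc _ (T / N : ℝ) Q]
      _ ≤ (|p.1 - p.2| ^ 2 * √|p.1 - p.2|)⁻¹ * (IsGaussSeq.K4 * ((2 * |p.1 - p.2|) * Q) ^ 2) := by gcongr
      _ = _ := by field_simp; ring
  · have e1 : slobN (T / N) (p.1 - p.2) = 0 := if_neg hd
    simp [e1]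

end

/-! ### Passage to the limit along a fixed path -/

section
variable (T : ℝ) (Gi : ℕ → L2 D) (θ : ℝ) (m0 : L2 D)

/-- The magnetization at time `t`. -/
def mS (N : ℕ) (a : ℕ → L2 D) (t : ℝ) : L2 D := iterSeq Gi θ (T / N) m0 a ⌊t / (T / N)⌋₊

/-- The difference quotient, without its stochastic part. -/
def zS (N : ℕ) (a : ℕ → L2 D) (n : ℕ) : L2 D := (T / N : ℝ)⁻¹ • remS Gi θ (T / N) m0 a n

/-- The class in `L²(0,T)` of the step function of time with values `c n`. -/
def tS (N : ℕ) {F : Type*} [NormedAddCommGroup F] (c : ℕ → F) :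
    Lp F 2 (ℐ T) := stepL (ℐ T) (tI T N) N c

/-- The step function of time `X_N`. -/
def xS (N : ℕ) (a : ℕ → L2 D) : L2T T D :=
  stepL (ℐ T) (fun n => Ici (((n : ℝ) + 1) * (T / N))) N fun n =>
    crt (iterSeq Gi θ (T / N) m0 a n) (a n)

/-- The properties of the paths of the scheme, along a sequence of time steps, that are used to
identify the limit. -/
structure LimitData (Cs Cb : ℝ) (N : ℕ → ℕ) (a : ℕ → ℕ → L2 D) (m X : L2T T D) (χ : ℕ → L2 D) : Prop where
  T_pos : 0 < T
  N_pos : ∀ k, 0 < N k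
  N_top : Tendsto N atTop atTop
  scheme : ∀ k, SchemeData Gi θ (T / N k) m0 Cs Cb
  energy : ∃ C, ∀ k, SchemeData.energyF Gi θ (T / N k) m0 (N k) (a k) ≤ C
  memH2 : ∀ k, ∀ n < N k, MemH2 (a k n)
  four : Tendsto (fun k => ∑ n ∈ Finset.range (N k), ‖a k n‖ ^ 4) atTop (𝓝 0)
  chi_le : ∀ j, ∀ᵐ x ∂ℒ D, ‖χ j x‖ ≤ 1
  chi_total : ∀ f : L2 D, (∀ j, inner ℝ (χ j) f = 0) → f = 0
  defect : ∀ j, Tendsto (fun k => SchemeData.defF Gi θ (T / N k) m0 (χ j) (N k) (a k)) atTop (𝓝 0)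
  lim_m : Tendsto (fun k => tS T (N k) (iterSeq Gi θ (T / N k) m0 (a k))) atTop (𝓝 m)
  lim_X : Tendsto (fun k => xS T Gi θ m0 (N k) (a k)) atTop (𝓝 X)
  holder : ∃ C : ENNReal, C ≠ ⊤ ∧ ∀ k, holderF T Gi θ m0 (N k) (a k) ≤ C
end

variable {T : ℝ} {Gi : ℕ → L2 D} {θ : ℝ} {m0 : L2 D} {Cs Cb : ℝ}

theorem tS_ae (hT : 0 < T) {N : ℕ} (hN : 0 < N) {F : Type*} [NormedAddCommGroup F] (c : ℕ → F) :
    tS T N c =ᵐ[ℐ T] fun t => c ⌊t / (T / N)⌋₊ := stepL_floor hT hN c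

theorem norm_tS_sq (hT : 0 < T) {N : ℕ} (hN : 0 < N) {F : Type*} [NormedAddCommGroup F]
    [InnerProductSpace ℝ F] (c : ℕ → F) :
    ‖tS T N c‖ ^ 2 = T / N * ∑ n ∈ Finset.range N, ‖c n‖ ^ 2 := norm_stepL_sq hT hN c

theorem xS_ae (hT : 0 < T) {N : ℕ} (hN : 0 < N) (a : ℕ → L2 D) :
    xS T Gi θ m0 N a =ᵐ[ℐ T] fun t =>
      SchemeData.XS Gi θ (T / N) m0 a ⌊t / (T / N)⌋₊ := by
  have hdt : 0 < T / N := by positivity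
  filter_upwards [coeFn_stepL (μ := ℐ T)
    (I := fun n => Ici (((n : ℝ) + 1) * (T / N))) (fun n => measurableSet_Ici) N
      (fun n => crt (iterSeq Gi θ (T / N) m0 a n) (a n)), ae_floor_mem hT hN] with t h1 ⟨h2, h3, h4⟩
  unfold xS
  rw [h1, SchemeData.XS, ← Finset.sum_subset (Finset.range_mono h4.le)]
  · refine Finset.sum_congr rfl fun n hn => indicator_of_mem ?_ _
    have h5 : n + 1 ≤ ⌊t / (T / N)⌋₊ := Finset.mem_range.1 hn
    have h6 := (Nat.le_floor_iff (by positivity)).1 h5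
    rw [le_div_iff₀ hdt] at h6
    simpa using h6
  · intro n _ hn
    refine indicator_of_notMem (fun h5 => hn (Finset.mem_range.2 ?_)) _
    refine Nat.lt_of_succ_le (Nat.le_floor ?_)
    rw [le_div_iff₀ hdt]
    simpa using h5

namespace LimitData
variable {N : ℕ → ℕ} {a : ℕ → ℕ → L2 D} {m X : L2T T D} {χ : ℕ → L2 D}

theorem comp (L : LimitData T Gi θ m0 Cs Cb N a m X χ) {ψ : ℕ → ℕ} (hψ : StrictMono ψ) :
    LimitData T Gi θ m0 Cs Cb (N ∘ ψ) (a ∘ ψ) m X χ where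
  T_pos := L.T_pos
  N_pos k := L.N_pos (ψ k)
  N_top := L.N_top.comp hψ.tendsto_atTop
  scheme k := L.scheme (ψ k)
  energy := let ⟨C, h⟩ := L.energy; ⟨C, fun k => h (ψ k)⟩
  memH2 k := L.memH2 (ψ k)
  four := L.four.comp hψ.tendsto_atTop
  chi_le := L.chi_le
  chi_total := L.chi_total
  defect j := (L.defect j).comp hψ.tendsto_atTop
  lim_m := L.lim_m.comp hψ.tendsto_atTop
  lim_X := L.lim_X.comp hψ.tendsto_atTop
  holder := let ⟨C, h0, h⟩ := L.holder; ⟨C, h0, fun k => h (ψ k)⟩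

theorem tendsto_dt (L : LimitData T Gi θ m0 Cs Cb N a m X χ) :
    Tendsto (fun k => T / N k) atTop (𝓝 0) :=
  tendsto_const_nhds.div_atTop (tendsto_natCast_atTop_atTop.comp L.N_top)

/-- The energy bounds. -/
theorem bounds (L : LimitData T Gi θ m0 Cs Cb N a m X χ) : ∃ C : ℝ, 0 ≤ C ∧ ∀ k,
    T / N k * ∑ n ∈ Finset.range (N k), dir (iterSeq Gi θ (T / N k) m0 (a k) n) ≤ C ∧
    ∑ n ∈ Finset.range (N k), dir (incS Gi θ (T / N k) m0 (a k) n) ≤ C ∧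
    ∑ n ∈ Finset.range (N k), ‖remS Gi θ (T / N k) m0 (a k) n‖ ^ 2 ≤ T / N k * C ∧
    ∑ n ∈ Finset.range (N k), sqH2 (a k n) ≤ C := by
  obtain ⟨C, hC⟩ := L.energy
  have hθ := (L.scheme 0).theta.1
  have hθ1 : 0 < 2 * θ - 1 := by linarith
  have key : ∀ k, 0 ≤ T / N k * ∑ n ∈ Finset.range (N k), dir (iterSeq Gi θ (T / N k) m0 (a k) n) ∧
      0 ≤ ∑ n ∈ Finset.range (N k), dir (incS Gi θ (T / N k) m0 (a k) n) ∧
      0 ≤ ∑ n ∈ Finset.range (N k), ‖remS Gi θ (T / N k) m0 (a k) n‖ ^ 2 ∧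
      0 ≤ ∑ n ∈ Finset.range (N k), sqH2 (a k n) ∧
      T / N k * ∑ n ∈ Finset.range (N k), dir (iterSeq Gi θ (T / N k) m0 (a k) n) +
      ((2 * θ - 1) / 2 * ∑ n ∈ Finset.range (N k), dir (incS Gi θ (T / N k) m0 (a k) n) +
      (∑ n ∈ Finset.range (N k), ‖remS Gi θ (T / N k) m0 (a k) n‖ ^ 2) / (2 * (T / N k))) +
      ∑ n ∈ Finset.range (N k), sqH2 (a k n) ≤ C := fun k => by
    have h := hC k
    have hdt := (L.scheme k).dt_pos
    simp only [SchemeData.energyF, SchemeData.diss, Finset.sum_add_distrib, ← Finset.mul_sum,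
      ← Finset.sum_div] at h
    exact ⟨mul_nonneg hdt.le (Finset.sum_nonneg fun _ _ => dir_nonneg _),
      Finset.sum_nonneg fun _ _ => dir_nonneg _, Finset.sum_nonneg fun _ _ => sq_nonneg _,
      Finset.sum_nonneg fun _ _ => sqH2_nonneg _, h⟩
  have hC0 : 0 ≤ C := by
    obtain ⟨h1, h2, h3, h4, h5⟩ := key 0
    have hdt := (L.scheme 0).dt_pos
    have := mul_nonneg (by linarith : 0 ≤ (2 * θ - 1) / 2) h2
    have := div_nonneg h3 (by linarith : 0 ≤ 2 * (T / N 0))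
    linarith
  have e1 : 2 / (2 * θ - 1) * C ≤ 2 / (2 * θ - 1) * C + 2 * C := by linarith
  have e2 : 0 ≤ 2 / (2 * θ - 1) * C := by positivity
  refine ⟨2 / (2 * θ - 1) * C + 2 * C, by linarith, fun k => ?_⟩
  obtain ⟨h1, h2, h3, h4, h5⟩ := key k
  have hdt := (L.scheme k).dt_pos
  have h6 := mul_nonneg (by linarith : 0 ≤ (2 * θ - 1) / 2) h2
  have h7 := div_nonneg h3 (by linarith : 0 ≤ 2 * (T / N k))
  refine ⟨by linarith, ?_, ?_, by linarith⟩
  · refine le_trans ?_ e1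
    rw [div_mul_eq_mul_div, le_div_iff₀ hθ1]
    linarith
  · have h8 : (∑ n ∈ Finset.range (N k), ‖remS Gi θ (T / N k) m0 (a k) n‖ ^ 2) / (2 * (T / N k)) ≤ C := by
      linarith
    rw [div_le_iff₀ (by linarith)] at h8
    nlinarith [mul_nonneg hdt.le e2]

end LimitData

theorem exists_subseq_ae {α F : Type*} [MeasurableSpace α] [NormedAddCommGroup F] {μ : Measure α}
    {f : ℕ → Lp F 2 μ} {g : Lp F 2 μ} (h : Tendsto f atTop (𝓝 g)) :
    ∃ ψ : ℕ → ℕ, StrictMono ψ ∧ ∀ᵐ t ∂μ, Tendsto (fun k => f (ψ k) t) atTop (𝓝 (g t)) :=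
  (tendstoInMeasure_of_tendsto_Lp h).exists_seq_tendsto_ae

/-- The consequences of `LimitData` for a suitable subsequence: almost everywhere convergence of
the magnetization and weak convergence of its gradients and of its difference quotients. -/
structure WeakData (T : ℝ) (Gi : ℕ → L2 D) (θ : ℝ) (m0 : L2 D) (Cs Cb : ℝ) (N : ℕ → ℕ)
    (a : ℕ → ℕ → L2 D) (m X : L2T T D) (χ : ℕ → L2 D) (z : L2T T D) (g : Fin 3 → L2T T D) : Prop
    extends LimitData T Gi θ m0 Cs Cb N a m X χ where
  ae_m : ∀ᵐ t ∂ℐ T,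
    Tendsto (fun k => mS T Gi θ m0 (N k) (a k) t) atTop (𝓝 (m t))
  ae_X : ∀ᵐ t ∂ℐ T,
    Tendsto (fun k => SchemeData.XS Gi θ (T / N k) m0 (a k) ⌊t / (T / N k)⌋₊) atTop (𝓝 (X t))
  weak_z : WeakTendsto (fun k => tS T (N k) (zS T Gi θ m0 (N k) (a k))) z
  bdd_z : ∃ C, ∀ k, ‖tS T (N k) (zS T Gi θ m0 (N k) (a k))‖ ≤ C
  weak_g : ∀ j, WeakTendsto (fun k => tS T (N k) fun n =>
    weakPartial j (iterSeq Gi θ (T / N k) m0 (a k) n)) (g j)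
  bdd_g : ∀ j, ∃ C, ∀ k, ‖tS T (N k) fun n => weakPartial j (iterSeq Gi θ (T / N k) m0 (a k) n)‖ ≤ C
  mem : ∀ᵐ t ∂ℐ T, m t ∈ sphereH1 D
  g_eq : ∀ᵐ t ∂ℐ T, ∀ j, g j t = weakPartial j (m t)

theorem isClosed_unit : IsClosed {m : L2 D | ∀ᵐ x ∂ℒ D, ‖m x‖ = 1} := by
  refine isClosed_of_closure_subset fun m hm => ?_
  obtain ⟨u, hu, hl⟩ := mem_closure_iff_seq_limit.1 hm
  obtain ⟨ψ, -, h⟩ := exists_subseq_ae hl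
  filter_upwards [h, ae_all_iff.2 fun k => hu (ψ k)] with x h1 h2
  refine tendsto_nhds_unique h1.norm ?_
  simp only [h2]
  exact tendsto_const_nhds

theorem compLp_tS {N : ℕ} {E F : Type*} [NormedAddCommGroup E] [NormedSpace ℝ E]
    [NormedAddCommGroup F] [NormedSpace ℝ F] (hT : 0 < T) (hN : 0 < N) (A : E →L[ℝ] F) (c : ℕ → E) :
    A.compLp (tS T N c) = tS T N fun n => A (c n) := by
  refine Lp.ext ?_
  filter_upwards [A.coeFn_compLp (tS T N c), tS_ae hT hN c, tS_ae hT hN fun n => A (c n)] with t h1 h2 h3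
  rw [h1, h2, h3]

theorem LimitData.exists_weakData {N : ℕ → ℕ} {a : ℕ → ℕ → L2 D} {m X : L2T T D} {χ : ℕ → L2 D}
    (L : LimitData T Gi θ m0 Cs Cb N a m X χ) :
    ∃ (N' : ℕ → ℕ) (a' : ℕ → ℕ → L2 D) (z : L2T T D) (g : Fin 3 → L2T T D),
      WeakData T Gi θ m0 Cs Cb N' a' m X χ z g := by
  have hT := L.T_pos
  have hD := (L.scheme 0).isOpen
  obtain ⟨C, hC0, hC⟩ := L.bounds
  have bz : ∀ k, ‖tS T (N k) (zS T Gi θ m0 (N k) (a k))‖ ≤ √C := fun k => by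
    have hdt := (L.scheme k).dt_pos
    refine Real.le_sqrt_of_sq_le ?_
    rw [norm_tS_sq hT (L.N_pos k)]
    simp only [zS, norm_smul, mul_pow, ← Finset.mul_sum]
    have h1 := (hC k).2.2.1
    rw [norm_inv, Real.norm_of_nonneg hdt.le]
    calc T / N k * ((T / N k)⁻¹ ^ 2 * ∑ n ∈ Finset.range (N k), ‖remS Gi θ (T / N k) m0 (a k) n‖ ^ 2)
        ≤ T / N k * ((T / N k)⁻¹ ^ 2 * (T / N k * C)) := by gcongr
      _ = C := (show ∀ d : ℝ, 0 < d → d * (d⁻¹ ^ 2 * (d * C)) = C from fun d hd => by field_simp) _ hdt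
  have bG : ∀ j k, ‖tS T (N k) fun n => weakPartial j (iterSeq Gi θ (T / N k) m0 (a k) n)‖ ≤ √C := fun j k => by
    have hdt := (L.scheme k).dt_pos
    refine Real.le_sqrt_of_sq_le ?_
    rw [norm_tS_sq hT (L.N_pos k)]
    refine le_trans ?_ (hC k).1
    gcongr with n _
    rw [((L.scheme k).mem (a k) n).1.dir_eq hD]
    exact Finset.single_le_sum (f := fun j => ‖weakPartial j (iterSeq Gi θ (T / N k) m0 (a k) n)‖ ^ 2)
      (fun _ _ => sq_nonneg _) (Finset.mem_univ j)
  have bU : ∀ k, ‖tS T (N k) fun n => ((L.scheme k).mem (a k) n).1.lift‖ ≤ √(T * volume.real D + C) := fun k => by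
    refine Real.le_sqrt_of_sq_le ?_
    rw [norm_tS_sq hT (L.N_pos k)]
    have e : ∀ n, ‖((L.scheme k).mem (a k) n).1.lift‖ ^ 2 =
        volume.real D + dir (iterSeq Gi θ (T / N k) m0 (a k) n) := fun n => by
      rw [H1.norm_sq_eq, MemH1.val_lift, norm_sq_of_unit ((L.scheme k).mem (a k) n).2,
        ((L.scheme k).mem (a k) n).1.dir_eq hD]
      rfl
    simp only [e, Finset.sum_add_distrib, Finset.sum_const, Finset.card_range, nsmul_eq_mul, mul_add]
    have hN : (0 : ℝ) < N k := by exact_mod_cast L.N_pos k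
    have e2 : T / N k * (N k * volume.real D) = T * volume.real D := by field_simp
    rw [e2]
    linarith [(hC k).1]
  obtain ⟨z, ψ1, hψ1, -, hz⟩ := exists_weak_limit bz
  obtain ⟨U, ψ2, hψ2, -, hU⟩ := exists_weak_limit
    (H := Lp (H1 D) 2 (ℐ T)) fun k => bU (ψ1 k)
  obtain ⟨ψ3, hψ3, hm⟩ := exists_subseq_ae (L.lim_m.comp (hψ1.comp hψ2).tendsto_atTop)
  obtain ⟨ψ4, hψ4, hX⟩ := exists_subseq_ae (L.lim_X.comp ((hψ1.comp hψ2).comp hψ3).tendsto_atTop)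
  have hU' : WeakTendsto (fun k => tS T (N (ψ1 (ψ2 k))) fun n => ((L.scheme (ψ1 (ψ2 k))).mem (a (ψ1 (ψ2 k))) n).1.lift) U := hU
  have L' := L.comp (((hψ1.comp hψ2).comp hψ3).comp hψ4)
  have hJ : (H1.val (D := D)).compLp U = m := by
    have h1 := hU'.map ((H1.val (D := D)).compLpL 2 (ℐ T))
    refine h1.unique (Tendsto.congr (fun k => ?_) (L.lim_m.comp (hψ1.comp hψ2).tendsto_atTop))
    refine Eq.trans ?_ (compLp_tS hT (L.N_pos _) _ _).symm
    simp only [Function.comp_def, MemH1.val_lift]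
  have hJ' : ∀ᵐ t ∂ℐ T, m t = H1.val (U t) := by
    rw [← hJ]; exact ContinuousLinearMap.coeFn_compLp _ _
  have hg : ∀ j, WeakTendsto (fun k => tS T (N (ψ1 (ψ2 k))) fun n =>
      weakPartial j (iterSeq Gi θ (T / N (ψ1 (ψ2 k))) m0 (a (ψ1 (ψ2 k))) n)) ((H1.grad (D := D) j).compLp U) := fun j => by
    have h1 := hU'.map ((H1.grad (D := D) j).compLpL 2 (ℐ T))
    have e : (fun k => tS T (N (ψ1 (ψ2 k))) fun n =>
      weakPartial j (iterSeq Gi θ (T / N (ψ1 (ψ2 k))) m0 (a (ψ1 (ψ2 k))) n)) = fun k =>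
      (H1.grad (D := D) j).compLpL 2 (ℐ T) (tS T (N (ψ1 (ψ2 k))) fun n => ((L.scheme (ψ1 (ψ2 k))).mem (a (ψ1 (ψ2 k))) n).1.lift) := by
      ext1 k
      refine Eq.trans ?_ (compLp_tS hT (L.N_pos _) _ _).symm
      simp only [MemH1.grad_lift]
    rw [e]; exact h1
  have hmt : ∀ᵐ t ∂ℐ T, Tendsto (fun k => mS T Gi θ m0
      (N (ψ1 (ψ2 (ψ3 (ψ4 k))))) (a (ψ1 (ψ2 (ψ3 (ψ4 k))))) t) atTop (𝓝 (m t)) := by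
    filter_upwards [hm, ae_all_iff.2 fun k => tS_ae hT (L.N_pos (ψ1 (ψ2 (ψ3 k))))
      (iterSeq Gi θ (T / N (ψ1 (ψ2 (ψ3 k)))) m0 (a (ψ1 (ψ2 (ψ3 k)))))] with t h1 h2
    have h3 := h1.comp hψ4.tendsto_atTop
    refine h3.congr fun k => ?_
    simp only [Function.comp_def]
    rw [h2]; rfl
  refine ⟨_, _, z, fun j => (H1.grad (D := D) j).compLp U, L', hmt, ?_, ?_, ?_, ?_, ?_, ?_, ?_⟩
  · filter_upwards [hX, ae_all_iff.2 fun k => xS_ae (Gi := Gi) (θ := θ) (m0 := m0) hT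
      (L.N_pos (ψ1 (ψ2 (ψ3 k)))) (a (ψ1 (ψ2 (ψ3 k))))] with t h1 h2
    refine h1.congr fun k => ?_
    simp only [Function.comp_def]
    rw [h2]
  · have h1 : WeakTendsto (fun k => tS T (N (ψ1 k)) (zS T Gi θ m0 (N (ψ1 k)) (a (ψ1 k)))) z := hz
    exact h1.comp ((hψ2.comp hψ3).comp hψ4)
  · exact ⟨√C, fun k => bz _⟩
  · exact fun j => (hg j).comp (hψ3.comp hψ4)
  · exact fun j => ⟨√C, fun k => bG j _⟩
  · filter_upwards [hJ', hmt] with t h1 h2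
    refine ⟨h1 ▸ H1.memH1 _, isClosed_unit.mem_of_tendsto h2 (Eventually.of_forall fun k => ?_)⟩
    exact ((L.scheme _).mem _ _).2
  · filter_upwards [hJ', ae_all_iff.2 fun j => ContinuousLinearMap.coeFn_compLp (H1.grad (D := D) j) U] with t h1 h2 j
    rw [h2, h1, H1.weakPartial_val hD]

/-! ### The equation of the drift -/

theorem ae_eq_zero_of_tendsto {α : Type*} [MeasurableSpace α] {μ : Measure α} {h : α → ℝ}
    (hi : Integrable h μ) {u : ℕ → α → ℝ} {ε : ℕ → ℝ} (hε : Tendsto ε atTop (𝓝 0))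
    (hlim : ∀ E, MeasurableSet E → Tendsto (fun k => ∫ t in E, u k t ∂μ) atTop (𝓝 (∫ t in E, h t ∂μ)))
    (hle : ∀ k E, MeasurableSet E → |∫ t in E, u k t ∂μ| ≤ ε k) : h =ᵐ[μ] 0 := by
  refine hi.ae_eq_zero_of_forall_setIntegral_eq_zero fun E hE _ => ?_
  exact tendsto_nhds_unique (hlim E hE) (squeeze_zero_norm (fun k => hle k E hE) hε)

theorem abs_setIntegral_le {α : Type*} [MeasurableSpace α] {μ : Measure α} {u b : α → ℝ}
    (hb : Integrable b μ) (hle : ∀ᵐ t ∂μ, |u t| ≤ b t) (E : Set α) :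
    |∫ t in E, u t ∂μ| ≤ ∫ t, b t ∂μ := by
  refine (norm_integral_le_of_norm_le (f := u) hb.integrableOn (ae_restrict_of_ae hle)).trans ?_
  exact setIntegral_le_integral hb (hle.mono fun t h => (abs_nonneg _).trans h)

theorem memLp_const_add_norm {α F : Type*} [MeasurableSpace α] [NormedAddCommGroup F] {μ : Measure α}
    [IsFiniteMeasure μ] (c : ℝ) (f : Lp F 2 μ) : MemLp (fun t => c + ‖f t‖) 2 μ := by
  have h1 : MemLp (fun _ : α => c) 2 μ := memLp_const c
  have h2 : MemLp (fun t => ‖f t‖) 2 μ := (Lp.memLp f).norm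
  have h3 := h1.add h2
  exact h3

theorem aesm_crt {α : Type*} [MeasurableSpace α] {μ : Measure α} {u v : α → L2 D}
    (hu : AEStronglyMeasurable u μ) (hv : AEStronglyMeasurable v μ) :
    AEStronglyMeasurable (fun t => crt (u t) (v t)) μ := by
  have := (continuous_crt (D := D)).comp_aestronglyMeasurable (hu.prodMk hv)
  simpa only [Function.comp_def] using this

theorem tendsto_crt {u v : ℕ → L2 D} {u' v' : L2 D} (hu : Tendsto u atTop (𝓝 u'))
    (hv : Tendsto v atTop (𝓝 v')) : Tendsto (fun k => crt (u k) (v k)) atTop (𝓝 (crt u' v')) := by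
  have := ((continuous_crt (D := D)).tendsto (u', v')).comp (hu.prodMk_nhds hv)
  simpa only [Function.comp_def] using this

theorem tendsto_nrm {u v : ℕ → L2 D} {u' v' : L2 D} (hu : Tendsto u atTop (𝓝 u'))
    (hv : Tendsto v atTop (𝓝 v')) : Tendsto (fun k => nrm (u k) (v k)) atTop (𝓝 (nrm u' v')) := by
  simp only [nrm_apply]
  exact hv.add (tendsto_crt hu (tendsto_crt hu hv))

variable {T : ℝ} {Gi : ℕ → L2 D} {θ : ℝ} {m0 : L2 D} {Cs Cb : ℝ}

theorem SchemeData.tang_remS {dt : ℝ} (S : SchemeData Gi θ dt m0 Cs Cb) (a : ℕ → L2 D) (n : ℕ) :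
    Tang (iterSeq Gi θ dt m0 a n) (remS Gi θ dt m0 a n) :=
  Tang.sub (S.isIncrement a n).1.2 (Tang.crt (sphereH1.le_one (S.mem a n)))

theorem aesm_mS (N : ℕ) (a : ℕ → L2 D) (μ : Measure ℝ) : AEStronglyMeasurable (mS T Gi θ m0 N a) μ :=
  (stronglyMeasurable_floor (iterSeq Gi θ (T / N) m0 a) (T / N)).aestronglyMeasurable

namespace WeakData
variable {N : ℕ → ℕ} {a : ℕ → ℕ → L2 D} {m X : L2T T D} {χ : ℕ → L2 D} {z : L2T T D} {g : Fin 3 → L2T T D}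

theorem mem_mS (W : WeakData T Gi θ m0 Cs Cb N a m X χ z g) (k : ℕ) (t : ℝ) :
    mS T Gi θ m0 (N k) (a k) t ∈ sphereH1 D := (W.scheme k).mem _ _

theorem nrm_z (W : WeakData T Gi θ m0 Cs Cb N a m X χ z g) :
    ∀ᵐ t ∂ℐ T, nrm (m t) (z t) = 0 := by
  have h1 : ∀ j, ∀ᵐ t ∂ℐ T,
      inner ℝ (z t) (nrm (m t) (TopologicalSpace.denseSeq (L2 D) j)) = 0 := fun j => by
    obtain ⟨f, hf⟩ : ∃ f, f = TopologicalSpace.denseSeq (L2 D) j := ⟨_, rfl⟩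
    rw [← hf]
    obtain ⟨C, hC⟩ := W.bdd_z
    have hm : ∀ k, AEStronglyMeasurable (fun t => nrm (mS T Gi θ m0 (N k) (a k) t) f)
        (ℐ T) := fun k => by
      simp only [nrm_apply]
      have h := aesm_crt (aesm_mS (T := T) (Gi := Gi) (θ := θ) (m0 := m0) (N k) (a k)
        (ℐ T)) (aestronglyMeasurable_const (b := f))
      exact aestronglyMeasurable_const.add (aesm_crt (aesm_mS _ _ _) h)
    have hlim : ∀ᵐ t ∂ℐ T,
        Tendsto (fun k => nrm (mS T Gi θ m0 (N k) (a k) t) f) atTop (𝓝 (nrm (m t) f)) := by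
      filter_upwards [W.ae_m] with t h
      exact tendsto_nrm h tendsto_const_nhds
    have hle : ∀ k, ∀ᵐ t ∂ℐ T,
      ‖nrm (mS T Gi θ m0 (N k) (a k) t) f‖ ≤ 2 * ‖f‖ := fun k => Eventually.of_forall fun t => norm_nrm_le _ _
    have hb : MemLp (fun _ : ℝ => 2 * ‖f‖) 2 (ℐ T) := memLp_const _
    refine ae_eq_zero_of_tendsto (W.weak_z.integral_inner hC hm hb hle hlim).2.1 tendsto_const_nhds
      (fun E hE => W.weak_z.setIntegral_inner hC hm hb hle hlim hE) fun k E _ => ?_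
    rw [integral_eq_zero_of_ae, abs_zero]
    refine ae_restrict_of_ae ?_
    filter_upwards [tS_ae W.T_pos (W.N_pos k) (zS T Gi θ m0 (N k) (a k))] with t h
    have h2 := (nrm_eq_zero_iff (W.mem_mS k t).2 _).2 ((W.scheme k).tang_remS (a k) ⌊t / (T / N k)⌋₊)
    rw [h, zS, real_inner_smul_left, ← inner_nrm_left, h2, inner_zero_left, mul_zero, Pi.zero_apply]
  filter_upwards [ae_all_iff.2 h1] with t h
  have h2 : ∀ f, inner ℝ (z t) (nrm (m t) f) = 0 := fun f => by
    refine (TopologicalSpace.denseRange_denseSeq (L2 D)).induction_on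
      (p := fun f => inner ℝ (z t) (nrm (m t) f) = 0) f (isClosed_eq ?_ continuous_const) h
    exact Continuous.inner continuous_const (nrm (m t)).continuous
  refine ext_inner_right ℝ fun f => ?_
  rw [inner_nrm_left, inner_zero_left]
  exact h2 f

/-- The limit of the weak gradients of the test functions. -/
def dΨ (m : L2T T D) (g : Fin 3 → L2T T D) (ψ : L2 D) (j : Fin 3) (t : ℝ) : L2 D :=
  crt (m t) (weakPartial j ψ) - crt ψ (g j t)

/-- The function `m × Ψ + m × (m × Ψ)`. -/
def rot (m Ψ : L2 D) : L2 D := crt m Ψ + crt m (crt m Ψ)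

theorem norm_rot_le (m Ψ : L2 D) : ‖rot m Ψ‖ ≤ 2 * ‖Ψ‖ := by
  have h1 := norm_add_le (crt m Ψ) (crt m (crt m Ψ))
  have h2 := norm_crt_le m Ψ
  have h3 := norm_crt_le m (crt m Ψ)
  unfold rot
  linarith

theorem error_bound {θ δ : ℝ} (hθ : 0 ≤ θ ∧ θ ≤ 1) (hδ : 0 < δ) {ι : Type*} (s : Finset ι) (v m b : ι → ℝ)
    (p : ι → ℝ) (hp : ∀ i, |p i| ≤ v i * (b i + m i)) :
    |-(2 * θ * ∑ i ∈ s, p i)| ≤ δ⁻¹ * ∑ i ∈ s, v i ^ 2 + 2 * δ * (∑ i ∈ s, b i ^ 2 + ∑ i ∈ s, m i ^ 2) := by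
  have h1 : ∀ i, 2 * (v i * (b i + m i)) ≤ δ⁻¹ * v i ^ 2 + 2 * δ * (b i ^ 2 + m i ^ 2) := fun i => by
    have h2 : 0 ≤ δ⁻¹ * (v i - δ * (b i + m i)) ^ 2 := by positivity
    have h3 : δ⁻¹ * (v i - δ * (b i + m i)) ^ 2 =
      δ⁻¹ * v i ^ 2 - 2 * (v i * (b i + m i)) + δ * (b i + m i) ^ 2 := by field_simp; ring
    nlinarith [mul_nonneg hδ.le (sq_nonneg (b i - m i))]
  rw [abs_neg, abs_mul, abs_of_nonneg (by linarith [hθ.1] : 0 ≤ 2 * θ), ← Finset.sum_add_distrib, Finset.mul_sum,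
    Finset.mul_sum, ← Finset.sum_add_distrib]
  calc 2 * θ * |∑ i ∈ s, p i| ≤ 2 * ∑ i ∈ s, |p i| := by
        have h4 := Finset.abs_sum_le_sum_abs p s
        have h5 := abs_nonneg (∑ i ∈ s, p i)
        nlinarith [hθ.2]
    _ = ∑ i ∈ s, 2 * |p i| := Finset.mul_sum _ _ _
    _ ≤ _ := Finset.sum_le_sum fun i _ => by
        have := hp i
        have := h1 i
        linarith

theorem norm_dcr_le (k : Fin 3) (m ψ : L2 D) : ‖dcr k m ψ‖ ≤ ‖weakPartial k ψ‖ + ‖weakPartial k m‖ :=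
  (norm_sub_le _ _).trans (add_le_add (norm_crt_le _ _) (norm_crt_le _ _))

set_option maxHeartbeats 400000 in
theorem drift_identity (W : WeakData T Gi θ m0 Cs Cb N a m X χ z g) {ψ : L2 D} (hψ : MemH1 ψ)
    (bψ : ∀ᵐ x ∂ℒ D, ‖ψ x‖ ≤ 1) : ∀ᵐ t ∂ℐ T,
      inner ℝ (z t) (rot (m t) (crt (m t) ψ)) + 2 * ∑ j, inner ℝ (g j t) (crt (m t) (dΨ m g ψ j t)) -
        (1 / 2) * inner ℝ (Sop Gi (m t)) (rot (m t) (crt (m t) ψ)) = 0 := by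
  have hD := (W.scheme 0).isOpen
  have hT := W.T_pos
  obtain ⟨C, hC0, hC⟩ := W.bounds
  obtain ⟨Cz, hCz⟩ := W.bdd_z
  choose Cg hCg using W.bdd_g
  have hmm : AEStronglyMeasurable m (ℐ T) := Lp.aestronglyMeasurable m
  have mΨ : AEStronglyMeasurable (fun t => crt (m t) ψ) (ℐ T) :=
    aesm_crt hmm aestronglyMeasurable_const
  have mF : ∀ k, AEStronglyMeasurable (fun t => rot (mS T Gi θ m0 (N k) (a k) t) (crt (m t) ψ))
      (ℐ T) := fun k => by
    have h := aesm_crt (aesm_mS (T := T) (Gi := Gi) (θ := θ) (m0 := m0) (N k) (a k) _) mΨ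
    exact h.add (aesm_crt (aesm_mS _ _ _) h)
  have bF : ∀ k t, ‖rot (mS T Gi θ m0 (N k) (a k) t) (crt (m t) ψ)‖ ≤ 2 * ‖ψ‖ := fun k t =>
    (norm_rot_le _ _).trans (by linarith [norm_crt_le (m t) ψ])
  have lF : ∀ᵐ t ∂ℐ T, Tendsto (fun k =>
      rot (mS T Gi θ m0 (N k) (a k) t) (crt (m t) ψ)) atTop (𝓝 (rot (m t) (crt (m t) ψ))) := by
    filter_upwards [W.ae_m] with t h
    have h1 := tendsto_crt h (tendsto_const_nhds (x := crt (m t) ψ))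
    exact h1.add (tendsto_crt h h1)
  have hbF : MemLp (fun _ : ℝ => 2 * ‖ψ‖) 2 (ℐ T) := memLp_const _
  have mdΨ : ∀ j, AEStronglyMeasurable (dΨ m g ψ j) (ℐ T) := fun j =>
    (aesm_crt hmm aestronglyMeasurable_const).sub (aesm_crt aestronglyMeasurable_const (Lp.aestronglyMeasurable (g j)))
  obtain ⟨b, hb⟩ : ∃ b : Fin 3 → ℝ → ℝ, b = fun j t => ‖weakPartial j ψ‖ + ‖g j t‖ := ⟨_, rfl⟩
  have hbm : ∀ j, MemLp (b j) 2 (ℐ T) := fun j => by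
    subst hb; exact memLp_const_add_norm _ (g j)
  have bdΨ : ∀ j t, ‖dΨ m g ψ j t‖ ≤ b j t := fun j t => by
    rw [hb]; exact (norm_sub_le _ _).trans (add_le_add (norm_crt_le _ _) (norm_crt_le _ _))
  have mH : ∀ j k, AEStronglyMeasurable (fun t => crt (mS T Gi θ m0 (N k) (a k) t) (dΨ m g ψ j t))
      (ℐ T) := fun j k => aesm_crt (aesm_mS _ _ _) (mdΨ j)
  have bH : ∀ j k, ∀ᵐ t ∂ℐ T,
      ‖crt (mS T Gi θ m0 (N k) (a k) t) (dΨ m g ψ j t)‖ ≤ b j t := fun j k =>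
    Eventually.of_forall fun t => (norm_crt_le _ _).trans (bdΨ j t)
  have lH : ∀ j, ∀ᵐ t ∂ℐ T, Tendsto (fun k =>
      crt (mS T Gi θ m0 (N k) (a k) t) (dΨ m g ψ j t)) atTop (𝓝 (crt (m t) (dΨ m g ψ j t))) := fun j => by
    filter_upwards [W.ae_m] with t h
    exact tendsto_crt h tendsto_const_nhds
  have hS := W.weak_z.integral_inner hCz mF hbF (fun k => Eventually.of_forall (bF k)) lF
  have hG := fun j => (W.weak_g j).integral_inner (hCg j) (mH j) (hbm j) (bH j) (lH j)
  -- the terms with the sum over the noise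
  have mSop : ∀ k, AEStronglyMeasurable (fun t => inner ℝ (Sop Gi (mS T Gi θ m0 (N k) (a k) t))
      (rot (mS T Gi θ m0 (N k) (a k) t) (crt (m t) ψ))) (ℐ T) := fun k =>
    ((W.scheme 0).sumBdd.continuous_Sop.comp_aestronglyMeasurable (aesm_mS _ _ _)).inner (mF k)
  have bSop : ∀ k t, ‖(inner ℝ (Sop Gi (mS T Gi θ m0 (N k) (a k) t))
      (rot (mS T Gi θ m0 (N k) (a k) t) (crt (m t) ψ)) : ℝ)‖ ≤ Cs * √(volume.real D) * (2 * ‖ψ‖) := fun k t => by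
    refine (norm_inner_le_norm _ _).trans (mul_le_mul ?_ (bF k t) (norm_nonneg _) ?_)
    · have h1 := (W.scheme 0).sumBdd.norm_Sop_le (mS T Gi θ m0 (N k) (a k) t)
      rwa [← Real.sqrt_sq (norm_nonneg (mS T Gi θ m0 (N k) (a k) t)),
        norm_sq_of_unit (W.mem_mS k t).2] at h1
    · exact mul_nonneg (W.scheme 0).sumBdd.nonneg (Real.sqrt_nonneg _)
  have lSop : ∀ᵐ t ∂ℐ T, Tendsto (fun k =>
      (inner ℝ (Sop Gi (mS T Gi θ m0 (N k) (a k) t)) (rot (mS T Gi θ m0 (N k) (a k) t) (crt (m t) ψ)) : ℝ))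
      atTop (𝓝 (inner ℝ (Sop Gi (m t)) (rot (m t) (crt (m t) ψ)))) := by
    filter_upwards [W.ae_m, lF] with t h h1
    exact (((W.scheme 0).sumBdd.continuous_Sop.tendsto _).comp h).inner h1
  have iSop : ∀ k, Integrable (fun t => (inner ℝ (Sop Gi (mS T Gi θ m0 (N k) (a k) t))
      (rot (mS T Gi θ m0 (N k) (a k) t) (crt (m t) ψ)) : ℝ)) (ℐ T) := fun k =>
    (integrable_const _).mono' (mSop k) (Eventually.of_forall (bSop k))
  have iSop' : Integrable (fun t => (inner ℝ (Sop Gi (m t)) (rot (m t) (crt (m t) ψ)) : ℝ))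
      (ℐ T) := by
    refine (integrable_const (Cs * √(volume.real D) * (2 * ‖ψ‖))).mono'
      (aestronglyMeasurable_of_tendsto_ae atTop mSop lSop) ?_
    filter_upwards [lSop] with t h
    exact le_of_tendsto h.norm (Eventually.of_forall fun k => bSop k t)
  obtain ⟨K, hK⟩ : ∃ K, K = ∫ t in Icc 0 T, ∑ j, b j t ^ 2 := ⟨_, rfl⟩
  have hε : Tendsto (fun k => √(T / N k) * (3 * C + 2 * K)) atTop (𝓝 0) := by
    have h1 := (Real.continuous_sqrt.tendsto 0).comp W.tendsto_dt
    simpa [Function.comp_def] using h1.mul_const (3 * C + 2 * K)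
  have I1 : ∀ (k : ℕ) (E : Set ℝ), IntegrableOn (fun t => ∑ j, (inner ℝ ((tS T (N k) fun n =>
      weakPartial j (iterSeq Gi θ (T / N k) m0 (a k) n)) t) (crt (mS T Gi θ m0 (N k) (a k) t) (dΨ m g ψ j t)) : ℝ))
      E (ℐ T) := fun k E => integrable_finsetSum _ fun j _ => ((hG j).1 k).integrableOn
  have I2 : ∀ (E : Set ℝ), IntegrableOn (fun t => ∑ j, (inner ℝ (g j t) (crt (m t) (dΨ m g ψ j t)) : ℝ))
      E (ℐ T) := fun E => integrable_finsetSum _ fun j _ => ((hG j).2.1).integrableOn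
  refine ae_eq_zero_of_tendsto (u := fun k t => inner ℝ (tS T (N k) (zS T Gi θ m0 (N k) (a k)) t)
      (rot (mS T Gi θ m0 (N k) (a k) t) (crt (m t) ψ)) +
      2 * ∑ j, inner ℝ ((tS T (N k) fun n => weakPartial j (iterSeq Gi θ (T / N k) m0 (a k) n)) t)
        (crt (mS T Gi θ m0 (N k) (a k) t) (dΨ m g ψ j t)) -
      1 / 2 * inner ℝ (Sop Gi (mS T Gi θ m0 (N k) (a k) t)) (rot (mS T Gi θ m0 (N k) (a k) t) (crt (m t) ψ)))
    ?_ hε ?_ ?_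
  · have := (integrable_finsetSum Finset.univ fun j _ => (hG j).2.1).const_mul 2
    exact (hS.2.1.add this).sub (iSop'.const_mul _)
  · intro E hE
    have e1 := W.weak_z.setIntegral_inner hCz mF hbF (fun k => Eventually.of_forall (bF k)) lF hE
    have e2 := fun j => (W.weak_g j).setIntegral_inner (hCg j) (mH j) (hbm j) (bH j) (lH j) hE
    have e3 : Tendsto (fun k => ∫ t in E, (inner ℝ (Sop Gi (mS T Gi θ m0 (N k) (a k) t))
        (rot (mS T Gi θ m0 (N k) (a k) t) (crt (m t) ψ)) : ℝ) ∂ℐ T) atTop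
        (𝓝 (∫ t in E, inner ℝ (Sop Gi (m t)) (rot (m t) (crt (m t) ψ)) ∂ℐ T)) :=
      tendsto_integral_of_dominated_convergence (fun _ => Cs * √(volume.real D) * (2 * ‖ψ‖))
        (fun k => (mSop k).restrict) (integrable_const _) (fun k => Eventually.of_forall (bSop k))
        (ae_restrict_of_ae lSop)
    have e4 := (e1.add ((tendsto_finsetSum Finset.univ fun j _ => e2 j).const_mul 2)).sub (e3.const_mul (1 / 2))
    refine Tendsto.congr (fun k => ?_) (e4.trans (le_of_eq (congrArg _ ?_)))
    · rw [integral_sub, integral_add, integral_const_mul, integral_const_mul, integral_finsetSum]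
      · exact fun j _ => ((hG j).1 k).integrableOn
      · exact (hS.1 k).integrableOn
      · exact (I1 k E).const_mul 2
      · exact (hS.1 k).integrableOn.add ((I1 k E).const_mul 2)
      · exact (iSop k).integrableOn.const_mul _
    · rw [integral_sub, integral_add, integral_const_mul, integral_const_mul, integral_finsetSum]
      · exact fun j _ => (hG j).2.1.integrableOn
      · exact hS.2.1.integrableOn
      · exact (I2 E).const_mul 2
      · exact hS.2.1.integrableOn.add ((I2 E).const_mul 2)
      · exact iSop'.integrableOn.const_mul _
  · intro k E _
    have hdt := (W.scheme k).dt_pos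
    have hδ : 0 < √(T / N k) := Real.sqrt_pos.2 hdt
    have i1 := integrable_floor hT (W.N_pos k) fun n => dir (incS Gi θ (T / N k) m0 (a k) n)
    have i2 := integrable_floor hT (W.N_pos k) fun n => dir (iterSeq Gi θ (T / N k) m0 (a k) n)
    have i3 : Integrable (fun t => ∑ j, b j t ^ 2) (ℐ T) :=
      integrable_finsetSum _ fun j _ => (hbm j).integrable_sq
    have i4 := (i1.const_mul (√(T / N k))⁻¹).add ((i3.add i2).const_mul (2 * √(T / N k)))
    refine (abs_setIntegral_le i4 ?_ E).trans ?_
    · filter_upwards [tS_ae hT (W.N_pos k) (zS T Gi θ m0 (N k) (a k)), ae_all_iff.2 fun j => tS_ae hT (W.N_pos k)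
        fun n => weakPartial j (iterSeq Gi θ (T / N k) m0 (a k) n), W.mem, W.g_eq] with t h1 h2 h3 h4
      have hm1 := sphereH1.le_one h3
      have hΨ1 := h3.1.crt hD hψ hm1 bψ
      have hΨ2 := norm_crt_apply_le (m t) hm1 bψ
      have e0 : ∀ j, weakPartial j (crt (m t) ψ) = dΨ m g ψ j t := fun j => by
        rw [weakPartial_crt hD h3.1 hψ hm1 bψ, dcr, dΨ, h4]
      have e1 := step_identity hD (W.scheme k).sumBdd hdt ((W.scheme k).mem (a k) ⌊t / (T / N k)⌋₊)
        ((W.scheme k).isIncrement (a k) ⌊t / (T / N k)⌋₊) hΨ1 hΨ2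
      simp only [e0] at e1
      simp only [h1, h2]
      refine (le_of_eq (congrArg abs e1)).trans ?_
      simp only [Pi.add_apply, ((W.scheme k).mem (a k) ⌊t / (T / N k)⌋₊).1.dir_eq hD,
        ((W.scheme k).isIncrement (a k) ⌊t / (T / N k)⌋₊).1.1.dir_eq hD]
      refine error_bound ⟨(W.scheme k).theta_pos.le, (W.scheme k).theta.2⟩ hδ Finset.univ
        (fun j => ‖weakPartial j (incS Gi θ (T / N k) m0 (a k) ⌊t / (T / N k)⌋₊)‖)
        (fun j => ‖weakPartial j (iterSeq Gi θ (T / N k) m0 (a k) ⌊t / (T / N k)⌋₊)‖) (fun j => b j t) _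
        fun j => ?_
      refine (abs_real_inner_le_norm _ _).trans (mul_le_mul_of_nonneg_left ?_ (norm_nonneg _))
      refine (norm_dcr_le _ _ _).trans ?_
      rw [e0]
      linarith [bdΨ j t]
    · have j1 := integral_floor hT (W.N_pos k) fun n => dir (incS Gi θ (T / N k) m0 (a k) n)
      have j2 := integral_floor hT (W.N_pos k) fun n => dir (iterSeq Gi θ (T / N k) m0 (a k) n)
      rw [integral_add' (i1.const_mul _) ((i3.add i2).const_mul _), integral_const_mul, integral_const_mul,
        integral_add' i3 i2, j1, j2, ← hK]
      obtain ⟨c1, c2, -, -⟩ := hC k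
      have hs : √(T / N k) * √(T / N k) = T / N k := Real.mul_self_sqrt hdt.le
      have c3 : (√(T / N k))⁻¹ * (T / N k * ∑ n ∈ Finset.range (N k), dir (incS Gi θ (T / N k) m0 (a k) n)) ≤
          √(T / N k) * C := by
        nth_rw 2 [← hs]
        rw [mul_assoc, inv_mul_cancel_left₀ hδ.ne']
        gcongr
      nlinarith [mul_le_mul_of_nonneg_left c1 hδ.le]

end WeakData

/-! ### The weak Laplacian of the limit -/

theorem exists_dense_tests (hDb : Bornology.IsBounded D) : ∃ φ : ℕ → E3 → ℝ,
    (∀ j, ContDiff ℝ (⊤ : ℕ∞) (φ j) ∧ HasCompactSupport (φ j) ∧ ∀ x, |φ j x| ≤ 1) ∧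
    ∀ η : E3 → ℝ, ContDiff ℝ (⊤ : ℕ∞) η → HasCompactSupport η → (∀ x, |η x| ≤ 1) → ∀ ε > 0, ∃ j,
      ∀ x ∈ D, |η x - φ j x| ≤ ε ∧ ∀ k, |pderiv3 k η x - pderiv3 k (φ j) x| ≤ ε := by
  have : CompactSpace (closure D) := isCompact_iff_compactSpace.1 hDb.isCompact_closure
  let Y := {φ : E3 → ℝ // ContDiff ℝ (⊤ : ℕ∞) φ ∧ HasCompactSupport φ ∧ ∀ x, |φ x| ≤ 1}
  let J : Y → C(closure D, ℝ) × (Fin 3 → C(closure D, ℝ)) := fun φ =>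
    (⟨fun x => φ.1 x, φ.2.1.continuous.comp continuous_subtype_val⟩,
      fun k => ⟨fun x => pderiv3 k φ.1 x, (contDiff_pderiv3 φ.2.1 k).continuous.comp continuous_subtype_val⟩)
  have h0 : Y := ⟨0, contDiff_const, HasCompactSupport.zero, by simp⟩
  have : Nonempty (range J) := ⟨⟨J h0, mem_range_self _⟩⟩
  have hs : ∀ j, ∃ φ, J φ = (TopologicalSpace.denseSeq (range J) j).1 := fun j =>
    (TopologicalSpace.denseSeq (range J) j).2
  choose φ hφ using hs
  refine ⟨fun j => (φ j).1, fun j => (φ j).2, fun η h1 h2 h3 ε hε => ?_⟩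
  obtain ⟨j, hj⟩ := (TopologicalSpace.denseRange_denseSeq (range J)).exists_dist_lt
    (⟨J ⟨η, h1, h2, h3⟩, mem_range_self _⟩ : range J) hε
  rw [Subtype.dist_eq, ← hφ, Prod.dist_eq, max_lt_iff] at hj
  refine ⟨j, fun x hx => ⟨?_, fun k => ?_⟩⟩
  · exact (ContinuousMap.dist_apply_le_dist (⟨x, subset_closure hx⟩ : closure D)).trans hj.1.le
  · have h4 := (dist_le_pi_dist (J ⟨η, h1, h2, h3⟩).2 (J (φ j)).2 k).trans hj.2.le
    exact (ContinuousMap.dist_apply_le_dist (⟨x, subset_closure hx⟩ : closure D)).trans h4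

theorem hasWeakPartial_tf (hD : IsOpen D) {φ : E3 → ℝ} (h1 : ContDiff ℝ (⊤ : ℕ∞) φ)
    (h2 : HasCompactSupport φ) (e : E3) (k : Fin 3) :
    HasWeakPartial D k (tf φ e) (tf (pderiv3 k φ) e) := by
  intro η g1 g2 g3
  have c1 := h1.continuous
  have c2 := (contDiff_pderiv3 h1 k).continuous
  have c3 := (contDiff_pderiv3 g1 k).continuous
  have hout : ∀ x, x ∉ D → η x = 0 := fun x hx => by
    by_contra h; exact hx (g3 (subset_tsupport _ h))
  have hout' : ∀ x, x ∉ D → pderiv3 k η x = 0 := fun x hx => by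
    by_contra h; exact hx (g3 (tsupport_pderiv3_subset η k (subset_tsupport _ h)))
  have e1 : ∫ x in D, pderiv3 k η x • (tf φ e : L2 D) x = ∫ x, (pderiv3 k η x * φ x) • e := by
    rw [setIntegral_congr_ae₀ (g := fun x => (pderiv3 k η x * φ x) • e) hD.measurableSet.nullMeasurableSet]
    · exact setIntegral_eq_integral_of_forall_compl_eq_zero fun x hx => by simp [hout' x hx]
    · filter_upwards [(ae_restrict_iff' hD.measurableSet).1 (coeFn_tf c1 h2 e)] with x hx hxD
      rw [hx hxD, smul_smul]
  have e2 : ∫ x in D, η x • (tf (pderiv3 k φ) e : L2 D) x = ∫ x, (η x * pderiv3 k φ x) • e := by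
    rw [setIntegral_congr_ae₀ (g := fun x => (η x * pderiv3 k φ x) • e) hD.measurableSet.nullMeasurableSet]
    · exact setIntegral_eq_integral_of_forall_compl_eq_zero fun x hx => by simp [hout x hx]
    · filter_upwards [(ae_restrict_iff' hD.measurableSet).1 (coeFn_tf c2 (hasCompactSupport_pderiv3 h2 k) e)] with x hx hxD
      rw [hx hxD, smul_smul]
  rw [e1, e2, integral_smul_const, integral_smul_const, ← neg_smul]
  congr 1
  have h3 := integral_pderiv3_eq_zero (g1.mul h1) g2.mul_right k
  have h4 : ∀ x, pderiv3 k (fun y => η y * φ y) x = pderiv3 k η x * φ x + η x * pderiv3 k φ x := fun x =>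
    pderiv3_mul k (g1.differentiable (by simp) x) (h1.differentiable (by simp) x)
  have h5 : ∫ x, pderiv3 k η x * φ x + η x * pderiv3 k φ x = 0 := by
    simp only [← h4]; exact h3
  rw [integral_add] at h5
  · linarith
  · exact (c3.mul c1).integrable_of_hasCompactSupport h2.mul_left
  · exact (g1.continuous.mul c2).integrable_of_hasCompactSupport g2.mul_right

theorem memH1_tf (hD : IsOpen D) {φ : E3 → ℝ} (h1 : ContDiff ℝ (⊤ : ℕ∞) φ)
    (h2 : HasCompactSupport φ) (e : E3) : MemH1 (tf φ e : L2 D) := fun k =>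
  ⟨_, hasWeakPartial_tf hD h1 h2 e k⟩

/-- The function `½ (z - u × z) + ¼ (u × (u × S) + u × S)`. -/
def lapL2 (u z S : L2 D) : L2 D :=
  (1 / 2 : ℝ) • (z - crt u z) + (1 / 4 : ℝ) • (crt u (crt u S) + crt u S)

/-- The weak Laplacian of the limit. -/
def lapF (u z S : L2 D) (x : E3) : E3 := lapL2 u z S x - (∑ k, ‖weakPartial k u x‖ ^ 2) • u x

theorem crt_nrm {u : L2 D} (hu : ∀ᵐ x ∂ℒ D, ‖u x‖ = 1) (f : L2 D) :
    crt u (nrm u f) = 0 := by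
  have hu1 := hu.mono fun _ h => h.le
  refine Lp.ext ?_
  filter_upwards [coeFn_crt hu1 (nrm u f), coeFn_nrm hu f, Lp.coeFn_zero E3 2 (ℒ D)] with x h1 h2 h3
  rw [h1, h2, h3, cross_smul_right, Pi.zero_apply]
  have : cross (u x) (u x) = 0 := by
    refine norm_eq_zero.1 (pow_eq_zero_iff two_ne_zero |>.1 ?_)
    rw [norm_cross_sq, real_inner_self_eq_norm_sq]; ring
  rw [this, smul_zero]

theorem integrable_gradSq (u : L2 D) : IntegrableOn (fun x => ∑ k, ‖weakPartial k u x‖ ^ 2) D :=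
  integrable_finsetSum _ fun k _ => (Lp.memLp (weakPartial k u)).norm.integrable_sq

theorem integrableOn_lapF (hDb : Bornology.IsBounded D) {u : L2 D}
    (hu : ∀ᵐ x ∂ℒ D, ‖u x‖ = 1) (z S : L2 D) : IntegrableOn (lapF u z S) D := by
  have : IsFiniteMeasure (ℒ D) := ⟨by simpa using hDb.measure_lt_top⟩
  have h1 : IntegrableOn (lapL2 u z S) D := (Lp.memLp _).integrable one_le_two
  refine Integrable.sub h1 (Integrable.mono (integrable_gradSq u) ?_ ?_)
  · exact (integrable_gradSq u).aestronglyMeasurable.smul (Lp.aestronglyMeasurable u)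
  · filter_upwards [hu] with x h
    rw [norm_smul, h, mul_one]

theorem nrm_weakPartial (hD : IsOpen D) {u : L2 D} (hu : u ∈ sphereH1 D) (k : Fin 3) :
    nrm u (weakPartial k u) = 0 := by
  rw [nrm_eq_zero_iff hu.2]
  filter_upwards [inner_weakPartial_eq_zero hD (hu.1.hasWeakPartial k) hu.2] with x h
  rw [real_inner_comm]; exact h

theorem integral_lapF (hD : IsOpen D) {u z S ψ : L2 D}
    (hu : u ∈ sphereH1 D) (hz : nrm u z = 0)
    (bψ : ∀ᵐ x ∂ℒ D, ‖ψ x‖ ≤ 1)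
    (h : inner ℝ z (WeakData.rot u (crt u ψ)) + 2 * ∑ j, inner ℝ (weakPartial j u) (crt u (dcr j u ψ)) -
      (1 / 2) * inner ℝ S (WeakData.rot u (crt u ψ)) = 0) :
    ∫ x in D, inner ℝ (lapF u z S x) (ψ x) = -∑ j, inner ℝ (weakPartial j u) (weakPartial j ψ) := by
  have hu1 := sphereH1.le_one hu
  have cc : ∀ f, crt u (crt u f) = nrm u f - f := fun f => by rw [nrm_apply]; abel
  have c3 : ∀ f, crt u (crt u (crt u f)) = -crt u f := fun f => by
    rw [cc f, crt_sub_right, crt_nrm hu.2, zero_sub]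
  have I1 : inner ℝ z (WeakData.rot u (crt u ψ)) = inner ℝ (crt u z - z) ψ := by
    rw [WeakData.rot, c3, cc, inner_add_right, inner_sub_right, inner_neg_right, ← inner_nrm_left,
      hz, inner_zero_left, inner_sub_left, inner_crt_left]
    ring
  have I3 : inner ℝ S (WeakData.rot u (crt u ψ)) = inner ℝ (crt u (crt u S) + crt u S) ψ := by
    rw [WeakData.rot, c3, inner_add_right, inner_add_left, inner_neg_right, inner_crt_left, inner_crt_left u S,
      inner_crt_left, neg_neg]
  have hint : IntegrableOn (fun x => (∑ k, ‖weakPartial k u x‖ ^ 2) * inner ℝ (u x) (ψ x)) D := by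
    refine Integrable.mono (integrable_gradSq u) ?_ ?_
    · exact (integrable_gradSq u).aestronglyMeasurable.mul ((Lp.aestronglyMeasurable u).inner (Lp.aestronglyMeasurable ψ))
    · filter_upwards [hu1, bψ] with x h1 h2
      rw [norm_mul]
      refine mul_le_of_le_one_right (norm_nonneg _) ?_
      exact (norm_inner_le_norm _ _).trans (mul_le_one₀ h1 (norm_nonneg _) h2)
  have I2 : ∑ j, inner ℝ (weakPartial j u) (crt u (dcr j u ψ)) =
      (∫ x in D, (∑ k, ‖weakPartial k u x‖ ^ 2) * inner ℝ (u x) (ψ x)) -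
        ∑ j, inner ℝ (weakPartial j u) (weakPartial j ψ) := by
    have e : ∀ j, inner ℝ (weakPartial j u) (crt u (dcr j u ψ)) =
        (∫ x in D, ‖weakPartial j u x‖ ^ 2 * inner ℝ (u x) (ψ x)) - inner ℝ (weakPartial j u) (weakPartial j ψ) := fun j => by
      rw [dcr, crt_sub_right, inner_sub_right, cc, inner_sub_right, ← inner_nrm_left, nrm_weakPartial hD hu,
        inner_zero_left, L2.inner_def (weakPartial j u) (crt u (crt ψ _))]
      have e2 : ∫ x in D, inner ℝ (weakPartial j u x) (crt u (crt ψ (weakPartial j u)) x) =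
          -∫ x in D, ‖weakPartial j u x‖ ^ 2 * inner ℝ (u x) (ψ x) := by
        rw [← integral_neg]
        refine integral_congr_ae ?_
        filter_upwards [coeFn_crt hu1 (crt ψ (weakPartial j u)), coeFn_crt bψ (weakPartial j u),
          inner_weakPartial_eq_zero hD (hu.1.hasWeakPartial j) hu.2] with x h1 h2 h3
        rw [h1, h2, cross_cross_eq, h3, zero_smul, zero_sub, inner_neg_right, inner_smul_right,
          real_inner_self_eq_norm_sq]
        ring
      rw [e2]; ring
    simp only [e, Finset.sum_sub_distrib, Finset.sum_mul]
    rw [integral_finsetSum]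
    intro j _
    refine Integrable.mono hint (((Lp.aestronglyMeasurable _).norm.pow 2).mul
      ((Lp.aestronglyMeasurable u).inner (Lp.aestronglyMeasurable ψ))) (Eventually.of_forall fun x => ?_)
    rw [norm_mul, norm_mul]
    refine mul_le_mul_of_nonneg_right ?_ (norm_nonneg _)
    rw [Real.norm_of_nonneg (sq_nonneg _), Real.norm_of_nonneg (Finset.sum_nonneg fun _ _ => sq_nonneg _)]
    exact Finset.single_le_sum (f := fun k => ‖weakPartial k u x‖ ^ 2) (fun _ _ => sq_nonneg _) (Finset.mem_univ j)
  have J : ∫ x in D, inner ℝ (lapF u z S x) (ψ x) = inner ℝ (lapL2 u z S) ψ -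
      ∫ x in D, (∑ k, ‖weakPartial k u x‖ ^ 2) * inner ℝ (u x) (ψ x) := by
    rw [L2.inner_def, ← integral_sub (L2.integrable_inner _ _) hint]
    refine integral_congr_ae (Eventually.of_forall fun x => ?_)
    simp only [lapF, inner_sub_left, real_inner_smul_left]
  rw [J, lapL2, inner_add_left, real_inner_smul_left, real_inner_smul_left]
  rw [I1, I2, I3] at h
  have e5 : inner ℝ (z - crt u z) ψ = -inner ℝ (crt u z - z) ψ := by rw [← inner_neg_left, neg_sub]
  rw [e5]
  linarith

theorem integrable_bdd_smul {h : E3 → E3} (hi : IntegrableOn h D) {c : E3 → ℝ} (hc : Continuous c)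
    {K : ℝ} (hK : ∀ᵐ x ∂ℒ D, |c x| ≤ K) : IntegrableOn (fun x => c x • h x) D := by
  refine Integrable.mono' (Integrable.const_mul hi.norm K) (hc.aestronglyMeasurable.smul hi.aestronglyMeasurable) ?_
  filter_upwards [hK] with x hx
  rw [norm_smul]
  exact mul_le_mul_of_nonneg_right hx (norm_nonneg _)

theorem norm_integral_smul_sub_le (hDm : MeasurableSet D) {h : E3 → E3} (hi : IntegrableOn h D) {c d : E3 → ℝ} (hc : Continuous c)
    (hcs : HasCompactSupport c) (hd : Continuous d) (hds : HasCompactSupport d)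
    {ε : ℝ} (hε : ∀ x ∈ D, |c x - d x| ≤ ε) :
    ‖(∫ x in D, c x • h x) - ∫ x in D, d x • h x‖ ≤ ε * ∫ x in D, ‖h x‖ := by
  obtain ⟨Kc, hKc⟩ := hcs.exists_bound_of_continuous hc
  obtain ⟨Kd, hKd⟩ := hds.exists_bound_of_continuous hd
  rw [← integral_sub (integrable_bdd_smul hi hc (Eventually.of_forall hKc))
    (integrable_bdd_smul hi hd (Eventually.of_forall hKd)), ← integral_const_mul]
  refine norm_integral_le_of_norm_le (Integrable.const_mul hi.norm ε) ?_
  filter_upwards [ae_restrict_mem hDm] with x hx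
  rw [← sub_smul, norm_smul]
  exact mul_le_mul_of_nonneg_right (hε x hx) (norm_nonneg _)

theorem pderiv3_const_mul {φ : E3 → ℝ} (h : ContDiff ℝ (⊤ : ℕ∞) φ) (c : ℝ) (k : Fin 3) (x : E3) :
    pderiv3 k (fun y => c * φ y) x = c * pderiv3 k φ x := by
  have := pderiv3_mul (φ := fun _ => c) k (differentiableAt_const (x := x) c) (h.differentiable (by simp) x)
  rw [this]
  simp [pderiv3]

theorem isWeakLaplacian_of_tests (hD : IsOpen D) (hDb : Bornology.IsBounded D) {u : L2 D} {h : E3 → E3} (hi : IntegrableOn h D)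
    {φ : ℕ → E3 → ℝ} (h1 : ∀ j, ContDiff ℝ (⊤ : ℕ∞) (φ j) ∧ HasCompactSupport (φ j))
    (h2 : ∀ η : E3 → ℝ, ContDiff ℝ (⊤ : ℕ∞) η → HasCompactSupport η → (∀ x, |η x| ≤ 1) → ∀ ε > 0, ∃ j,
      ∀ x ∈ D, |η x - φ j x| ≤ ε ∧ ∀ k, |pderiv3 k η x - pderiv3 k (φ j) x| ≤ ε)
    (h3 : ∀ j (l : Fin 3), ∫ x in D, inner ℝ (h x) ((tf (φ j) (EuclideanSpace.single l 1) : L2 D) x) =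
      -∑ k, inner ℝ (weakPartial k u) (tf (pderiv3 k (φ j)) (EuclideanSpace.single l 1))) :
    IsWeakLaplacian u h := by
  have : IsFiniteMeasure (ℒ D) := ⟨by simpa using hDb.measure_lt_top⟩
  have hg : ∀ k, IntegrableOn (weakPartial k u) D := fun k => (Lp.memLp _).integrable one_le_two
  have key : ∀ j, ∫ x in D, φ j x • h x = -∑ k, ∫ x in D, pderiv3 k (φ j) x • weakPartial k u x := fun j => by
    obtain ⟨K, hK⟩ := (h1 j).2.exists_bound_of_continuous (h1 j).1.continuous
    have hij : IntegrableOn (fun x => φ j x • h x) D :=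
      integrable_bdd_smul hi (h1 j).1.continuous (Eventually.of_forall hK)
    have hcoord : ∀ l : Fin 3, inner ℝ (EuclideanSpace.single l (1 : ℝ)) (∫ x in D, φ j x • h x) =
        inner ℝ (EuclideanSpace.single l (1 : ℝ)) (-∑ k, ∫ x in D, pderiv3 k (φ j) x • weakPartial k u x) := fun l => by
      have h4 := h3 j l
      have e1 : ∀ k, inner ℝ (weakPartial k u) (tf (pderiv3 k (φ j)) (EuclideanSpace.single l 1)) =
          inner ℝ (EuclideanSpace.single l (1 : ℝ)) (∫ x in D, pderiv3 k (φ j) x • weakPartial k u x) := fun k => by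
        rw [real_inner_comm, inner_tf (contDiff_pderiv3 (h1 j).1 k).continuous (hasCompactSupport_pderiv3 (h1 j).2 k)]
      simp only [e1] at h4
      rw [inner_neg_right, inner_sum, ← h4, ← integral_inner hij]
      refine integral_congr_ae ?_
      filter_upwards [coeFn_tf (h1 j).1.continuous (h1 j).2 (EuclideanSpace.single l (1 : ℝ))] with x hx
      rw [hx, inner_smul_right, inner_smul_right, real_inner_comm]
    refine PiLp.ext fun l => ?_
    simpa [EuclideanSpace.inner_single_left] using hcoord l
  refine ⟨hi, ?_⟩
  have main : ∀ η : E3 → ℝ, ContDiff ℝ (⊤ : ℕ∞) η → HasCompactSupport η → (∀ x, |η x| ≤ 1) →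
      ∫ x in D, η x • h x = -∑ k, ∫ x in D, pderiv3 k η x • weakPartial k u x := fun η g1 g2 g3 => by
    rw [← sub_eq_zero, ← norm_le_zero_iff]
    obtain ⟨K, hK⟩ : ∃ K, K = (∫ x in D, ‖h x‖) + ∑ k, ∫ x in D, ‖weakPartial k u x‖ := ⟨_, rfl⟩
    have hb : ∀ ε > 0, ‖(∫ x in D, η x • h x) - -∑ k, ∫ x in D, pderiv3 k η x • weakPartial k u x‖ ≤ ε * K := fun ε hε => by
      obtain ⟨j, hj⟩ := h2 η g1 g2 g3 ε hε
      have b1 := norm_integral_smul_sub_le hD.measurableSet hi g1.continuous g2 (h1 j).1.continuous (h1 j).2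
        fun x hx => (hj x hx).1
      have b2 := fun k => norm_integral_smul_sub_le hD.measurableSet (hg k) (contDiff_pderiv3 g1 k).continuous
        (hasCompactSupport_pderiv3 g2 k) (contDiff_pderiv3 (h1 j).1 k).continuous
        (hasCompactSupport_pderiv3 (h1 j).2 k) fun x hx => (hj x hx).2 k
      have e2 : (∫ x in D, η x • h x) - -∑ k, ∫ x in D, pderiv3 k η x • weakPartial k u x =
          ((∫ x in D, η x • h x) - ∫ x in D, φ j x • h x) + ∑ k, ((∫ x in D, pderiv3 k η x • weakPartial k u x) -
            ∫ x in D, pderiv3 k (φ j) x • weakPartial k u x) := by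
        rw [key j, Finset.sum_sub_distrib]; abel
      rw [e2, hK, mul_add, Finset.mul_sum]
      exact (norm_add_le _ _).trans (add_le_add b1 ((norm_sum_le _ _).trans (Finset.sum_le_sum fun k _ => b2 k)))
    have hl : Tendsto (fun ε : ℝ => ε * K) (𝓝[>] 0) (𝓝 0) := by
      have : Tendsto (fun ε : ℝ => ε * K) (𝓝 0) (𝓝 (0 * K)) := tendsto_id.mul_const K
      rw [zero_mul] at this
      exact this.mono_left nhdsWithin_le_nhds
    exact ge_of_tendsto hl (eventually_mem_nhdsWithin.mono hb)
  intro η g1 g2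
  obtain ⟨M, hM⟩ := g2.exists_bound_of_continuous g1.continuous
  obtain ⟨K, hK0, hK⟩ : ∃ K : ℝ, 0 < K ∧ ∀ x, |η x| ≤ K := ⟨max M 1, by positivity, fun x => (hM x).trans (le_max_left _ _)⟩
  have h5 := main (fun x => K⁻¹ * η x) (contDiff_const.mul g1) g2.mul_left fun x => by
    rw [abs_mul, abs_inv, abs_of_pos hK0, inv_mul_le_one₀ hK0]; exact hK x
  simp only [pderiv3_const_mul g1, ← smul_smul, integral_smul, ← Finset.smul_sum, ← smul_neg] at h5
  exact smul_right_injective _ (inv_ne_zero hK0.ne') h5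

theorem isDrift_of_lapF {Gi : ℕ → L2 D} {Cs : ℝ} (hG : SumBdd Gi Cs) {u z : L2 D} (hu : u ∈ sphereH1 D)
    (hz : nrm u z = 0) (hl : IsWeakLaplacian u (lapF u z (Sop Gi u))) :
    IsDrift Gi u (z + (1 / 2 : ℝ) • nSop Gi u) := by
  refine ⟨hu.1, _, Sop Gi u, hl, (hG.coeFn_Sop u).mono fun x h => h.1, ?_⟩
  have hu1 := sphereH1.le_one hu
  obtain ⟨S, hS⟩ : ∃ S, S = Sop Gi u := ⟨_, rfl⟩
  simp only [nSop, ← hS]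
  filter_upwards [hu.2, (nrm_eq_zero_iff hu.2 z).1 hz, coeFn_nrm hu.2 S, Lp.coeFn_add z ((1 / 2 : ℝ) • nrm u S),
    Lp.coeFn_smul (1 / 2 : ℝ) (nrm u S), coeFn_crt hu1 z, coeFn_crt hu1 S, coeFn_crt hu1 (crt u S),
    Lp.coeFn_add ((1 / 2 : ℝ) • (z - crt u z)) ((1 / 4 : ℝ) • (crt u (crt u S) + crt u S)),
    Lp.coeFn_smul (1 / 2 : ℝ) (z - crt u z), Lp.coeFn_smul (1 / 4 : ℝ) (crt u (crt u S) + crt u S),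
    Lp.coeFn_sub z (crt u z), Lp.coeFn_add (crt u (crt u S)) (crt u S)] with x a0 a1 a2 a3 a4 a5 a6 a7 a8 a9 a10 a11 a12
  obtain ⟨r, hr⟩ : ∃ r, r = ∑ k, ‖weakPartial k u x‖ ^ 2 := ⟨_, rfl⟩
  have e : lapL2 u z S x = (1 / 2 : ℝ) • (z x - cross (u x) (z x)) +
      (1 / 4 : ℝ) • (cross (u x) (cross (u x) (S x)) + cross (u x) (S x)) := by
    rw [lapL2, a8, Pi.add_apply, a9, a10, Pi.smul_apply, Pi.smul_apply, a11, a12, Pi.sub_apply, Pi.add_apply,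
      a7, a6, a5]
  rw [a3, Pi.add_apply, a4, Pi.smul_apply, a2]
  simp only [lapF, e, ← hr]
  have b0 : inner ℝ (u x) (u x) = (1 : ℝ) := by rw [real_inner_self_eq_norm_sq, a0]; norm_num
  have b1 : ∀ v, cross (u x) (cross (u x) v) = (inner ℝ (u x) v : ℝ) • u x - v := fun v => by
    rw [cross_cross_eq, b0, one_smul]
  have b2 : cross (u x) (u x) = 0 := by
    refine norm_eq_zero.1 (pow_eq_zero_iff two_ne_zero |>.1 ?_)
    rw [norm_cross_sq, real_inner_self_eq_norm_sq]; ring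
  have b3 : inner ℝ (u x) (z x) = (0 : ℝ) := by rw [real_inner_comm]; exact a1
  simp only [cross_sub_right, cross_add_right, cross_smul_right, b1, b2, b3]
  module

theorem WeakData.isDrift {T : ℝ} {Gi : ℕ → L2 D} {θ : ℝ} {m0 : L2 D} {Cs Cb : ℝ} {N : ℕ → ℕ}
    {a : ℕ → ℕ → L2 D} {m X : L2T T D} {χ : ℕ → L2 D} {z : L2T T D} {g : Fin 3 → L2T T D}
    (W : WeakData T Gi θ m0 Cs Cb N a m X χ z g) : ∀ᵐ t ∂ℐ T,
      IsDrift Gi (m t) (z t + (1 / 2 : ℝ) • nSop Gi (m t)) := by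
  have hD := (W.scheme 0).isOpen
  have hDb := (W.scheme 0).isBounded
  obtain ⟨φ, h1, h2⟩ := exists_dense_tests hDb
  have hb : ∀ j (l : Fin 3), ∀ᵐ x ∂ℒ D,
      ‖(tf (φ j) (EuclideanSpace.single l 1) : L2 D) x‖ ≤ 1 := fun j l => by
    filter_upwards [coeFn_tf (D := D) (h1 j).1.continuous (h1 j).2.1 (EuclideanSpace.single l 1)] with x hx
    rw [hx, norm_smul]
    simpa using (h1 j).2.2 x
  have h3 := fun j (l : Fin 3) => W.drift_identity (memH1_tf hD (h1 j).1 (h1 j).2.1 (EuclideanSpace.single l 1)) (hb j l)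
  filter_upwards [W.mem, W.nrm_z, W.g_eq, ae_all_iff.2 fun j => ae_all_iff.2 fun l => h3 j l] with t a1 a2 a3 a4
  refine isDrift_of_lapF (W.scheme 0).sumBdd a1 a2 (isWeakLaplacian_of_tests hD hDb
    (integrableOn_lapF hDb a1.2 _ _) (fun j => ⟨(h1 j).1, (h1 j).2.1⟩) h2 fun j l => ?_)
  have h4 := a4 j l
  have e : ∀ k, weakPartial k (tf (φ j) (EuclideanSpace.single l 1) : L2 D) =
      tf (pderiv3 k (φ j)) (EuclideanSpace.single l 1) := fun k =>
    (hasWeakPartial_tf hD (h1 j).1 (h1 j).2.1 _ k).weakPartial_eq hD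
  simp only [← e]
  refine integral_lapF hD a1 a2 (hb j l) ?_
  simp only [WeakData.dΨ, a3] at h4
  exact h4

/-! ### The limit equation -/

theorem abs_expansion_le {m ξ w χ : L2 D} {B : ℝ} (hm : ∀ᵐ x ∂ℒ D, ‖m x‖ = 1)
    (hw : Tang m w) (hχ : ∀ᵐ x ∂ℒ D, ‖χ x‖ ≤ 1) (hB : ∀ᵐ x ∂ℒ D, ‖ξ x‖ ≤ B) :
    |inner ℝ χ (retr (m + (crt m ξ + w)) - m - crt m ξ - w) + 1 / 2 * quad χ m ξ ξ| ≤
      12 * (B * ‖ξ‖ ^ 2) + 9 * ‖w‖ ^ 2 + ‖w‖ * ‖ξ‖ := by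
  have hm1 : ∀ᵐ x ∂ℒ D, ‖m x‖ ≤ 1 := hm.mono fun _ h => h.le
  have ht : Tang m (crt m ξ + w) := by
    have := Tang.sub (Tang.crt (ξ := ξ) hm1) (Tang.sub (Tang.crt (ξ := 0) hm1) hw)
    have e : crt m ξ - (crt m 0 - w) = crt m ξ + w := by
      have : crt m (0 : L2 D) = 0 := (crtL m).map_zero
      rw [this]; abel
    rwa [e] at this
  have hq : IntegrableOn (fun x => inner ℝ (χ x) (m x) * ‖cross (m x) (ξ x)‖ ^ 2) D := by
    refine Integrable.mono' (Lp.memLp ξ).norm.integrable_sq ?_ ?_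
    · exact ((Lp.aestronglyMeasurable χ).inner (Lp.aestronglyMeasurable m)).mul
        ((aestronglyMeasurable_cross (Lp.aestronglyMeasurable m) (Lp.aestronglyMeasurable ξ)).norm.pow 2)
    · filter_upwards [hm, hχ] with x h1 h2
      rw [norm_mul, norm_pow, norm_norm]
      have h3 : ‖(inner ℝ (χ x) (m x) : ℝ)‖ ≤ 1 :=
        (norm_inner_le_norm _ _).trans (by rw [h1, mul_one]; exact h2)
      have h4 : ‖cross (m x) (ξ x)‖ ≤ ‖ξ x‖ := (norm_cross_le _ _).trans (by rw [h1, one_mul])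
      calc _ ≤ 1 * ‖ξ x‖ ^ 2 := by gcongr
        _ = ‖ξ x‖ ^ 2 := one_mul _
  rw [quad_eq hχ hm, L2.inner_def, ← integral_const_mul, ← integral_add (L2.integrable_inner _ _) (hq.const_mul _)]
  have i1 : Integrable (fun x => ‖ξ x‖ ^ 2) (ℒ D) := (Lp.memLp ξ).norm.integrable_sq
  have i2 : Integrable (fun x => ‖w x‖ ^ 2) (ℒ D) := (Lp.memLp w).norm.integrable_sq
  have i3 : Integrable (fun x => ‖w x‖ * ‖ξ x‖) (ℒ D) :=
    (Lp.memLp w).norm.integrable_mul (Lp.memLp ξ).norm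
  have i4 := ((i1.const_mul B).const_mul 12).add (i2.const_mul 9)
  have hle : ∫ x in D, ‖w x‖ * ‖ξ x‖ ≤ ‖w‖ * ‖ξ‖ := by
    have h1 := real_inner_le_norm ((Lp.memLp w).norm.toLp _) ((Lp.memLp ξ).norm.toLp _)
    rw [Lp.norm_toLp, Lp.norm_toLp, eLpNorm_norm, eLpNorm_norm, ← Lp.norm_def, ← Lp.norm_def, L2.inner_def] at h1
    refine le_trans (le_of_eq (integral_congr_ae ?_)) h1
    filter_upwards [(Lp.memLp w).norm.coeFn_toLp, (Lp.memLp ξ).norm.coeFn_toLp] with x e1 e2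
    rw [e1, e2, real_inner_eq_re_inner, RCLike.inner_apply]
    simp [mul_comm]
  rw [← Real.norm_eq_abs]
  refine (norm_integral_le_of_norm_le (i4.add i3) ?_).trans ?_
  · filter_upwards [hm, hχ, hB, ht, coeFn_retr_add hm ht, coeFn_crt hm1 ξ, Lp.coeFn_add (crt m ξ) w,
      Lp.coeFn_sub (retr (m + (crt m ξ + w))) m, Lp.coeFn_sub (retr (m + (crt m ξ + w)) - m) (crt m ξ),
      Lp.coeFn_sub (retr (m + (crt m ξ + w)) - m - crt m ξ) w] with x a1 a2 a3 a4 a5 a6 a7 a8 a9 a10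
    rw [a7, Pi.add_apply, a6] at a4
    have h1 := norm_renorm_sub_le a1 a4
    rw [a10, Pi.sub_apply, a9, Pi.sub_apply, a8, Pi.sub_apply, a5, a7, Pi.add_apply, a6]
    obtain ⟨c, hc⟩ : ∃ c, c = cross (m x) (ξ x) := ⟨_, rfl⟩
    have h4 : ‖c‖ ≤ ‖ξ x‖ := by rw [hc]; exact (norm_cross_le _ _).trans (by rw [a1, one_mul])
    rw [← hc] at h1 ⊢
    have e : (inner ℝ (χ x) (‖m x + (c + w x)‖⁻¹ • (m x + (c + w x)) - m x - c - w x) : ℝ) +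
        1 / 2 * (inner ℝ (χ x) (m x) * ‖c‖ ^ 2) = inner ℝ (χ x)
        (‖m x + (c + w x)‖⁻¹ • (m x + (c + w x)) - m x - c - w x + (‖c‖ ^ 2 / 2) • m x) := by
      rw [inner_add_right, inner_smul_right]; ring
    rw [e]
    have h5 : ‖(inner ℝ (χ x) (‖m x + (c + w x)‖⁻¹ • (m x + (c + w x)) - m x - c - w x + (‖c‖ ^ 2 / 2) • m x) : ℝ)‖ ≤
        1 * (12 * ‖c‖ ^ 3 + 9 * ‖w x‖ ^ 2 + ‖w x‖ * ‖c‖) := (norm_inner_le_norm _ _).trans (by gcongr)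
    refine h5.trans ?_
    simp only [Pi.add_apply]
    have h6 : ‖c‖ ^ 3 ≤ B * ‖ξ x‖ ^ 2 := by
      calc ‖c‖ ^ 3 ≤ ‖ξ x‖ ^ 3 := by gcongr
        _ = ‖ξ x‖ * ‖ξ x‖ ^ 2 := by ring
        _ ≤ _ := by gcongr
    have h7 : ‖w x‖ * ‖c‖ ≤ ‖w x‖ * ‖ξ x‖ := by gcongr
    linarith
  · rw [integral_add' i4 i3, integral_add' ((i1.const_mul B).const_mul 12) (i2.const_mul 9), integral_const_mul,
      integral_const_mul, integral_const_mul, ← norm_sq_Lp, ← norm_sq_Lp]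
    linarith

variable {T : ℝ} {Gi : ℕ → L2 D} {θ : ℝ} {m0 : L2 D} {Cs Cb : ℝ}

theorem SchemeData.abs_remainder_le {dt : ℝ} (S : SchemeData Gi θ dt m0 Cs Cb) (a : ℕ → L2 D) {χ : L2 D}
    (hχ : ∀ᵐ x ∂ℒ D, ‖χ x‖ ≤ 1) {k N : ℕ} (hk : k ≤ N) (h2 : ∀ n < N, MemH2 (a n)) :
    |inner ℝ χ (iterSeq Gi θ dt m0 a k - m0 - XS Gi θ dt m0 a k) -
      (∑ n ∈ Finset.range k, inner ℝ χ (remS Gi θ dt m0 a n + (dt / 2) • nSop Gi (iterSeq Gi θ dt m0 a n)) -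
        1 / 2 * defSum Gi θ dt m0 χ k a)| ≤
      12 * (√(∑ n ∈ Finset.range N, Cb * sqH2 (a n)) * √(∑ n ∈ Finset.range N, ‖a n‖ ^ 4)) +
      9 * ∑ n ∈ Finset.range N, ‖remS Gi θ dt m0 a n‖ ^ 2 +
      √(∑ n ∈ Finset.range N, ‖remS Gi θ dt m0 a n‖ ^ 2) * √(∑ n ∈ Finset.range N, sqH2 (a n)) := by
  have e1 : inner ℝ χ (iterSeq Gi θ dt m0 a k - m0 - XS Gi θ dt m0 a k) = ∑ n ∈ Finset.range k,
      inner ℝ χ (iterSeq Gi θ dt m0 a (n + 1) - iterSeq Gi θ dt m0 a n - crt (iterSeq Gi θ dt m0 a n) (a n)) := by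
    rw [← inner_sum, Finset.sum_sub_distrib, Finset.sum_range_sub]
    rfl
  have e2 : inner ℝ χ (iterSeq Gi θ dt m0 a k - m0 - XS Gi θ dt m0 a k) -
      (∑ n ∈ Finset.range k, inner ℝ χ (remS Gi θ dt m0 a n + (dt / 2) • nSop Gi (iterSeq Gi θ dt m0 a n)) -
        1 / 2 * defSum Gi θ dt m0 χ k a) = ∑ n ∈ Finset.range k, (inner ℝ χ (iterSeq Gi θ dt m0 a (n + 1) -
        iterSeq Gi θ dt m0 a n - crt (iterSeq Gi θ dt m0 a n) (a n) - remS Gi θ dt m0 a n) +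
        1 / 2 * quad χ (iterSeq Gi θ dt m0 a n) (a n) (a n)) := by
    rw [e1, defSum, Finset.mul_sum, ← Finset.sum_sub_distrib, ← Finset.sum_sub_distrib]
    refine Finset.sum_congr rfl fun n _ => ?_
    rw [defS, inner_sub_right _ _ (remS Gi θ dt m0 a n), inner_add_right, inner_smul_right, real_inner_comm χ (nSop _ _)]
    ring
  have hb : ∀ n ∈ Finset.range N, |inner ℝ χ (iterSeq Gi θ dt m0 a (n + 1) -
        iterSeq Gi θ dt m0 a n - crt (iterSeq Gi θ dt m0 a n) (a n) - remS Gi θ dt m0 a n) +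
        1 / 2 * quad χ (iterSeq Gi θ dt m0 a n) (a n) (a n)| ≤
      12 * (√(Cb * sqH2 (a n)) * ‖a n‖ ^ 2) + 9 * ‖remS Gi θ dt m0 a n‖ ^ 2 + ‖remS Gi θ dt m0 a n‖ * ‖a n‖ := fun n hn => by
    have hn2 := h2 n (Finset.mem_range.1 hn)
    have e3 : incS Gi θ dt m0 a n = crt (iterSeq Gi θ dt m0 a n) (a n) + remS Gi θ dt m0 a n := by
      rw [remS]; abel
    rw [S.succ, e3]
    refine abs_expansion_le (S.mem a n).2 (S.tang_remS a n) hχ ?_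
    filter_upwards [S.sup _ hn2] with x hx
    rw [← hn2.sqH2_eq S.isOpen] at hx
    exact Real.le_sqrt_of_sq_le hx
  rw [e2]
  refine (Finset.abs_sum_le_sum_abs _ _).trans ((Finset.sum_le_sum_of_subset_of_nonneg (Finset.range_mono hk)
    fun _ _ _ => abs_nonneg _).trans ((Finset.sum_le_sum hb).trans ?_))
  calc _ = 12 * ∑ n ∈ Finset.range N, √(Cb * sqH2 (a n)) * ‖a n‖ ^ 2 + 9 * ∑ n ∈ Finset.range N, ‖remS Gi θ dt m0 a n‖ ^ 2 +
        ∑ n ∈ Finset.range N, ‖remS Gi θ dt m0 a n‖ * ‖a n‖ := by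
        rw [Finset.sum_add_distrib, Finset.sum_add_distrib, Finset.mul_sum, Finset.mul_sum]
    _ ≤ _ := by
      have c1 := Real.sum_mul_le_sqrt_mul_sqrt (Finset.range N) (fun n => √(Cb * sqH2 (a n))) fun n => ‖a n‖ ^ 2
      have c2 := Real.sum_mul_le_sqrt_mul_sqrt (Finset.range N) (fun n => ‖remS Gi θ dt m0 a n‖) fun n => ‖a n‖
      have c3 : ∀ n, √(Cb * sqH2 (a n)) ^ 2 = Cb * sqH2 (a n) := fun n =>
        Real.sq_sqrt (mul_nonneg S.pos.le (sqH2_nonneg _))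
      have c4 : ∀ n, (‖a n‖ ^ 2) ^ 2 = ‖a n‖ ^ 4 := fun n => by ring
      simp only [c3, c4] at c1
      have c5 : √(∑ n ∈ Finset.range N, ‖a n‖ ^ 2) ≤ √(∑ n ∈ Finset.range N, sqH2 (a n)) :=
        Real.sqrt_le_sqrt (Finset.sum_le_sum fun n _ => norm_sq_le_sqH2 _)
      have c6 := mul_le_mul_of_nonneg_left c5 (Real.sqrt_nonneg (∑ n ∈ Finset.range N, ‖remS Gi θ dt m0 a n‖ ^ 2))
      linarith

theorem tendsto_floor_indicator {F : Type*} [Zero F] [TopologicalSpace F] {d : ℕ → ℝ} (hd : ∀ k, 0 < d k)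
    (hl : Tendsto d atTop (𝓝 0)) {s t : ℝ} (hs : 0 ≤ s) (c : F) :
    Tendsto (fun k => if ⌊s / d k⌋₊ < ⌊t / d k⌋₊ then c else 0) atTop (𝓝 (if s < t then c else 0)) := by
  refine tendsto_const_nhds.congr' ?_
  by_cases hst : s < t
  · filter_upwards [hl.eventually (gt_mem_nhds (sub_pos.2 hst))] with k hk
    rw [if_pos hst, if_pos]
    have h1 : s / d k + 1 ≤ t / d k := by
      rw [← sub_nonneg, show t / d k - (s / d k + 1) = (t - s - d k) / d k by have := (hd k).ne'; field_simp; ring]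
      exact div_nonneg (by linarith) (hd k).le
    have h2 := Nat.floor_le_floor h1
    rw [Nat.floor_add_one (div_nonneg hs (hd k).le)] at h2
    omega
  · refine Eventually.of_forall fun k => ?_
    rw [if_neg hst]
    symm
    refine if_neg (not_lt.2 (Nat.floor_le_floor ?_))
    have := (hd k).le
    gcongr
    exact not_lt.1 hst

namespace WeakData
variable {N : ℕ → ℕ} {a : ℕ → ℕ → L2 D} {m X : L2T T D} {χ : ℕ → L2 D} {z : L2T T D} {g : Fin 3 → L2T T D}

/-- The drift of the limit equation. -/
def drift (Gi : ℕ → L2 D) (m z : L2T T D) (t : ℝ) : L2 D := z t + (1 / 2 : ℝ) • nSop Gi (m t)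

theorem norm_nSop_mS_le (W : WeakData T Gi θ m0 Cs Cb N a m X χ z g) (k : ℕ) (t : ℝ) :
    ‖nSop Gi (mS T Gi θ m0 (N k) (a k) t)‖ ≤ 2 * (Cs * √(volume.real D)) := by
  have h1 := (W.scheme 0).sumBdd.norm_nSop_le (mS T Gi θ m0 (N k) (a k) t)
  rwa [← Real.sqrt_sq (norm_nonneg (mS T Gi θ m0 (N k) (a k) t)),
    norm_sq_of_unit (W.mem_mS k t).2] at h1

theorem integrable_drift (W : WeakData T Gi θ m0 Cs Cb N a m X χ z g) :
    IntegrableOn (drift Gi m z) (Icc 0 T) := by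
  have h1 : IntegrableOn z (Icc 0 T) := (Lp.memLp z).integrable one_le_two
  have h2 : IntegrableOn (fun t => nSop Gi (m t)) (Icc 0 T) := by
    refine (integrable_const (2 * (Cs * √(volume.real D)))).mono' ?_ ?_
    · exact (continuous_nSop (W.scheme 0).sumBdd).comp_aestronglyMeasurable (Lp.aestronglyMeasurable m)
    · filter_upwards [W.mem] with t h
      have h1 := (W.scheme 0).sumBdd.norm_nSop_le (m t)
      rwa [← Real.sqrt_sq (norm_nonneg (m t)), norm_sq_of_unit h.2] at h1
  have h3 := Integrable.smul (1 / 2 : ℝ) h2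
  exact Integrable.add h1 h3

theorem integral_cutoff (W : WeakData T Gi θ m0 Cs Cb N a m X χ z g) {t : ℝ} (ht : t ∈ Icc 0 T) (f : L2 D) :
    ∫ s in Icc 0 T, inner ℝ (drift Gi m z s) (if s < t then f else 0) =
      inner ℝ f (∫ s in (0 : ℝ)..t, drift Gi m z s) := by
  have e : (fun s => inner ℝ (drift Gi m z s) (if s < t then f else 0)) =
      (Iio t).indicator fun s => inner ℝ f (drift Gi m z s) := by
    ext1 s
    by_cases h : s < t
    · rw [if_pos h, indicator_of_mem (mem_Iio.2 h), real_inner_comm]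
    · rw [if_neg h, indicator_of_notMem (show s ∉ Iio t from h), inner_zero_right]
  have e2 : Icc 0 T ∩ Iio t = Ico 0 t := by
    ext s
    simp only [mem_inter_iff, mem_Icc, mem_Iio, mem_Ico]
    exact ⟨fun h => ⟨h.1.1, h.2⟩, fun h => ⟨⟨h.1, h.2.le.trans ht.2⟩, h.2⟩⟩
  rw [e, setIntegral_indicator measurableSet_Iio, e2, integral_inner, intervalIntegral.integral_of_le ht.1,
    integral_Ico_eq_integral_Ioo, integral_Ioc_eq_integral_Ioo]
  exact W.integrable_drift.mono_set fun s hs => ⟨hs.1, hs.2.le.trans ht.2⟩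

theorem tendsto_sum_drift (W : WeakData T Gi θ m0 Cs Cb N a m X χ z g) {t : ℝ} (ht : t ∈ Icc 0 T)
    (hk : ∀ k, ⌊t / (T / N k)⌋₊ ≤ N k) (f : L2 D) :
    Tendsto (fun k => ∑ n ∈ Finset.range ⌊t / (T / N k)⌋₊, inner ℝ f (remS Gi θ (T / N k) m0 (a k) n +
      (T / N k / 2) • nSop Gi (iterSeq Gi θ (T / N k) m0 (a k) n))) atTop
      (𝓝 (inner ℝ f (∫ s in (0 : ℝ)..t, drift Gi m z s))) := by
  have hT := W.T_pos
  obtain ⟨Cz, hCz⟩ := W.bdd_z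
  obtain ⟨c, hc⟩ : ∃ c : ℕ → ℝ → L2 D, c = fun k s => if ⌊s / (T / N k)⌋₊ < ⌊t / (T / N k)⌋₊ then f else 0 := ⟨_, rfl⟩
  have mc : ∀ k, AEStronglyMeasurable (c k) (ℐ T) := fun k => by
    rw [hc]
    exact (stronglyMeasurable_floor (fun n => if n < ⌊t / (T / N k)⌋₊ then f else 0) (T / N k)).aestronglyMeasurable
  have bc : ∀ k s, ‖c k s‖ ≤ ‖f‖ := fun k s => by
    rw [hc]; dsimp only; split_ifs <;> simp
  have lc : ∀ᵐ s ∂ℐ T, Tendsto (fun k => c k s) atTop (𝓝 (if s < t then f else 0)) := by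
    filter_upwards [ae_restrict_mem measurableSet_Icc] with s hs
    rw [hc]
    exact tendsto_floor_indicator (fun k => (W.scheme k).dt_pos) W.tendsto_dt hs.1 f
  have hz := W.weak_z.integral_inner hCz mc (memLp_const ‖f‖) (fun k => Eventually.of_forall (bc k)) lc
  have mn : ∀ k, AEStronglyMeasurable (fun s => (inner ℝ (nSop Gi (mS T Gi θ m0 (N k) (a k) s)) (c k s) : ℝ))
      (ℐ T) := fun k =>
    ((continuous_nSop (W.scheme 0).sumBdd).comp_aestronglyMeasurable (aesm_mS _ _ _)).inner (mc k)
  have bn : ∀ k s, ‖(inner ℝ (nSop Gi (mS T Gi θ m0 (N k) (a k) s)) (c k s) : ℝ)‖ ≤ 2 * (Cs * √(volume.real D)) * ‖f‖ :=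
    fun k s => (norm_inner_le_norm _ _).trans (mul_le_mul (W.norm_nSop_mS_le k s) (bc k s) (norm_nonneg _)
      ((norm_nonneg _).trans (W.norm_nSop_mS_le k s)))
  have ln : ∀ᵐ s ∂ℐ T, Tendsto (fun k =>
      (inner ℝ (nSop Gi (mS T Gi θ m0 (N k) (a k) s)) (c k s) : ℝ)) atTop
      (𝓝 (inner ℝ (nSop Gi (m s)) (if s < t then f else 0))) := by
    filter_upwards [lc, W.ae_m] with s h1 h2
    exact (((continuous_nSop (W.scheme 0).sumBdd).tendsto _).comp h2).inner h1
  have hn := tendsto_integral_of_dominated_convergence (fun _ => 2 * (Cs * √(volume.real D)) * ‖f‖) mn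
    (integrable_const _) (fun k => Eventually.of_forall (bn k)) ln
  have ik : ∀ k, Integrable (fun s => (inner ℝ (nSop Gi (mS T Gi θ m0 (N k) (a k) s)) (c k s) : ℝ))
      (ℐ T) := fun k => (integrable_const _).mono' (mn k) (Eventually.of_forall (bn k))
  have iM : Integrable (fun s => (inner ℝ (nSop Gi (m s)) (if s < t then f else 0) : ℝ))
      (ℐ T) := by
    refine (integrable_const (2 * (Cs * √(volume.real D)) * ‖f‖)).mono' (aestronglyMeasurable_of_tendsto_ae atTop mn ln) ?_
    filter_upwards [ln] with s h
    exact le_of_tendsto h.norm (Eventually.of_forall fun k => bn k s)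
  have key := hz.2.2.add (hn.const_mul (1 / 2))
  rw [← integral_const_mul, ← integral_add hz.2.1 (iM.const_mul _)] at key
  rw [← W.integral_cutoff ht f]
  refine Tendsto.congr (fun k => ?_) (key.trans (le_of_eq (congrArg _ (integral_congr_ae (Eventually.of_forall fun s => ?_)))))
  · have hdt := (W.scheme k).dt_pos
    have h1 := integral_floor hT (W.N_pos k) fun n => if n < ⌊t / (T / N k)⌋₊ then
      inner ℝ (zS T Gi θ m0 (N k) (a k) n) f + 1 / 2 * inner ℝ (nSop Gi (iterSeq Gi θ (T / N k) m0 (a k) n)) f else 0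
    rw [← integral_const_mul, ← integral_add (hz.1 k) ((ik k).const_mul _)]
    have h2 : T / N k * ∑ n ∈ Finset.range (N k), (if n < ⌊t / (T / N k)⌋₊ then
      inner ℝ (zS T Gi θ m0 (N k) (a k) n) f + 1 / 2 * inner ℝ (nSop Gi (iterSeq Gi θ (T / N k) m0 (a k) n)) f else 0) =
      ∑ n ∈ Finset.range ⌊t / (T / N k)⌋₊, inner ℝ f (remS Gi θ (T / N k) m0 (a k) n +
      (T / N k / 2) • nSop Gi (iterSeq Gi θ (T / N k) m0 (a k) n)) := by
      rw [← Finset.sum_filter, Finset.mul_sum]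
      refine Finset.sum_congr ?_ fun n _ => ?_
      · ext n
        simp only [Finset.mem_filter, Finset.mem_range]
        exact ⟨fun h => h.2, fun h => ⟨h.trans_le (hk k), h⟩⟩
      · rw [zS, real_inner_smul_left, inner_add_right, inner_smul_right, real_inner_comm f, real_inner_comm f, mul_add,
          ← mul_assoc, mul_inv_cancel₀ hdt.ne']
        ring
    rw [← h2, ← h1]
    refine integral_congr_ae ?_
    filter_upwards [tS_ae hT (W.N_pos k) (zS T Gi θ m0 (N k) (a k))] with s hs
    rw [hs, hc]
    simp only [mS]
    split_ifs <;> simp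
  · simp only [drift, inner_add_left, real_inner_smul_left]

theorem equation (W : WeakData T Gi θ m0 Cs Cb N a m X χ z g) : ∀ᵐ t ∂ℐ T,
    X t = m t - m0 - ∫ s in (0 : ℝ)..t, drift Gi m z s := by
  have hT := W.T_pos
  obtain ⟨C, hC0, hC⟩ := W.bounds
  have hrem : Tendsto (fun k => 12 * (√(Cb * C) * √(∑ n ∈ Finset.range (N k), ‖a k n‖ ^ 4)) +
      9 * (T / N k * C) + √(T / N k * C) * √C) atTop (𝓝 0) := by
    have h1 : Tendsto (fun k => √(∑ n ∈ Finset.range (N k), ‖a k n‖ ^ 4)) atTop (𝓝 0) := by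
      have := (Real.continuous_sqrt.tendsto 0).comp W.four
      simpa [Function.comp_def] using this
    have h2 : Tendsto (fun k => T / N k * C) atTop (𝓝 0) := by simpa using W.tendsto_dt.mul_const C
    have h3 : Tendsto (fun k => √(T / N k * C)) atTop (𝓝 0) := by
      have := (Real.continuous_sqrt.tendsto 0).comp h2
      simpa [Function.comp_def] using this
    simpa using (((h1.const_mul (√(Cb * C))).const_mul 12).add (h2.const_mul 9)).add (h3.mul_const (√C))
  have hdef : ∀ j, ∃ ψ : ℕ → ℕ, StrictMono ψ ∧ ∀ᵐ t ∂ℐ T, Tendsto (fun k =>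
      SchemeData.defSum Gi θ (T / N (ψ k)) m0 (χ j) ⌊t / (T / N (ψ k))⌋₊ (a (ψ k))) atTop (𝓝 0) := fun j => by
    have h1 : Tendsto (fun k => tS T (N k) fun n => SchemeData.defSum Gi θ (T / N k) m0 (χ j) n (a k)) atTop (𝓝 0) := by
      rw [tendsto_zero_iff_norm_tendsto_zero]
      have h2 := (Real.continuous_sqrt.tendsto 0).comp (W.defect j)
      rw [Real.sqrt_zero] at h2
      refine h2.congr fun k => ?_
      rw [← Real.sqrt_sq (norm_nonneg (tS _ _ _)), norm_tS_sq hT (W.N_pos k)]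
      simp only [Function.comp_def, SchemeData.defF, Real.norm_eq_abs, sq_abs]
    obtain ⟨ψ, hψ, h2⟩ := exists_subseq_ae h1
    refine ⟨ψ, hψ, ?_⟩
    filter_upwards [h2, ae_all_iff.2 fun k => tS_ae hT (W.N_pos (ψ k)) fun n =>
      SchemeData.defSum Gi θ (T / N (ψ k)) m0 (χ j) n (a (ψ k)),
      Lp.coeFn_zero ℝ 2 (ℐ T)] with t h3 h4 h5
    rw [h5] at h3
    exact h3.congr fun k => by rw [h4]
  choose ψ hψ hd using hdef
  filter_upwards [ae_all_iff.2 hd, W.ae_m, W.ae_X, ae_all_iff.2 fun k => ae_floor_mem hT (W.N_pos k),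
    ae_restrict_mem measurableSet_Icc] with t h1 h2 h3 h4 ht
  have key : ∀ j, inner ℝ (χ j) (m t - m0 - X t - ∫ s in (0 : ℝ)..t, drift Gi m z s) = 0 := fun j => by
    have e1 : Tendsto (fun k => inner ℝ (χ j) (mS T Gi θ m0 (N k) (a k) t - m0 -
        SchemeData.XS Gi θ (T / N k) m0 (a k) ⌊t / (T / N k)⌋₊)) atTop (𝓝 (inner ℝ (χ j) (m t - m0 - X t))) :=
      tendsto_const_nhds.inner ((h2.sub_const m0).sub h3)
    have e2 := W.tendsto_sum_drift ht (fun k => (h4 k).2.2.le) (χ j)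
    have e3 := ((e1.sub e2).comp (hψ j).tendsto_atTop).add ((h1 j).const_mul (1 / 2))
    rw [mul_zero, add_zero, ← inner_sub_right] at e3
    refine tendsto_nhds_unique e3 (squeeze_zero_norm (fun k => ?_) (hrem.comp (hψ j).tendsto_atTop))
    have e4 := (W.scheme (ψ j k)).abs_remainder_le (a (ψ j k)) (W.chi_le j) (h4 (ψ j k)).2.2.le (W.memH2 (ψ j k))
    obtain ⟨c1, c2, c3, c4⟩ := hC (ψ j k)
    have e5 : (12 * (√(∑ n ∈ Finset.range (N (ψ j k)), Cb * sqH2 (a (ψ j k) n)) *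
        √(∑ n ∈ Finset.range (N (ψ j k)), ‖a (ψ j k) n‖ ^ 4)) +
      9 * ∑ n ∈ Finset.range (N (ψ j k)), ‖remS Gi θ (T / N (ψ j k)) m0 (a (ψ j k)) n‖ ^ 2 +
      √(∑ n ∈ Finset.range (N (ψ j k)), ‖remS Gi θ (T / N (ψ j k)) m0 (a (ψ j k)) n‖ ^ 2) *
        √(∑ n ∈ Finset.range (N (ψ j k)), sqH2 (a (ψ j k) n))) ≤
      12 * (√(Cb * C) * √(∑ n ∈ Finset.range (N (ψ j k)), ‖a (ψ j k) n‖ ^ 4)) +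
      9 * (T / N (ψ j k) * C) + √(T / N (ψ j k) * C) * √C := by
      have := (W.scheme 0).pos.le
      rw [← Finset.mul_sum]
      gcongr
    refine le_trans (le_of_eq ?_) (e4.trans e5)
    rw [Real.norm_eq_abs]
    congr 1
    simp only [Function.comp_def, mS]
    ring
  have := W.chi_total _ key
  rw [sub_eq_zero] at this
  rw [← this]; abel

end WeakData

/-! ### Continuity of the limit -/

variable {T : ℝ} {Gi : ℕ → L2 D} {θ : ℝ} {m0 : L2 D} {Cs Cb : ℝ}
  {N : ℕ → ℕ} {a : ℕ → ℕ → L2 D} {m X : L2T T D} {χ : ℕ → L2 D}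

theorem tendsto_slobN {d : ℕ → ℝ} (hd : ∀ k, 0 < d k) (h : Tendsto d atTop (𝓝 0)) (u : ℝ) :
    Tendsto (fun k => slobN (d k) u) atTop (𝓝 (slobK u)) := by
  rcases eq_or_ne u 0 with rfl | hu
  · have e : (fun k => slobN (d k) (0 : ℝ)) = fun _ => slobK 0 := by
      ext1 k
      rw [slobN, if_neg (by rw [abs_zero]; exact (hd k).not_ge)]
      simp [slobK]
    rw [e]; exact tendsto_const_nhds
  · refine tendsto_const_nhds.congr' ?_
    filter_upwards [h.eventually (ge_mem_nhds (abs_pos.2 hu))] with k hk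
    rw [slobN, if_pos hk]

namespace WeakData
variable {z : L2T T D} {g : Fin 3 → L2T T D}

theorem slob_ne_top (W : WeakData T Gi θ m0 Cs Cb N a m X χ z g) : slob T X ≠ ⊤ := by
  obtain ⟨C, h0, hC⟩ := W.holder
  refine ne_top_of_le_ne_top h0 ?_
  have h1 : ∀ᵐ p : ℝ × ℝ ∂(ℐ T).prod (ℐ T),
      Tendsto (fun k => slobN (T / N k) (p.1 - p.2) *
        ‖SchemeData.XS Gi θ (T / N k) m0 (a k) ⌊p.1 / (T / N k)⌋₊ -
        SchemeData.XS Gi θ (T / N k) m0 (a k) ⌊p.2 / (T / N k)⌋₊‖ₑ ^ 4) atTop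
        (𝓝 (slobK (p.1 - p.2) * ‖X p.1 - X p.2‖ₑ ^ 4)) := by
    filter_upwards [Measure.quasiMeasurePreserving_fst.ae W.ae_X,
      Measure.quasiMeasurePreserving_snd.ae W.ae_X] with p h2 h3
    have h4 : Tendsto (fun k => ‖SchemeData.XS Gi θ (T / N k) m0 (a k) ⌊p.1 / (T / N k)⌋₊ -
        SchemeData.XS Gi θ (T / N k) m0 (a k) ⌊p.2 / (T / N k)⌋₊‖ₑ ^ 4) atTop
        (𝓝 (‖X p.1 - X p.2‖ₑ ^ 4)) := ENNReal.Tendsto.pow (h2.sub h3).enorm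
    exact ENNReal.Tendsto.mul (tendsto_slobN (fun k => (W.scheme k).dt_pos) W.tendsto_dt _)
      (Or.inr (ENNReal.pow_ne_top enorm_ne_top)) h4 (Or.inr ofReal_ne_top)
  have h2 : slob T X = ∫⁻ p : ℝ × ℝ, liminf (fun k => slobN (T / N k) (p.1 - p.2) *
        ‖SchemeData.XS Gi θ (T / N k) m0 (a k) ⌊p.1 / (T / N k)⌋₊ -
        SchemeData.XS Gi θ (T / N k) m0 (a k) ⌊p.2 / (T / N k)⌋₊‖ₑ ^ 4) atTop
      ∂(ℐ T).prod (ℐ T) :=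
    lintegral_congr_ae (h1.mono fun p hp => hp.liminf_eq.symm)
  rw [h2]
  refine (lintegral_liminf_le fun k => ?_).trans ?_
  · have := (measurable_holder_integrand (W.scheme k)).comp
      (measurable_prodMk_left (x := a k) : Measurable fun p : ℝ × ℝ => (a k, p))
    simpa only [Function.comp_def] using this
  · exact liminf_le_of_frequently_le' (Frequently.of_forall hC)

end WeakData

/-- The conclusion for a path along which the scheme converges. -/
theorem LimitData.conclusion (L : LimitData T Gi θ m0 Cs Cb N a m X χ) :
    (∃ A : ℝ → L2 D, IntegrableOn A (Icc 0 T) ∧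
      (∀ᵐ s ∂volume.restrict (Icc 0 T), IsDrift Gi (m s) (A s)) ∧
      ∀ᵐ t ∂volume.restrict (Icc 0 T), X t = m t - m0 - ∫ s in (0 : ℝ)..t, A s) ∧
    ∃ c : ℝ → L2 D, ContinuousOn c (Icc 0 T) ∧ ∀ᵐ t ∂volume.restrict (Icc 0 T), m t = c t := by
  obtain ⟨N', a', z, g, W⟩ := L.exists_weakData
  have hA := W.integrable_drift
  refine ⟨⟨_, hA, W.isDrift, W.equation⟩, ?_⟩
  have hX : Integrable ((Icc 0 T).indicator X) :=
    (integrable_indicator_iff measurableSet_Icc).2 ((Lp.memLp X).integrable (by norm_num))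
  have hs : slob T ((Icc 0 T).indicator X) = slob T X := by
    refine lintegral_congr_ae ?_
    have h1 : ∀ᵐ t ∂ℐ T, (Icc 0 T).indicator X t = X t :=
      (ae_restrict_mem measurableSet_Icc).mono fun t ht => indicator_of_mem ht _
    filter_upwards [Measure.quasiMeasurePreserving_fst.ae h1,
      Measure.quasiMeasurePreserving_snd.ae h1] with p h2 h3
    rw [h2, h3]
  obtain ⟨c, hc, he⟩ := exists_continuous_of_slob L.T_pos hX (hs ▸ W.slob_ne_top)
  refine ⟨fun t => c t + m0 + ∫ s in (0 : ℝ)..t, WeakData.drift Gi m z s, ?_, ?_⟩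
  · refine (hc.add continuousOn_const).add ?_
    have := intervalIntegral.continuousOn_primitive_interval (a := 0) (b := T) (μ := volume)
      (f := WeakData.drift Gi m z) (by rwa [uIcc_of_le L.T_pos.le])
    rwa [uIcc_of_le L.T_pos.le] at this
  · filter_upwards [W.equation, ae_restrict_of_ae he, ae_restrict_mem measurableSet_Icc] with t h1 h2 h3
    rw [← h2 h3, indicator_of_mem h3, h1]
    abel

/-! ### Almost sure choice of subsequences -/

theorem exists_total_family : ∃ χ : ℕ → L2 D, (∀ j, ∀ᵐ x ∂ℒ D, ‖χ j x‖ ≤ 1) ∧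
    ∀ f : L2 D, (∀ j, inner ℝ (χ j) f = 0) → f = 0 := by
  refine ⟨fun j => retr (TopologicalSpace.denseSeq (L2 D) j), fun j => norm_retr_apply_le _, fun f hf => ?_⟩
  have h1 : inner ℝ (retr f) f = 0 :=
    (TopologicalSpace.denseRange_denseSeq (L2 D)).induction_on (p := fun u => inner ℝ (retr u) f = 0) f
      (isClosed_eq (continuous_retr.inner continuous_const) continuous_const) hf
  have h2 : ∀ᵐ x ∂ℒ D, inner ℝ (retr f x) (f x) = (max 1 ‖f x‖)⁻¹ * ‖f x‖ ^ 2 := by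
    filter_upwards [coeFn_retr f] with x hx
    rw [hx, retract, real_inner_smul_left, real_inner_self_eq_norm_sq]
  have h3 : 0 ≤ᵐ[ℒ D] fun x => inner ℝ (retr f x) (f x) := by
    filter_upwards [h2] with x hx
    rw [hx, Pi.zero_apply]
    positivity
  rw [L2.inner_def, integral_eq_zero_iff_of_nonneg_ae h3 (L2.integrable_inner _ _)] at h1
  refine Lp.ext ?_
  filter_upwards [h1, h2, Lp.coeFn_zero E3 2 (ℒ D)] with x a1 a2 a3
  rw [a2, Pi.zero_apply, mul_eq_zero] at a1
  have h4 : (max 1 ‖f x‖)⁻¹ ≠ 0 := by positivity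
  rw [a3, Pi.zero_apply]
  simpa using a1.resolve_left h4

theorem ae_tendsto_zero_of_lintegral_le {Ω : Type*} [MeasurableSpace Ω] {μ : Measure Ω}
    {f : ℕ → Ω → ENNReal} (hf : ∀ k, AEMeasurable (f k) μ) {K : ENNReal} (hK : K ≠ ⊤)
    (h : ∀ k, ∫⁻ ω, f k ω ∂μ ≤ K * 2⁻¹ ^ k) : ∀ᵐ ω ∂μ, Tendsto (fun k => f k ω) atTop (𝓝 0) := by
  have h1 : ∫⁻ ω, ∑' k, f k ω ∂μ ≠ ⊤ := by
    rw [lintegral_tsum hf]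
    refine ne_top_of_le_ne_top ?_ (ENNReal.tsum_le_tsum h)
    rw [ENNReal.tsum_mul_left, ENNReal.tsum_geometric_two]
    exact ENNReal.mul_ne_top hK (by simp)
  filter_upwards [ae_lt_top' (AEMeasurable.tsum hf) h1] with ω hω
  exact ENNReal.tendsto_atTop_zero_of_tsum_ne_top hω.ne

theorem ae_exists_subseq_le {Ω : Type*} [MeasurableSpace Ω] {μ : Measure Ω}
    {f : ℕ → Ω → ENNReal} (hf : ∀ k, AEMeasurable (f k) μ) {K : ENNReal} (hK : K ≠ ⊤)
    (h : ∀ k, ∫⁻ ω, f k ω ∂μ ≤ K) :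
    ∀ᵐ ω ∂μ, ∃ C : ENNReal, C ≠ ⊤ ∧ ∃ ψ : ℕ → ℕ, StrictMono ψ ∧ ∀ k, f (ψ k) ω ≤ C := by
  have h1 : ∫⁻ ω, liminf (fun k => f k ω) atTop ∂μ ≠ ⊤ :=
    ne_top_of_le_ne_top hK ((lintegral_liminf_le' hf).trans
      (liminf_le_of_frequently_le' (Frequently.of_forall h)))
  have h0 : AEMeasurable (fun ω => liminf (fun k => f k ω) atTop) μ :=
    ⟨fun ω => liminf (fun k => (hf k).mk (f k) ω) atTop, Measurable.liminf fun k => (hf k).measurable_mk, by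
      filter_upwards [ae_all_iff.2 fun k => (hf k).ae_eq_mk] with ω hω
      simp only [hω]⟩
  filter_upwards [ae_lt_top' h0 h1] with ω hω
  obtain ⟨C, h2, h3⟩ := exists_between hω
  obtain ⟨ψ, h4, h5⟩ := extraction_of_frequently_atTop (frequently_lt_of_liminf_lt (by isBoundedDefault) h2)
  exact ⟨C, h3.ne, ψ, h4, fun k => (h5 k).le⟩

theorem tendsto_of_tendsto_ofReal {u : ℕ → ℝ} (h0 : ∀ k, 0 ≤ u k)
    (h : Tendsto (fun k => ofReal (u k)) atTop (𝓝 0)) : Tendsto u atTop (𝓝 0) := by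
  have := (ENNReal.tendsto_toReal ENNReal.zero_ne_top).comp h
  refine this.congr fun k => ?_
  exact ENNReal.toReal_ofReal (h0 k)

theorem ofReal_div_le {c : ℝ} (hc : 0 ≤ c) {N k : ℕ} (hN : 2 ^ k ≤ N) :
    ofReal (c / N) ≤ ofReal c * 2⁻¹ ^ k := by
  have h1 : (2⁻¹ : ENNReal) ^ k = ofReal ((2 ^ k : ℝ)⁻¹) := by
    rw [ENNReal.ofReal_inv_of_pos (by positivity), ofReal_pow (by norm_num), ENNReal.inv_pow]
    norm_num
  rw [h1, ← ofReal_mul hc, div_eq_mul_inv]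
  have h2 : (2 ^ k : ℝ) ≤ N := by exact_mod_cast hN
  gcongr

theorem SchemeData.defF_nonneg {Gi : ℕ → L2 D} {θ dt : ℝ} {m0 : L2 D} {Cs Cb : ℝ}
    (S : SchemeData Gi θ dt m0 Cs Cb) (N : ℕ) (a : ℕ → L2 D) (χ : L2 D) : 0 ≤ defF Gi θ dt m0 χ N a :=
  mul_nonneg S.dt_pos.le (Finset.sum_nonneg fun _ _ => sq_nonneg _)

/-- Almost every path satisfies `LimitData`, along a subsequence that depends on the path. -/
theorem ae_exists_limitData {T : ℝ} (hT : 0 < T) {Gi : ℕ → L2 D} {θ : ℝ} {m0 : L2 D} {Cs Cb Q : ℝ}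
    (hQ : 0 ≤ Q) {N : ℕ → ℕ} (hN : ∀ k, 2 ^ k ≤ N k) (S : ∀ k, SchemeData Gi θ (T / N k) m0 Cs Cb)
    {ν : Measure (CT T D)} [IsProbabilityMeasure ν]
    (h : ∀ k, IsNoiseSeq ν Gi Q (T / N k) (N k) fun n (w : CT T D) => noiseInc (N k) n w)
    {Ω : Type*} [MeasurableSpace Ω] {μ : Measure Ω} {W : ℕ → Ω → CT T D}
    (hW : ∀ k, AEMeasurable (W k) μ) (hmap : ∀ k, μ.map (W k) = ν) {χ : ℕ → L2 D}
    (hχ : ∀ j, ∀ᵐ x ∂ℒ D, ‖χ j x‖ ≤ 1)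
    (hχ0 : ∀ f : L2 D, (∀ j, inner ℝ (χ j) f = 0) → f = 0) :
    ∀ᵐ ω ∂μ, ∀ m X : L2T T D,
      Tendsto (fun k => tS T (N k) (iterSeq Gi θ (T / N k) m0 fun n => noiseInc (N k) n (W k ω))) atTop (𝓝 m) →
      Tendsto (fun k => xS T Gi θ m0 (N k) fun n => noiseInc (N k) n (W k ω)) atTop (𝓝 X) →
      ∃ ψ : ℕ → ℕ, LimitData T Gi θ m0 Cs Cb (N ∘ ψ)
        ((fun k n => noiseInc (N k) n (W k ω)) ∘ ψ) m X χ := by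
  have hNpos : ∀ k, 0 < N k := fun k => (pow_pos two_pos k).trans_le (hN k)
  have hNr : ∀ k, (0 : ℝ) < N k := fun k => by exact_mod_cast hNpos k
  have hNdt : ∀ k, (N k : ℝ) * (T / N k) = T := fun k => mul_div_cancel₀ T (hNr k).ne'
  have hK := K4_nonneg
  have htop : Tendsto N atTop atTop :=
    tendsto_atTop_mono (fun k => (Nat.lt_two_pow_self (n := k)).le.trans (hN k)) tendsto_id
  have hξ : ∀ k, Measurable fun (w : CT T D) n => noiseInc (N k) n w := fun k =>
    measurable_pi_lambda _ (h k).meas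
  have tr : ∀ {f : CT T D → ENNReal} (k : ℕ), Measurable f →
      AEMeasurable (fun ω => f (W k ω)) μ ∧ ∫⁻ ω, f (W k ω) ∂μ = ∫⁻ w, f w ∂ν := fun k hf => by
    refine ⟨hf.comp_aemeasurable (hW k), ?_⟩
    rw [← hmap k, lintegral_map' hf.aemeasurable (hW k)]
  -- the fourth powers of the noise increments
  have a1 : ∀ᵐ ω ∂μ, Tendsto (fun k => ∑ n ∈ Finset.range (N k), ‖noiseInc (N k) n (W k ω)‖ ^ 4)
      atTop (𝓝 0) := by
    have m1 : ∀ k, Measurable fun w : CT T D =>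
        ofReal (∑ n ∈ Finset.range (N k), ‖noiseInc (N k) n w‖ ^ 4) := fun k =>
      (Finset.measurable_fun_sum _ fun n _ => ((h k).meas n).norm.pow_const 4).ennreal_ofReal
    have := ae_tendsto_zero_of_lintegral_le (fun k => (tr k (m1 k)).1)
      (K := ofReal (IsGaussSeq.K4 * (T * Q) ^ 2)) ofReal_ne_top fun k => by
        rw [(tr k (m1 k)).2]
        refine le_trans ?_ (ofReal_div_le (by positivity) (hN k))
        have e : ∀ w : CT T D, ofReal (∑ n ∈ Finset.range (N k), ‖noiseInc (N k) n w‖ ^ 4) =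
            ∑ n ∈ Finset.range (N k), ofReal (‖noiseInc (N k) n w‖ ^ 4) := fun w =>
          ofReal_sum_of_nonneg fun _ _ => by positivity
        simp only [e]
        rw [lintegral_finsetSum _ fun n _ => (((h k).meas n).norm.pow_const 4).ennreal_ofReal]
        refine (Finset.sum_le_sum fun n hn => (h k).lintegral_pow_four n (Finset.mem_range.1 hn)).trans ?_
        rw [Finset.sum_const, Finset.card_range, nsmul_eq_mul, ← ENNReal.ofReal_natCast,
          ← ofReal_mul (hNr k).le]
        refine ofReal_le_ofReal (le_of_eq ?_)
        have := (hNr k).ne'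
        field_simp
    exact this.mono fun ω hω => tendsto_of_tendsto_ofReal
      (fun k => Finset.sum_nonneg fun _ _ => by positivity) hω
  -- the compensated quadratic variation
  have a2 : ∀ᵐ ω ∂μ, ∀ j, Tendsto (fun k => SchemeData.defF Gi θ (T / N k) m0 (χ j) (N k)
      fun n => noiseInc (N k) n (W k ω)) atTop (𝓝 0) := by
    refine ae_all_iff.2 fun j => ?_
    have m1 : ∀ k, Measurable fun w : CT T D => ofReal (SchemeData.defF Gi θ (T / N k) m0 (χ j) (N k)
        fun n => noiseInc (N k) n w) := fun k =>
      (((S k).measurable_defF (χ j) (N k)).comp (hξ k)).ennreal_ofReal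
    have := ae_tendsto_zero_of_lintegral_le (fun k => (tr k (m1 k)).1)
      (K := ofReal (T ^ 2 * (2 * (IsGaussSeq.K4 * Q ^ 2 + SchemeData.Kd Cs (χ j) ^ 2)) * T))
      ofReal_ne_top fun k => by
        rw [(tr k (m1 k)).2]
        refine le_trans ?_ (ofReal_div_le (by positivity) (hN k))
        have := (S k).lintegral_defF (h k) (hχ j)
        rwa [hNdt, ← mul_div_assoc] at this
    exact this.mono fun ω hω => tendsto_of_tendsto_ofReal (fun k => (S k).defF_nonneg _ _ _) hω
  have a3 : ∀ᵐ ω ∂μ, ∀ k, ∀ n < N k, MemH2 (noiseInc (N k) n (W k ω)) :=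
    ae_all_iff.2 fun k => ae_all_iff.2 fun n => by
      by_cases hn : n < N k
      · have h1 := (h k).memH2 n hn
        rw [← hmap k] at h1
        exact (ae_of_ae_map (hW k) h1).mono fun _ h _ => h
      · exact Eventually.of_forall fun _ h => absurd h hn
  -- the bounds along a subsequence
  have m1 : ∀ k, Measurable fun w : CT T D => ofReal (SchemeData.energyF Gi θ (T / N k) m0 (N k)
      fun n => noiseInc (N k) n w) := fun k =>
    (((S k).measurable_energyF (N k)).comp (hξ k)).ennreal_ofReal
  have m2 : ∀ k, Measurable fun w : CT T D => holderF T Gi θ m0 (N k) fun n => noiseInc (N k) n w := fun k =>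
    (measurable_holderF (S k)).comp (hξ k)
  have a4 := ae_exists_subseq_le (fun k => (tr k ((m1 k).add (m2 k))).1)
    (ENNReal.add_ne_top.2 ⟨ofReal_ne_top,
      ENNReal.mul_ne_top ofReal_ne_top (lintegral_inv_sqrt_ne_top T)⟩) fun k => by
      rw [(tr k ((m1 k).add (m2 k))).2]
      simp only [Pi.add_apply]
      rw [lintegral_add_left (m1 k)]
      have e1 := (S k).lintegral_energyF (h k) hQ
      rw [hNdt] at e1
      exact add_le_add e1 (lintegral_holderF hT (hNpos k) (S k) (h k) hQ)
  filter_upwards [a1, a2, a3, a4] with ω b1 b2 b3 ⟨C, hC, ψ, hψ, b4⟩ m X hm hX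
  refine ⟨ψ, ?_⟩
  exact
    { T_pos := hT
      N_pos := fun k => hNpos _
      N_top := htop.comp hψ.tendsto_atTop
      scheme := fun k => S _
      energy := ⟨C.toReal, fun k => (ENNReal.ofReal_le_iff_le_toReal hC).1 (le_self_add.trans (b4 k))⟩
      memH2 := fun k => b3 _
      four := b1.comp hψ.tendsto_atTop
      chi_le := hχ
      chi_total := hχ0
      defect := fun j => (b2 j).comp hψ.tendsto_atTop
      lim_m := hm.comp hψ.tendsto_atTop
      lim_X := hX.comp hψ.tendsto_atTop
      holder := ⟨C, hC, fun k => le_add_self.trans (b4 k)⟩ }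

end SLLG

end

theorem mainTheorem7
    (T θ : ℝ) (hT : 0 < T) (hθ : θ ∈ Set.Ioc (1 / 2 : ℝ) 1)
    (D : Set E3) (hDo : IsOpen D) (hDne : D.Nonempty) (hDb : Bornology.IsBounded D)
    (hDc : ConeCondition D)
    (e : HilbertBasis ℕ ℝ (L2 D)) (G : L2 D →L[ℝ] L2 D) (hG : IsHilbertSchmidtH2 e G)
    (m0 : L2 D) (hm0 : MemH1 m0) (hm0_unit : ∀ᵐ x ∂volume.restrict D, ‖m0 x‖ = 1)
    -- the original probability space, the noise and the scheme
    {Ω : Type*} [MeasurableSpace Ω] (P : Measure Ω) [IsProbabilityMeasure P]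
    (β : ℕ → ℝ≥0 → Ω → ℝ) (GW : Ω → CT T D) (hGW : IsNoise P e G β GW)
    -- the new probability space, with the variables of the same laws that converge a.s.
    {Ω' : Type*} [MeasurableSpace Ω'] (P' : Measure Ω') [IsProbabilityMeasure P']
    (mN XN : ℕ → Ω' → L2T T D) (WN : ℕ → Ω' → CT T D)
    (m X : Ω' → L2T T D) (W : Ω' → CT T D)
    (hlaw : ∀ N : ℕ, 0 < N → IdentDistrib
      (fun ω => (mN N ω, XN N ω, WN N ω))
      (fun ω => (mProc (fun i => G (e i)) θ m0 N (GW ω),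
        XProc (fun i => G (e i)) θ m0 N (GW ω), GW ω)) P' P)
    (σ : ℕ → ℕ) (hσ : StrictMono σ)
    (hm : ∀ᵐ ω ∂P', Tendsto (fun j => mN (σ j) ω) atTop (𝓝 (m ω)))
    (hX : ∀ᵐ ω ∂P', Tendsto (fun j => XN (σ j) ω) atTop (𝓝 (X ω)))
    (hW : ∀ᵐ ω ∂P', Tendsto (fun j => WN (σ j) ω) atTop (𝓝 (W ω))) :
    ∀ᵐ ω ∂P',
      (∃ A : ℝ → L2 D, IntegrableOn A (Icc 0 T) ∧
        (∀ᵐ s ∂volume.restrict (Icc 0 T), IsDrift (fun i => G (e i)) (m ω s) (A s)) ∧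
        ∀ᵐ t ∂volume.restrict (Icc 0 T), X ω t = m ω t - m0 - ∫ s in (0 : ℝ)..t, A s) ∧
      ∃ c : ℝ → L2 D, ContinuousOn c (Icc 0 T) ∧
        ∀ᵐ t ∂volume.restrict (Icc 0 T), m ω t = c t := by
  obtain ⟨Cb, hCb, hsup⟩ := exists_sup_bound hDo hDc
  have hsum : SumBdd (fun i => G (e i)) (∑' i, Cb * normSqH2 (G (e i))) :=
    ⟨_, fun i => mul_nonneg hCb.le (normSqH2_nonneg _), (hG.2.mul_left Cb).hasSum,
      fun i => hsup _ (hG.1 _)⟩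
  have hmem : m0 ∈ sphereH1 D := ⟨hm0, hm0_unit⟩
  have hθ0 : 0 < θ := (by norm_num : (0 : ℝ) < 1 / 2).trans hθ.1
  have S : ∀ N : ℕ, 0 < N → SchemeData (fun i => G (e i)) θ (T / N) m0
      (∑' i, Cb * normSqH2 (G (e i))) Cb := fun N hN =>
    ⟨hDo, hDb, hsum, hθ, div_pos hT (Nat.cast_pos.2 hN), hmem, hCb, hsup⟩
  have hGWm : AEMeasurable GW P := (hlaw 1 one_pos).aemeasurable_snd.snd.snd
  have hWm : ∀ N, 0 < N → AEMeasurable (WN N) P' := fun N hN => (hlaw N hN).aemeasurable_fst.snd.snd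
  have hmap : ∀ N, 0 < N → P'.map (WN N) = P.map GW := fun N hN =>
    ((hlaw N hN).comp (measurable_snd.comp measurable_snd)).map_eq
  have hm1 : ∀ N, 0 < N → Measurable (mProc (T := T) (fun i => G (e i)) θ m0 N) := fun N hN =>
    measurable_mProc hT hDo hDb hsum hθ0 hmem hN
  have hX1 : ∀ N, 0 < N → Measurable (XProc (T := T) (fun i => G (e i)) θ m0 N) := fun N hN =>
    measurable_XProc hT hDo hDb hsum hθ0 hmem hN
  have hpath : ∀ N, 0 < N → ∀ᵐ ω ∂P', mN N ω = mProc (fun i => G (e i)) θ m0 N (WN N ω) ∧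
      XN N ω = XProc (fun i => G (e i)) θ m0 N (WN N ω) := fun N hN => by
    have hs : MeasurableSet {p : L2T T D × L2T T D × CT T D | p.1 = mProc (fun i => G (e i)) θ m0 N p.2.2 ∧
        p.2.1 = XProc (fun i => G (e i)) θ m0 N p.2.2} :=
      (measurableSet_eq_fun measurable_fst ((hm1 N hN).comp (measurable_snd.comp measurable_snd))).inter
        (measurableSet_eq_fun (measurable_fst.comp measurable_snd)
          ((hX1 N hN).comp (measurable_snd.comp measurable_snd)))
    exact (hlaw N hN).symm.ae_snd hs (Eventually.of_forall fun ω => ⟨rfl, rfl⟩)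
  have hN : ∀ k, 2 ^ k ≤ σ (2 ^ k) := fun k => hσ.id_le _
  have hN0 : ∀ k, 0 < σ (2 ^ k) := fun k => (pow_pos two_pos k).trans_le (hN k)
  have h2 : Tendsto (fun k : ℕ => 2 ^ k) atTop atTop := tendsto_pow_atTop_atTop_of_one_lt one_lt_two
  have : IsProbabilityMeasure (P.map GW) := Measure.isProbabilityMeasure_map hGWm
  obtain ⟨χ, hχ, hχ0⟩ := exists_total_family (D := D)
  have key := ae_exists_limitData hT (tsum_nonneg fun i => normSqH2_nonneg (G (e i))) hN
    (fun k => S _ (hN0 k)) (fun k => hGW.isNoiseSeq_map hT hDo hG hGWm (hN0 k))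
    (fun k => hWm _ (hN0 k)) (fun k => hmap _ (hN0 k)) hχ hχ0
  filter_upwards [key, hm, hX, ae_all_iff.2 fun k => hpath _ (hN0 k)] with ω h1 h3 h4 h5
  suffices h6 : _ ∧ _ by
    obtain ⟨ψ, L⟩ := h1 (m ω) (X ω) h6.1 h6.2
    exact L.conclusion
  refine ⟨(h3.comp h2).congr fun k => ?_, (h4.comp h2).congr fun k => ?_⟩
  · rw [Function.comp_apply, (h5 k).1, mProc_eq_stepL hT (hN0 k), tS]
    congr 1
    ext1 n
    exact iterate_eq_iterSeq _ _ _ _ _ n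
  · rw [Function.comp_apply, (h5 k).2, XProc_eq_stepL, xS]
    congr 1
    ext1 n
    rw [iterate_eq_iterSeq, crt_eq (sphereH1.le_one ((S _ (hN0 k)).mem _ n))]
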